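/- **Conventions.** Let $\widetilde\Delta$ be the category whose objects are the sets $[0,n]=\{0,1,\dots,n\}$, $n\ge 0$, with all maps of sets as morphisms. An *oversimplicial object* of a category $\mathcal C$ with fibre products is a contravariant functor $P_\bullet\colon\widetilde\Delta\to\mathcal C$, $P_n=P([0,n])$; morphisms are morphisms of functors. An *additive cocartesian diagram* is a cocartesian diagram in $\widetilde\Delta$ formed by maps $[0]\to[0,m]$, $[0]\to[0,l]$, $[0,m]\to[0,n]$, $[0,l]\to[0,n]$. $P_\bullet$ is *multiplicative* if for every such diagram the induced square $P_n\to P_m,\ P_n\to P_l$ over $P_0$ is cartesian, i.e. $P_n\cong P_m\times_{P_0}P_l$. A morphism $Q_\bullet\to P_\bullet$ is *multiplicative* if for every such diagram the square formed by $Q_n\to Q_m\times_{P_m}P_n$, $Q_n\to Q_l\times_{P_l}P_n$ and the projections to $P_n$ is cartesian. For a scheme $Y$, a closed subscheme $Z$ and a locally principal closed subscheme $E$, the *dilatation* $Y^{(E\cdot Z)}\to Y$ is the universal morphism $T\to Y$ such that $E\times_YT$ is an effective Cartier divisor of $T$ contained in the closed subscheme $Z\times_YT$ (if $E$ is a Cartier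 divisor, it is the complement of the proper transform of $E$ in the blow-up of $Y$ at $E\cap Z$). **Setting.** Let $k$ be a perfect field, $X$ a smooth separated scheme over $k$, $D$ a divisor of $X$ with simple normal crossings, $D_1,\dots,D_h$ its irreducible components, and $U=X\setminus D$. Let $r_i\ge1$ be rational numbers and $m_i\ge 1$ integers such that $m_ir_i$ is an integer for every $i=1,\dots,h$; put $R=\sum r_iD_i$, $M=\sum m_iD_i$. All products are over $k$. Define oversimplicial schemes as follows. (a) $P_n^{(D)}\to X^{n+1}$ is the universal scheme that is admissible for the dilatations of $X^{n+1}$ with respect to the diagonal $X\subset X^{n+1}$ and each of the divisors $\mathrm{pr}_j^*D$, $0\le j\le n$ (the intersection of these $n+1$ dilatations in the blow-up of $X^{n+1}$ at $D\subset X$). The pull-back $D_{n,i}^{(D)}$ of $D_i$ to $P_n^{(D)}$ by the $j$-th projection does not depend on $j$. (b) $P_n^{(D,M)}\to P_n^{(D)}\times\mathbf A^h$ is the universal scheme over $P_n^{(D)}\times\mathbf A^h$ on which, for every $i$, the pull-back of $D_{n,i}^{(D)}$ and the pull-back of the $m_i$-th power of the ideal of the zero-section of the $i$-th coordinate $s_i$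 define the same effective Cartier divisor. Let $D^{(D,M)}_{n,i}=\{s_i=0\}\subset P_n^{(D,M)}$ and $\widetilde X^{(M)}=P_0^{(D,M)}$, a closed subscheme of $P_n^{(D,M)}$ by the map $[0,n]\to[0]$. (c) $P_n^{(R,M)}$ is the dilatation of $P_n^{(D,M)}$ with respect to the divisor $\sum_i m_i(r_i-1)D^{(D,M)}_{n,i}$ and the closed subscheme $\widetilde X^{(M)}$. By the universal properties, $P_\bullet^{(R,M)}$ is an oversimplicial scheme, and there is a canonical morphism $U^{\bullet+1}\times\mathbf G_m^h\to P_\bullet^{(R,M)}$. Let $G$ be a finite group and $V\to U$ a $G$-torsor. Let $V^{n+1}/\Delta G$ be the quotient of $V^{n+1}$ by the diagonal action of $G$; it is finite over $U^{n+1}$. Let $Q_n^{(R,M)}$ be the normalization of $P_n^{(R,M)}$ in $V^{n+1}/\Delta G\times\mathbf G_m^h\to U^{n+1}\times\mathbf G_m^h\to P_n^{(R,M)}$. By functoriality, $Q_\bullet^{(R,M)}\to P_\bullet^{(R,M)}$ is a morphism of oversimplicial schemes. The ramification of $V$ over $U$ along $D$ is *bounded by $R+$* if $Q_1^{(R,M)}\to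 P_1^{(R,M)}$ is étale on a neighbourhood of the image of the morphism $Q_0^{(R,M)}\to Q_1^{(R,M)}$ induced by $[0,1]\to[0]$. **Theorem.** Assume that the ramification of $V$ over $U$ along $D$ is bounded by $R+$. For every $n\ge0$ let $W_n^{(R,M)}$ be the largest open subscheme of $Q_n^{(R,M)}$ that is étale over $P_n^{(R,M)}$. Then: 1. the $W_n^{(R,M)}$ form an oversimplicial open subscheme $W_\bullet^{(R,M)}$ of $Q_\bullet^{(R,M)}$, i.e. for every map $[0,n]\to[0,m]$ the morphism $Q_m^{(R,M)}\to Q_n^{(R,M)}$ maps $W_m^{(R,M)}$ into $W_n^{(R,M)}$; 2. the morphism $W_\bullet^{(R,M)}\to P_\bullet^{(R,M)}$ is multiplicative; 3. the oversimplicial scheme $W_\bullet=W_\bullet^{(R,M)}$ is multiplicative. In particular $W_1$ is a groupoid over $W_0$: the source and target $s,t\colon W_1\to W_0$ are induced by $0\mapsto0$ and $0\mapsto1$, the unit by $[0,1]\to[0]$, the inverse by the transposition of $[0,1]$, and the composition is $$W_1\times_{t,W_0,s}W_1\ \xleftarrow{\ \cong\ }\ W_2\longrightarrow W_1,$$ where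 the isomorphism is induced by $(0,1)\mapsto(0,1)$ and $(0,1)\mapsto(1,2)$, and the second morphism by $(0,1)\mapsto(0,2)$. -/

import Mathlib

open CategoryTheory Limits AlgebraicGeometry Opposite
open AlgebraicGeometry.Scheme.AffineZariskiSite
universe u
noncomputable section
namespace RelSpec

lemma specMap_fromSpec_le {S : Scheme.{u}} {U : S.Opens} (hU : IsAffineOpen U) {R : CommRingCat.{u}}
    (a : Γ(S, U) ⟶ R) : (⊤ : (Spec R).Opens) ≤ (Spec.map a ≫ hU.fromSpec) ⁻¹ᵁ U := by
  rw [Scheme.Hom.comp_preimage, hU.fromSpec_preimage_self]; rfl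

lemma specMap_fromSpec_appLE {S : Scheme.{u}} {U : S.Opens} (hU : IsAffineOpen U)
    {R : CommRingCat.{u}} (a : Γ(S, U) ⟶ R) :
    (Spec.map a ≫ hU.fromSpec).appLE U ⊤ (specMap_fromSpec_le hU a) ≫
      (Scheme.ΓSpecIso R).hom = a := by
  have h3 : hU.fromSpec.appLE U ⊤ hU.fromSpec_preimage_self.ge =
      (Scheme.ΓSpecIso Γ(S, U)).inv := by
    rw [Scheme.Hom.appLE, IsAffineOpen.fromSpec_app_self, Category.assoc, ← Functor.map_comp]
    exact Category.comp_id _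
  have h4 : (Spec.map a).appLE ⊤ ⊤ le_rfl = (Spec.map a).appTop :=
    ((Spec.map a).app_eq_appLE (U := ⊤)).symm
  rw [← Scheme.Hom.appLE_comp_appLE _ _ U ⊤ ⊤ hU.fromSpec_preimage_self.ge le_rfl, h3, h4,
    Category.assoc, Iso.inv_comp_eq]
  exact Scheme.ΓSpecIso_naturality _
variable {S : Scheme.{u}} {F : S.AffineZariskiSiteᵒᵖ ⥤ CommRingCat.{u}}
  {α : (toOpensFunctor S).op ⋙ S.presheaf ⟶ F} (H : α.Coequifibered)

instance : ((relativeGluingData H).functor ⋙ Scheme.forget).IsLocallyDirected :=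
  Scheme.Cover.RelativeGluingData.instIsLocallyDirectedI₀CompFunctorForgetOfIsThin ..

/-- The relative spectrum of a quasi-coherent algebra. -/
def spec : Scheme.{u} := (relativeGluingData H).glued

/-- The structure morphism of the relative spectrum. -/
def str : spec H ⟶ S := (relativeGluingData H).toBase

/-- The cover of the relative spectrum by affine charts. -/
def chartCover : (spec H).OpenCover := (relativeGluingData H).cover

/-- The affine charts of the relative spectrum. -/
def chart (U : S.AffineZariskiSite) : Spec (F.obj (op U)) ⟶ spec H :=
  (chartCover H).f U

lemma isOpenImmersion_chart (U : S.AffineZariskiSite) : IsOpenImmersion (chart H U) :=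
  (chartCover H).map_prop U
instance (U : S.AffineZariskiSite) : IsOpenImmersion (chart H U) := isOpenImmersion_chart H U

lemma chart_str (U : S.AffineZariskiSite) :
    chart H U ≫ str H = Spec.map (α.app (op U)) ≫ U.2.fromSpec :=
  colimit.ι_desc _ _

lemma chart_map {U V : S.AffineZariskiSite} (h : U ⟶ V) :
    Spec.map (F.map h.op) ≫ chart H V = chart H U :=
  colimit.w (relativeGluingData H).functor h

lemma str_preimage (U : S.AffineZariskiSite) : str H ⁻¹ᵁ U.1 = (chart H U).opensRange := by
  simpa using! (relativeGluingData H).toBase_preimage_eq_opensRange_ι U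

lemma isAffineOpen_preimage (U : S.AffineZariskiSite) : IsAffineOpen (str H ⁻¹ᵁ U.1) := by
  rw [str_preimage]; exact isAffineOpen_opensRange _

instance : IsAffineHom (str H) := 
  ⟨fun U hU => isAffineOpen_preimage H ⟨U, hU⟩⟩

/-- Sections of the relative spectrum over an affine open subset. -/
def secIso (U : S.AffineZariskiSite) : Γ(spec H, str H ⁻¹ᵁ U.1) ≅ F.obj (op U) :=
  (spec H).presheaf.mapIso (eqToIso ((chart H U).image_top_eq_opensRange.trans (str_preimage H U).symm)).op ≪≫
    (chart H U).appIso ⊤ ≪≫ Scheme.ΓSpecIso _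


lemma app_secIso (U : S.AffineZariskiSite) :
    (str H).app U.1 ≫ (secIso H U).hom = α.app (op U) := by
  have h1 : (str H).app U.1 ≫ (secIso H U).hom =
      (chart H U ≫ str H).appLE U.1 ⊤ (by
        rw [Scheme.Hom.comp_preimage, str_preimage]; simp) ≫ (Scheme.ΓSpecIso _).hom := by
    simp [secIso, Scheme.Hom.appIso_hom', Scheme.Hom.app_eq_appLE]
  have h2 : (chart H U ≫ str H).appLE U.1 ⊤ (by
        rw [Scheme.Hom.comp_preimage, str_preimage]; simp) = 
        (Spec.map (α.app (op U)) ≫ U.2.fromSpec).appLE U.1 ⊤ (specMap_fromSpec_le U.2 _) := by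
    congr 1; exact chart_str H U
  exact (h1.trans congr($h2 ≫ _)).trans (specMap_fromSpec_appLE U.2 (α.app (op U)))

end RelSpec

/-- A quasi-coherent sub-algebra of `f_* O_Y` for a morphism `f : Y ⟶ S`, given on affine open
subsets of `S`. -/
structure QcohSubalgebra {Y S : Scheme.{u}} (f : Y ⟶ S) where
  carrier (U : S.Opens) (hU : IsAffineOpen U) : Subring Γ(Y, f ⁻¹ᵁ U)
  app_mem (U : S.Opens) (hU : IsAffineOpen U) (a : Γ(S, U)) : f.app U a ∈ carrier U hU
  res_mem (U V : S.Opens) (hU : IsAffineOpen U) (hV : IsAffineOpen V) (h : V ≤ U)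
    (x : Γ(Y, f ⁻¹ᵁ U)) (hx : x ∈ carrier U hU) :
    Y.presheaf.map (homOfLE (f.preimage_mono h)).op x ∈ carrier V hV
  exists_pow (U : S.Opens) (hU : IsAffineOpen U) (r : Γ(S, U)) (x : Γ(Y, f ⁻¹ᵁ S.basicOpen r))
    (hx : x ∈ carrier (S.basicOpen r) (hU.basicOpen r)) :
    ∃ (n : ℕ) (y : Γ(Y, f ⁻¹ᵁ U)), y ∈ carrier U hU ∧
      Y.presheaf.map (homOfLE (f.preimage_mono (S.basicOpen_le r))).op y =
        Y.presheaf.map (homOfLE (f.preimage_mono (S.basicOpen_le r))).op (f.app U r ^ n) * x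

namespace QcohSubalgebra
variable {Y S : Scheme.{u}} {f : Y ⟶ S} (B : QcohSubalgebra f)

/-- The presheaf of algebras on affine open subsets. -/
def diagram : S.AffineZariskiSiteᵒᵖ ⥤ CommRingCat.{u} where
  obj U := .of (B.carrier U.unop.1 U.unop.2)
  map {U V} i := CommRingCat.ofHom
    ((Y.presheaf.map (homOfLE (f.preimage_mono (toOpens_mono i.unop.le))).op).hom.restrict
      (B.carrier U.unop.1 U.unop.2) (B.carrier V.unop.1 V.unop.2)
      (B.res_mem _ _ U.unop.2 V.unop.2 (toOpens_mono i.unop.le)))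
  map_id U := by
    ext x
    exact congr($(Y.presheaf.map_id _) x.1)
  map_comp {U V W} i j := by
    ext x
    exact congr($(Y.presheaf.map_comp
      (homOfLE (f.preimage_mono (toOpens_mono i.unop.le))).op
      (homOfLE (f.preimage_mono (toOpens_mono j.unop.le))).op) x.1)

/-- The structure map of the algebra. -/
def unit : (toOpensFunctor S).op ⋙ S.presheaf ⟶ B.diagram where
  app U := CommRingCat.ofHom ((f.app U.unop.1).hom.codRestrict
    (B.carrier U.unop.1 U.unop.2) (B.app_mem U.unop.1 U.unop.2))
  naturality {U V} i := by
    ext x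
    apply Subtype.ext
    exact congr($(f.naturality (homOfLE (toOpens_mono i.unop.le)).op) x)


lemma exists_pow_mul_eq_zero [QuasiCompact f] {U : S.Opens} (hU : IsAffineOpen U) (r : Γ(S, U)) (x : Γ(Y, f ⁻¹ᵁ U))
    (hx : Y.presheaf.map (homOfLE (f.preimage_mono (S.basicOpen_le r))).op x = 0) :
    ∃ n : ℕ, f.app U r ^ n * x = 0 := by
  have h := exists_pow_mul_eq_zero_of_res_basicOpen_eq_zero_of_isCompact Y
    (f.isCompact_preimage hU.isCompact) x (f.app U r) (by
      have e : Y.basicOpen (f.app U r) ≤ f ⁻¹ᵁ S.basicOpen r := (f.preimage_basicOpen r).ge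
      have := congr(Y.presheaf.map (homOfLE e).op $hx)
      rw [← ConcreteCategory.comp_apply, ← Functor.map_comp, map_zero] at this
      exact this)
  exact h

lemma isUnit_unit (U : S.Opens) (hU : IsAffineOpen U) (r : Γ(S, U)) :
    IsUnit ((B.diagram.map (homOfLE (Scheme.AffineZariskiSite.basicOpen_le (⟨U, hU⟩ : S.AffineZariskiSite) r)).op).hom
      ((B.unit.app (op ⟨U, hU⟩)).hom r)) := by
  have h1 : IsUnit (S.presheaf.map (homOfLE (S.basicOpen_le r)).op r) :=
    RingedSpace.isUnit_res_basicOpen _ r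
  have h2 := h1.map ((f.app (S.basicOpen r)).hom.codRestrict
    (B.carrier _ (hU.basicOpen r)) (B.app_mem _ (hU.basicOpen r)))
  have hn := congr(($(B.unit.naturality (homOfLE (Scheme.AffineZariskiSite.basicOpen_le
    (⟨U, hU⟩ : S.AffineZariskiSite) r)).op)).hom r)
  exact hn ▸ h2

lemma coequifibered [QuasiCompact f] : B.unit.Coequifibered := by
  refine coequifibered_iff_forall_isLocalizationAway.mpr fun U r ↦ ?_
  let _ := (B.diagram.map (homOfLE (U.basicOpen_le r)).op).hom.toAlgebra
  have hle : f ⁻¹ᵁ S.basicOpen r ≤ f ⁻¹ᵁ U.1 := f.preimage_mono (S.basicOpen_le r)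
  refine ⟨?_, ?_, ?_⟩
  · rintro ⟨_, n, rfl⟩
    have := (B.isUnit_unit U.1 U.2 r).pow n
    rw [← map_pow] at this
    exact this
  · intro z
    obtain ⟨n, y, hy, e⟩ := B.exists_pow U.1 U.2 r z.1 z.2
    refine ⟨⟨⟨y, hy⟩, ⟨_, n, rfl⟩⟩, Subtype.ext ?_⟩
    refine (mul_comm _ _).trans (Eq.trans ?_ e.symm)
    rfl
  · intro x y e
    have e' : Y.presheaf.map (homOfLE hle).op (x.1 - y.1) = 0 := by
      rw [map_sub, sub_eq_zero]
      exact congr(($e).1)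
    obtain ⟨n, hn⟩ := exists_pow_mul_eq_zero (f := f) U.2 r _ e'
    refine ⟨⟨_, n, rfl⟩, Subtype.ext ?_⟩
    rw [mul_sub, sub_eq_zero] at hn
    exact hn

end QcohSubalgebra

lemma exists_glue {X Y : Scheme.{u}} {κ : Type u} (U : κ → X.Opens)
    (hU : TopologicalSpace.IsOpenCover U) (f : ∀ i, (U i).toScheme ⟶ Y)
    (H : ∀ i j x, x ∈ U i → x ∈ U j → ∃ (W : X.Opens) (_ : x ∈ W) (hi : W ≤ U i) (hj : W ≤ U j),
      X.homOfLE hi ≫ f i = X.homOfLE hj ≫ f j) :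
    ∃ u : X ⟶ Y, ∀ i, (U i).ι ≫ u = f i := by
  let 𝒰 : X.OpenCover := X.openCoverOfIsOpenCover U hU
  have key (i j : κ) {Z : Scheme.{u}} (a : Z ⟶ U i) (b : Z ⟶ U j) (q : Z ⟶ X)
      (ha : a ≫ (U i).ι = q) (hb : b ≫ (U j).ι = q) : a ≫ f i = b ≫ f j := by
    refine Scheme.hom_ext_of_forall _ _ fun z ↦ ?_
    have hi : q z ∈ U i := by rw [← ha]; exact (a z).2
    have hj : q z ∈ U j := by rw [← hb]; exact (b z).2
    obtain ⟨W, hW, hi, hj, e⟩ := H i j (q z) hi hj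
    refine ⟨q ⁻¹ᵁ W, hW, ?_⟩
    have h1 : (q ⁻¹ᵁ W).ι ≫ a = (q ∣_ W) ≫ X.homOfLE hi := by
      rw [← cancel_mono (U i).ι, Category.assoc, ha, Category.assoc, Scheme.homOfLE_ι,
        morphismRestrict_ι]
    have h2 : (q ⁻¹ᵁ W).ι ≫ b = (q ∣_ W) ≫ X.homOfLE hj := by
      rw [← cancel_mono (U j).ι, Category.assoc, hb, Category.assoc, Scheme.homOfLE_ι,
        morphismRestrict_ι]
    rw [← Category.assoc, ← Category.assoc, h1, h2, Category.assoc, Category.assoc, e]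
  exact ⟨𝒰.glueMorphisms f fun i j ↦ key i j _ _ _ rfl pullback.condition.symm,
    fun i ↦ 𝒰.ι_glueMorphisms _ _ i⟩

namespace QcohSubalgebra
variable {Y S : Scheme.{u}} {f : Y ⟶ S} (B : QcohSubalgebra f) [QuasiCompact f]

/-- The relative spectrum of a quasi-coherent sub-algebra. -/
def spec : Scheme.{u} := RelSpec.spec B.coequifibered

/-- The structure morphism of the relative spectrum. -/
def str : B.spec ⟶ S := RelSpec.str B.coequifibered

instance : IsAffineHom B.str := inferInstanceAs (IsAffineHom (RelSpec.str _))

/-- The affine chart of the relative spectrum over an affine open subset. -/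
def chart (U : S.Opens) (hU : IsAffineOpen U) : Spec (.of (B.carrier U hU)) ⟶ B.spec :=
  RelSpec.chart B.coequifibered ⟨U, hU⟩

instance (U : S.Opens) (hU : IsAffineOpen U) : IsOpenImmersion (B.chart U hU) :=
  RelSpec.isOpenImmersion_chart B.coequifibered ⟨U, hU⟩

/-- The structure ring map of the algebra on an affine open subset. -/
def unitHom (U : S.Opens) (hU : IsAffineOpen U) : Γ(S, U) →+* B.carrier U hU :=
  (f.app U).hom.codRestrict (B.carrier U hU) (B.app_mem U hU)

/-- The restriction map of the algebra. -/
def resHom {U V : S.Opens} (hU : IsAffineOpen U) (hV : IsAffineOpen V) (h : V ≤ U) :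
    B.carrier U hU →+* B.carrier V hV :=
  (Y.presheaf.map (homOfLE (f.preimage_mono h)).op).hom.restrict
      (B.carrier U hU) (B.carrier V hV) (B.res_mem _ _ hU hV h)

lemma chart_str (U : S.Opens) (hU : IsAffineOpen U) :
    B.chart U hU ≫ B.str = Spec.map (CommRingCat.ofHom (B.unitHom U hU)) ≫ hU.fromSpec :=
  RelSpec.chart_str B.coequifibered ⟨U, hU⟩

lemma str_preimage (U : S.Opens) (hU : IsAffineOpen U) :
    B.str ⁻¹ᵁ U = (B.chart U hU).opensRange :=
  RelSpec.str_preimage B.coequifibered ⟨U, hU⟩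

lemma chart_res {U V : S.Opens} (hU : IsAffineOpen U) (hV : IsAffineOpen V) (h : V ≤ U)
    (hb : ∃ r : Γ(S, U), S.basicOpen r = V) :
    Spec.map (CommRingCat.ofHom (B.resHom hU hV h)) ≫ B.chart U hU = B.chart V hV := by
  obtain ⟨r, rfl⟩ := hb
  exact RelSpec.chart_map B.coequifibered (homOfLE (Scheme.AffineZariskiSite.basicOpen_le (⟨U, hU⟩ : S.AffineZariskiSite) r))

lemma exists_local {T : Scheme.{u}} {g : T ⟶ S} {U : S.Opens} (hU : IsAffineOpen U)
    (W : T.affineOpens) (hWU : W.1 ≤ g ⁻¹ᵁ U) (ψ : B.carrier U hU →+* Γ(T, W.1))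
    (hψ : ∀ a, ψ (B.unitHom U hU a) = g.appLE U W hWU a) :
    ∃ b : W.1.toScheme ⟶ B.spec, b ≫ B.str = W.1.ι ≫ g := by
  refine ⟨W.1.toSpecΓ ≫ Spec.map (CommRingCat.ofHom ψ) ≫ B.chart U hU, ?_⟩
  have h2 : CommRingCat.ofHom (B.unitHom U hU) ≫ CommRingCat.ofHom ψ = g.appLE U W hWU := by
    ext a; exact hψ a
  rw [Category.assoc, Category.assoc, B.chart_str, ← Spec.map_comp_assoc, h2,
    hU.SpecMap_appLE_fromSpec g W.2, W.2.toSpecΓ_fromSpec_assoc]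

/-- Over `g : T ⟶ S`, a compatible family of maps from the algebra to the sections of `T`. -/
structure Family {T : Scheme.{u}} (g : T ⟶ S) where
  map (U : S.Opens) (hU : IsAffineOpen U) : B.carrier U hU →+* Γ(T, g ⁻¹ᵁ U)
  map_unit (U : S.Opens) (hU : IsAffineOpen U) (a : Γ(S, U)) :
    map U hU (B.unitHom U hU a) = g.app U a
  map_res {U V : S.Opens} (hU : IsAffineOpen U) (hV : IsAffineOpen V) (h : V ≤ U)
    (x : B.carrier U hU) :
    map V hV (B.resHom hU hV h x) = T.presheaf.map (homOfLE (g.preimage_mono h)).op (map U hU x)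

variable {B}

/-- The local morphisms given by a compatible family. -/
def Family.loc {T : Scheme.{u}} {g : T ⟶ S} (φ : B.Family g) (U : S.Opens) (hU : IsAffineOpen U) :
    (g ⁻¹ᵁ U).toScheme ⟶ B.spec :=
  (g ⁻¹ᵁ U).toSpecΓ ≫ Spec.map (CommRingCat.ofHom (φ.map U hU)) ≫ B.chart U hU

lemma Family.loc_str {T : Scheme.{u}} {g : T ⟶ S} (φ : B.Family g) (U : S.Opens)
    (hU : IsAffineOpen U) : φ.loc U hU ≫ B.str = (g ⁻¹ᵁ U).ι ≫ g := by
  rw [loc, Category.assoc, Category.assoc, chart_str, ← Spec.map_comp_assoc]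
  have : CommRingCat.ofHom (B.unitHom U hU) ≫ CommRingCat.ofHom (φ.map U hU) = g.app U := by
    ext a; exact φ.map_unit U hU a
  rw [this]
  simp

lemma Family.loc_res {T : Scheme.{u}} {g : T ⟶ S} (φ : B.Family g) {U V : S.Opens}
    (hU : IsAffineOpen U) (hV : IsAffineOpen V) (h : V ≤ U)
    (hb : ∃ r : Γ(S, U), S.basicOpen r = V) :
    T.homOfLE (g.preimage_mono h) ≫ φ.loc U hU = φ.loc V hV := by
  have : CommRingCat.ofHom (φ.map U hU) ≫ T.presheaf.map (homOfLE (g.preimage_mono h)).op =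
      CommRingCat.ofHom (B.resHom hU hV h) ≫ CommRingCat.ofHom (φ.map V hV) := by
    ext a; exact (φ.map_res hU hV h a).symm
  rw [loc, loc, ← Scheme.Opens.toSpecΓ_SpecMap_presheaf_map_assoc, ← Spec.map_comp_assoc, this,
    Spec.map_comp_assoc, B.chart_res hU hV h hb]


lemma Family.exists_hom {T : Scheme.{u}} {g : T ⟶ S} (φ : B.Family g) :
    ∃ u : T ⟶ B.spec, u ≫ B.str = g ∧ ∀ U hU, (g ⁻¹ᵁ U).ι ≫ u = φ.loc U hU := by
  obtain ⟨u, hu⟩ := exists_glue (fun U : S.affineOpens ↦ g ⁻¹ᵁ U.1)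
    (.comap (iSup_affineOpens_eq_top S) g.base.1) (fun U ↦ φ.loc U.1 U.2) (by
      intro U V x hxU hxV
      obtain ⟨a, b, e, hx⟩ := exists_basicOpen_le_affine_inter U.2 V.2 (g x) ⟨hxU, hxV⟩
      refine ⟨g ⁻¹ᵁ S.basicOpen a, hx, g.preimage_mono (S.basicOpen_le a),
        g.preimage_mono (e.trans_le (S.basicOpen_le b)), ?_⟩
      rw [φ.loc_res U.2 (U.2.basicOpen a) (S.basicOpen_le a) ⟨a, rfl⟩,
        φ.loc_res V.2 (U.2.basicOpen a) (e.trans_le (S.basicOpen_le b)) ⟨b, e.symm⟩])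
  refine ⟨u, Scheme.Cover.hom_ext (T.openCoverOfIsOpenCover _
    (.comap (iSup_affineOpens_eq_top S) g.base.1)) _ _ fun U ↦ ?_, fun U hU ↦ hu ⟨U, hU⟩⟩
  exact (Category.assoc ..).symm.trans (congr($(hu U) ≫ B.str).trans (φ.loc_str U.1 U.2))

end QcohSubalgebra

section Ideals
open Scheme.IdealSheafData
variable {X Y : Scheme.{u}}

lemma isIso_map_of_eq {U V : X.Opens} (i : U ⟶ V) (h : U = V) : IsIso (X.presheaf.map i.op) := by
  subst h; rw [Subsingleton.elim i (𝟙 _)]; infer_instance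

lemma ideal_comap_top_of_isAffine [IsAffine X] [IsAffine Y] (f : X ⟶ Y) (I : Y.IdealSheafData) :
    (I.comap f).ideal ⟨⊤, isAffineOpen_top X⟩ =
      (I.ideal ⟨⊤, isAffineOpen_top Y⟩).map f.appTop.hom := by
  apply le_antisymm
  · let K : X.IdealSheafData := ofIdealTop ((I.ideal ⟨⊤, isAffineOpen_top Y⟩).map f.appTop.hom)
    have hK : K.ideal ⟨⊤, isAffineOpen_top X⟩ =
        (I.ideal ⟨⊤, isAffineOpen_top Y⟩).map f.appTop.hom := by simp [K]
    have h : I.comap f ≤ K := by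
      rw [← le_map_iff_comap_le]
      apply le_of_isAffine
      rw [ideal_map_of_isAffineHom, ← Ideal.map_le_iff_le_comap]
      exact hK.ge
    exact (h _).trans hK.le
  · have h := le_map_comap I f ⟨⊤, isAffineOpen_top Y⟩
    rw [ideal_map_of_isAffineHom, ← Ideal.map_le_iff_le_comap] at h
    exact h

lemma ideal_comap_of_isOpenImmersion' (j : X ⟶ Y) [IsOpenImmersion j] (I : Y.IdealSheafData)
    (U : X.affineOpens) (V : Y.affineOpens) (h : j ''ᵁ U.1 = V.1) (e : U.1 ≤ j ⁻¹ᵁ V.1) :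
    (I.comap j).ideal U = (I.ideal V).map (j.appLE V U e).hom := by
  obtain ⟨V, hV⟩ := V
  obtain rfl : j ''ᵁ U.1 = V := h
  rw [ideal_comap_of_isOpenImmersion]
  have : (j.appLE (j ''ᵁ U.1) U e) = (j.appIso U).hom := (j.appIso_hom' _).symm
  erw [this]
  exact (Ideal.map_comap_of_equiv (j.appIso U.1).commRingCatIsoToRingEquiv).symm

/-- The inverse image ideal sheaf on affine open subsets. -/
lemma ideal_comap (f : X ⟶ Y) (I : Y.IdealSheafData) (U : Y.affineOpens) (W : X.affineOpens)
    (h : W.1 ≤ f ⁻¹ᵁ U.1) : (I.comap f).ideal W = (I.ideal U).map (f.appLE U W h).hom := by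
  have hW := W.2
  have hU := U.2
  have : IsAffine W.1.toScheme := W.2
  have : IsAffine U.1.toScheme := U.2
  have e1 : (I.comap f).comap W.1.ι = (I.comap U.1.ι).comap (f.resLE U W h) := by
    rw [← comap_comp, ← comap_comp, Scheme.Hom.resLE_comp_ι]
  have e2 := ideal_comap_top_of_isAffine (f.resLE U W h) (I.comap U.1.ι)
  rw [← e1, ideal_comap_of_isOpenImmersion' W.1.ι _ _ W (by simp) (by simp),
    ideal_comap_of_isOpenImmersion' U.1.ι _ _ U (by simp) (by simp), Ideal.map_map] at e2
  have e3 : U.1.ι.appLE U.1 ⊤ (by simp) ≫ (f.resLE U W h).appTop =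
      f.appLE U W h ≫ W.1.ι.appLE W.1 ⊤ (by simp) := by
    have h1 : (f.resLE U W h).appTop = (f.resLE U W h).appLE ⊤ ⊤ (le_of_eq rfl) :=
      (f.resLE U W h).app_eq_appLE
    have h3 : ⊤ ≤ (W.1.ι ≫ f) ⁻¹ᵁ U.1 := fun x _ ↦ h x.2
    have h2 : (f.resLE U W h ≫ U.1.ι).appLE U.1 ⊤ (by rwa [Scheme.Hom.resLE_comp_ι]) =
      (W.1.ι ≫ f).appLE U.1 ⊤ h3 := by
      congr 1; exact Scheme.Hom.resLE_comp_ι ..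
    exact (congr(U.1.ι.appLE U.1 ⊤ (by simp) ≫ $h1)).trans
      ((Scheme.Hom.appLE_comp_appLE _ _ _ _ _ _ _).trans
        (h2.trans (Scheme.Hom.appLE_comp_appLE _ _ _ _ _ _ _).symm))
  have e4 : (f.resLE U W h).appTop.hom.comp (U.1.ι.appLE U.1 ⊤ (by simp)).hom =
      (W.1.ι.appLE W.1 ⊤ (by simp)).hom.comp (f.appLE U W h).hom := congr(($e3).hom)
  rw [e4, ← Ideal.map_map] at e2
  have : IsIso (W.1.ι.appLE W.1 ⊤ (by simp)) := by
    rw [W.1.ι_appLE]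
    exact isIso_map_of_eq _ (by simp)
  have hb := ConcreteCategory.bijective_of_isIso (W.1.ι.appLE W.1 ⊤ (W.1.ι_preimage_self.ge))
  exact (Ideal.comap_map_of_bijective _ hb).symm.trans
    ((congrArg _ e2).trans (Ideal.comap_map_of_bijective _ hb))
end Ideals

section Principal
open Scheme.IdealSheafData
variable {X Y : Scheme.{u}}

/-- An ideal sheaf is locally principal if it is locally generated by one section. -/
def IsLocallyPrincipal (J : X.IdealSheafData) : Prop :=
  ∀ x : X, ∃ U : X.affineOpens, x ∈ U.1 ∧ ∃ t : Γ(X, U), J.ideal U = Ideal.span {t}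

/-- An ideal sheaf is invertible if it is locally generated by one nonzerodivisor, i.e. if it
defines an effective Cartier divisor. -/
def IsInvertible (J : X.IdealSheafData) : Prop :=
  ∀ x : X, ∃ U : X.affineOpens, x ∈ U.1 ∧ ∃ t ∈ nonZeroDivisors Γ(X, U), J.ideal U = Ideal.span {t}

lemma IsInvertible.isLocallyPrincipal {J : X.IdealSheafData} (h : IsInvertible J) :
    IsLocallyPrincipal J := fun x ↦ by
  obtain ⟨U, hx, t, -, e⟩ := h x
  exact ⟨U, hx, t, e⟩

lemma isInvertible_top : IsInvertible (⊤ : X.IdealSheafData) := fun x ↦ by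
  obtain ⟨U, hU, hx, -⟩ := exists_isAffineOpen_mem_and_subset (X := X) (x := x) (U := ⊤) trivial
  exact ⟨⟨U, hU⟩, hx, 1, one_mem _, by simp⟩

lemma ideal_span_of_le {J : X.IdealSheafData} {U V : X.affineOpens} (h : V.1 ≤ U.1)
    {t : Γ(X, U)} (e : J.ideal U = Ideal.span {t}) :
    J.ideal V = Ideal.span {X.presheaf.map (homOfLE h).op t} := by
  rw [← J.map_ideal (U := V) (V := U) h, e, Ideal.map_span, Set.image_singleton]
  rfl

lemma nonZeroDivisors_basicOpen {U : X.Opens} (hU : IsAffineOpen U) (r : Γ(X, U)) {t : Γ(X, U)}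
    (ht : t ∈ nonZeroDivisors Γ(X, U)) :
    X.presheaf.map (homOfLE (X.basicOpen_le r)).op t ∈ nonZeroDivisors Γ(X, X.basicOpen r) := by
  have := hU.isLocalization_basicOpen r
  exact IsLocalization.map_nonZeroDivisors_le (.powers r) _ ⟨t, ht, rfl⟩

lemma IsLocallyPrincipal.exists_le {J : X.IdealSheafData} (h : IsLocallyPrincipal J)
    (O : X.Opens) (x : X) (hx : x ∈ O) :
    ∃ U : X.affineOpens, x ∈ U.1 ∧ U.1 ≤ O ∧ ∃ t : Γ(X, U), J.ideal U = Ideal.span {t} := by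
  obtain ⟨U, hxU, t, e⟩ := h x
  obtain ⟨r, hr, hxr⟩ := U.2.exists_basicOpen_le ⟨x, hx⟩ hxU
  exact ⟨X.affineBasicOpen r, hxr, hr, _, ideal_span_of_le (X.basicOpen_le r) e⟩

lemma IsInvertible.exists_le {J : X.IdealSheafData} (h : IsInvertible J)
    (O : X.Opens) (x : X) (hx : x ∈ O) :
    ∃ U : X.affineOpens, x ∈ U.1 ∧ U.1 ≤ O ∧
      ∃ t ∈ nonZeroDivisors Γ(X, U), J.ideal U = Ideal.span {t} := by
  obtain ⟨U, hxU, t, ht, e⟩ := h x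
  obtain ⟨r, hr, hxr⟩ := U.2.exists_basicOpen_le ⟨x, hx⟩ hxU
  exact ⟨X.affineBasicOpen r, hxr, hr, _, nonZeroDivisors_basicOpen U.2 r ht,
    ideal_span_of_le (X.basicOpen_le r) e⟩

lemma IsLocallyPrincipal.mul {I J : X.IdealSheafData} (hI : IsLocallyPrincipal I)
    (hJ : IsLocallyPrincipal J) : IsLocallyPrincipal (I * J) := fun x ↦ by
  obtain ⟨U, hxU, t, e⟩ := hI x
  obtain ⟨V, hxV, hVU, s, e'⟩ := hJ.exists_le U.1 x hxU
  refine ⟨V, hxV, X.presheaf.map (homOfLE hVU).op t * s, ?_⟩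
  rw [ideal_mul, Pi.mul_apply, e', ideal_span_of_le hVU e, Ideal.span_singleton_mul_span_singleton]

lemma IsInvertible.mul {I J : X.IdealSheafData} (hI : IsInvertible I)
    (hJ : IsInvertible J) : IsInvertible (I * J) := fun x ↦ by
  obtain ⟨U, hxU, t, ht, e⟩ := hI x
  obtain ⟨V, hxV, hVU, s, hs, e'⟩ := hJ.exists_le U.1 x hxU
  obtain ⟨r, r', hr, hxr⟩ := exists_basicOpen_le_affine_inter V.2 U.2 x ⟨hxV, hxU⟩
  have h1 := nonZeroDivisors_basicOpen U.2 r' ht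
  have h2 := nonZeroDivisors_basicOpen V.2 r hs
  have h3 : X.presheaf.map (homOfLE (hr.trans_le (X.basicOpen_le r'))).op t ∈
      nonZeroDivisors Γ(X, X.basicOpen r) := by
    revert hr
    generalize X.basicOpen r = W
    rintro rfl
    exact h1
  refine ⟨X.affineBasicOpen r, hxr, _, mul_mem h3 h2, Eq.trans ?_ (Ideal.span_singleton_mul_span_singleton _ _)⟩
  rw [ideal_mul, Pi.mul_apply, ideal_span_of_le (V := X.affineBasicOpen r) (X.basicOpen_le r) e',
    ideal_span_of_le (V := X.affineBasicOpen r) (hr.trans_le (X.basicOpen_le r')) e]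
  rfl

lemma IsLocallyPrincipal.prod {κ : Type*} (s : Finset κ) (J : κ → X.IdealSheafData)
    (h : ∀ i, IsLocallyPrincipal (J i)) : IsLocallyPrincipal (∏ i ∈ s, J i) :=
  Finset.prod_induction J _ (fun _ _ ↦ .mul) isInvertible_top.isLocallyPrincipal fun i _ ↦ h i

lemma IsInvertible.prod {κ : Type*} (s : Finset κ) (J : κ → X.IdealSheafData)
    (h : ∀ i, IsInvertible (J i)) : IsInvertible (∏ i ∈ s, J i) :=
  Finset.prod_induction J _ (fun _ _ ↦ .mul) isInvertible_top fun i _ ↦ h i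

lemma IsLocallyPrincipal.pow {J : X.IdealSheafData} (h : IsLocallyPrincipal J) (n : ℕ) :
    IsLocallyPrincipal (J ^ n) := by
  simpa using IsLocallyPrincipal.prod (Finset.range n) (fun _ ↦ J) fun _ ↦ h

lemma IsLocallyPrincipal.comap {J : Y.IdealSheafData} (h : IsLocallyPrincipal J) (f : X ⟶ Y) :
    IsLocallyPrincipal (J.comap f) := fun x ↦ by
  obtain ⟨U, hxU, t, e⟩ := h (f x)
  obtain ⟨W, hW, hx, hle⟩ := exists_isAffineOpen_mem_and_subset (X := X) (x := x) (U := f ⁻¹ᵁ U.1) hxU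
  refine ⟨⟨W, hW⟩, hx, f.appLE U W hle t, ?_⟩
  rw [ideal_comap f J U ⟨W, hW⟩ hle, e, Ideal.map_span, Set.image_singleton]

lemma comap_mul (f : X ⟶ Y) (I J : Y.IdealSheafData) :
    (I * J).comap f = I.comap f * J.comap f := by
  have (x : X) : ∃ W : X.affineOpens, x ∈ W.1 ∧ ∃ U : Y.affineOpens, W.1 ≤ f ⁻¹ᵁ U.1 := by
    obtain ⟨U, hU, hx, -⟩ := exists_isAffineOpen_mem_and_subset (X := Y) (x := f x) (U := ⊤) trivial
    obtain ⟨W, hW, hx', hle⟩ := exists_isAffineOpen_mem_and_subset (X := X) (x := x) (U := f ⁻¹ᵁ U) hx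
    exact ⟨⟨W, hW⟩, hx', ⟨U, hU⟩, hle⟩
  choose W hW U hWU using this
  refine ext_of_iSup_eq_top W (top_le_iff.mp fun x _ ↦
    TopologicalSpace.Opens.mem_iSup.mpr ⟨x, hW x⟩) fun x ↦ ?_
  rw [ideal_mul, Pi.mul_apply, ideal_comap f _ (U x) _ (hWU x), ideal_comap f _ (U x) _ (hWU x),
    ideal_comap f _ (U x) _ (hWU x), ideal_mul, Pi.mul_apply, Ideal.map_mul]

lemma comap_prod {κ : Type*} (s : Finset κ) (f : X ⟶ Y) (J : κ → Y.IdealSheafData) :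
    (∏ i ∈ s, J i).comap f = ∏ i ∈ s, (J i).comap f := by
  classical
  induction s using Finset.induction_on with
  | empty => simp
  | insert a s ha ih => rw [Finset.prod_insert ha, Finset.prod_insert ha, comap_mul, ih]

lemma comap_pow (f : X ⟶ Y) (J : Y.IdealSheafData) (n : ℕ) :
    (J ^ n).comap f = (J.comap f) ^ n := by
  simpa using comap_prod (Finset.range n) f fun _ ↦ J

lemma IsLocallyPrincipal.fg {J : X.IdealSheafData} (h : IsLocallyPrincipal J)
    (U : X.affineOpens) : (J.ideal U).FG := by
  let s : Set Γ(X, U) := { r | ∃ t, J.ideal (X.affineBasicOpen r) = Ideal.span {t} }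
  refine Ideal.fg_of_localizationSpan s ?_ fun r ↦ ?_
  · rw [← U.2.self_le_iSup_basicOpen_iff]
    intro x hx
    obtain ⟨V, hxV, t, e⟩ := h x
    obtain ⟨r, r', hr, hxr⟩ := exists_basicOpen_le_affine_inter U.2 V.2 x ⟨hx, hxV⟩
    exact TopologicalSpace.Opens.mem_iSup.mpr ⟨⟨r, _, ideal_span_of_le
      (V := X.affineBasicOpen r) (hr.trans_le (X.basicOpen_le r')) e⟩, hxr⟩
  · obtain ⟨t, ht⟩ := r.2
    have := U.2.isLocalization_basicOpen r.1
    let e := IsLocalization.algEquiv (.powers r.1) Γ(X, X.basicOpen r.1) (Localization.Away r.1)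
    have h1 : algebraMap Γ(X, U) (Localization.Away r.1) =
        (e : _ →+* _).comp (X.presheaf.map (homOfLE (X.basicOpen_le r.1)).op).hom := by
      ext x; exact (e.commutes x).symm
    rw [h1, ← Ideal.map_map, J.map_ideal_basicOpen]
    have h2 : (J.ideal (X.affineBasicOpen r.1)).FG := ht ▸ Submodule.fg_span_singleton _
    exact h2.map _

end Principal

/-- The open complement of the closed subset defined by an ideal sheaf. -/
def complOpen {X : Scheme.{u}} (J : X.IdealSheafData) : X.Opens :=
  ⟨(J.support : Set X)ᶜ, J.support.isClosed.isOpen_compl⟩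

lemma complOpen_inf {X : Scheme.{u}} (J : X.IdealSheafData) (U : X.affineOpens) {t : Γ(X, U)}
    (e : J.ideal U = Ideal.span {t}) : complOpen J ⊓ U.1 = X.basicOpen t := by
  ext x
  have h := Set.ext_iff.mp (J.coe_support_inter U) x
  rw [e, Scheme.zeroLocus_span, Scheme.zeroLocus_singleton] at h
  have := X.basicOpen_le t
  constructor
  · rintro ⟨h1, h2⟩
    by_contra h3
    exact h1 (h.mpr ⟨h3, h2⟩).1
  · intro h3
    exact ⟨fun h4 ↦ (h.mp ⟨h4, this h3⟩).1 h3, this h3⟩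

lemma preimage_complOpen {X Y : Scheme.{u}} (f : X ⟶ Y) (J : Y.IdealSheafData) :
    f ⁻¹ᵁ complOpen J = complOpen (J.comap f) := by
  ext x
  have := Set.ext_iff.mp (congr(($(J.support_comap f) : Set X))) x
  exact not_congr this.symm

lemma isAffineHom_complOpen {X : Scheme.{u}} {J : X.IdealSheafData} (h : IsLocallyPrincipal J) :
    IsAffineHom (complOpen J).ι := by
  apply isAffineHom_of_forall_exists_isAffineOpen
  intro x
  obtain ⟨U, hxU, t, e⟩ := h x
  refine ⟨U.1, hxU, U.2, ?_⟩
  rw [← Scheme.Hom.isAffineOpen_iff_of_isOpenImmersion (complOpen J).ι]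
  have : (complOpen J).ι ''ᵁ (complOpen J).ι ⁻¹ᵁ U.1 = X.basicOpen t := by
    rw [Scheme.Hom.image_preimage_eq_opensRange_inf, Scheme.Opens.opensRange_ι, complOpen_inf J U e]
  rw [this]
  exact U.2.basicOpen t

section Dilatation
variable {Y P : Scheme.{u}} (j : Y ⟶ P) {κ : Type*} (I J : κ → P.IdealSheafData)

/-- The fractions `x / t` with `x` in `I i` and denominators in `J i`, as sections of `Y`. -/
def dilGens (U : P.Opens) (hU : IsAffineOpen U) : Set Γ(Y, j ⁻¹ᵁ U) :=
  { b | ∃ i, ∀ t ∈ (J i).ideal ⟨U, hU⟩, ∃ x ∈ (I i).ideal ⟨U, hU⟩, j.app U t * b = j.app U x }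

/-- The sub-algebra generated by the fractions. -/
def dilCarrier (U : P.Opens) (hU : IsAffineOpen U) : Subring Γ(Y, j ⁻¹ᵁ U) :=
  Subring.closure ((j.app U).hom.range ∪ dilGens j I J U hU)

lemma dil_res_mem {U V : P.Opens} (hU : IsAffineOpen U) (hV : IsAffineOpen V) (h : V ≤ U)
    (b : Γ(Y, j ⁻¹ᵁ U)) (hb : b ∈ dilCarrier j I J U hU) :
    Y.presheaf.map (homOfLE (j.preimage_mono h)).op b ∈ dilCarrier j I J V hV := by
  let φ := Y.presheaf.map (homOfLE (j.preimage_mono h)).op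
  have nat (a : Γ(P, U)) : φ (j.app U a) = j.app V (P.presheaf.map (homOfLE h).op a) :=
    congr(($(j.naturality (homOfLE h).op)).hom a).symm
  suffices dilCarrier j I J U hU ≤ (dilCarrier j I J V hV).comap φ.hom from this hb
  refine Subring.closure_le.mpr ?_
  rintro b (⟨a, rfl⟩ | ⟨i, hi⟩)
  · exact Subring.subset_closure (.inl ⟨_, (nat a).symm⟩)
  · refine Subring.subset_closure (.inr ⟨i, fun t ht ↦ ?_⟩)
    rw [← (J i).map_ideal (U := ⟨V, hV⟩) (V := ⟨U, hU⟩) h] at ht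
    have hx {x} (hx : x ∈ (I i).ideal ⟨U, hU⟩) : P.presheaf.map (homOfLE h).op x ∈ (I i).ideal ⟨V, hV⟩ := by
      rw [← (I i).map_ideal (U := ⟨V, hV⟩) (V := ⟨U, hU⟩) h]
      exact Ideal.mem_map_of_mem _ hx
    induction ht using Submodule.span_induction with
    | mem t ht =>
      obtain ⟨t, ht, rfl⟩ := ht
      obtain ⟨x, hx', e⟩ := hi t ht
      refine ⟨_, hx hx', ?_⟩
      refine Eq.trans ?_ (congr(φ $e).trans (nat x))
      rw [map_mul]
      exact congrArg (· * φ b) (nat t).symm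
    | zero => exact ⟨0, zero_mem _, by simp⟩
    | add t s _ _ ht hs =>
      obtain ⟨x, hx, e⟩ := ht
      obtain ⟨y, hy, e'⟩ := hs
      exact ⟨x + y, add_mem hx hy, by rw [map_add, add_mul, e, e', map_add]⟩
    | smul a t _ ht =>
      obtain ⟨x, hx, e⟩ := ht
      exact ⟨a * x, Ideal.mul_mem_left _ _ hx, by
        rw [smul_eq_mul, map_mul, mul_assoc, e, map_mul]⟩

lemma dil_exists_pow [IsAffineHom j] (hJ : ∀ i, IsLocallyPrincipal (J i)) {U : P.Opens} (hU : IsAffineOpen U)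
    (r : Γ(P, U)) (x : Γ(Y, j ⁻¹ᵁ P.basicOpen r))
    (hx : x ∈ dilCarrier j I J (P.basicOpen r) (hU.basicOpen r)) :
    ∃ (n : ℕ) (y : Γ(Y, j ⁻¹ᵁ U)), y ∈ dilCarrier j I J U hU ∧
      Y.presheaf.map (homOfLE (j.preimage_mono (P.basicOpen_le r))).op y =
      Y.presheaf.map (homOfLE (j.preimage_mono (P.basicOpen_le r))).op (j.app U r ^ n) * x := by
  let φ := Y.presheaf.map
    (homOfLE (j.preimage_mono (P.basicOpen_le r))).op
  let ψ := P.presheaf.map (homOfLE (P.basicOpen_le r)).op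
  have nat (a : Γ(P, U)) : φ (j.app U a) = j.app (P.basicOpen r) (ψ a) :=
    congr(($(j.naturality (homOfLE (P.basicOpen_le r)).op)).hom a).symm
  let _ := ψ.hom.toAlgebra
  let _ := φ.hom.toAlgebra
  have loc : IsLocalization.Away r Γ(P, P.basicOpen r) := hU.isLocalization_basicOpen r
  have loc' : IsLocalization.Away (j.app U r) Γ(Y, j ⁻¹ᵁ P.basicOpen r) :=
    (hU.preimage j).isLocalization_of_eq_basicOpen _ _ (j.preimage_basicOpen r)
  have hI (K : P.IdealSheafData) : (K.ideal ⟨U, hU⟩).map ψ.hom =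
      K.ideal ⟨P.basicOpen r, hU.basicOpen r⟩ := K.map_ideal_basicOpen ⟨U, hU⟩ r
  change ∃ n y, y ∈ dilCarrier j I J U hU ∧ φ y = φ (j.app U r ^ n) * x
  have hr (n : ℕ) : j.app U r ^ n ∈ dilCarrier j I J U hU :=
    pow_mem (Subring.subset_closure (.inl ⟨r, rfl⟩)) n
  induction hx using Subring.closure_induction with
  | mem b hb =>
    rcases hb with ⟨a, rfl⟩ | ⟨i, hi⟩
    · obtain ⟨⟨a', _, n, rfl⟩, e⟩ := IsLocalization.surj (.powers r) a
      refine ⟨n, j.app U a', Subring.subset_closure (.inl ⟨_, rfl⟩), ?_⟩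
      have e' : a * ψ (r ^ n) = ψ a' := e
      refine (nat a').trans ?_
      rw [← e', map_mul, mul_comm, ← nat, map_pow]
    · obtain ⟨⟨y, _, n, rfl⟩, e⟩ := IsLocalization.surj (.powers (j.app U r)) b
      have e : b * φ (j.app U r ^ n) = φ y := e
      have key (t) (ht : t ∈ (J i).ideal ⟨U, hU⟩) : ∃ N : ℕ, ∀ M ≥ N, ∃ x ∈ (I i).ideal ⟨U, hU⟩,
          j.app U t * (j.app U r ^ M * y) = j.app U x := by
        have ht' : ψ t ∈ (J i).ideal ⟨P.basicOpen r, hU.basicOpen r⟩ :=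
          (hI (J i)).le (Ideal.mem_map_of_mem _ ht)
        obtain ⟨x, hx, ex⟩ := hi _ ht'
        have hx : x ∈ ((I i).ideal ⟨U, hU⟩).map ψ.hom := (hI (I i)).ge hx
        obtain ⟨⟨⟨a, ha⟩, _, m, rfl⟩, ea⟩ := (IsLocalization.mem_map_algebraMap_iff (.powers r) _).mp hx
        have ea : x * ψ (r ^ m) = ψ a := ea
        have e0 : φ (j.app U t * y * j.app U r ^ m) = φ (j.app U a * j.app U r ^ n) := by
          have h1 : j.app (P.basicOpen r) x * φ (j.app U r ^ m) = φ (j.app U a) := by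
            rw [nat, ← ea, map_mul, ← map_pow (j.app U).hom, nat]
          have h2 : φ (j.app U t) * b = j.app (P.basicOpen r) x := by rw [nat]; exact ex
          rw [map_mul, map_mul, ← e, map_mul φ.hom (j.app U a), ← h1, ← h2]
          ring
        obtain ⟨k, hk⟩ := QcohSubalgebra.exists_pow_mul_eq_zero (f := j) hU r
          (j.app U t * y * j.app U r ^ m - j.app U a * j.app U r ^ n)
          (by rw [map_sub, sub_eq_zero]; exact e0)
        refine ⟨m + k, fun M hM ↦ ?_⟩
        obtain ⟨d, rfl⟩ := Nat.exists_eq_add_of_le hM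
        refine ⟨a * r ^ (n + k + d), Ideal.mul_mem_right _ _ ha, ?_⟩
        rw [map_mul, map_pow]
        linear_combination (j.app U r ^ d) * hk
      obtain ⟨T, hT⟩ := (hJ i).fg ⟨U, hU⟩
      have hT' (t : T) : t.1 ∈ (J i).ideal ⟨U, hU⟩ := hT ▸ Ideal.subset_span t.2
      choose N hN using fun t : T ↦ key t.1 (hT' t)
      refine ⟨n + Finset.univ.sup N, j.app U r ^ Finset.univ.sup N * y,
        Subring.subset_closure (.inr ⟨i, fun t ht ↦ ?_⟩), ?_⟩
      · rw [← hT] at ht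
        induction ht using Submodule.span_induction with
        | mem t ht => exact hN ⟨t, ht⟩ _ (Finset.le_sup (f := N) (Finset.mem_univ _))
        | zero => exact ⟨0, zero_mem _, by simp⟩
        | add t s _ _ ht hs =>
          obtain ⟨x, hx, e⟩ := ht
          obtain ⟨y, hy, e'⟩ := hs
          exact ⟨x + y, add_mem hx hy, by rw [map_add, add_mul, e, e', map_add]⟩
        | smul a t _ ht =>
          obtain ⟨x, hx, e⟩ := ht
          exact ⟨a * x, Ideal.mul_mem_left _ _ hx, by
            rw [smul_eq_mul, map_mul, mul_assoc, e, map_mul]⟩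
      · rw [map_mul, ← e, pow_add, map_mul]
        ring
  | zero => exact ⟨0, 0, zero_mem _, by simp⟩
  | one => exact ⟨0, 1, one_mem _, by simp⟩
  | add a b _ _ ha hb =>
    obtain ⟨n, y, hy, e⟩ := ha
    obtain ⟨m, z, hz, e'⟩ := hb
    refine ⟨n + m, j.app U r ^ m * y + j.app U r ^ n * z,
      add_mem (mul_mem (hr m) hy) (mul_mem (hr n) hz), ?_⟩
    rw [map_add, map_mul, map_mul, e, e', pow_add, map_mul]
    ring
  | neg a _ ha =>
    obtain ⟨n, y, hy, e⟩ := ha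
    exact ⟨n, -y, neg_mem hy, by rw [map_neg, e, mul_neg]⟩
  | mul a b _ _ ha hb =>
    obtain ⟨n, y, hy, e⟩ := ha
    obtain ⟨m, z, hz, e'⟩ := hb
    refine ⟨n + m, y * z, mul_mem hy hz, ?_⟩
    rw [map_mul, e, e', pow_add, map_mul]
    ring

end Dilatation

section Admissible
open Scheme.IdealSheafData
variable {X Y : Scheme.{u}}

lemma isUnit_appLE (f : X ⟶ Y) {U : Y.Opens} {W : X.Opens} (h : W ≤ f ⁻¹ᵁ U) (t : Γ(Y, U))
    (h' : W ≤ f ⁻¹ᵁ Y.basicOpen t) : IsUnit (f.appLE U W h t) := by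
  have h1 : IsUnit (Y.presheaf.map (homOfLE (Y.basicOpen_le t)).op t) :=
    RingedSpace.isUnit_res_basicOpen _ t
  have h2 := h1.map (f.appLE _ W h').hom
  rwa [← CommRingCat.comp_apply, Scheme.Hom.map_appLE] at h2

lemma nonZeroDivisors_appLE (f : X ⟶ Y) [Flat f] (U : Y.affineOpens) (W : X.affineOpens)
    (h : W.1 ≤ f ⁻¹ᵁ U.1) {t : Γ(Y, U)} (ht : t ∈ nonZeroDivisors Γ(Y, U)) :
    f.appLE U W h t ∈ nonZeroDivisors Γ(X, W) := by
  have hf : (f.appLE U W h).hom.Flat := HasRingHomProperty.appLE @Flat f ‹_› U W h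
  let _ := (f.appLE U W h).hom.toAlgebra
  have : Module.Flat Γ(Y, U) Γ(X, W) := hf
  have := Module.Flat.isSMulRegular_of_nonZeroDivisors (M := Γ(X, W)) ht
  rw [mem_nonZeroDivisors_iff_right]
  intro x hx
  apply this
  simp only [smul_zero]
  rw [Algebra.smul_def, mul_comm]
  exact hx

lemma IsInvertible.comap_of_flat {J : Y.IdealSheafData} (h : IsInvertible J) (f : X ⟶ Y) [Flat f] :
    IsInvertible (J.comap f) := fun x ↦ by
  obtain ⟨U, hxU, t, ht, e⟩ := h (f x)
  obtain ⟨W, hW, hx, hle⟩ := exists_isAffineOpen_mem_and_subset (X := X) (x := x) (U := f ⁻¹ᵁ U.1) hxU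
  refine ⟨⟨W, hW⟩, hx, f.appLE U W hle t, nonZeroDivisors_appLE f U ⟨W, hW⟩ hle ht, ?_⟩
  rw [ideal_comap f J U ⟨W, hW⟩ hle, e, Ideal.map_span, Set.image_singleton]

lemma nonZeroDivisors_res (U V : X.affineOpens) (h : V.1 ≤ U.1) {t : Γ(X, U)}
    (ht : t ∈ nonZeroDivisors Γ(X, U)) :
    X.presheaf.map (homOfLE h).op t ∈ nonZeroDivisors Γ(X, V) := by
  have := nonZeroDivisors_appLE (𝟙 X) U V h ht
  simpa [Scheme.Hom.appLE] using! this

lemma exists_common_chart {κ : Type*} [Finite κ] {J : κ → X.IdealSheafData}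
    (h : ∀ i, IsInvertible (J i)) (O : X.Opens) (x : X) (hx : x ∈ O) :
    ∃ W : X.affineOpens, x ∈ W.1 ∧ W.1 ≤ O ∧
      ∀ i, ∃ t ∈ nonZeroDivisors Γ(X, W), (J i).ideal W = Ideal.span {t} := by
  choose U hU hUO t ht e using fun i ↦ (h i).exists_le O x hx
  obtain ⟨W, hW, hxW, hle⟩ := exists_isAffineOpen_mem_and_subset (X := X) (x := x)
    (U := O ⊓ (⨅ i, (U i).1)) ⟨hx, by
      rw [TopologicalSpace.Opens.coe_iInf]; simpa using hU⟩
  have hWU (i) : W ≤ (U i).1 := (show W ≤ _ from hle).trans (inf_le_right.trans (iInf_le _ i))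
  exact ⟨⟨W, hW⟩, hxW, (show W ≤ _ from hle).trans inf_le_left,
    fun i ↦ ⟨_, nonZeroDivisors_res (U i) ⟨W, hW⟩ (hWU i) (ht i), ideal_span_of_le (hWU i) (e i)⟩⟩

lemma hom_ext_of_affine {T E : Scheme.{u}} (a b : T ⟶ E)
    (H : ∀ z : T, ∃ (W : T.affineOpens) (V : E.affineOpens) (_ : z ∈ W.1) (ha : W.1 ≤ a ⁻¹ᵁ V.1)
      (hb : W.1 ≤ b ⁻¹ᵁ V.1), a.appLE V W ha = b.appLE V W hb) : a = b := by
  refine Scheme.hom_ext_of_forall _ _ fun z ↦ ?_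
  obtain ⟨W, V, hz, ha, hb, e⟩ := H z
  refine ⟨W.1, hz, ?_⟩
  have h1 := V.2.SpecMap_appLE_fromSpec a W.2 ha
  have h2 := V.2.SpecMap_appLE_fromSpec b W.2 hb
  rw [e, h2] at h1
  rw [← W.2.isoSpec_hom_fromSpec, Category.assoc, Category.assoc, ← h1]

end Admissible

section DilatationScheme
open Scheme.IdealSheafData
variable {P : Scheme.{u}} {κ : Type*} [Fintype κ] (I J : κ → P.IdealSheafData)
  (hJ : ∀ i, IsLocallyPrincipal (J i))

/-- The quasi-coherent algebra of the dilatation. -/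
def dilAlg : QcohSubalgebra (complOpen (∏ i, J i)).ι where
  carrier U hU := dilCarrier _ I J U hU
  app_mem _ _ a := Subring.subset_closure (.inl ⟨a, rfl⟩)
  res_mem _ _ hU hV h x hx := dil_res_mem _ I J hU hV h x hx
  exists_pow _ hU r x hx :=
    have := isAffineHom_complOpen (IsLocallyPrincipal.prod Finset.univ J hJ)
    dil_exists_pow _ I J hJ hU r x hx

lemma quasiCompact_complOpen (hJ : ∀ i, IsLocallyPrincipal (J i)) : QuasiCompact (complOpen (∏ i, J i)).ι :=
  have := isAffineHom_complOpen (IsLocallyPrincipal.prod Finset.univ J hJ)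
  inferInstance

/-- The dilatation of `P` with centers `(I i, J i)`: the universal scheme over `P` on which every
`J i` becomes invertible and every `I i` becomes contained in `J i`. -/
def dil : Scheme.{u} :=
  have := quasiCompact_complOpen J hJ
  (dilAlg I J hJ).spec

/-- The structure morphism of the dilatation. -/
def dilStr : dil I J hJ ⟶ P :=
  have := quasiCompact_complOpen J hJ
  (dilAlg I J hJ).str

instance : IsAffineHom (dilStr I J hJ) :=
  have := quasiCompact_complOpen J hJ
  inferInstanceAs (IsAffineHom (dilAlg I J hJ).str)

/-- The condition for a morphism to lift to the dilatation. -/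
structure IsAdmissible {T : Scheme.{u}} (f : T ⟶ P) : Prop where
  isInvertible (i : κ) : IsInvertible ((J i).comap f)
  le (i : κ) : (I i).comap f ≤ (J i).comap f

variable {I J}

lemma IsAdmissible.comp_of_flat {T T' : Scheme.{u}} {f : T ⟶ P} (h : IsAdmissible I J f)
    (g : T' ⟶ T) [Flat g] : IsAdmissible I J (g ≫ f) where
  isInvertible i := by rw [comap_comp]; exact (h.isInvertible i).comap_of_flat g
  le i := by rw [comap_comp, comap_comp]; exact comap_mono _ (h.le i)

variable {hJ}

/-- Sections of the dilatation over an affine open subset. -/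
lemma exists_dilSec (U : P.Opens) (hU : IsAffineOpen U) :
    ∃ σ : dilCarrier (complOpen (∏ i, J i)).ι I J U hU ≃+* Γ(dil I J hJ, dilStr I J hJ ⁻¹ᵁ U),
      ∀ a : Γ(P, U), σ ⟨(complOpen (∏ i, J i)).ι.app U a,
        Subring.subset_closure (.inl ⟨a, rfl⟩)⟩ = (dilStr I J hJ).app U a := by
  have := quasiCompact_complOpen J hJ
  let e := RelSpec.secIso (dilAlg I J hJ).coequifibered ⟨U, hU⟩
  refine ⟨e.symm.commRingCatIsoToRingEquiv, fun a ↦ ?_⟩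
  have h := congr(($(RelSpec.app_secIso (dilAlg I J hJ).coequifibered ⟨U, hU⟩)).hom a)
  have h2 := congr(e.inv.hom $h)
  refine h2.symm.trans ?_
  exact congr(($(e.hom_inv_id)).hom ((dilStr I J hJ).app U a))

lemma isUnit_complOpen_app (i : κ) {U : P.affineOpens} {t : Γ(P, U)}
    (e : (J i).ideal U = Ideal.span {t}) : IsUnit ((complOpen (∏ i, J i)).ι.app U t) := by
  have := isUnit_appLE (complOpen (∏ i, J i)).ι (U := U.1) le_rfl t (by
    have h1 : complOpen (∏ i, J i) ≤ complOpen (J i) := by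
      classical
      intro x hx hx'
      refine hx ?_
      rw [← Finset.mul_prod_erase _ _ (Finset.mem_univ i), support_mul]
      exact .inl hx'
    rw [← complOpen_inf _ U e]
    exact fun x hx ↦ ⟨h1 x.2, hx⟩)
  rwa [← Scheme.Hom.app_eq_appLE] at this

lemma isAdmissible_dilStr : IsAdmissible I J (dilStr I J hJ) where
  isInvertible i z := by
    obtain ⟨U, hxU, t, e⟩ := hJ i (dilStr I J hJ z)
    obtain ⟨σ, hσ⟩ := exists_dilSec (I := I) (hJ := hJ) U.1 U.2
    refine ⟨⟨dilStr I J hJ ⁻¹ᵁ U.1, U.2.preimage _⟩, hxU, (dilStr I J hJ).app U.1 t, ?_, ?_⟩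
    · rw [← hσ, mem_nonZeroDivisors_iff_right]
      intro x hx
      obtain ⟨x, rfl⟩ := σ.surjective x
      rw [← map_mul, map_eq_zero_iff _ σ.injective] at hx
      rw [map_eq_zero_iff _ σ.injective]
      have := congr(($hx).1)
      exact Subtype.ext ((isUnit_complOpen_app i e).mul_left_eq_zero.mp this)
    · rw [ideal_comap _ _ U _ le_rfl, e, Ideal.map_span, Set.image_singleton,
        ← Scheme.Hom.app_eq_appLE]
  le i := by
    choose U hxU t e using hJ i
    refine le_of_iSup_eq_top (fun x ↦ ⟨dilStr I J hJ ⁻¹ᵁ (U x).1, (U x).2.preimage _⟩)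
      (top_le_iff.mp fun z _ ↦ TopologicalSpace.Opens.mem_iSup.mpr ⟨_, hxU _⟩) fun x ↦ ?_
    obtain ⟨σ, hσ⟩ := exists_dilSec (I := I) (hJ := hJ) (U x).1 (U x).2
    rw [ideal_comap _ _ (U x) _ le_rfl, ideal_comap _ _ (U x) _ le_rfl, Ideal.map_le_iff_le_comap]
    intro a ha
    obtain ⟨v, hv⟩ := isUnit_complOpen_app i (e x)
    let b : dilCarrier (complOpen (∏ i, J i)).ι I J (U x).1 (U x).2 :=
      ⟨((v⁻¹ : _ˣ) : _) * (complOpen (∏ i, J i)).ι.app (U x).1 a,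
        Subring.subset_closure (.inr ⟨i, fun t' ht' ↦ by
          obtain ⟨c, rfl⟩ := Ideal.mem_span_singleton.mp ((e x).le ht')
          refine ⟨c * a, Ideal.mul_mem_left _ _ ha, ?_⟩
          rw [map_mul, map_mul, ← hv]
          rw [show ∀ p q r s : Γ(complOpen (∏ i, J i), (complOpen (∏ i, J i)).ι ⁻¹ᵁ (U x).1),
            p * q * (r * s) = (p * r) * (q * s) by intros; ring, v.mul_inv, one_mul]⟩)⟩
    have h1 : (dilStr I J hJ).app (U x).1 a = (dilStr I J hJ).app (U x).1 (t x) * σ b := by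
      rw [← hσ, ← hσ, ← map_mul]
      congr 1
      refine Subtype.ext ?_
      change _ = (complOpen (∏ i, J i)).ι.app (U x).1 (t x) * (((v⁻¹ : _ˣ) : _) * _)
      rw [← hv, v.mul_inv_cancel_left]
    have h2 : (dilStr I J hJ).app (U x).1 (t x) ∈ ((J i).ideal (U x)).map
        ((dilStr I J hJ).app (U x).1).hom :=
      Ideal.mem_map_of_mem _ (by rw [e x]; exact Ideal.mem_span_singleton_self _)
    have h3 := Ideal.mul_mem_right (σ b) _ h2
    rw [← h1, Scheme.Hom.app_eq_appLE] at h3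
    exact h3
end DilatationScheme

section DilatationUniversal
open Scheme.IdealSheafData
variable {P : Scheme.{u}} {κ : Type*} [Fintype κ] {I J : κ → P.IdealSheafData}
  {hJ : ∀ i, IsLocallyPrincipal (J i)}

lemma appLE_congr {X Y : Scheme.{u}} {f g : X ⟶ Y} (e : f = g) (U : Y.Opens) (W : X.Opens)
    (h : W ≤ f ⁻¹ᵁ U) (h' : W ≤ g ⁻¹ᵁ U) (a : Γ(Y, U)) : f.appLE U W h a = g.appLE U W h' a := by
  subst e; rfl

/-- Uniqueness in the universal property of the dilatation. -/
lemma dil_hom_ext {T : Scheme.{u}} {f : T ⟶ P} (hf : IsAdmissible I J f) {a b : T ⟶ dil I J hJ}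
    (ha : a ≫ dilStr I J hJ = f) (hb : b ≫ dilStr I J hJ = f) : a = b := by
  refine hom_ext_of_affine a b fun z ↦ ?_
  obtain ⟨U, hU, hzU, -⟩ := exists_isAffineOpen_mem_and_subset (X := P) (x := f z) (U := ⊤) trivial
  obtain ⟨W, hzW, hWU, hW⟩ := exists_common_chart hf.isInvertible (f ⁻¹ᵁ U) z hzU
  have h1 : W.1 ≤ a ⁻¹ᵁ dilStr I J hJ ⁻¹ᵁ U := by
    rw [← Scheme.Hom.comp_preimage, ha]; exact hWU
  have h2 : W.1 ≤ b ⁻¹ᵁ dilStr I J hJ ⁻¹ᵁ U := by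
    rw [← Scheme.Hom.comp_preimage, hb]; exact hWU
  refine ⟨W, ⟨_, hU.preimage (dilStr I J hJ)⟩, hzW, h1, h2, ?_⟩
  obtain ⟨σ, hσ⟩ := exists_dilSec (I := I) (hJ := hJ) U hU
  have ka (x : Γ(P, U)) : a.appLE _ W h1 ((dilStr I J hJ).app U x) = f.appLE U W hWU x := by
    rw [Scheme.Hom.app_eq_appLE, ← CommRingCat.comp_apply, Scheme.Hom.appLE_comp_appLE]
    exact appLE_congr ha _ _ _ _ _
  have kb (x : Γ(P, U)) : b.appLE _ W h2 ((dilStr I J hJ).app U x) = f.appLE U W hWU x := by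
    rw [Scheme.Hom.app_eq_appLE, ← CommRingCat.comp_apply, Scheme.Hom.appLE_comp_appLE]
    exact appLE_congr hb _ _ _ _ _
  ext y
  obtain ⟨⟨y, hy⟩, rfl⟩ := σ.surjective y
  change a.appLE _ W h1 (σ ⟨y, hy⟩) = b.appLE _ W h2 (σ ⟨y, hy⟩)
  induction hy using Subring.closure_induction with
  | mem y hy =>
    rcases hy with ⟨x, rfl⟩ | ⟨i, hi⟩
    · have := hσ x
      exact (congrArg _ this).trans ((ka x).trans ((kb x).symm.trans (congrArg _ this).symm))
    · have hy : y ∈ dilCarrier (complOpen (∏ i, J i)).ι I J U hU := Subring.subset_closure (.inr ⟨i, hi⟩)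
      obtain ⟨τ, hτ, e⟩ := hW i
      have key : ∀ τ ∈ ((J i).comap f).ideal W,
          τ * (a.appLE _ W h1 (σ ⟨y, hy⟩) - b.appLE _ W h2 (σ ⟨y, hy⟩)) = 0 := by
        intro τ hτ
        rw [ideal_comap f (J i) ⟨U, hU⟩ W hWU] at hτ
        induction hτ using Submodule.span_induction with
        | mem τ hτ =>
          obtain ⟨t, ht, rfl⟩ := hτ
          obtain ⟨x, -, hx⟩ := hi t ht
          have h3 : (dilStr I J hJ).app U t * σ ⟨y, hy⟩ = (dilStr I J hJ).app U x := by
            rw [← hσ, ← hσ, ← map_mul]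
            exact congrArg σ (Subtype.ext hx)
          have h4 := congr(a.appLE _ W h1 $h3)
          have h5 := congr(b.appLE _ W h2 $h3)
          rw [map_mul, ka, ka] at h4
          rw [map_mul, kb, kb] at h5
          rw [mul_sub, sub_eq_zero]
          exact h4.trans h5.symm
        | zero => simp
        | add s t _ _ hs ht => rw [add_mul, hs, ht, add_zero]
        | smul c t _ ht => rw [smul_eq_mul, mul_assoc, ht, mul_zero]
      have := key τ (by rw [e]; exact Ideal.mem_span_singleton_self _)
      rw [mul_comm] at this
      exact sub_eq_zero.mp ((mem_nonZeroDivisors_iff_right.mp hτ) _ this)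
  | zero => 
    rw [show (⟨0, _⟩ : dilCarrier (complOpen (∏ i, J i)).ι I J U hU) = 0 from rfl]; simp
  | one =>
    rw [show (⟨1, _⟩ : dilCarrier (complOpen (∏ i, J i)).ι I J U hU) = 1 from rfl]; simp
  | add x y hx hy h h' =>
    rw [show (⟨x + y, _⟩ : dilCarrier (complOpen (∏ i, J i)).ι I J U hU) = ⟨x, hx⟩ + ⟨y, hy⟩ from rfl]
    rw [map_add, map_add, map_add, h, h']
  | neg x hx h =>
    rw [show (⟨-x, _⟩ : dilCarrier (complOpen (∏ i, J i)).ι I J U hU) = - ⟨x, hx⟩ from rfl]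
    rw [map_neg, map_neg, map_neg, h]
  | mul x y hx hy h h2 =>
    rw [show (⟨x * y, _⟩ : dilCarrier (complOpen (∏ i, J i)).ι I J U hU) = ⟨x, hx⟩ * ⟨y, hy⟩ from rfl]
    rw [map_mul, map_mul, map_mul, h, h2]

/-- Local existence in the universal property of the dilatation. -/
lemma exists_ringHom {T : Scheme.{u}} {f : T ⟶ P} (hf : IsAdmissible I J f) {U : P.Opens}
    (hU : IsAffineOpen U) (W : T.affineOpens) (hWU : W.1 ≤ f ⁻¹ᵁ U)
    (hW : ∀ i, ∃ t ∈ nonZeroDivisors Γ(T, W), ((J i).comap f).ideal W = Ideal.span {t}) :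
    ∃ ψ : dilCarrier (complOpen (∏ i, J i)).ι I J U hU →+* Γ(T, W),
      ∀ a : Γ(P, U), ψ ⟨(complOpen (∏ i, J i)).ι.app U a,
        Subring.subset_closure (.inl ⟨a, rfl⟩)⟩ = f.appLE U W hWU a := by
  choose τ hτ e using hW
  let π := ∏ i, τ i
  have hπ : π ∈ nonZeroDivisors Γ(T, W) := prod_mem fun i _ ↦ hτ i
  have eπ : ((∏ i, J i).comap f).ideal W = Ideal.span {π} := by
    rw [comap_prod]
    have : ∀ s : Finset κ, (∏ i ∈ s, (J i).comap f).ideal W = Ideal.span {∏ i ∈ s, τ i} := by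
      classical
      intro s
      induction s using Finset.induction_on with
      | empty => simp
      | insert a s ha ih =>
        rw [Finset.prod_insert ha, Finset.prod_insert ha, ideal_mul, Pi.mul_apply, ih, e,
          Ideal.span_singleton_mul_span_singleton]
    exact this _
  let D := T.basicOpen π
  have hDW : D ≤ W.1 := T.basicOpen_le π
  have hD : D ≤ f ⁻¹ᵁ complOpen (∏ i, J i) := by
    rw [preimage_complOpen]
    exact (complOpen_inf _ W eπ).ge.trans inf_le_left
  let q : D.toScheme ⟶ (complOpen (∏ i, J i)).toScheme := f.resLE _ D hD
  have hq : q ≫ (complOpen (∏ i, J i)).ι = D.ι ≫ f := Scheme.Hom.resLE_comp_ι ..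
  have hDW' : (⊤ : D.toScheme.Opens) ≤ D.ι ⁻¹ᵁ W.1 := fun x _ ↦ hDW x.2
  have hqU : (⊤ : D.toScheme.Opens) ≤ q ⁻¹ᵁ (complOpen (∏ i, J i)).ι ⁻¹ᵁ U := by
    rw [← Scheme.Hom.comp_preimage, hq]
    exact fun x _ ↦ hWU (hDW x.2)
  let δ : Γ(T, W.1) →+* Γ(D, ⊤) := (D.ι.appLE W.1 ⊤ hDW').hom
  let θ : Γ(complOpen (∏ i, J i), (complOpen (∏ i, J i)).ι ⁻¹ᵁ U) →+* Γ(D, ⊤) :=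
    (q.appLE _ ⊤ hqU).hom
  have hθ (a : Γ(P, U)) : θ ((complOpen (∏ i, J i)).ι.app U a) = δ (f.appLE U W hWU a) := by
    change q.appLE _ ⊤ hqU _ = D.ι.appLE W.1 ⊤ hDW' _
    rw [Scheme.Hom.app_eq_appLE, ← CommRingCat.comp_apply, ← CommRingCat.comp_apply,
      Scheme.Hom.appLE_comp_appLE, Scheme.Hom.appLE_comp_appLE]
    exact appLE_congr hq _ _ _ _ _
  have hδπ : IsUnit (δ π) := isUnit_appLE _ _ _ fun x _ ↦ x.2
  have hδ : Function.Injective δ := by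
    rw [injective_iff_map_eq_zero]
    intro s hs
    have : ∃ n, π ^ n * s = 0 := by
      apply exists_pow_mul_eq_zero_of_res_basicOpen_eq_zero_of_isCompact T W.2.isCompact s π
      have hs' : D.ι.appLE W.1 ⊤ hDW' s = 0 := hs
      rw [D.ι_appLE] at hs'
      have hle : D ≤ D.ι ''ᵁ ⊤ := by simp
      have hle' : D.ι ''ᵁ ⊤ ≤ W.1 := by simpa using hDW
      have h := (congrArg (T.presheaf.map (homOfLE hle).op).hom hs').trans (map_zero _)
      have h' : T.presheaf.map (homOfLE hDW).op =
          T.presheaf.map (homOfLE hle').op ≫ T.presheaf.map (homOfLE hle).op := by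
        rw [← Functor.map_comp]; rfl
      exact congr(($h').hom s).trans h
    obtain ⟨n, hn⟩ := this
    rw [mul_comm] at hn
    exact (mem_nonZeroDivisors_iff_right.mp (pow_mem hπ n)) _ hn
  have hδτ (i) : IsUnit (δ (τ i)) := by
    classical
    refine isUnit_of_dvd_unit ?_ hδπ
    exact map_dvd δ (Finset.dvd_prod_of_mem τ (Finset.mem_univ i))
  have hrange : dilCarrier (complOpen (∏ i, J i)).ι I J U hU ≤ δ.range.comap θ := by
    refine Subring.closure_le.mpr ?_
    rintro b (⟨a, rfl⟩ | ⟨i, hi⟩)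
    · exact ⟨_, (hθ a).symm⟩
    · have key : ∀ t ∈ ((J i).comap f).ideal W, ∃ y ∈ ((I i).comap f).ideal W,
          δ t * θ b = δ y := by
        intro t ht
        rw [ideal_comap f (J i) ⟨U, hU⟩ W hWU] at ht
        induction ht using Submodule.span_induction with
        | mem t ht =>
          obtain ⟨t, ht, rfl⟩ := ht
          obtain ⟨x, hx', hx⟩ := hi t ht
          refine ⟨f.appLE U W hWU x, ?_, ?_⟩
          · rw [ideal_comap f (I i) ⟨U, hU⟩ W hWU]
            exact Ideal.mem_map_of_mem _ hx'
          · have := congr(θ $hx)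
            rw [map_mul] at this
            exact ((congrArg (· * θ b) (hθ t)).symm.trans this).trans (hθ x)
        | zero => exact ⟨0, zero_mem _, by simp⟩
        | add t s _ _ ht hs =>
          obtain ⟨x, hx, e⟩ := ht
          obtain ⟨y, hy, e'⟩ := hs
          exact ⟨x + y, add_mem hx hy, by rw [map_add, add_mul, e, e', map_add]⟩
        | smul a t _ ht =>
          obtain ⟨x, hx, e⟩ := ht
          exact ⟨a * x, Ideal.mul_mem_left _ _ hx, by
            rw [smul_eq_mul, map_mul, mul_assoc, e, map_mul]⟩
      obtain ⟨y, hy, ey⟩ := key (τ i) (by rw [e]; exact Ideal.mem_span_singleton_self _)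
      have hy := hf.le i W hy
      rw [e] at hy
      obtain ⟨c, rfl⟩ := Ideal.mem_span_singleton.mp hy
      rw [map_mul] at ey
      exact ⟨c, ((hδτ i).mul_left_cancel ey).symm⟩
  let ε : Γ(T, W.1) ≃+* δ.range := RingEquiv.ofBijective δ.rangeRestrict
    ⟨fun x y h ↦ hδ congr(($h).1), δ.rangeRestrict_surjective⟩
  let ψ : dilCarrier (complOpen (∏ i, J i)).ι I J U hU →+* Γ(T, W) :=
    ε.symm.toRingHom.comp ((θ.comp (Subring.subtype _)).codRestrict δ.range fun b ↦ hrange b.2)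
  refine ⟨ψ, fun a ↦ ?_⟩
  exact ε.symm_apply_eq.mpr (Subtype.ext (hθ a))

/-- Existence in the universal property of the dilatation. -/
lemma exists_dilLift {T : Scheme.{u}} {f : T ⟶ P} (hf : IsAdmissible I J f) :
    ∃ a : T ⟶ dil I J hJ, a ≫ dilStr I J hJ = f := by
  have hqc := quasiCompact_complOpen J hJ
  have (z : T) : ∃ (W : T.Opens) (_ : z ∈ W) (b : W.toScheme ⟶ dil I J hJ),
      b ≫ dilStr I J hJ = W.ι ≫ f := by
    obtain ⟨U, hU, hzU, -⟩ := exists_isAffineOpen_mem_and_subset (X := P) (x := f z) (U := ⊤) trivial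
    obtain ⟨W, hzW, hWU, hW⟩ := exists_common_chart hf.isInvertible (f ⁻¹ᵁ U) z hzU
    obtain ⟨ψ, hψ⟩ := exists_ringHom hf hU W hWU hW
    obtain ⟨b, hb⟩ := (dilAlg I J hJ).exists_local hU W hWU ψ hψ
    exact ⟨W.1, hzW, b, hb⟩
  choose W hW b hb using this
  obtain ⟨a, ha⟩ := exists_glue W (by
      rw [TopologicalSpace.IsOpenCover, eq_top_iff]
      exact fun z _ ↦ TopologicalSpace.Opens.mem_iSup.mpr ⟨z, hW z⟩) b (by
    intro x y z hx hy
    refine ⟨W x ⊓ W y, ⟨hx, hy⟩, inf_le_left, inf_le_right, ?_⟩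
    refine dil_hom_ext (hf.comp_of_flat (W x ⊓ W y).ι) ?_ ?_
    · rw [Category.assoc, hb, Scheme.homOfLE_ι_assoc]
    · rw [Category.assoc, hb, Scheme.homOfLE_ι_assoc])
  refine ⟨a, Scheme.hom_ext_of_forall _ _ fun z ↦ ⟨W z, hW z, ?_⟩⟩
  rw [← Category.assoc, ha, hb]

variable (hJ) in
/-- The lift of an admissible morphism to the dilatation. -/
def dilLift {T : Scheme.{u}} (f : T ⟶ P) (hf : IsAdmissible I J f) : T ⟶ dil I J hJ :=
  (exists_dilLift hf).choose

lemma dilLift_str {T : Scheme.{u}} (f : T ⟶ P) (hf : IsAdmissible I J f) :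
    dilLift hJ f hf ≫ dilStr I J hJ = f :=
  (exists_dilLift hf).choose_spec

end DilatationUniversal

lemma ext_of_dominant {Y T E S : Scheme.{u}} (p : Y ⟶ T) [IsSchemeTheoreticallyDominant p]
    [QuasiCompact p] (z : E ⟶ S) [IsAffineHom z] {a b : T ⟶ E} (h : a ≫ z = b ≫ z)
    (h' : p ≫ a = p ≫ b) : a = b := by
  refine hom_ext_of_affine a b fun t ↦ ?_
  obtain ⟨U, hU, htU, -⟩ := exists_isAffineOpen_mem_and_subset (X := S) (x := (a ≫ z) t) (U := ⊤) trivial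
  obtain ⟨W, hW, htW, hWU⟩ := exists_isAffineOpen_mem_and_subset (X := T) (x := t)
    (U := (a ≫ z) ⁻¹ᵁ U) htU
  have ha : W ≤ a ⁻¹ᵁ z ⁻¹ᵁ U := hWU
  have hb : W ≤ b ⁻¹ᵁ z ⁻¹ᵁ U := by rw [← Scheme.Hom.comp_preimage, ← h]; exact hWU
  refine ⟨⟨W, hW⟩, ⟨_, hU.preimage z⟩, htW, ha, hb, ?_⟩
  ext x
  apply p.app_injective W
  change p.app W (a.appLE _ W ha x) = p.app W (b.appLE _ W hb x)
  rw [Scheme.Hom.app_eq_appLE, ← CommRingCat.comp_apply, ← CommRingCat.comp_apply,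
    Scheme.Hom.appLE_comp_appLE, Scheme.Hom.appLE_comp_appLE]
  exact appLE_congr h' _ _ _ _ _

lemma isIso_appLE_of_opensRange {X Y : Scheme.{u}} (c : X ⟶ Y) [IsOpenImmersion c] {V : Y.Opens}
    (hV : c ''ᵁ ⊤ = V) (h : ⊤ ≤ c ⁻¹ᵁ V) : IsIso (c.appLE V ⊤ h) := by
  subst hV
  rw [← c.appIso_hom']
  infer_instance

lemma specMap_appTop_injective {R A : CommRingCat.{u}} (φ : R ⟶ A) (h : Function.Injective φ) :
    Function.Injective (Spec.map φ).appTop := by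
  have e : (Spec.map φ).appTop =
      (Scheme.ΓSpecIso R).hom ≫ φ ≫ (Scheme.ΓSpecIso A).inv := by
    rw [← Scheme.ΓSpecIso_naturality_assoc, Iso.hom_inv_id, Category.comp_id]
  rw [e]
  have h1 := (ConcreteCategory.bijective_of_isIso (Scheme.ΓSpecIso R).hom).1
  have h2 := (ConcreteCategory.bijective_of_isIso (Scheme.ΓSpecIso A).inv).1
  have h3 := h2.comp (h.comp h1)
  exact h3

namespace RelSpec
open AlgebraicGeometry.Scheme.AffineZariskiSite
variable {S Z : Scheme.{u}} {F : S.AffineZariskiSiteᵒᵖ ⥤ CommRingCat.{u}}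
  {α : (toOpensFunctor S).op ⋙ S.presheaf ⟶ F} (H : α.Coequifibered)

/-- Morphisms out of a relative spectrum. -/
def desc (d : ∀ U : S.AffineZariskiSite, Spec (F.obj (op U)) ⟶ Z)
    (hd : ∀ (U V : S.AffineZariskiSite) (h : U ⟶ V), Spec.map (F.map h.op) ≫ d V = d U) :
    spec H ⟶ Z :=
  colimit.desc (relativeGluingData H).functor ⟨Z, ⟨d, fun U V h ↦
    (hd U V h).trans (Category.comp_id _).symm⟩⟩

lemma chart_desc (d : ∀ U : S.AffineZariskiSite, Spec (F.obj (op U)) ⟶ Z)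
    (hd : ∀ (U V : S.AffineZariskiSite) (h : U ⟶ V), Spec.map (F.map h.op) ≫ d V = d U)
    (U : S.AffineZariskiSite) : chart H U ≫ desc H d hd = d U :=
  colimit.ι_desc _ _

end RelSpec

namespace QcohSubalgebra
variable {Y S : Scheme.{u}} {f : Y ⟶ S} (B : QcohSubalgebra f) [QuasiCompact f]

lemma hom_ext {Z : Scheme.{u}} {a b : B.spec ⟶ Z}
    (h : ∀ U hU, B.chart U hU ≫ a = B.chart U hU ≫ b) : a = b :=
  (RelSpec.chartCover B.coequifibered).hom_ext _ _ fun U ↦ h U.1 U.2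

/-- The inclusion of the sub-algebra into the direct image. -/
def incl : B.Family f where
  map U hU := (B.carrier U hU).subtype
  map_unit _ _ _ := rfl
  map_res _ _ _ _ := rfl

/-- The canonical morphism to the relative spectrum of a sub-algebra. -/
def toSpec : Y ⟶ B.spec := B.incl.exists_hom.choose

lemma toSpec_str : B.toSpec ≫ B.str = f := B.incl.exists_hom.choose_spec.1

lemma ι_toSpec (U : S.Opens) (hU : IsAffineOpen U) :
    (f ⁻¹ᵁ U).ι ≫ B.toSpec = (f ⁻¹ᵁ U).toSpecΓ ≫
      Spec.map (CommRingCat.ofHom (B.carrier U hU).subtype) ≫ B.chart U hU :=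
  B.incl.exists_hom.choose_spec.2 U hU

instance [IsAffineHom f] : IsAffineHom B.toSpec := by
  have : IsAffineHom (B.toSpec ≫ B.str) := by rw [toSpec_str]; infer_instance
  exact MorphismProperty.of_postcomp (W := @IsAffineHom) (W' := @IsSeparated) _ B.str
    inferInstance this

instance [IsAffineHom f] : IsSchemeTheoreticallyDominant B.toSpec := by
  refine ⟨?_⟩
  refine Scheme.IdealSheafData.ext_of_iSup_eq_top
    (fun U : S.affineOpens ↦ ⟨B.str ⁻¹ᵁ U.1, U.2.preimage _⟩)
    (TopologicalSpace.IsOpenCover.comap (iSup_affineOpens_eq_top _) _) fun U ↦ ?_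
  rw [Scheme.Hom.ker_apply, Scheme.IdealSheafData.ideal_bot, Pi.bot_apply,
    ← RingHom.injective_iff_ker_eq_bot]
  obtain ⟨U, hU⟩ := U
  have hU : IsAffineOpen U := hU
  have h1 : ⊤ ≤ (B.chart U hU) ⁻¹ᵁ (B.str ⁻¹ᵁ U) := by
    rw [str_preimage _ _ hU]
    simp
  have h2 := isIso_appLE_of_opensRange (B.chart U hU) (V := B.str ⁻¹ᵁ U)
    (by rw [str_preimage _ _ hU]; simp) h1
  have h4 : (⊤ : (f ⁻¹ᵁ U).toScheme.Opens) ≤ ((f ⁻¹ᵁ U).ι ≫ B.toSpec) ⁻¹ᵁ (B.str ⁻¹ᵁ U) := by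
    rw [← Scheme.Hom.comp_preimage, Category.assoc, toSpec_str]
    exact fun x _ ↦ x.2
  have h3 : ((f ⁻¹ᵁ U).ι ≫ B.toSpec).appLE (B.str ⁻¹ᵁ U) ⊤ h4 =
      (B.chart U hU).appLE (B.str ⁻¹ᵁ U) ⊤ h1 ≫
        (Spec.map (CommRingCat.ofHom (B.carrier U hU).subtype)).appTop ≫
          (f ⁻¹ᵁ U).toSpecΓ.appTop := by
    have e1 := Scheme.Hom.appLE_comp_appLE
      (Spec.map (CommRingCat.ofHom (B.carrier U hU).subtype)) (B.chart U hU)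
      (B.str ⁻¹ᵁ U) ⊤ ⊤ h1 le_rfl
    have e2 := Scheme.Hom.appLE_comp_appLE (f ⁻¹ᵁ U).toSpecΓ
      (Spec.map (CommRingCat.ofHom (B.carrier U hU).subtype) ≫ B.chart U hU)
      (B.str ⁻¹ᵁ U) ⊤ ⊤ (fun x _ ↦ h1 trivial) le_rfl
    rw [← e1, Category.assoc] at e2
    ext x
    refine (appLE_congr (B.ι_toSpec U hU) _ _ _ (fun x _ ↦ h1 trivial) _).trans ?_
    refine congr($(e2.symm) x).trans ?_
    rw [Scheme.Hom.appTop, Scheme.Hom.appTop, Scheme.Hom.app_eq_appLE, Scheme.Hom.app_eq_appLE]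
    rfl
  have i1 := (ConcreteCategory.bijective_of_isIso ((B.chart U hU).appLE (B.str ⁻¹ᵁ U) ⊤ h1)).1
  have i2 := specMap_appTop_injective (CommRingCat.ofHom (B.carrier U hU).subtype)
    Subtype.val_injective
  have i3 : Function.Injective (f ⁻¹ᵁ U).toSpecΓ.appTop := by
    rw [Scheme.Opens.toSpecΓ_appTop]
    exact (ConcreteCategory.bijective_of_isIso _).1
  rw [injective_iff_map_eq_zero]
  intro x hx
  have h5 : ((f ⁻¹ᵁ U).ι ≫ B.toSpec).appLE (B.str ⁻¹ᵁ U) ⊤ h4 x = 0 := by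
    rw [← Scheme.Hom.appLE_comp_appLE _ _ _ (B.toSpec ⁻¹ᵁ B.str ⁻¹ᵁ U) _ le_rfl h4,
      CommRingCat.comp_apply, ← Scheme.Hom.app_eq_appLE]
    exact (congrArg _ hx).trans (map_zero _)
  rw [h3] at h5
  refine i1 (i2 (i3 ?_))
  refine (show _ = _ from h5).trans ?_
  simp

/-- Morphisms from the relative spectrum of a sub-algebra to a scheme affine over the base. -/
lemma exists_desc {Z : Scheme.{u}} (z : Z ⟶ S) [IsAffineHom z] (a : Y ⟶ Z) (ha : a ≫ z = f)
    (H : ∀ (U : S.Opens) (hU : IsAffineOpen U) (x : Γ(Z, z ⁻¹ᵁ U)),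
      a.appLE (z ⁻¹ᵁ U) (f ⁻¹ᵁ U) (by rw [← ha]; rfl) x ∈ B.carrier U hU) :
    ∃ b : B.spec ⟶ Z, B.toSpec ≫ b = a ∧ b ≫ z = B.str := by
  let ψ (U : S.Opens) (hU : IsAffineOpen U) : Γ(Z, z ⁻¹ᵁ U) ⟶ .of (B.carrier U hU) :=
    CommRingCat.ofHom ((a.appLE (z ⁻¹ᵁ U) (f ⁻¹ᵁ U) (by rw [← ha]; rfl)).hom.codRestrict _ (H U hU))
  let b : B.spec ⟶ Z := RelSpec.desc B.coequifibered
    (fun U ↦ Spec.map (ψ U.1 U.2) ≫ (U.2.preimage z).fromSpec) (by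
      intro U V h
      have hz : z ⁻¹ᵁ U.1 ≤ z ⁻¹ᵁ V.1 :=
        z.preimage_mono (Scheme.AffineZariskiSite.toOpens_mono h.le)
      have e : ψ V.1 V.2 ≫ B.diagram.map h.op =
          Z.presheaf.map (homOfLE hz).op ≫ ψ U.1 U.2 := by
        ext x
        refine Subtype.ext ?_
        have e1 := Scheme.Hom.appLE_map a (U := z ⁻¹ᵁ V.1) (V := f ⁻¹ᵁ V.1)
          (by rw [← ha]; rfl) (homOfLE (f.preimage_mono
            (Scheme.AffineZariskiSite.toOpens_mono h.le))).op
        have e2 := Scheme.Hom.map_appLE a (V := f ⁻¹ᵁ U.1)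
          (by rw [← ha]; rfl) (homOfLE hz).op
        exact congr($(e1.trans e2.symm) x)
      have e' := (Spec.map_comp _ _).symm.trans (congr(Spec.map $e).trans (Spec.map_comp _ _))
      rw [← (V.2.preimage z).map_fromSpec (U.2.preimage z) (homOfLE hz).op]
      exact (Category.assoc ..).symm.trans
        ((congrArg (· ≫ (V.2.preimage z).fromSpec) e').trans (Category.assoc ..)))
  have hb (U : S.Opens) (hU : IsAffineOpen U) :
      B.chart U hU ≫ b = Spec.map (ψ U hU) ≫ (hU.preimage z).fromSpec :=
    RelSpec.chart_desc B.coequifibered _ _ ⟨U, hU⟩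
  refine ⟨b, ?_, ?_⟩
  · refine Scheme.Cover.hom_ext (Y.openCoverOfIsOpenCover _
      (.comap (iSup_affineOpens_eq_top S) f.base.1)) _ _ fun U ↦ ?_
    change (f ⁻¹ᵁ U.1).ι ≫ B.toSpec ≫ b = (f ⁻¹ᵁ U.1).ι ≫ a
    have e : ψ U.1 U.2 ≫ CommRingCat.ofHom (B.carrier U.1 U.2).subtype =
      a.appLE (z ⁻¹ᵁ U.1) (f ⁻¹ᵁ U.1) (by rw [← ha]; rfl) := rfl
    rw [← Category.assoc, B.ι_toSpec U.1 U.2, Category.assoc, Category.assoc, hb U.1 U.2, ← Spec.map_comp_assoc, e]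
    simp
  · refine B.hom_ext fun U hU ↦ ?_
    have e := hU.SpecMap_appLE_fromSpec z (hU.preimage z) le_rfl
    rw [← Category.assoc, hb, Category.assoc, ← e, chart_str, ← Spec.map_comp_assoc]
    congr 2
    ext x
    change a.appLE (z ⁻¹ᵁ U) (f ⁻¹ᵁ U) _ (z.appLE U (z ⁻¹ᵁ U) _ x) = f.app U x
    rw [Scheme.Hom.app_eq_appLE, ← CommRingCat.comp_apply, Scheme.Hom.appLE_comp_appLE]
    exact appLE_congr ha _ _ _ _ _
end QcohSubalgebra

lemma ι_appLE_top {X : Scheme.{u}} (U : X.Opens) (h : ⊤ ≤ U.ι ⁻¹ᵁ U) :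
    U.ι.appLE U ⊤ h = U.topIso.inv := by
  rw [Scheme.Opens.ι_appLE]
  rfl

namespace QcohSubalgebra
variable {Y S : Scheme.{u}} {f : Y ⟶ S} (B : QcohSubalgebra f) [QuasiCompact f]

lemma appLE_toSpec_mem (U : S.Opens) (hU : IsAffineOpen U) (x : Γ(B.spec, B.str ⁻¹ᵁ U)) :
    B.toSpec.appLE (B.str ⁻¹ᵁ U) (f ⁻¹ᵁ U)
      (by rw [← Scheme.Hom.comp_preimage, toSpec_str]) x ∈ B.carrier U hU := by
  have h1 : ⊤ ≤ (B.chart U hU) ⁻¹ᵁ (B.str ⁻¹ᵁ U) := by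
    rw [str_preimage _ _ hU]
    simp
  have h0 : f ⁻¹ᵁ U ≤ B.toSpec ⁻¹ᵁ B.str ⁻¹ᵁ U := by
    rw [← Scheme.Hom.comp_preimage, toSpec_str]
  have h4 : (⊤ : (f ⁻¹ᵁ U).toScheme.Opens) ≤ ((f ⁻¹ᵁ U).ι ≫ B.toSpec) ⁻¹ᵁ (B.str ⁻¹ᵁ U) := by
    rw [← Scheme.Hom.comp_preimage, Category.assoc, toSpec_str]
    exact fun x _ ↦ x.2
  let σ := CommRingCat.ofHom (B.carrier U hU).subtype
  let y := (B.chart U hU).appLE (B.str ⁻¹ᵁ U) ⊤ h1 x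
  let z : B.carrier U hU := (Scheme.ΓSpecIso (.of (B.carrier U hU))).hom y
  suffices h : B.toSpec.appLE (B.str ⁻¹ᵁ U) (f ⁻¹ᵁ U) h0 x = z.1 by
    rw [h]
    exact z.2
  apply (ConcreteCategory.bijective_of_isIso (f ⁻¹ᵁ U).topIso.inv).1
  have e1 := congr($(Scheme.Hom.appLE_comp_appLE (Spec.map σ) (B.chart U hU)
    (B.str ⁻¹ᵁ U) ⊤ ⊤ h1 le_rfl) x)
  have e2 := congr($(Scheme.Hom.appLE_comp_appLE (f ⁻¹ᵁ U).toSpecΓ (Spec.map σ ≫ B.chart U hU)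
    (B.str ⁻¹ᵁ U) ⊤ ⊤ (fun x _ ↦ h1 trivial) le_rfl) x)
  have e3 := appLE_congr (B.ι_toSpec U hU) _ _ h4 (fun x _ ↦ h1 trivial) x
  have e4 := congr($(Scheme.Hom.appLE_comp_appLE (f ⁻¹ᵁ U).ι B.toSpec (B.str ⁻¹ᵁ U) (f ⁻¹ᵁ U) ⊤
    h0 (fun x _ ↦ x.2)) x)
  have e5 : (f ⁻¹ᵁ U).ι.appLE (f ⁻¹ᵁ U) ⊤ (fun x _ ↦ x.2) = (f ⁻¹ᵁ U).topIso.inv :=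
    ι_appLE_top _ _
  have e6 := congr($(Scheme.ΓSpecIso_naturality σ) y)
  have e7 := (f ⁻¹ᵁ U).toSpecΓ_appTop
  refine congr($e5 _).symm.trans ?_
  refine e4.trans (e3.trans (e2.symm.trans ?_))
  have e8 : (Spec.map σ).appLE ⊤ ⊤ le_rfl y = (Spec.map σ).appTop y := by
    rw [Scheme.Hom.appTop, Scheme.Hom.app_eq_appLE]
    rfl
  have e9 (w : Γ(Spec Γ(Y, f ⁻¹ᵁ U), ⊤)) : (f ⁻¹ᵁ U).toSpecΓ.appLE ⊤ ⊤ le_rfl w =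
      (f ⁻¹ᵁ U).topIso.inv ((Scheme.ΓSpecIso _).hom w) := by
    have : (f ⁻¹ᵁ U).toSpecΓ.appLE ⊤ ⊤ le_rfl w = (f ⁻¹ᵁ U).toSpecΓ.appTop w := by
      rw [Scheme.Hom.appTop, Scheme.Hom.app_eq_appLE]
      rfl
    rw [this, e7]
    rfl
  refine (e9 _).trans (congrArg _ ?_)
  exact (congrArg _ (e1.symm.trans e8)).trans e6

end QcohSubalgebra

section Quotient
variable {Y S : Scheme.{u}} {f : Y ⟶ S} {G : Type*} [Finite G] (ρ : G → (Y ⟶ Y))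
  (hρ : ∀ g, ρ g ≫ f = f)

lemma le_of_over {Y S : Scheme.{u}} {f : Y ⟶ S} {a : Y ⟶ Y} (h : a ≫ f = f) (U : S.Opens) :
    f ⁻¹ᵁ U ≤ a ⁻¹ᵁ f ⁻¹ᵁ U := by
  rw [← Scheme.Hom.comp_preimage, h]

lemma appLE_app_of_over {Y S : Scheme.{u}} {f : Y ⟶ S} {a : Y ⟶ Y} (h : a ≫ f = f) (U : S.Opens)
    (x : Γ(S, U)) : a.appLE (f ⁻¹ᵁ U) (f ⁻¹ᵁ U) (le_of_over h U) (f.app U x) = f.app U x := by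
  rw [Scheme.Hom.app_eq_appLE, ← CommRingCat.comp_apply, Scheme.Hom.appLE_comp_appLE]
  exact appLE_congr h _ _ _ _ _

lemma appLE_map_of_over {Y S : Scheme.{u}} {f : Y ⟶ S} {a : Y ⟶ Y} (h : a ≫ f = f) {U V : S.Opens}
    (hUV : V ≤ U) (x : Γ(Y, f ⁻¹ᵁ U)) :
    a.appLE (f ⁻¹ᵁ V) (f ⁻¹ᵁ V) (le_of_over h V)
      (Y.presheaf.map (homOfLE (f.preimage_mono hUV)).op x) =
    Y.presheaf.map (homOfLE (f.preimage_mono hUV)).op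
      (a.appLE (f ⁻¹ᵁ U) (f ⁻¹ᵁ U) (le_of_over h U) x) := by
  rw [← CommRingCat.comp_apply, ← CommRingCat.comp_apply, Scheme.Hom.map_appLE,
    Scheme.Hom.appLE_map]

/-- The quasi-coherent sub-algebra of invariants of `f_* O_Y` under a finite family of
endomorphisms of `Y` over `S`. -/
def invAlg [IsAffineHom f] : QcohSubalgebra f where
  carrier U _ :=
    { carrier := { x | ∀ g, (ρ g).appLE (f ⁻¹ᵁ U) (f ⁻¹ᵁ U) (le_of_over (hρ g) U) x = x }
      mul_mem' := fun ha hb g ↦ by rw [map_mul, ha g, hb g]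
      one_mem' := fun g ↦ map_one _
      add_mem' := fun ha hb g ↦ by rw [map_add, ha g, hb g]
      zero_mem' := fun g ↦ map_zero _
      neg_mem' := fun ha g ↦ by rw [map_neg, ha g] }
  app_mem U _ a g := appLE_app_of_over (hρ g) U a
  res_mem U V _ _ h x hx g := by
    rw [appLE_map_of_over (hρ g) h, hx g]
  exists_pow U hU r x hx := by
    have hle := S.basicOpen_le r
    obtain ⟨n, y, hy⟩ := exists_eq_pow_mul_of_isCompact_of_isQuasiSeparated Y (f ⁻¹ᵁ U)
      (hU.preimage f).isCompact (hU.preimage f).isQuasiSeparated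
      (f.app U r) (Y.presheaf.map (eqToHom (f.preimage_basicOpen r).symm).op x)
    have hy' : Y.presheaf.map (homOfLE (f.preimage_mono hle)).op y =
        Y.presheaf.map (homOfLE (f.preimage_mono hle)).op (f.app U r ^ n) * x := by
      have e := congr(Y.presheaf.map (eqToHom (f.preimage_basicOpen r)).op $hy)
      simp only [TopCat.Presheaf.restrictOpenCommRingCat_apply, map_mul, map_pow] at e
      rw [map_pow]
      refine (Eq.trans ?_ e).trans (congrArg₂ (· * ·) (congrArg (· ^ n) ?_) ?_)
      · rw [← CommRingCat.comp_apply, ← Functor.map_comp]; rfl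
      · rw [← CommRingCat.comp_apply, ← Functor.map_comp]; rfl
      · rw [← CommRingCat.comp_apply, ← Functor.map_comp]
        exact congr($(Y.presheaf.map_id _) x)
    have h0 (g : G) : ∃ m : ℕ, f.app U r ^ m *
        ((ρ g).appLE (f ⁻¹ᵁ U) (f ⁻¹ᵁ U) (le_of_over (hρ g) U) y - y) = 0 := by
      apply QcohSubalgebra.exists_pow_mul_eq_zero hU r
      rw [map_sub, ← appLE_map_of_over (hρ g) hle, hy', map_mul, hx g, sub_eq_zero,
        appLE_map_of_over (hρ g) hle, map_pow, appLE_app_of_over (hρ g)]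
    choose m hm using h0
    cases nonempty_fintype G
    let N := ∑ g, m g
    refine ⟨N + n, f.app U r ^ N * y, fun g ↦ ?_, ?_⟩
    · have : f.app U r ^ N *
          ((ρ g).appLE (f ⁻¹ᵁ U) (f ⁻¹ᵁ U) (le_of_over (hρ g) U) y - y) = 0 := by
        have hN : N - m g + m g = N := Nat.sub_add_cancel (Finset.single_le_sum (f := m) (fun _ _ ↦ Nat.zero_le _)
          (Finset.mem_univ g) : m g ≤ N)
        rw [← hN, pow_add, mul_assoc, hm, mul_zero]
      rw [map_mul, map_pow, appLE_app_of_over (hρ g)]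
      rwa [mul_sub, sub_eq_zero] at this
    · rw [map_mul, hy', pow_add, map_mul, mul_assoc]

lemma comp_toSpec_invAlg [IsAffineHom f] (g : G) :
    ρ g ≫ (invAlg ρ hρ).toSpec = (invAlg ρ hρ).toSpec := by
  set B := invAlg ρ hρ
  refine hom_ext_of_affine _ _ fun y ↦ ?_
  obtain ⟨U, hU, hyU, -⟩ :=
    exists_isAffineOpen_mem_and_subset (X := S) (x := f y) (U := ⊤) trivial
  have h0 : f ⁻¹ᵁ U ≤ B.toSpec ⁻¹ᵁ B.str ⁻¹ᵁ U := by
    rw [← Scheme.Hom.comp_preimage, B.toSpec_str]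
  refine ⟨⟨_, hU.preimage f⟩, ⟨_, hU.preimage B.str⟩, hyU, ?_, h0, ?_⟩
  · rw [Scheme.Hom.comp_preimage]
    exact (le_of_over (hρ g) U).trans ((ρ g).preimage_mono h0)
  ext x
  have h1 := B.appLE_toSpec_mem U hU x g
  rw [← CommRingCat.comp_apply, Scheme.Hom.appLE_comp_appLE] at h1
  exact h1

end Quotient

section GenericFunctors
variable {C : Type*} [Category* C]

/-- The functor given by factorizations of the components of a natural transformation `Y ⟶ S`
into a scheme-theoretically dominant morphism followed by an affine morphism. -/
def functorOfDominant (Y S : C ⥤ Scheme.{u}) (N : C → Scheme.{u}) (p : ∀ c, Y.obj c ⟶ N c)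
    (q : ∀ c, N c ⟶ S.obj c) [∀ c, IsSchemeTheoreticallyDominant (p c)]
    [∀ c, QuasiCompact (p c)] [∀ c, IsAffineHom (q c)]
    (H : ∀ {c d : C} (α : c ⟶ d), ∃ v : N c ⟶ N d,
      p c ≫ v = Y.map α ≫ p d ∧ v ≫ q d = q c ≫ S.map α) : C ⥤ Scheme.{u} where
  obj := N
  map α := (H α).choose
  map_id c := by
    refine ext_of_dominant (p c) (q c) ?_ ?_
    · rw [(H (𝟙 c)).choose_spec.2]
      simp
    · rw [(H (𝟙 c)).choose_spec.1]
      simp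
  map_comp {c d e} α β := by
    refine ext_of_dominant (p c) (q e) ?_ ?_
    · rw [(H (α ≫ β)).choose_spec.2, Category.assoc, (H β).choose_spec.2,
        reassoc_of% (H α).choose_spec.2, S.map_comp]
    · rw [(H (α ≫ β)).choose_spec.1, reassoc_of% (H α).choose_spec.1, (H β).choose_spec.1,
        Y.map_comp, Category.assoc]

section
variable (Y S : C ⥤ Scheme.{u}) (N : C → Scheme.{u}) (p : ∀ c, Y.obj c ⟶ N c)
    (q : ∀ c, N c ⟶ S.obj c) [∀ c, IsSchemeTheoreticallyDominant (p c)]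
    [∀ c, QuasiCompact (p c)] [∀ c, IsAffineHom (q c)]
    (H : ∀ {c d : C} (α : c ⟶ d), ∃ v : N c ⟶ N d,
      p c ≫ v = Y.map α ≫ p d ∧ v ≫ q d = q c ≫ S.map α)

/-- The projection from the functor of factorizations to the target. -/
def functorOfDominantStr : functorOfDominant Y S N p q H ⟶ S where
  app c := q c
  naturality _ _ α := (H α).choose_spec.2

/-- The morphism from the source to the functor of factorizations. -/
def toFunctorOfDominant : Y ⟶ functorOfDominant Y S N p q H where
  app c := p c
  naturality _ _ α := (H α).choose_spec.1.symm

end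

/-- The functor of dilatations of a functor. -/
def dilFunctor (P : C ⥤ Scheme.{u}) {κ : C → Type*} [∀ c, Fintype (κ c)]
    (I J : ∀ c, κ c → (P.obj c).IdealSheafData) (hJ : ∀ c i, IsLocallyPrincipal (J c i))
    (h : ∀ {c d : C} (α : c ⟶ d),
      IsAdmissible (I d) (J d) (dilStr (I c) (J c) (hJ c) ≫ P.map α)) : C ⥤ Scheme.{u} where
  obj c := dil (I c) (J c) (hJ c)
  map {c d} α := dilLift (hJ d) (dilStr (I c) (J c) (hJ c) ≫ P.map α) (h α)
  map_id c := by
    refine dil_hom_ext (f := dilStr (I c) (J c) (hJ c)) (isAdmissible_dilStr) ?_ ?_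
    · rw [dilLift_str]
      simp
    · simp
  map_comp {c d e} α β := by
    refine dil_hom_ext (f := dilStr (I c) (J c) (hJ c) ≫ P.map (α ≫ β)) (h _) ?_ ?_
    · rw [dilLift_str]
    · rw [Category.assoc, dilLift_str, reassoc_of% (dilLift_str (hJ := hJ d) (dilStr (I c) (J c) (hJ c) ≫ P.map α) (h α)), P.map_comp]

/-- The structure morphism of the functor of dilatations. -/
def dilFunctorStr (P : C ⥤ Scheme.{u}) {κ : C → Type*} [∀ c, Fintype (κ c)]
    (I J : ∀ c, κ c → (P.obj c).IdealSheafData) (hJ : ∀ c i, IsLocallyPrincipal (J c i))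
    (h : ∀ {c d : C} (α : c ⟶ d),
      IsAdmissible (I d) (J d) (dilStr (I c) (J c) (hJ c) ≫ P.map α)) :
    dilFunctor P I J hJ h ⟶ P where
  app c := dilStr (I c) (J c) (hJ c)
  naturality _ _ α := dilLift_str _ (h α)

/-- The functor formed by compatible open subschemes. -/
def openFunctor (A : C ⥤ Scheme.{u}) (O : ∀ c, (A.obj c).Opens)
    (h : ∀ {c d : C} (α : c ⟶ d), O c ≤ A.map α ⁻¹ᵁ O d) : C ⥤ Scheme.{u} where
  obj c := (O c).toScheme
  map {c d} α := (A.map α).resLE (O d) (O c) (h α)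
  map_id c := by
    rw [← cancel_mono (O c).ι]
    simp
  map_comp {c d e} α β := by
    rw [← cancel_mono (O e).ι]
    simp

/-- The inclusion of compatible open subschemes. -/
def openFunctorι (A : C ⥤ Scheme.{u}) (O : ∀ c, (A.obj c).Opens)
    (h : ∀ {c d : C} (α : c ⟶ d), O c ≤ A.map α ⁻¹ᵁ O d) : openFunctor A O h ⟶ A where
  app c := (O c).ι
  naturality _ _ _ := Scheme.Hom.resLE_comp_ι _ _

/-- The functor `c ↦ 𝔸(ι; P c)`. -/
def affFunctor (ι : Type u) (P : C ⥤ Scheme.{u}) : C ⥤ Scheme.{u} where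
  obj c := 𝔸(ι; P.obj c)
  map α := AffineSpace.map ι (P.map α)
  map_id c := by rw [P.map_id, AffineSpace.map_id]
  map_comp α β := by rw [P.map_comp, AffineSpace.map_comp]

end GenericFunctors

section FiberPower
variable {X B : Scheme.{u}} (p : X ⟶ B)

/-- The `n + 1`-fold fibre power of `X` over `B`, with its structure morphism. -/
def fiberPow : ℕ → Over B
  | 0 => Over.mk p
  | n + 1 => Over.mk (pullback.fst (fiberPow n).hom p ≫ (fiberPow n).hom)

namespace fiberPow

/-- The projections of the fibre power. -/
def proj : ∀ n : ℕ, Fin (n + 1) → ((fiberPow p n).left ⟶ X)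
  | 0, _ => 𝟙 X
  | n + 1, i => Fin.lastCases (motive := fun _ ↦ pullback (fiberPow p n).hom p ⟶ X)
      (pullback.snd _ _) (fun j ↦ pullback.fst _ _ ≫ proj n j) i

lemma proj_zero (i : Fin 1) : proj p 0 i = 𝟙 X := rfl

lemma proj_last (n : ℕ) : proj p (n + 1) (Fin.last _) = pullback.snd (fiberPow p n).hom p :=
  Fin.lastCases_last

lemma proj_castSucc (n : ℕ) (j : Fin (n + 1)) :
    proj p (n + 1) j.castSucc = pullback.fst (fiberPow p n).hom p ≫ proj p n j :=
  Fin.lastCases_castSucc j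

lemma proj_comp (n : ℕ) (i : Fin (n + 1)) : proj p n i ≫ p = (fiberPow p n).hom := by
  induction n with
  | zero => exact Category.id_comp _
  | succ n ih =>
    cases i using Fin.lastCases with
    | last =>
      rw [proj_last]
      exact pullback.condition.symm
    | cast j =>
      rw [proj_castSucc]
      exact (Category.assoc _ _ _).trans (congrArg (pullback.fst (fiberPow p n).hom p ≫ ·) (ih j))

lemma hom_ext {n : ℕ} {T : Scheme.{u}} {a b : T ⟶ (fiberPow p n).left}
    (h : ∀ i, a ≫ proj p n i = b ≫ proj p n i) : a = b := by
  induction n with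
  | zero => exact (Category.comp_id _).symm.trans ((h 0).trans (Category.comp_id _))
  | succ n ih =>
    refine pullback.hom_ext (ih fun i ↦ ?_) ?_
    · have := h i.castSucc
      rw [proj_castSucc] at this
      exact (Category.assoc _ _ _).trans (this.trans (Category.assoc _ _ _).symm)
    · have := h (Fin.last _)
      rwa [proj_last] at this

lemma exists_lift (n : ℕ) {T : Scheme.{u}} (a : Fin (n + 1) → (T ⟶ X)) (t : T ⟶ B)
    (h : ∀ i, a i ≫ p = t) : ∃ b : T ⟶ (fiberPow p n).left, ∀ i, b ≫ proj p n i = a i := by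
  induction n with
  | zero =>
    exact ⟨a 0, fun i ↦ by rw [Fin.fin_one_eq_zero i]; exact Category.comp_id _⟩
  | succ n ih =>
    obtain ⟨b, hb⟩ := ih (fun i ↦ a i.castSucc) (fun i ↦ h _)
    have hb' : b ≫ (fiberPow p n).hom = t := by
      rw [← proj_comp p n 0, reassoc_of% (hb 0), h]
    refine ⟨pullback.lift b (a (Fin.last _)) (hb'.trans (h _).symm), fun i ↦ ?_⟩
    cases i using Fin.lastCases with
    | last =>
      rw [proj_last]
      exact pullback.lift_snd _ _ _
    | cast j =>
      rw [proj_castSucc, ← hb]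
      exact pullback.lift_fst_assoc _ _ _ _

variable {p} in
/-- The morphism to the fibre power with given components. -/
def lift {n : ℕ} {T : Scheme.{u}} (a : Fin (n + 1) → (T ⟶ X)) (t : T ⟶ B)
    (h : ∀ i, a i ≫ p = t) : T ⟶ (fiberPow p n).left :=
  (exists_lift p n a t h).choose

variable {p} in
lemma lift_proj {n : ℕ} {T : Scheme.{u}} (a : Fin (n + 1) → (T ⟶ X)) (t : T ⟶ B)
    (h : ∀ i, a i ≫ p = t) (i : Fin (n + 1)) : lift a t h ≫ proj p n i = a i :=
  (exists_lift p n a t h).choose_spec i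

variable {p} in
/-- The morphism of fibre powers induced by a morphism over `B`. -/
def map {X' : Scheme.{u}} {p' : X' ⟶ B} (f : X' ⟶ X) (hf : f ≫ p = p') (n : ℕ) :
    (fiberPow p' n).left ⟶ (fiberPow p n).left :=
  lift (fun i ↦ proj p' n i ≫ f) (fiberPow p' n).hom
    (fun i ↦ by rw [Category.assoc, hf, proj_comp])

variable {p} in
lemma map_proj {X' : Scheme.{u}} {p' : X' ⟶ B} (f : X' ⟶ X) (hf : f ≫ p = p') (n : ℕ)
    (i : Fin (n + 1)) : map f hf n ≫ proj p n i = proj p' n i ≫ f :=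
  lift_proj _ _ _ _

variable {p} in
lemma map_hom {X' : Scheme.{u}} {p' : X' ⟶ B} (f : X' ⟶ X) (hf : f ≫ p = p') (n : ℕ) :
    map f hf n ≫ (fiberPow p n).hom = (fiberPow p' n).hom := by
  rw [← proj_comp p' n 0, ← proj_comp p n 0, ← Category.assoc, map_proj, Category.assoc, hf]

variable {p} in
lemma isAffineHom_map {X' : Scheme.{u}} {p' : X' ⟶ B} (f : X' ⟶ X) (hf : f ≫ p = p')
    [IsAffineHom f] (n : ℕ) : IsAffineHom (map f hf n) := by
  induction n with
  | zero =>
    have : map f hf 0 = f := by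
      have := map_proj f hf 0 0
      exact (Category.comp_id _).symm.trans (this.trans (Category.id_comp _))
    rw [this]
    exact ‹IsAffineHom f›
  | succ n ih =>
    have e : map f hf (n + 1) = pullback.map (fiberPow p' n).hom p' (fiberPow p n).hom p
        (map f hf n) f (𝟙 B) (by rw [map_hom]; exact Category.comp_id _)
        (by rw [hf, Category.comp_id]) := by
      refine hom_ext p fun i ↦ ?_
      rw [map_proj]
      cases i using Fin.lastCases with
      | last =>
        rw [proj_last, proj_last]
        exact (pullback.lift_snd _ _ _).symm
      | cast j =>
        rw [proj_castSucc, proj_castSucc]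
        refine (Category.assoc _ _ _).trans (Eq.trans ?_ (pullback.lift_fst_assoc _ _ _ _).symm)
        exact (congrArg (pullback.fst (fiberPow p' n).hom p' ≫ ·) (map_proj f hf n j).symm).trans
          (Category.assoc _ _ _).symm
    rw [e]
    have := @MorphismProperty.IsMultiplicative.toIsStableUnderComposition Scheme.{u} _ @IsAffineHom
      inferInstance
    exact MorphismProperty.pullbackMap (P := @IsAffineHom) ih ‹_› (map_hom f hf n).symm hf.symm

end fiberPow
end FiberPower

section PrincipalIdeals
open Scheme.IdealSheafData
variable {X Y : Scheme.{u}}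

/-- The ideal sheaf generated by a global section. -/
def princ (t : Γ(X, ⊤)) : X.IdealSheafData := ofIdealTop (Ideal.span {t})

lemma princ_ideal (t : Γ(X, ⊤)) (U : X.affineOpens) :
    (princ t).ideal U = Ideal.span {X.presheaf.map (homOfLE le_top).op t} := by
  rw [princ, ofIdealTop_ideal, Ideal.map_span, Set.image_singleton]

lemma isLocallyPrincipal_princ (t : Γ(X, ⊤)) : IsLocallyPrincipal (princ t) := fun x ↦ by
  obtain ⟨U, hU, hx, -⟩ := exists_isAffineOpen_mem_and_subset (X := X) (x := x) (U := ⊤) trivial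
  exact ⟨⟨U, hU⟩, hx, _, princ_ideal t _⟩

lemma ext_of_common_chart (f : X ⟶ Y) {I J : X.IdealSheafData}
    (h : ∀ (U : Y.affineOpens) (W : X.affineOpens), W.1 ≤ f ⁻¹ᵁ U.1 → I.ideal W = J.ideal W) :
    I = J := by
  have (x : X) : ∃ W : X.affineOpens, x ∈ W.1 ∧ ∃ U : Y.affineOpens, W.1 ≤ f ⁻¹ᵁ U.1 := by
    obtain ⟨U, hU, hx, -⟩ := exists_isAffineOpen_mem_and_subset (X := Y) (x := f x) (U := ⊤) trivial
    obtain ⟨W, hW, hx', hle⟩ := exists_isAffineOpen_mem_and_subset (X := X) (x := x) (U := f ⁻¹ᵁ U) hx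
    exact ⟨⟨W, hW⟩, hx', ⟨U, hU⟩, hle⟩
  choose W hW U hWU using this
  exact ext_of_iSup_eq_top W (top_le_iff.mp fun x _ ↦
    TopologicalSpace.Opens.mem_iSup.mpr ⟨x, hW x⟩) fun x ↦ h (U x) _ (hWU x)

lemma comap_princ (f : X ⟶ Y) (t : Γ(Y, ⊤)) : (princ t).comap f = princ (f.appTop t) := by
  refine ext_of_common_chart f fun U W h ↦ ?_
  rw [ideal_comap f _ U W h, princ_ideal, princ_ideal, Ideal.map_span, Set.image_singleton]
  change Ideal.span {f.appLE U W h (Y.presheaf.map _ t)} = Ideal.span {X.presheaf.map _ (f.app ⊤ t)}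
  congr 2
  rw [Scheme.Hom.app_eq_appLE, ← CommRingCat.comp_apply, ← CommRingCat.comp_apply,
    Scheme.Hom.map_appLE]
  exact congr($((Scheme.Hom.appLE_map f (U := ⊤) (V := f ⁻¹ᵁ ⊤) le_rfl (homOfLE le_top).op).symm) t)

lemma princ_of_isUnit {t : Γ(X, ⊤)} (h : IsUnit t) : princ t = ⊤ := by
  refine Scheme.IdealSheafData.ext (funext fun U ↦ ?_)
  rw [princ_ideal, ideal_top, Pi.top_apply, Ideal.span_singleton_eq_top]
  exact h.map (X.presheaf.map (homOfLE le_top).op).hom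

lemma comap_complOpen_ι (J : X.IdealSheafData) : J.comap (complOpen J).ι = ⊤ := by
  rw [← support_eq_bot_iff]
  refine TopologicalSpace.Closeds.ext ?_
  have h : (complOpen J).ι ⁻¹ᵁ complOpen J = ⊤ := by simp
  rw [preimage_complOpen] at h
  have h' : ((J.comap (complOpen J).ι).support : Set (complOpen J).toScheme)ᶜ = Set.univ :=
    congrArg (fun O : (complOpen J).toScheme.Opens ↦ (O : Set (complOpen J).toScheme)) h
  exact Set.compl_univ_iff.mp h'

lemma comap_eq_top_of_le {I J : X.IdealSheafData} (h : J ≤ I) (f : Y ⟶ X)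
    (h' : J.comap f = ⊤) : I.comap f = ⊤ :=
  top_le_iff.mp (h'.symm.trans_le (comap_mono f h))

lemma prod_le {κ : Type*} [Fintype κ] (J : κ → X.IdealSheafData) (i : κ) : ∏ j, J j ≤ J i := by
  classical
  rw [← Finset.mul_prod_erase _ _ (Finset.mem_univ i)]
  intro U
  rw [ideal_mul, Pi.mul_apply]
  exact Ideal.mul_le_left (I := (J i).ideal U)

lemma comap_ker_le {Z : Scheme.{u}} {g : Z ⟶ X} {f : X ⟶ Y} {h : Z ⟶ Y} (e : g ≫ f = h) :
    h.ker.comap f ≤ g.ker := by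
  rw [← le_map_iff_comap_le, map_ker, e]

/-- If two morphisms coincide on the closed subscheme defined by `K`, which contains the inverse
images of a closed subscheme by both of them, then these inverse images coincide. -/
lemma comap_le_comap_of_agree {K : Y.IdealSheafData} {a b : Y ⟶ X}
    (h : K.subschemeι ≫ a = K.subschemeι ≫ b) (E : X.IdealSheafData) (ha : K ≤ E.comap a) :
    E.comap b ≤ E.comap a := by
  rw [← le_map_iff_comap_le, ← ker_subschemeι (E.comap a), map_ker]
  have e : (E.comap a).subschemeι ≫ b = (E.comap a).subschemeι ≫ a := by
    rw [← inclusion_subschemeι ha, Category.assoc, Category.assoc, h]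
  rw [e, ← map_ker, ker_subschemeι]
  exact le_map_comap _ _

end PrincipalIdeals

/-- The category of the sets `[0, n] = {0, …, n}`, with all maps as morphisms. -/
structure OverSimplex : Type where
  /-- the number `n` -/
  len : ℕ

namespace OverSimplex

instance : Category OverSimplex where
  Hom a b := Fin (a.len + 1) → Fin (b.len + 1)
  id _ := id
  comp f g := g ∘ f

/-- The morphism given by a map. -/
def ofMap {a b : ℕ} (f : Fin (a + 1) → Fin (b + 1)) : mk a ⟶ mk b := f

/-- The map given by a morphism. -/
def toMap {a b : OverSimplex} (f : a ⟶ b) : Fin (a.len + 1) → Fin (b.len + 1) := f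

/-- The unique morphism to `[0, 0]`. -/
def toZero (a : OverSimplex) : a ⟶ mk 0 := fun _ ↦ 0

lemma toZero_ext {a : OverSimplex} (f g : a ⟶ mk 0) : f = g :=
  funext fun _ ↦ (Fin.fin_one_eq_zero _).trans (Fin.fin_one_eq_zero _).symm

end OverSimplex

section Power
variable {X B : Scheme.{u}} (p : X ⟶ B)

/-- The oversimplicial scheme of the fibre powers `X^{n+1}` over `B`. -/
def powFunctor : OverSimplexᵒᵖ ⥤ Scheme.{u} where
  obj a := (fiberPow p a.unop.len).left
  map {a b} α := fiberPow.lift (fun i ↦ fiberPow.proj p a.unop.len (OverSimplex.toMap α.unop i))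
    (fiberPow p a.unop.len).hom (fun _ ↦ fiberPow.proj_comp _ _ _)
  map_id a := fiberPow.hom_ext _ fun i ↦ (fiberPow.lift_proj _ _ _ _).trans (Category.id_comp _).symm
  map_comp α β := fiberPow.hom_ext _ fun i ↦ by
    rw [Category.assoc, fiberPow.lift_proj, fiberPow.lift_proj, fiberPow.lift_proj]
    rfl

/-- The projections of `X^{n+1}`. -/
def powProj (a : OverSimplexᵒᵖ) (j : Fin (a.unop.len + 1)) : (powFunctor p).obj a ⟶ X :=
  fiberPow.proj p a.unop.len j

lemma powFunctor_map_proj {a b : OverSimplexᵒᵖ} (α : a ⟶ b) (j : Fin (b.unop.len + 1)) :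
    (powFunctor p).map α ≫ powProj p b j = powProj p a (OverSimplex.toMap α.unop j) :=
  fiberPow.lift_proj (fun i ↦ fiberPow.proj p a.unop.len (OverSimplex.toMap α.unop i))
    (fiberPow p a.unop.len).hom (fun _ ↦ fiberPow.proj_comp _ _ _) j

lemma powFunctor_hom_ext {a : OverSimplexᵒᵖ} {T : Scheme.{u}} {f g : T ⟶ (powFunctor p).obj a}
    (h : ∀ j, f ≫ powProj p a j = g ≫ powProj p a j) : f = g :=
  fiberPow.hom_ext p h

/-- The diagonal `X ⟶ X^{n+1}`. -/
def powDiag (a : OverSimplexᵒᵖ) : X ⟶ (powFunctor p).obj a :=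
  fiberPow.lift (fun _ ↦ 𝟙 X) p (fun _ ↦ Category.id_comp p)

lemma powDiag_proj (a : OverSimplexᵒᵖ) (j : Fin (a.unop.len + 1)) :
    powDiag p a ≫ powProj p a j = 𝟙 X :=
  fiberPow.lift_proj _ _ _ _

lemma powDiag_map {a b : OverSimplexᵒᵖ} (α : a ⟶ b) :
    powDiag p a ≫ (powFunctor p).map α = powDiag p b :=
  powFunctor_hom_ext p fun j ↦ by
    rw [Category.assoc, powFunctor_map_proj, powDiag_proj, powDiag_proj]

/-- The morphism `X'^{n+1} ⟶ X^{n+1}` induced by a morphism over `B`. -/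
def powMapApp {X' : Scheme.{u}} {p' : X' ⟶ B} (f : X' ⟶ X) (hf : f ≫ p = p')
    (a : OverSimplexᵒᵖ) : (powFunctor p').obj a ⟶ (powFunctor p).obj a :=
  fiberPow.map f hf a.unop.len

lemma powMapApp_proj {X' : Scheme.{u}} {p' : X' ⟶ B} (f : X' ⟶ X) (hf : f ≫ p = p')
    (a : OverSimplexᵒᵖ) (j : Fin (a.unop.len + 1)) :
    powMapApp p f hf a ≫ powProj p a j = powProj p' a j ≫ f :=
  fiberPow.map_proj f hf _ j

/-- The morphism of oversimplicial schemes induced by a morphism over `B`. -/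
def powMap {X' : Scheme.{u}} {p' : X' ⟶ B} (f : X' ⟶ X) (hf : f ≫ p = p') :
    powFunctor p' ⟶ powFunctor p where
  app a := powMapApp p f hf a
  naturality a b α := powFunctor_hom_ext p fun j ↦ by
    rw [Category.assoc, Category.assoc, powFunctor_map_proj, powMapApp_proj, powMapApp_proj,
      reassoc_of% (powFunctor_map_proj p' α j)]

lemma powMap_app_proj {X' : Scheme.{u}} {p' : X' ⟶ B} (f : X' ⟶ X) (hf : f ≫ p = p')
    (a : OverSimplexᵒᵖ) (j : Fin (a.unop.len + 1)) :
    (powMap p f hf).app a ≫ powProj p a j = powProj p' a j ≫ f :=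
  fiberPow.map_proj f hf _ j

lemma isAffineHom_powMap {X' : Scheme.{u}} {p' : X' ⟶ B} (f : X' ⟶ X) (hf : f ≫ p = p')
    [IsAffineHom f] (a : OverSimplexᵒᵖ) : IsAffineHom ((powMap p f hf).app a) :=
  fiberPow.isAffineHom_map f hf _

lemma isSeparated_fiberPow [IsSeparated p] (n : ℕ) : IsSeparated (fiberPow p n).hom := by
  induction n with
  | zero => exact ‹IsSeparated p›
  | succ n ih =>
    exact inferInstanceAs (IsSeparated (pullback.fst (fiberPow p n).hom p ≫ (fiberPow p n).hom))

lemma isClosedImmersion_powDiag [IsSeparated p] (a : OverSimplexᵒᵖ) :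
    IsClosedImmersion (powDiag p a) := by
  have := isSeparated_fiberPow p a.unop.len
  have h : powProj p a 0 ≫ p = (fiberPow p a.unop.len).hom := fiberPow.proj_comp _ _ _
  have : IsSeparated (powProj p a 0 ≫ p) := by
    rw [h]
    exact isSeparated_fiberPow p a.unop.len
  have : IsSeparated (powProj p a 0) := IsSeparated.of_comp _ p
  have : IsClosedImmersion (powDiag p a ≫ powProj p a 0) := by
    rw [powDiag_proj]; infer_instance
  exact IsClosedImmersion.of_comp _ (powProj p a 0)

lemma ker_powDiag_agree [IsSeparated p] (a : OverSimplexᵒᵖ) (i j : Fin (a.unop.len + 1)) :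
    (powDiag p a).ker.subschemeι ≫ powProj p a i = (powDiag p a).ker.subschemeι ≫ powProj p a j := by
  have := isClosedImmersion_powDiag p a
  have h (i : Fin (a.unop.len + 1)) :
      (powDiag p a).toImage ≫ (powDiag p a).ker.subschemeι ≫ powProj p a i = 𝟙 X := by
    refine (Category.assoc _ _ _).symm.trans ?_
    exact (congrArg (· ≫ powProj p a i) (powDiag p a).toImage_imageι).trans (powDiag_proj p a i)
  exact (cancel_epi (powDiag p a).toImage).mp ((h i).trans (h j).symm)

end Power

section Tower
open Scheme.IdealSheafData
variable {X B : Scheme.{u}} (p : X ⟶ B) [IsSeparated p] {ι : Type u} [Fintype ι]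
  (D : ι → X.IdealSheafData) (hD : ∀ i, IsLocallyPrincipal (D i)) (m e : ι → ℕ)

/-- The ideal sheaf of the pull-back of `D = ⋃ D i` by the `j`-th projection. -/
def powDiv (a : OverSimplexᵒᵖ) (j : Fin (a.unop.len + 1)) : ((powFunctor p).obj a).IdealSheafData :=
  (∏ i, D i).comap (powProj p a j)

variable {D} in
lemma isLocallyPrincipal_powDiv (hD : ∀ i, IsLocallyPrincipal (D i)) (a : OverSimplexᵒᵖ)
    (j : Fin (a.unop.len + 1)) : IsLocallyPrincipal (powDiv p D a j) :=
  (IsLocallyPrincipal.prod Finset.univ D hD).comap _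

lemma isAdmissible_pow {a b : OverSimplexᵒᵖ} (α : a ⟶ b) :
    IsAdmissible (fun _ ↦ (powDiag p b).ker) (powDiv p D b)
      (dilStr (fun _ ↦ (powDiag p a).ker) (powDiv p D a) (isLocallyPrincipal_powDiv p hD a) ≫
        (powFunctor p).map α) := by
  have h (j : Fin (b.unop.len + 1)) : (powDiv p D b j).comap ((powFunctor p).map α) =
      powDiv p D a (OverSimplex.toMap α.unop j) := by
    rw [powDiv, powDiv, ← comap_comp, powFunctor_map_proj]
  have h0 := isAdmissible_dilStr (I := fun _ ↦ (powDiag p a).ker) (J := powDiv p D a)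
    (hJ := isLocallyPrincipal_powDiv p hD a)
  refine ⟨fun j ↦ ?_, fun j ↦ ?_⟩
  · rw [comap_comp, h]
    exact h0.isInvertible _
  · rw [comap_comp, comap_comp, h]
    exact (comap_mono _ (comap_ker_le (powDiag_map p α))).trans (h0.le _)

/-- The oversimplicial scheme `P^{(D)}`: the dilatation of `X^{n+1}` with respect to the diagonal
and the pull-backs of `D` by all the projections. -/
def dilD : OverSimplexᵒᵖ ⥤ Scheme.{u} :=
  dilFunctor (powFunctor p) (fun a _ ↦ (powDiag p a).ker) (powDiv p D)
    (isLocallyPrincipal_powDiv p hD) (isAdmissible_pow p D hD)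

/-- The canonical morphism to the oversimplicial scheme of the fibre powers. -/
def dilDStr : dilD p D hD ⟶ powFunctor p :=
  dilFunctorStr (powFunctor p) (fun a _ ↦ (powDiag p a).ker) (powDiv p D)
    (isLocallyPrincipal_powDiv p hD) (isAdmissible_pow p D hD)

instance (a : OverSimplexᵒᵖ) : IsAffineHom ((dilDStr p D hD).app a) :=
  inferInstanceAs (IsAffineHom (dilStr _ _ _))

lemma isAdmissible_dilDStr (a : OverSimplexᵒᵖ) :
    IsAdmissible (fun _ ↦ (powDiag p a).ker) (powDiv p D a) ((dilDStr p D hD).app a) :=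
  isAdmissible_dilStr

/-- The pull-back of `D i` to `P^{(D)}` by a projection. -/
def divD (a : OverSimplexᵒᵖ) (i : ι) (j : Fin (a.unop.len + 1)) :
    ((dilD p D hD).obj a).IdealSheafData :=
  (D i).comap ((dilDStr p D hD).app a ≫ powProj p a j)

lemma divD_le (a : OverSimplexᵒᵖ) (i : ι) (j k : Fin (a.unop.len + 1)) :
    divD p D hD a i j ≤ divD p D hD a i k := by
  refine comap_le_comap_of_agree (K := (powDiag p a).ker.comap ((dilDStr p D hD).app a)) ?_ _ ?_
  · have h1 : ((powDiag p a).ker.comap ((dilDStr p D hD).app a)).subschemeι ≫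
        (dilDStr p D hD).app a = (((powDiag p a).ker.comapIso ((dilDStr p D hD).app a)).hom ≫
          pullback.snd _ _) ≫ (powDiag p a).ker.subschemeι := by
      rw [Category.assoc, ← pullback.condition, ← Category.assoc, comapIso_hom_fst]
    rw [reassoc_of% h1, reassoc_of% h1, ker_powDiag_agree p a k j]
  · refine ((isAdmissible_dilDStr p D hD a).le k).trans ?_
    rw [powDiv, ← comap_comp]
    exact comap_mono _ (prod_le D i)

lemma divD_eq (a : OverSimplexᵒᵖ) (i : ι) (j k : Fin (a.unop.len + 1)) :
    divD p D hD a i j = divD p D hD a i k :=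
  le_antisymm (divD_le p D hD a i j k) (divD_le p D hD a i k j)

lemma comap_divD {a b : OverSimplexᵒᵖ} (α : a ⟶ b) (i : ι) :
    (divD p D hD b i 0).comap ((dilD p D hD).map α) = divD p D hD a i 0 := by
  rw [divD, ← comap_comp, reassoc_of% (dilDStr p D hD).naturality α, powFunctor_map_proj]
  exact divD_eq p D hD a i _ 0

/-- The centers of the second dilatation, in `𝔸(ι; P^{(D)})`: for every `i`, the ideal sheaf of the
pull-back of `D i` and the `m i`-th power of the ideal sheaf of the zero-section of the `i`-th
coordinate. -/
def centerM (a : OverSimplexᵒᵖ) : ι × Bool → ((affFunctor ι (dilD p D hD)).obj a).IdealSheafData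
  | (i, true) => (divD p D hD a i 0).comap (𝔸(ι; (dilD p D hD).obj a) ↘ (dilD p D hD).obj a)
  | (i, false) => princ (AffineSpace.coord ((dilD p D hD).obj a) i) ^ m i

lemma isLocallyPrincipal_centerM (a : OverSimplexᵒᵖ) (x : ι × Bool) :
    IsLocallyPrincipal (centerM p D hD m a x) := by
  obtain ⟨i, _ | _⟩ := x
  · exact (isLocallyPrincipal_princ _).pow _
  · exact ((hD i).comap _).comap _

lemma comap_centerM {a b : OverSimplexᵒᵖ} (α : a ⟶ b) (x : ι × Bool) :
    (centerM p D hD m b x).comap ((affFunctor ι (dilD p D hD)).map α) = centerM p D hD m a x := by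
  obtain ⟨i, _ | _⟩ := x
  · have h : (AffineSpace.map ι ((dilD p D hD).map α)).appTop
        (AffineSpace.coord ((dilD p D hD).obj b) i) = AffineSpace.coord ((dilD p D hD).obj a) i :=
      AffineSpace.map_appTop_coord _ _
    refine (comap_pow _ _ _).trans (congrArg (· ^ m i) ?_)
    exact (comap_princ _ _).trans (congrArg _ h)
  · have h : AffineSpace.map ι ((dilD p D hD).map α) ≫
        (𝔸(ι; (dilD p D hD).obj b) ↘ (dilD p D hD).obj b) = _ := AffineSpace.map_over _
    refine (comap_comp _ _ _).symm.trans ?_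
    refine (congrArg (fun f ↦ (divD p D hD b i 0).comap f) h).trans ?_
    rw [comap_comp, comap_divD]
    rfl

/-- The pairing of the two ideal sheaves for every `i`. -/
def swapM (x : ι × Bool) : ι × Bool := (x.1, !x.2)

lemma isAdmissible_M {a b : OverSimplexᵒᵖ} (α : a ⟶ b) :
    IsAdmissible (fun x ↦ centerM p D hD m b (swapM x)) (centerM p D hD m b)
      (dilStr (fun x ↦ centerM p D hD m a (swapM x)) (centerM p D hD m a)
        (isLocallyPrincipal_centerM p D hD m a) ≫ (affFunctor ι (dilD p D hD)).map α) := by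
  have h0 := isAdmissible_dilStr (I := fun x ↦ centerM p D hD m a (swapM x))
    (J := centerM p D hD m a) (hJ := isLocallyPrincipal_centerM p D hD m a)
  refine ⟨fun x ↦ ?_, fun x ↦ ?_⟩
  · rw [comap_comp, comap_centerM]
    exact h0.isInvertible _
  · rw [comap_comp, comap_comp, comap_centerM, comap_centerM]
    exact h0.le _

/-- The oversimplicial scheme `P^{(D,M)}`: the universal scheme over `𝔸(ι; P^{(D)})` on which the
inverse image of `D i` is the Cartier divisor `m i • {s i = 0}`, where `s i` is the `i`-th
coordinate. -/
def dilM : OverSimplexᵒᵖ ⥤ Scheme.{u} :=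
  dilFunctor (affFunctor ι (dilD p D hD)) (fun a x ↦ centerM p D hD m a (swapM x))
    (centerM p D hD m) (isLocallyPrincipal_centerM p D hD m) (isAdmissible_M p D hD m)

/-- The canonical morphism from `P^{(D,M)}` to `𝔸(ι; P^{(D)})`. -/
def dilMStr : dilM p D hD m ⟶ affFunctor ι (dilD p D hD) :=
  dilFunctorStr (affFunctor ι (dilD p D hD)) (fun a x ↦ centerM p D hD m a (swapM x))
    (centerM p D hD m) (isLocallyPrincipal_centerM p D hD m) (isAdmissible_M p D hD m)

instance (a : OverSimplexᵒᵖ) : IsAffineHom ((dilMStr p D hD m).app a) :=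
  inferInstanceAs (IsAffineHom (dilStr _ _ _))

/-- The coordinate functions on `P^{(D,M)}`. -/
def coordM (a : OverSimplexᵒᵖ) (i : ι) : Γ((dilM p D hD m).obj a, ⊤) :=
  ((dilMStr p D hD m).app a).appTop (AffineSpace.coord ((dilD p D hD).obj a) i)

lemma map_coordM {a b : OverSimplexᵒᵖ} (α : a ⟶ b) (i : ι) :
    ((dilM p D hD m).map α).appTop (coordM p D hD m b i) = coordM p D hD m a i := by
  have h1 := congr(($((dilMStr p D hD m).naturality α)).appTop
    (AffineSpace.coord ((dilD p D hD).obj b) i))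
  rw [Scheme.Hom.comp_appTop, Scheme.Hom.comp_appTop] at h1
  refine (show _ = _ from h1).trans ?_
  exact congrArg ((dilMStr p D hD m).app a).appTop (AffineSpace.map_appTop_coord _ _)

/-- The degeneracy morphism from `P_0^{(D,M)}` to `P_n^{(D,M)}`. -/
def degM (a : OverSimplexᵒᵖ) : (dilM p D hD m).obj (op (.mk 0)) ⟶ (dilM p D hD m).obj a :=
  (dilM p D hD m).map a.unop.toZero.op

lemma degM_map {a b : OverSimplexᵒᵖ} (α : a ⟶ b) :
    degM p D hD m a ≫ (dilM p D hD m).map α = degM p D hD m b := by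
  rw [degM, degM, ← Functor.map_comp]
  refine congrArg _ ?_
  exact congrArg Quiver.Hom.op (OverSimplex.toZero_ext (α.unop ≫ a.unop.toZero) b.unop.toZero)

/-- The ideal sheaf of the divisor `∑ i, e i • {s i = 0}` of `P^{(D,M)}`. -/
def centerR (a : OverSimplexᵒᵖ) : ((dilM p D hD m).obj a).IdealSheafData :=
  princ (∏ i, coordM p D hD m a i ^ e i)

lemma isLocallyPrincipal_centerR (a : OverSimplexᵒᵖ) :
    IsLocallyPrincipal (centerR p D hD m e a) :=
  isLocallyPrincipal_princ _

lemma comap_centerR {a b : OverSimplexᵒᵖ} (α : a ⟶ b) :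
    (centerR p D hD m e b).comap ((dilM p D hD m).map α) = centerR p D hD m e a := by
  rw [centerR, centerR, comap_princ, map_prod]
  simp_rw [map_pow, map_coordM]

lemma isAdmissible_R {a b : OverSimplexᵒᵖ} (α : a ⟶ b) :
    IsAdmissible (fun _ : Unit ↦ (degM p D hD m b).ker) (fun _ ↦ centerR p D hD m e b)
      (dilStr (fun _ : Unit ↦ (degM p D hD m a).ker) (fun _ ↦ centerR p D hD m e a)
        (fun _ ↦ isLocallyPrincipal_centerR p D hD m e a) ≫ (dilM p D hD m).map α) := by
  have h0 := isAdmissible_dilStr (I := fun _ : Unit ↦ (degM p D hD m a).ker)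
    (J := fun _ ↦ centerR p D hD m e a) (hJ := fun _ ↦ isLocallyPrincipal_centerR p D hD m e a)
  refine ⟨fun x ↦ ?_, fun x ↦ ?_⟩
  · rw [comap_comp, comap_centerR]
    exact h0.isInvertible x
  · rw [comap_comp, comap_comp, comap_centerR]
    exact (comap_mono _ (comap_ker_le (degM_map p D hD m α))).trans (h0.le x)

/-- The oversimplicial scheme `P^{(R,M)}`: the dilatation of `P_n^{(D,M)}` with respect to the
closed subscheme `P_0^{(D,M)}` and the divisor `∑ i, e i • {s i = 0}`. -/
def dilR : OverSimplexᵒᵖ ⥤ Scheme.{u} :=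
  dilFunctor (dilM p D hD m) (fun a (_ : Unit) ↦ (degM p D hD m a).ker)
    (fun a _ ↦ centerR p D hD m e a) (fun a _ ↦ isLocallyPrincipal_centerR p D hD m e a)
    (isAdmissible_R p D hD m e)

/-- The canonical morphism from `P^{(R,M)}` to `P^{(D,M)}`. -/
def dilRStr : dilR p D hD m e ⟶ dilM p D hD m :=
  dilFunctorStr (dilM p D hD m) (fun a (_ : Unit) ↦ (degM p D hD m a).ker)
    (fun a _ ↦ centerR p D hD m e a) (fun a _ ↦ isLocallyPrincipal_centerR p D hD m e a)
    (isAdmissible_R p D hD m e)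

instance (a : OverSimplexᵒᵖ) : IsAffineHom ((dilRStr p D hD m e).app a) :=
  inferInstanceAs (IsAffineHom (dilStr _ _ _))

end Tower

section QuotientNormalization
variable {C : Type*} [Category* C]

/-- The lift of a natural transformation to the functor of dilatations, when the inverse images of
the divisors are empty. -/
def dilFunctorLift {P : C ⥤ Scheme.{u}} {κ : C → Type*} [∀ c, Fintype (κ c)]
    {I J : ∀ c, κ c → (P.obj c).IdealSheafData} (hJ : ∀ c i, IsLocallyPrincipal (J c i))
    (h : ∀ {c d : C} (α : c ⟶ d),
      IsAdmissible (I d) (J d) (dilStr (I c) (J c) (hJ c) ≫ P.map α))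
    {Y : C ⥤ Scheme.{u}} (t : Y ⟶ P) (ht : ∀ c i, (J c i).comap (t.app c) = ⊤) :
    Y ⟶ dilFunctor P I J hJ h where
  app c := dilLift (hJ c) (t.app c)
    ⟨fun i ↦ by rw [ht]; exact isInvertible_top, fun i ↦ by rw [ht]; exact le_top⟩
  naturality {c d} α := by
    refine dil_hom_ext (f := Y.map α ≫ t.app d) (hJ := hJ d) ⟨fun i ↦ ?_, fun i ↦ ?_⟩ ?_ ?_
    · rw [Scheme.IdealSheafData.comap_comp, ht, Scheme.IdealSheafData.comap_top]
      exact isInvertible_top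
    · rw [Scheme.IdealSheafData.comap_comp (J d i), ht d i, Scheme.IdealSheafData.comap_top]
      exact le_top
    · exact (Category.assoc _ _ _).trans (congrArg (Y.map α ≫ ·) (dilLift_str _ _))
    · refine (Category.assoc _ _ _).trans ?_
      refine (congrArg (_ ≫ ·) (dilLift_str _ (h α))).trans ?_
      rw [← Category.assoc, dilLift_str, t.naturality]

lemma dilFunctorLift_str {P : C ⥤ Scheme.{u}} {κ : C → Type*} [∀ c, Fintype (κ c)]
    {I J : ∀ c, κ c → (P.obj c).IdealSheafData} (hJ : ∀ c i, IsLocallyPrincipal (J c i))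
    (h : ∀ {c d : C} (α : c ⟶ d),
      IsAdmissible (I d) (J d) (dilStr (I c) (J c) (hJ c) ≫ P.map α))
    {Y : C ⥤ Scheme.{u}} (t : Y ⟶ P) (ht : ∀ c i, (J c i).comap (t.app c) = ⊤) (c : C) :
    (dilFunctorLift hJ h t ht).app c ≫ (dilFunctorStr P I J hJ h).app c = t.app c :=
  dilLift_str (hJ := hJ c) (t.app c)
    ⟨fun i ↦ by rw [ht]; exact isInvertible_top, fun i ↦ by rw [ht]; exact le_top⟩

/-- The morphism of affine spaces induced by a natural transformation. -/
def affMap (ι : Type u) {Y P : C ⥤ Scheme.{u}} (t : Y ⟶ P) : affFunctor ι Y ⟶ affFunctor ι P where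
  app c := AffineSpace.map ι (t.app c)
  naturality c d α := by
    change AffineSpace.map ι _ ≫ AffineSpace.map ι _ = AffineSpace.map ι _ ≫ AffineSpace.map ι _
    rw [← AffineSpace.map_comp, ← AffineSpace.map_comp, t.naturality]

/-- The open subscheme of `𝔸(ι; S)` on which all the coordinates are invertible. -/
def gmOpen (ι : Type u) [Fintype ι] (S : Scheme.{u}) : (𝔸(ι; S)).Opens :=
  (𝔸(ι; S)).basicOpen (∏ i, AffineSpace.coord S i)

lemma gmOpen_le (ι : Type u) [Fintype ι] {S T : Scheme.{u}} (f : S ⟶ T) :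
    gmOpen ι S ≤ AffineSpace.map ι f ⁻¹ᵁ gmOpen ι T := by
  rw [gmOpen, gmOpen, Scheme.preimage_basicOpen]
  refine le_of_eq (congrArg _ ?_)
  refine Eq.trans ?_ (map_prod (AffineSpace.map ι f).appTop.hom _ _).symm
  exact Finset.prod_congr rfl fun i _ ↦ (AffineSpace.map_appTop_coord f i).symm

/-- The functor `c ↦ Y c × G_m^ι`. -/
def gmFunctor (ι : Type u) [Fintype ι] (Y : C ⥤ Scheme.{u}) : C ⥤ Scheme.{u} :=
  openFunctor (affFunctor ι Y) (fun c ↦ gmOpen ι (Y.obj c)) (fun α ↦ gmOpen_le ι (Y.map α))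

/-- The inclusion into the affine space. -/
def gmι (ι : Type u) [Fintype ι] (Y : C ⥤ Scheme.{u}) : gmFunctor ι Y ⟶ affFunctor ι Y :=
  openFunctorι _ _ (fun α ↦ gmOpen_le ι (Y.map α))

/-- The morphism induced by a natural transformation. -/
def gmMap (ι : Type u) [Fintype ι] {Y P : C ⥤ Scheme.{u}} (t : Y ⟶ P) :
    gmFunctor ι Y ⟶ gmFunctor ι P where
  app c := (AffineSpace.map ι (t.app c)).resLE _ _ (gmOpen_le ι (t.app c))
  naturality c d α := by
    change (AffineSpace.map ι _).resLE _ _ _ ≫ (AffineSpace.map ι _).resLE _ _ _ =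
      (AffineSpace.map ι _).resLE _ _ _ ≫ (AffineSpace.map ι _).resLE _ _ _
    rw [Scheme.Hom.resLE_comp_resLE, Scheme.Hom.resLE_comp_resLE]
    congr 1
    exact (affMap ι t).naturality α

lemma isAffineHom_pullback_snd {X Y Z: Scheme.{u}} (f : X ⟶ Z) (g : Y ⟶ Z) [h : IsAffineHom f] :
    IsAffineHom (pullback.snd f g) :=
  MorphismProperty.IsStableUnderBaseChange.of_isPullback (P := @IsAffineHom)
    (IsPullback.of_hasPullback f g) h

lemma exists_quotMap {Y S Y' S' : Scheme.{u}} {f : Y ⟶ S} {f' : Y' ⟶ S'} [IsAffineHom f]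
    [IsAffineHom f'] {G : Type*} [Finite G] {ρ : G → (Y ⟶ Y)} {ρ' : G → (Y' ⟶ Y')}
    (hρ : ∀ g, ρ g ≫ f = f) (hρ' : ∀ g, ρ' g ≫ f' = f') (a : Y ⟶ Y') (b : S ⟶ S')
    (h : a ≫ f' = f ≫ b) (ha : ∀ g, ρ g ≫ a = a ≫ ρ' g) :
    ∃ v : (invAlg ρ hρ).spec ⟶ (invAlg ρ' hρ').spec,
      (invAlg ρ hρ).toSpec ≫ v = a ≫ (invAlg ρ' hρ').toSpec ∧
        v ≫ (invAlg ρ' hρ').str = (invAlg ρ hρ).str ≫ b := by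
  let c : Y ⟶ pullback (invAlg ρ' hρ').str b := pullback.lift (a ≫ (invAlg ρ' hρ').toSpec) f (by
    rw [Category.assoc, QcohSubalgebra.toSpec_str, h])
  have : IsAffineHom (pullback.snd (invAlg ρ' hρ').str b) :=
    isAffineHom_pullback_snd _ _
  obtain ⟨w, hw, hw'⟩ := (invAlg ρ hρ).exists_desc (pullback.snd (invAlg ρ' hρ').str b) c
    (pullback.lift_snd _ _ _) (by
      intro U hU x g
      rw [← CommRingCat.comp_apply, Scheme.Hom.appLE_comp_appLE]
      refine appLE_congr ?_ _ _ _ _ _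
      refine pullback.hom_ext ?_ ?_
      · rw [Category.assoc, pullback.lift_fst, reassoc_of% (ha g), comp_toSpec_invAlg]
      · rw [Category.assoc, pullback.lift_snd, hρ])
  refine ⟨w ≫ pullback.fst _ _, ?_, ?_⟩
  · rw [reassoc_of% hw, pullback.lift_fst]
  · rw [Category.assoc, pullback.condition, reassoc_of% hw']

section
variable {Y S : C ⥤ Scheme.{u}} (f : Y ⟶ S) [∀ c, IsAffineHom (f.app c)] {G : Type*}
    [Finite G] (ρ : G → (Y ⟶ Y)) (hρ : ∀ g, ρ g ≫ f = f)

/-- The algebra of invariants of the direct image of `O_Y` in `S`. -/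
def quotAlg (c : C) : QcohSubalgebra (f.app c) :=
  invAlg (fun g ↦ (ρ g).app c) (fun g ↦ by rw [← NatTrans.comp_app, hρ])

lemma exists_quotAlgMap {c d : C} (α : c ⟶ d) :
    ∃ v : (quotAlg f ρ hρ c).spec ⟶ (quotAlg f ρ hρ d).spec,
      (quotAlg f ρ hρ c).toSpec ≫ v = Y.map α ≫ (quotAlg f ρ hρ d).toSpec ∧
        v ≫ (quotAlg f ρ hρ d).str = (quotAlg f ρ hρ c).str ≫ S.map α :=
  exists_quotMap _ _ (Y.map α) (S.map α) (f.naturality α) fun g ↦ ((ρ g).naturality α).symm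

/-- The functor of quotients of `Y` by a finite group of automorphisms over `S`, for an affine
morphism `f : Y ⟶ S`: the relative spectrum over `S` of the algebra of invariants. -/
def quotFunctor : C ⥤ Scheme.{u} :=
  functorOfDominant Y S (fun c ↦ (quotAlg f ρ hρ c).spec) (fun c ↦ (quotAlg f ρ hρ c).toSpec)
    (fun c ↦ (quotAlg f ρ hρ c).str) (exists_quotAlgMap f ρ hρ)

/-- The morphism from the quotient to the base. -/
def quotStr : quotFunctor f ρ hρ ⟶ S :=
  functorOfDominantStr Y S (fun c ↦ (quotAlg f ρ hρ c).spec) (fun c ↦ (quotAlg f ρ hρ c).toSpec)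
    (fun c ↦ (quotAlg f ρ hρ c).str) (exists_quotAlgMap f ρ hρ)

instance (c : C) : IsAffineHom ((quotStr f ρ hρ).app c) :=
  inferInstanceAs (IsAffineHom (quotAlg f ρ hρ c).str)

end

section
variable {Y S : C ⥤ Scheme.{u}} (f : Y ⟶ S) [∀ c, IsAffineHom (f.app c)]

lemma exists_normMap {c d : C} (α : c ⟶ d) :
    ∃ v : (f.app c).normalization ⟶ (f.app d).normalization,
      (f.app c).toNormalization ≫ v = Y.map α ≫ (f.app d).toNormalization ∧
        v ≫ (f.app d).fromNormalization = (f.app c).fromNormalization ≫ S.map α := by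
  let b : Y.obj c ⟶ pullback (f.app d).fromNormalization (S.map α) :=
    pullback.lift (Y.map α ≫ (f.app d).toNormalization) (f.app c) (by
      rw [Category.assoc, Scheme.Hom.toNormalization_fromNormalization, f.naturality])
  have hb : f.app c = b ≫ pullback.snd _ _ := (pullback.lift_snd _ _ _).symm
  refine ⟨(f.app c).normalizationDesc b (pullback.snd _ _) hb ≫ pullback.fst _ _, ?_, ?_⟩
  · rw [Scheme.Hom.toNormalization_normalizationDesc_assoc, pullback.lift_fst]
  · rw [Category.assoc, pullback.condition, Scheme.Hom.normalizationDesc_comp_assoc]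

instance (c : C) : IsSchemeTheoreticallyDominant (f.app c).toNormalization :=
  ⟨Scheme.Hom.ker_toNormalization _⟩

/-- The functor of normalizations of `S` in `Y`. -/
def normFunctor : C ⥤ Scheme.{u} :=
  functorOfDominant Y S (fun c ↦ (f.app c).normalization) (fun c ↦ (f.app c).toNormalization)
    (fun c ↦ (f.app c).fromNormalization) (exists_normMap f)

/-- The integral morphism from the normalization. -/
def normStr : normFunctor f ⟶ S :=
  functorOfDominantStr Y S (fun c ↦ (f.app c).normalization) (fun c ↦ (f.app c).toNormalization)
    (fun c ↦ (f.app c).fromNormalization) (exists_normMap f)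

end

end QuotientNormalization

section OpenPart
open Scheme.IdealSheafData
variable {X B : Scheme.{u}} (p : X ⟶ B) [IsSeparated p] {ι : Type u} [Fintype ι]
  (D : ι → X.IdealSheafData) (hD : ∀ i, IsLocallyPrincipal (D i)) (m e : ι → ℕ)

/-- The complement `U` of the union of the `D i`. -/
def complUnion : X.Opens := complOpen (∏ i, D i)

lemma comap_complUnion_prod : (∏ i, D i).comap (complUnion D).ι = ⊤ :=
  comap_complOpen_ι _

lemma comap_complUnion_ι (i : ι) : (D i).comap (complUnion D).ι = ⊤ :=
  comap_eq_top_of_le (prod_le D i) _ (comap_complOpen_ι _)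

lemma comap_powDiv (a : OverSimplexᵒᵖ) (j : Fin (a.unop.len + 1)) :
    (powDiv p D a j).comap ((powMap p (complUnion D).ι rfl).app a) = ⊤ := by
  rw [powDiv, ← comap_comp, powMap_app_proj, comap_comp]
  rw [comap_complUnion_prod, comap_top]

/-- The open part `U^{n+1}` of `P^{(D)}`. -/
def toDilD : powFunctor ((complUnion D).ι ≫ p) ⟶ dilD p D hD :=
  dilFunctorLift _ _ (powMap p (complUnion D).ι rfl) (comap_powDiv p D)

lemma toDilD_str (a : OverSimplexᵒᵖ) : (toDilD p D hD).app a ≫ (dilDStr p D hD).app a =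
    (powMap p (complUnion D).ι rfl).app a :=
  dilFunctorLift_str _ _ _ _ _

lemma comap_divD_eq_top (a : OverSimplexᵒᵖ) (i : ι) :
    (divD p D hD a i 0).comap ((toDilD p D hD).app a) = ⊤ := by
  rw [divD, ← comap_comp, reassoc_of% (toDilD_str p D hD a), powMap_app_proj, comap_comp,
    comap_complUnion_ι, comap_top]

lemma comap_over_eq_top {T S S' : Scheme.{u}} (g : T ⟶ 𝔸(ι; S)) (q : S ⟶ S')
    (K : S'.IdealSheafData) (h : K.comap q = ⊤) :
    (K.comap (𝔸(ι; S') ↘ S')).comap (g ≫ AffineSpace.map ι q) = ⊤ := by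
  rw [← comap_comp, Category.assoc, AffineSpace.map_over, comap_comp, comap_comp, h, comap_top,
    comap_top]

lemma isUnit_coord (S : Scheme.{u}) (i : ι) :
    IsUnit ((gmOpen ι S).ι.appTop (AffineSpace.coord S i)) := by
  have h : IsUnit ((gmOpen ι S).ι.appTop (∏ i, AffineSpace.coord S i)) := by
    have h1 := isUnit_appLE (gmOpen ι S).ι (U := ⊤) (W := ⊤) le_rfl
      (∏ i, AffineSpace.coord S i) (fun x _ ↦ x.2)
    rwa [Scheme.Hom.appTop, Scheme.Hom.app_eq_appLE]
  rw [map_prod] at h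
  exact (IsUnit.prod_iff.mp h) i (Finset.mem_univ i)

/-- The morphism from `U^{n+1} × G_m^ι` to `𝔸(ι; P^{(D)})`. -/
def toAffDilD : gmFunctor ι (powFunctor ((complUnion D).ι ≫ p)) ⟶ affFunctor ι (dilD p D hD) :=
  gmι ι _ ≫ affMap ι (toDilD p D hD)

lemma toAffDilD_coord (a : OverSimplexᵒᵖ) (i : ι) :
    IsUnit (((toAffDilD p D hD).app a).appTop (AffineSpace.coord ((dilD p D hD).obj a) i)) := by
  have h := isUnit_coord ((powFunctor ((complUnion D).ι ≫ p)).obj a) i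
  rw [← AffineSpace.map_appTop_coord ((toDilD p D hD).app a) i] at h
  exact h

lemma comap_centerM_eq_top (a : OverSimplexᵒᵖ) (x : ι × Bool) :
    (centerM p D hD m a x).comap ((toAffDilD p D hD).app a) = ⊤ := by
  obtain ⟨i, _ | _⟩ := x
  · refine (comap_pow _ _ _).trans ?_
    have h := (comap_princ ((toAffDilD p D hD).app a) _).trans
      (princ_of_isUnit (toAffDilD_coord p D hD a i))
    exact (congrArg (· ^ m i) h).trans (one_pow _)
  · exact comap_over_eq_top ((gmι ι (powFunctor ((complUnion D).ι ≫ p))).app a)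
      ((toDilD p D hD).app a) _ (comap_divD_eq_top p D hD a i)

/-- The open part `U^{n+1} × G_m^ι` of `P^{(D,M)}`. -/
def toDilM : gmFunctor ι (powFunctor ((complUnion D).ι ≫ p)) ⟶ dilM p D hD m :=
  dilFunctorLift _ _ (toAffDilD p D hD) (comap_centerM_eq_top p D hD m)

lemma toDilM_str (a : OverSimplexᵒᵖ) : (toDilM p D hD m).app a ≫ (dilMStr p D hD m).app a =
    (toAffDilD p D hD).app a :=
  dilFunctorLift_str _ _ _ _ _

lemma isUnit_toDilM_coordM (a : OverSimplexᵒᵖ) (i : ι) :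
    IsUnit (((toDilM p D hD m).app a).appTop (coordM p D hD m a i)) := by
  have h := toAffDilD_coord p D hD a i
  rw [← toDilM_str p D hD m, Scheme.Hom.comp_appTop] at h
  exact h

lemma comap_centerR_eq_top (a : OverSimplexᵒᵖ) (_x : Unit) :
    (centerR p D hD m e a).comap ((toDilM p D hD m).app a) = ⊤ := by
  rw [centerR, comap_princ, map_prod]
  refine princ_of_isUnit ?_
  rw [IsUnit.prod_iff]
  intro i _
  rw [map_pow]
  exact (isUnit_toDilM_coordM p D hD m a i).pow _

/-- The open part `U^{n+1} × G_m^ι` of `P^{(R,M)}`. -/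
def toDilR : gmFunctor ι (powFunctor ((complUnion D).ι ≫ p)) ⟶ dilR p D hD m e :=
  dilFunctorLift _ _ (toDilM p D hD m) (comap_centerR_eq_top p D hD m e)

lemma toDilR_str (a : OverSimplexᵒᵖ) : (toDilR p D hD m e).app a ≫ (dilRStr p D hD m e).app a =
    (toDilM p D hD m).app a :=
  dilFunctorLift_str _ _ _ _ _

end OpenPart

section Torsor
open Scheme.IdealSheafData
variable {X B : Scheme.{u}} (p : X ⟶ B) [IsSeparated p] {ι : Type u} [Fintype ι]
  (D : ι → X.IdealSheafData) (hD : ∀ i, IsLocallyPrincipal (D i)) (m e : ι → ℕ)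

/-- `f : V ⟶ U` is a torsor under the finite constant group `G`, acting on `V` through `ρ`. -/
structure IsTorsor {V U : Scheme.{u}} (f : V ⟶ U) {G : Type u} [Group G] (ρ : G →* Aut V) :
    Prop where
  comp_eq (g : G) : (ρ g).hom ≫ f = f
  isFinite : IsFinite f
  etale : Etale f
  surjective : Surjective f
  isIso : IsIso (Sigma.desc fun g : G ↦
    pullback.lift (f := f) (g := f) (𝟙 V) (ρ g).hom (by rw [comp_eq, Category.id_comp]))

variable {V : Scheme.{u}} (f : V ⟶ (complUnion D).toScheme) {G : Type u} [Group G] [Finite G]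
  (ρ : G →* Aut V)

/-- The diagonal action of an element of `G` on `V^{•+1}`. -/
def diagAct (hρ : ∀ g, (ρ g).hom ≫ f = f) (g : G) :
    powFunctor (f ≫ (complUnion D).ι ≫ p) ⟶ powFunctor (f ≫ (complUnion D).ι ≫ p) :=
  powMap _ (ρ g).hom (by rw [reassoc_of% hρ])

lemma diagAct_comp (hρ : ∀ g, (ρ g).hom ≫ f = f) (g : G) :
    diagAct p D f ρ hρ g ≫ powMap ((complUnion D).ι ≫ p) f rfl =
      powMap ((complUnion D).ι ≫ p) f rfl := by
  ext a : 2
  refine powFunctor_hom_ext _ fun j ↦ ?_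
  rw [NatTrans.comp_app, Category.assoc, powMap_app_proj, diagAct]
  refine (Category.assoc _ _ _).symm.trans ?_
  refine (congrArg (· ≫ f) (powMap_app_proj _ _ _ a j)).trans ?_
  exact (Category.assoc _ _ _).trans (congrArg (_ ≫ ·) (hρ g))

instance [IsAffineHom f] (a : OverSimplexᵒᵖ) :
    IsAffineHom ((powMap ((complUnion D).ι ≫ p) f rfl).app a) :=
  isAffineHom_powMap _ _ _ _

lemma IsTorsor.isAffineHom {V U : Scheme.{u}} {f : V ⟶ U} {G : Type u} [Group G]
    {ρ : G →* Aut V} (hf : IsTorsor f ρ) : IsAffineHom f := by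
  have := hf.isFinite
  infer_instance

variable {f ρ} (hf : IsTorsor f ρ)

/-- The oversimplicial scheme `V^{•+1}/ΔG`. -/
def quotPow : OverSimplexᵒᵖ ⥤ Scheme.{u} :=
  have := hf.isAffineHom
  quotFunctor (powMap ((complUnion D).ι ≫ p) f rfl) (diagAct p D f ρ hf.comp_eq)
    (diagAct_comp p D f ρ hf.comp_eq)

/-- The morphism `V^{•+1}/ΔG ⟶ U^{•+1}`. -/
def quotPowStr : quotPow p D hf ⟶ powFunctor ((complUnion D).ι ≫ p) :=
  have := hf.isAffineHom
  quotStr (powMap ((complUnion D).ι ≫ p) f rfl) (diagAct p D f ρ hf.comp_eq)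
    (diagAct_comp p D f ρ hf.comp_eq)

instance (a : OverSimplexᵒᵖ) : IsAffineHom ((quotPowStr p D hf).app a) :=
  have := hf.isAffineHom
  inferInstanceAs (IsAffineHom ((quotStr (powMap ((complUnion D).ι ≫ p) f rfl)
    (diagAct p D f ρ hf.comp_eq) (diagAct_comp p D f ρ hf.comp_eq)).app a))

/-- The morphism `V^{•+1}/ΔG × G_m^ι ⟶ U^{•+1} × G_m^ι ⟶ P^{(R,M)}`. -/
def coverMap : gmFunctor ι (quotPow p D hf) ⟶ dilR p D hD m e :=
  gmMap ι (quotPowStr p D hf) ≫ toDilR p D hD m e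

instance (Y : OverSimplexᵒᵖ ⥤ Scheme.{u}) (a : OverSimplexᵒᵖ) : IsAffineHom ((gmι ι Y).app a) :=
  inferInstanceAs (IsAffineHom ((𝔸(ι; Y.obj a)).basicOpen _).ι)

/-- The projection from the affine space. -/
def affOver (ι : Type u) (P : OverSimplexᵒᵖ ⥤ Scheme.{u}) : affFunctor ι P ⟶ P where
  app a := 𝔸(ι; P.obj a) ↘ P.obj a
  naturality _ _ _ := AffineSpace.map_over _

instance (P : OverSimplexᵒᵖ ⥤ Scheme.{u}) (a : OverSimplexᵒᵖ) : IsAffineHom ((affOver ι P).app a) :=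
  inferInstanceAs (IsAffineHom (𝔸(ι; P.obj a) ↘ P.obj a))

lemma affMap_affOver {Y P : OverSimplexᵒᵖ ⥤ Scheme.{u}} (t : Y ⟶ P) (a : OverSimplexᵒᵖ) :
    (affMap ι t).app a ≫ (affOver ι P).app a = (affOver ι Y).app a ≫ t.app a :=
  AffineSpace.map_over _

lemma gmMap_gmι {Y P : OverSimplexᵒᵖ ⥤ Scheme.{u}} (t : Y ⟶ P) (a : OverSimplexᵒᵖ) :
    (gmMap ι t).app a ≫ (gmι ι P).app a = (gmι ι Y).app a ≫ (affMap ι t).app a :=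
  Scheme.Hom.resLE_comp_ι _ _

/-- The morphism `P^{(R,M)} ⟶ X^{•+1}`. -/
def dilRToPow : dilR p D hD m e ⟶ powFunctor p :=
  dilRStr p D hD m e ≫ dilMStr p D hD m ≫ affOver ι (dilD p D hD) ≫ dilDStr p D hD

instance isAffineHom_dilRToPow (a : OverSimplexᵒᵖ) : IsAffineHom ((dilRToPow p D hD m e).app a) :=
  inferInstanceAs (IsAffineHom ((dilRStr p D hD m e).app a ≫ (dilMStr p D hD m).app a ≫
    (affOver ι (dilD p D hD)).app a ≫ (dilDStr p D hD).app a))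

lemma coverMap_comp (a : OverSimplexᵒᵖ) :
    (coverMap p D hD m e hf).app a ≫ (dilRToPow p D hD m e).app a =
    (gmι ι (quotPow p D hf)).app a ≫ (affOver ι (quotPow p D hf)).app a ≫
        (quotPowStr p D hf).app a ≫ (powMap p (complUnion D).ι rfl).app a := by
  have h1 := toDilR_str p D hD m e a
  have h2 := toDilM_str p D hD m a
  have h3 : (toAffDilD p D hD).app a ≫ (affOver ι (dilD p D hD)).app a =
      (gmι ι (powFunctor ((complUnion D).ι ≫ p))).app a ≫
        (affOver ι (powFunctor ((complUnion D).ι ≫ p))).app a ≫ (toDilD p D hD).app a :=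
    (Category.assoc _ _ _).trans (congrArg (_ ≫ ·) (affMap_affOver (ι := ι) (toDilD p D hD) a))
  have h4 := gmMap_gmι (ι := ι) (quotPowStr p D hf) a
  have h5 := affMap_affOver (ι := ι) (quotPowStr p D hf) a
  rw [coverMap, dilRToPow, NatTrans.comp_app, NatTrans.comp_app, NatTrans.comp_app,
    NatTrans.comp_app, Category.assoc, reassoc_of% h1, reassoc_of% h2,
    reassoc_of% h3, toDilD_str, reassoc_of% h4, reassoc_of% h5]

instance (a : OverSimplexᵒᵖ) : IsAffineHom ((coverMap p D hD m e hf).app a) := by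
  have : IsAffineHom (complUnion D).ι :=
    isAffineHom_complOpen (IsLocallyPrincipal.prod Finset.univ D hD)
  have : IsAffineHom ((powMap p (complUnion D).ι rfl).app a) := isAffineHom_powMap _ _ _ _
  have h := coverMap_comp p D hD m e hf a
  have : IsAffineHom ((coverMap p D hD m e hf).app a ≫ (dilRToPow p D hD m e).app a) := by
    rw [h]
    infer_instance
  exact MorphismProperty.of_postcomp (W := @IsAffineHom) (W' := @IsSeparated) _
    ((dilRToPow p D hD m e).app a) inferInstance this

/-- The oversimplicial scheme `Q^{(R,M)}`: the normalization of `P^{(R,M)}` in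
`V^{•+1}/ΔG × G_m^ι`. -/
def normR : OverSimplexᵒᵖ ⥤ Scheme.{u} := normFunctor (coverMap p D hD m e hf)

/-- The integral morphism `Q^{(R,M)} ⟶ P^{(R,M)}`. -/
def normRStr : normR p D hD m e hf ⟶ dilR p D hD m e := normStr (coverMap p D hD m e hf)

/-- The largest open subscheme of `Q` on which `g` is étale. -/
def etaleLocus {Q P : Scheme.{u}} (g : Q ⟶ P) : Q.Opens := sSup {O | Etale (O.ι ≫ g)}

/-- The largest open subscheme `W^{(R,M)}` of `Q^{(R,M)}` that is étale over `P^{(R,M)}`. -/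
def etaleR (a : OverSimplexᵒᵖ) : ((normR p D hD m e hf).obj a).Opens :=
  etaleLocus ((normRStr p D hD m e hf).app a)

/-- The ramification of `V` over `U` is bounded by `R+`: the morphism from `Q_1` to `P_1` is étale
on a neighbourhood of the image of `Q_0`. -/
def IsBounded : Prop :=
  ∃ O : ((normR p D hD m e hf).obj (op (.mk 1))).Opens,
    Set.range ((normR p D hD m e hf).map (OverSimplex.toZero (.mk 1)).op) ⊆ O ∧
      Etale (O.ι ≫ (normRStr p D hD m e hf).app (op (.mk 1)))

end Torsor

section NormalCrossings

/-- The closed subschemes `D i` of a regular scheme are the irreducible components of a divisor with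
simple normal crossings: they are integral, and locally they are defined by functions `t i` such
that, at every point `x`, the `t i` with `x ∈ D i` are part of a regular system of parameters. -/
structure IsSimpleNormalCrossings {X : Scheme.{u}} {ι : Type u} (D : ι → X.IdealSheafData) :
    Prop where
  isIntegral (i : ι) : IsIntegral (D i).subscheme
  exists_parameters (x : X) : ∃ (U : X.affineOpens) (hx : x ∈ U.1) (t : ι → Γ(X, U)),
    (∀ i, (D i).ideal U = Ideal.span {t i}) ∧
    ∃ s : {i : ι // x ∈ (D i).support} → IsLocalRing.maximalIdeal (X.presheaf.stalk x),
      (∀ i, (s i : X.presheaf.stalk x) = X.presheaf.germ U.1 x hx (t i)) ∧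
      LinearIndependent (IsLocalRing.ResidueField (X.presheaf.stalk x))
        (fun i ↦ (IsLocalRing.maximalIdeal (X.presheaf.stalk x)).toCotangent (s i))

lemma IsSimpleNormalCrossings.isLocallyPrincipal {X : Scheme.{u}} {ι : Type u}
    {D : ι → X.IdealSheafData} (h : IsSimpleNormalCrossings D) (i : ι) :
    IsLocallyPrincipal (D i) := fun x ↦ by
  obtain ⟨U, hx, t, ht, -⟩ := h.exists_parameters x
  exact ⟨U, hx, t i, ht i⟩

end NormalCrossings

section Multiplicative
variable {C : Type*} [Category* C]

/-- An oversimplicial object is multiplicative if it maps the cocartesian squares with vertex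
`[0, 0]` to cartesian squares. -/
def IsMultiplicative (P : OverSimplexᵒᵖ ⥤ C) : Prop :=
  ∀ ⦃m l n : OverSimplex⦄ (a : .mk 0 ⟶ m) (b : .mk 0 ⟶ l) (c : m ⟶ n) (d : l ⟶ n),
    IsPushout a b c d → IsPullback (P.map c.op) (P.map d.op) (P.map a.op) (P.map b.op)

/-- A morphism `f : Q ⟶ P` of oversimplicial objects is multiplicative if, for every cocartesian
square with vertex `[0, 0]`, the object `Q_n` is the fibre product over `P_n` of the fibre
products `Q_m ×_{P_m} P_n` and `Q_l ×_{P_l} P_n`. -/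
def IsMultiplicativeHom [HasPullbacks C] {Q P : OverSimplexᵒᵖ ⥤ C} (f : Q ⟶ P) : Prop :=
  ∀ ⦃m l n : OverSimplex⦄ (a : .mk 0 ⟶ m) (b : .mk 0 ⟶ l) (c : m ⟶ n) (d : l ⟶ n),
    IsPushout a b c d →
    IsPullback
      (pullback.lift (f := f.app (op m)) (g := P.map c.op) (Q.map c.op) (f.app (op n))
        (f.naturality c.op))
      (pullback.lift (f := f.app (op l)) (g := P.map d.op) (Q.map d.op) (f.app (op n))
        (f.naturality d.op))
      (pullback.snd (f.app (op m)) (P.map c.op))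
      (pullback.snd (f.app (op l)) (P.map d.op))

/-- The laws of a groupoid in a category, with objects `P₀`, morphisms `P₁`, source `s`,
target `t`, identities `e`, composition `μ` and inversion `inv`. -/
structure IsGroupoid [HasPullbacks C] {P₁ P₀ : C} (s t : P₁ ⟶ P₀) (e : P₀ ⟶ P₁)
    (μ : pullback t s ⟶ P₁) (inv : P₁ ⟶ P₁) : Prop where
  e_s : e ≫ s = 𝟙 P₀
  e_t : e ≫ t = 𝟙 P₀
  mul_s : μ ≫ s = pullback.fst t s ≫ s
  mul_t : μ ≫ t = pullback.snd t s ≫ t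
  inv_s : inv ≫ s = t
  inv_t : inv ≫ t = s
  assoc ⦃T : C⦄ (x y z : T ⟶ P₁) (hxy : x ≫ t = y ≫ s) (hyz : y ≫ t = z ≫ s) :
    pullback.lift (pullback.lift x y hxy ≫ μ) z
      (by rw [Category.assoc, mul_t, pullback.lift_snd_assoc, hyz]) ≫ μ =
    pullback.lift x (pullback.lift y z hyz ≫ μ)
      (by rw [Category.assoc, mul_s, pullback.lift_fst_assoc, hxy]) ≫ μ
  one_mul : pullback.lift (s ≫ e) (𝟙 P₁) (by rw [Category.assoc, e_t]; simp) ≫ μ = 𝟙 P₁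
  mul_one : pullback.lift (𝟙 P₁) (t ≫ e) (by rw [Category.assoc, e_s]; simp) ≫ μ = 𝟙 P₁
  mul_inv : pullback.lift (𝟙 P₁) inv (by rw [inv_s, Category.id_comp]) ≫ μ = s ≫ e
  inv_mul : pullback.lift inv (𝟙 P₁) (by rw [inv_t, Category.id_comp]) ≫ μ = t ≫ e

end Multiplicative

section Groupoid
variable {C : Type*} [Category* C] (P : OverSimplexᵒᵖ ⥤ C)

/-- The source `P_1 ⟶ P_0`, given by `0 ↦ 0`. -/
def srcMap : P.obj (op (.mk 1)) ⟶ P.obj (op (.mk 0)) :=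
  P.map (OverSimplex.ofMap (a := 0) (b := 1) ![0]).op

/-- The target `P_1 ⟶ P_0`, given by `0 ↦ 1`. -/
def tgtMap : P.obj (op (.mk 1)) ⟶ P.obj (op (.mk 0)) :=
  P.map (OverSimplex.ofMap (a := 0) (b := 1) ![1]).op

/-- The identity `P_0 ⟶ P_1`. -/
def unitMap : P.obj (op (.mk 0)) ⟶ P.obj (op (.mk 1)) :=
  P.map (OverSimplex.ofMap (a := 1) (b := 0) ![0, 0]).op

/-- The inverse `P_1 ⟶ P_1`, given by the transposition. -/
def invMap : P.obj (op (.mk 1)) ⟶ P.obj (op (.mk 1)) :=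
  P.map (OverSimplex.ofMap (a := 1) (b := 1) ![1, 0]).op

/-- The morphism `P_2 ⟶ P_1` given by `0 ↦ 0, 1 ↦ 1`. -/
def fstMap : P.obj (op (.mk 2)) ⟶ P.obj (op (.mk 1)) :=
  P.map (OverSimplex.ofMap (a := 1) (b := 2) ![0, 1]).op

/-- The morphism `P_2 ⟶ P_1` given by `0 ↦ 1, 1 ↦ 2`. -/
def sndMap : P.obj (op (.mk 2)) ⟶ P.obj (op (.mk 1)) :=
  P.map (OverSimplex.ofMap (a := 1) (b := 2) ![1, 2]).op

/-- The morphism `P_2 ⟶ P_1` given by `0 ↦ 0, 1 ↦ 2`. -/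
def compMap : P.obj (op (.mk 2)) ⟶ P.obj (op (.mk 1)) :=
  P.map (OverSimplex.ofMap (a := 1) (b := 2) ![0, 2]).op

lemma fstMap_tgtMap : fstMap P ≫ tgtMap P = sndMap P ≫ srcMap P := by
  rw [fstMap, tgtMap, sndMap, srcMap, ← P.map_comp, ← P.map_comp]
  refine congrArg P.map (congrArg Quiver.Hom.op (funext fun i ↦ ?_))
  rw [Fin.fin_one_eq_zero i]
  rfl

/-- The canonical morphism `P_2 ⟶ P_1 ×_{P_0} P_1`. -/
def segalMap [HasPullbacks C] : P.obj (op (.mk 2)) ⟶ pullback (tgtMap P) (srcMap P) :=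
  pullback.lift (fstMap P) (sndMap P) (fstMap_tgtMap P)

/-- The oversimplicial object `P` defines a groupoid: the canonical morphism from `P_2` to
`P_1 ×_{P_0} P_1` is an isomorphism, and the composition of its inverse with `P_2 ⟶ P_1` makes
`(P_1, P_0)` a groupoid. -/
def DefinesGroupoid [HasPullbacks C] : Prop :=
  ∃ _ : IsIso (segalMap P),
    IsGroupoid (srcMap P) (tgtMap P) (unitMap P) (inv (segalMap P) ≫ compMap P) (invMap P)

end Groupoid

section Truncation
open Scheme.IdealSheafData
variable {X B : Scheme.{u}} (p : X ⟶ B) [IsSeparated p] {ι : Type u} [Fintype ι]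
  (D : ι → X.IdealSheafData) (hD : ∀ i, IsLocallyPrincipal (D i)) (m e : ι → ℕ)
  {V : Scheme.{u}} {f : V ⟶ (complUnion D).toScheme} {G : Type u} [Group G] [Finite G]
  {ρ : G →* Aut V} (hf : IsTorsor f ρ)

/-- The `W_n` form an oversimplicial open subscheme of `Q^{(R,M)}`. -/
def EtaleRCompatible : Prop :=
  ∀ {a b : OverSimplexᵒᵖ} (α : a ⟶ b), etaleR p D hD m e hf a ≤
    (normR p D hD m e hf).map α ⁻¹ᵁ etaleR p D hD m e hf b

/-- The oversimplicial scheme `W^{(R,M)}`. -/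
def etaleRFunctor (hW : EtaleRCompatible p D hD m e hf) : OverSimplexᵒᵖ ⥤ Scheme.{u} :=
  openFunctor (normR p D hD m e hf) (etaleR p D hD m e hf) hW

/-- The morphism `W^{(R,M)} ⟶ P^{(R,M)}`. -/
def etaleRStr (hW : EtaleRCompatible p D hD m e hf) :
    etaleRFunctor p D hD m e hf hW ⟶ dilR p D hD m e :=
  openFunctorι (normR p D hD m e hf) (etaleR p D hD m e hf) hW ≫ normRStr p D hD m e hf

end Truncation

end

/-!
Let `P = P^{(R,M)}`, let `𝒱 = V^{•+1}/ΔG × 𝔾_m^ι`, let `Q` be the normalization of `P` in `𝒱`, and let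
`W` be the étale locus of `Q` over `P`. The theorem follows from formal properties of `𝒱 ⟶ Q ⟶ P`,
collected in `IsNormalizedCover`.

**The formal part.** Suppose that `P` is multiplicative, locally Noetherian and smooth over `P_0`
along every vertex, that `𝒱` is multiplicative, that `𝒱_0` is an open subscheme of `P_0` in which
`P_0` is integrally closed, and that `𝒱_n` is integral and étale over the inverse image of `𝒱_0` in
`P_n`. Normalization commutes with smooth base change, so `Q_n` is equal to `𝒱_n` over this open
subscheme, and a section of the base change of `Q_n` to a smooth `P_n`-scheme is an open immersion
(`IsNormalization.isOpenImmersion_section`). Hence every morphism to `Q_n` over `P_n` from an étale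
`P_n`-scheme is étale, and this remains true after a smooth base change
(`IsNormalization.etale_of_etale_comp`). There are three consequences.

* For a leg `[0, m] ⟶ [0, n]` of a cocartesian square, `P_n ⟶ P_m` is smooth, and `W_n` is étale over
  the base change of `Q_m` to `P_n`. By descent of étaleness along smooth morphisms
  (`mem_etaleLocus_of_smooth`), the image of `W_n` in `Q_m` lies in `W_m`. It is not known beforehand
  that `Q_m` is of finite type over `P_m`; this is a part of the descent statement.
* Conversely, on the fibre product over `P_n` of the base changes of `W_m` and `W_l`, the morphisms to
  `Q_m` and `Q_l` glue over `𝒱_n`, because `𝒱` is multiplicative, and the glued morphism extends to a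
  morphism to `Q_n`, because the fibre product is integrally closed in its open part
  (`IsNormalizedCover.exists_lift`). The extension is étale, so it takes values in `W_n`. It
  follows that `W ⟶ P` is multiplicative, and also that a point of `Q_n` lies in `W_n` if its images in
  `Q_m` and `Q_l` lie in `W_m` and `W_l` (`IsNormalizedCover.mem_etaleLocus_of_map`).
* By the last assertion, as `[0, n + 1]` is obtained from `[0, n]` by gluing an edge, a point of `Q_n`
  lies in `W_n` as soon as its images under all edges lie in `W_1`. An injective edge is a leg of a
  cocartesian square, and a constant edge factors through the degenerate simplex, whose image lies
  in `W_1` if the ramification is bounded. Hence `W` is an oversimplicial open subscheme of `Q`.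

Since `W ⟶ P` and `P` are multiplicative, so is `W`, and it is then the nerve of a groupoid
(`IsMultiplicative.definesGroupoid`).

**The oversimplicial scheme `P`.** In étale coordinates along a section, the dilatation of a smooth
scheme in the section divides the coordinates by the equation of the divisor, so it is smooth over the
base (`smooth_dilStr_ker_section`). Near each of its points, `P_n^{(D)}` is the dilatation with
respect to a single divisor `pr_j^* D`, hence smooth over `X`; `P_n^{(D,M)}` is the base change of
`P_0^{(D,M)}` to `P_n^{(D)}`; and `P_n^{(R,M)}` is again the dilatation of a smooth scheme in a section.
Flatness allows to compare the universal properties of the dilatations, which gives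
multiplicativity (`isMultiplicative_dilFunctor`). By the Jacobian criterion, local equations `t i` of
the components of `D` are the coordinates of a smooth morphism to an affine space. As `P_0^{(D,M)}` is
locally given by `t i * v i = s i ^ m i` with `v i` invertible, it is smooth over the affine space
with coordinates `s i` (`smooth_coordMap`), so it is locally Noetherian and integrally closed in the
complement of the divisors `s i = 0`, which is `U × 𝔾_m^ι`.

**The cover `𝒱`.** By Galois descent, `V^{n+1}` is the pull-back of the torsor `V` to the quotient
`V^{n+1}/ΔG` by each projection to `U` (`IsTorsor.isPullback_toSpec`). Therefore `V^{n+1}/ΔG` is étale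
and integral over `U^{n+1}`, it is equal to `U` for `n = 0`, and the multiplicativity of `V^{•+1}`
descends to `V^{•+1}/ΔG`.
-/

/-! ### Cocartesian squares of simplices -/
namespace OverSimplex

section Pushout
variable {m l n : OverSimplex} {a : .mk 0 ⟶ m} {b : .mk 0 ⟶ l} {c : m ⟶ n} {d : l ⟶ n}

lemma jointly_surjective (H : IsPushout a b c d) (z : Fin (n.len + 1)) :
    (∃ x, toMap c x = z) ∨ ∃ y, toMap d y = z := by
  by_contra! h
  let u : n ⟶ .mk 1 := fun w ↦ if w = z then 1 else 0
  let v : n ⟶ .mk 1 := fun _ ↦ 0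
  have e : u = v := by
    refine H.hom_ext (funext fun x ↦ if_neg (h.1 x)) (funext fun y ↦ if_neg (h.2 y))
  have := congrFun e z
  simp [u, v] at this

/-- Cocartesian squares in `OverSimplex` have the universal property of a pushout with respect to
all sets, not only the finite ones. -/
lemma exists_extension (H : IsPushout a b c d) {S : Type*} (s : Fin (m.len + 1) → S)
    (t : Fin (l.len + 1) → S) (hst : s (toMap a 0) = t (toMap b 0)) :
    ∃ u : Fin (n.len + 1) → S, (∀ x, u (toMap c x) = s x) ∧ ∀ y, u (toMap d y) = t y := by
  classical
  -- only the finite set of values of `s` and `t` matters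
  let F : Finset S := Finset.univ.image s ∪ Finset.univ.image t
  have hs (x) : s x ∈ F := by simp [F]
  have ht (x) : t x ∈ F := by simp [F]
  obtain ⟨N, hN⟩ : ∃ N, F.card = N + 1 :=
    Nat.exists_eq_succ_of_ne_zero (Finset.card_ne_zero_of_mem (hs 0))
  let ε : F ≃ Fin (N + 1) := F.equivFin.trans (finCongr hN)
  let s' : m ⟶ .mk N := fun x ↦ ε ⟨s x, hs x⟩
  let t' : l ⟶ .mk N := fun x ↦ ε ⟨t x, ht x⟩
  have hst' : a ≫ s' = b ≫ t' := by
    funext i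
    obtain rfl := Fin.fin_one_eq_zero i
    exact congrArg ε (Subtype.ext hst)
  refine ⟨fun z ↦ (ε.symm (toMap (H.desc s' t' hst') z)).1, fun x ↦ ?_, fun y ↦ ?_⟩
  · have := congrFun (H.inl_desc s' t' hst') x
    exact (congrArg (fun w ↦ (ε.symm w).1) this).trans (by simp [s'])
  · have := congrFun (H.inr_desc s' t' hst') y
    exact (congrArg (fun w ↦ (ε.symm w).1) this).trans (by simp [t'])

/-- A square of injective maps which cover their target and meet only in the base point is
cocartesian. -/
lemma isPushout_of_injective (w : toMap c (toMap a 0) = toMap d (toMap b 0))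
    (hc : Function.Injective (toMap c)) (hd : Function.Injective (toMap d))
    (hcd : ∀ x y, toMap c x = toMap d y → x = toMap a 0)
    (hs : ∀ z, (∃ x, toMap c x = z) ∨ ∃ y, toMap d y = z) : IsPushout a b c d := by
  classical
  have w' : a ≫ c = b ≫ d := by
    funext i
    obtain rfl := Fin.fin_one_eq_zero i
    exact w
  refine ⟨⟨w'⟩, ⟨PushoutCocone.IsColimit.mk w' (fun s ↦
    (fun z ↦ if h : ∃ x, toMap c x = z then toMap s.inl h.choose else
      if h' : ∃ y, toMap d y = z then toMap s.inr h'.choose else 0 : Fin (n.len + 1) → _))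
      ?_ ?_ ?_⟩⟩
  · intro s
    funext x
    have h : ∃ x', toMap c x' = toMap c x := ⟨x, rfl⟩
    exact (dif_pos h).trans (congrArg (toMap s.inl) (hc h.choose_spec))
  · intro s
    funext y
    by_cases h : ∃ x', toMap c x' = toMap d y
    · refine (dif_pos h).trans ?_
      have h1 := hcd _ _ h.choose_spec
      have h2 : y = toMap b 0 := hd (by rw [← h.choose_spec, h1, w])
      exact (congrArg (toMap s.inl) h1).trans
        ((congrFun s.condition 0).trans (congrArg (toMap s.inr) h2.symm))
    · have h' : ∃ y', toMap d y' = toMap d y := ⟨y, rfl⟩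
      exact (dif_neg h).trans ((dif_pos h').trans (congrArg (toMap s.inr) (hd h'.choose_spec)))
  · intro s q h1 h2
    funext z
    have h1' (x) : toMap q (toMap c x) = toMap s.inl x := congrFun h1 x
    have h2' (x) : toMap q (toMap d x) = toMap s.inr x := congrFun h2 x
    by_cases h : ∃ x', toMap c x' = z
    · refine Eq.trans ?_ (dif_pos h).symm
      rw [← h1', h.choose_spec]
      rfl
    · have h' := (hs z).resolve_left h
      refine Eq.trans ?_ ((dif_neg h).trans (dif_pos h')).symm
      rw [← h2', h'.choose_spec]
      rfl

/-- Every edge of `[0, m + 1]` is a summand of a decomposition of `[0, m + 1]` along a vertex. -/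
lemma exists_isPushout_edge {m : ℕ} (f : mk 1 ⟶ mk m) (hf : Function.Injective (toMap f)) :
    ∃ (l : OverSimplex) (a : mk 0 ⟶ mk 1) (b : mk 0 ⟶ l) (d : l ⟶ mk m),
      IsPushout a b f d := by
  have h01 : toMap f 0 ≠ toMap f 1 := fun h ↦ by simpa using hf h
  obtain ⟨m, rfl⟩ : ∃ k, m = k + 1 := by
    refine Nat.exists_eq_succ_of_ne_zero ?_
    rintro rfl
    exact h01 (Subsingleton.elim (α := Fin 1) _ _)
  obtain ⟨y, hy⟩ := Fin.exists_succAbove_eq (x := toMap f 0) (y := toMap f 1) h01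
  refine ⟨.mk m, fun _ ↦ (0 : Fin 2), fun _ ↦ y, fun z ↦ (toMap f 1).succAbove z,
    isPushout_of_injective hy.symm hf Fin.succAbove_right_injective ?_ ?_⟩
  · intro x y h
    change Fin 2 at x
    fin_cases x
    · rfl
    · exact absurd h.symm (Fin.succAbove_ne _ _)
  · intro z
    by_cases h : z = toMap f 1
    · exact .inl ⟨1, h.symm⟩
    · exact .inr (Fin.exists_succAbove_eq h)

/-- The simplex `[0, n + 1]` is obtained from `[0, n]` by gluing an edge at the vertex `0`. -/
lemma exists_isPushout_last (n : ℕ) :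
    ∃ (a : mk 0 ⟶ mk n) (b : mk 0 ⟶ mk 1) (c : mk n ⟶ mk (n + 1)) (d : mk 1 ⟶ mk (n + 1)),
      IsPushout a b c d := by
  refine ⟨fun _ ↦ (0 : Fin (n + 1)), fun _ ↦ (0 : Fin 2), fun x ↦ Fin.castSucc x,
    fun x ↦ ![0, Fin.last (n + 1)] x, isPushout_of_injective ?_ (Fin.castSucc_injective _) ?_ ?_ ?_⟩
  · rfl
  · intro x y h
    change Fin 2 at x y
    have h' : (![0, Fin.last (n + 1)] : Fin 2 → Fin (n + 2)) x =
      (![0, Fin.last (n + 1)] : Fin 2 → Fin (n + 2)) y := h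
    fin_cases x <;> fin_cases y <;> simp_all [Fin.ext_iff]
  · intro x y h
    change Fin 2 at y
    have h' : Fin.castSucc x = (![0, Fin.last (n + 1)] : Fin 2 → Fin (n + 2)) y := h
    fin_cases y
    · exact Fin.castSucc_injective _ h'
    · exact absurd h' (Fin.castSucc_lt_last x).ne
  · intro z
    induction z using Fin.lastCases with
    | last => exact .inr ⟨1, rfl⟩
    | cast i => exact .inl ⟨i, rfl⟩

end Pushout

end OverSimplex

/-! ### The groupoid of a multiplicative oversimplicial object -/
section Groupoid
open OverSimplex
variable {C : Type*} [Category* C] {P : OverSimplexᵒᵖ ⥤ C}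

lemma map_op_ofMap_comp {a b c : ℕ} (f : Fin (a + 1) → Fin (b + 1)) (g : Fin (b + 1) → Fin (c + 1))
    (h : Fin (a + 1) → Fin (c + 1)) (e : ∀ x, g (f x) = h x) :
    P.map (ofMap g).op ≫ P.map (ofMap f).op = P.map (ofMap h).op := by
  rw [← P.map_comp]
  exact congrArg (fun h ↦ P.map (Quiver.Hom.op (ofMap h))) (funext e)

lemma IsMultiplicative.isPullback_fstMap_sndMap (H : IsMultiplicative P) :
    IsPullback (fstMap P) (sndMap P) (tgtMap P) (srcMap P) :=
  H _ _ _ _ (isPushout_of_injective (by rfl) (by decide) (by decide) (by decide) (by decide))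

/-- `P_3` is the object of triples of composable arrows: it is used to check associativity. -/
lemma IsMultiplicative.isPullback_three (H : IsMultiplicative P) :
    IsPullback (P.map (ofMap (a := 1) (b := 3) ![0, 1]).op)
      (P.map (ofMap (a := 2) (b := 3) ![1, 2, 3]).op) (tgtMap P)
      (P.map (ofMap (a := 0) (b := 2) ![0]).op) :=
  H _ _ _ _ (isPushout_of_injective (by rfl) (by decide) (by decide) (by decide) (by decide))

/-- If the pair `(x, y)` of composable arrows comes from a `T`-point `w` of `P_2`, their composite is
the long edge of `w`. -/
lemma lift_inv_segalMap_compMap [HasPullbacks C] [IsIso (segalMap P)] {T : C}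
    (x y : T ⟶ P.obj (op (.mk 1))) (h : x ≫ tgtMap P = y ≫ srcMap P)
    (w : T ⟶ P.obj (op (.mk 2))) (h1 : w ≫ fstMap P = x) (h2 : w ≫ sndMap P = y) :
    pullback.lift x y h ≫ inv (segalMap P) ≫ compMap P = w ≫ compMap P := by
  have : pullback.lift x y h = w ≫ segalMap P := by
    apply pullback.hom_ext
    · rw [pullback.lift_fst, Category.assoc, segalMap, pullback.lift_fst, h1]
    · rw [pullback.lift_snd, Category.assoc, segalMap, pullback.lift_snd, h2]
  rw [this, Category.assoc, IsIso.hom_inv_id_assoc]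

/-- A multiplicative oversimplicial object is the nerve of a groupoid: compositions of two and of
three arrows are read off from `P_2` and `P_3`. -/
lemma IsMultiplicative.definesGroupoid [HasPullbacks C] (H : IsMultiplicative P) :
    DefinesGroupoid P := by
  have iso : IsIso (segalMap P) := by
    have : segalMap P = H.isPullback_fstMap_sndMap.isoPullback.hom := by
      apply pullback.hom_ext
      · rw [segalMap, pullback.lift_fst, IsPullback.isoPullback_hom_fst]
      · rw [segalMap, pullback.lift_snd, IsPullback.isoPullback_hom_snd]
    rw [this]
    infer_instance
  refine ⟨iso, ?_⟩
  have hμs : compMap P ≫ srcMap P = fstMap P ≫ srcMap P :=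
    (map_op_ofMap_comp _ _ ![0] (by decide)).trans (map_op_ofMap_comp _ _ ![0] (by decide)).symm
  have hμt : compMap P ≫ tgtMap P = sndMap P ≫ tgtMap P :=
    (map_op_ofMap_comp _ _ ![2] (by decide)).trans (map_op_ofMap_comp _ _ ![2] (by decide)).symm
  have hf : segalMap P ≫ pullback.fst _ _ = fstMap P := pullback.lift_fst _ _ _
  have hs : segalMap P ≫ pullback.snd _ _ = sndMap P := pullback.lift_snd _ _ _
  have hid : P.map (ofMap (a := 1) (b := 1) ![0, 1]).op = 𝟙 _ := by
    have : ofMap (a := 1) (b := 1) ![0, 1] = 𝟙 _ := funext (by decide)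
    rw [this]
    exact P.map_id _
  refine
    { e_s := ?_, e_t := ?_, mul_s := ?_, mul_t := ?_, inv_s := ?_, inv_t := ?_, assoc := ?_,
      one_mul := ?_, mul_one := ?_, mul_inv := ?_, inv_mul := ?_ }
  · refine (map_op_ofMap_comp _ _ ![0] (by decide)).trans ?_
    have : ofMap (a := 0) (b := 0) ![0] = 𝟙 _ := funext (by decide)
    rw [this]
    exact P.map_id _
  · refine (map_op_ofMap_comp _ _ ![0] (by decide)).trans ?_
    have : ofMap (a := 0) (b := 0) ![0] = 𝟙 _ := funext (by decide)
    rw [this]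
    exact P.map_id _
  · rw [Category.assoc, hμs, ← hf, Category.assoc, IsIso.inv_hom_id_assoc]
  · rw [Category.assoc, hμt, ← hs, Category.assoc, IsIso.inv_hom_id_assoc]
  · exact map_op_ofMap_comp _ _ ![1] (by decide)
  · exact map_op_ofMap_comp _ _ ![0] (by decide)
  · intro T x y z hxy hyz
    obtain ⟨w, hw1, hw2⟩ : ∃ w : T ⟶ P.obj (op (.mk 2)), w ≫ fstMap P = y ∧ w ≫ sndMap P = z :=
      ⟨_, H.isPullback_fstMap_sndMap.lift_fst y z hyz, H.isPullback_fstMap_sndMap.lift_snd y z hyz⟩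
    have hxw : x ≫ tgtMap P = w ≫ P.map (ofMap (a := 0) (b := 2) ![0]).op := by
      rw [hxy, ← hw1, Category.assoc]
      exact congrArg (w ≫ ·) (map_op_ofMap_comp _ _ ![0] (by decide))
    obtain ⟨v, hv1, hv2⟩ : ∃ v : T ⟶ P.obj (op (.mk 3)),
        v ≫ P.map (ofMap (a := 1) (b := 3) ![0, 1]).op = x ∧
        v ≫ P.map (ofMap (a := 2) (b := 3) ![1, 2, 3]).op = w :=
      ⟨_, H.isPullback_three.lift_fst x w hxw, H.isPullback_three.lift_snd x w hxw⟩
    have hv12 : v ≫ P.map (ofMap (a := 1) (b := 3) ![1, 2]).op = y := by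
      rw [← hw1, ← hv2, Category.assoc]
      exact congrArg (v ≫ ·) (map_op_ofMap_comp _ _ _ (by decide)).symm
    have hv23 : v ≫ P.map (ofMap (a := 1) (b := 3) ![2, 3]).op = z := by
      rw [← hw2, ← hv2, Category.assoc]
      exact congrArg (v ≫ ·) (map_op_ofMap_comp _ _ _ (by decide)).symm
    have hxy' := lift_inv_segalMap_compMap x y hxy
      (v ≫ P.map (ofMap (a := 2) (b := 3) ![0, 1, 2]).op)
      (by rw [← hv1, Category.assoc]
          exact congrArg (v ≫ ·) (map_op_ofMap_comp _ _ _ (by decide)))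
      (by rw [← hv12, Category.assoc]
          exact congrArg (v ≫ ·) (map_op_ofMap_comp _ _ _ (by decide)))
    have hyz' := lift_inv_segalMap_compMap y z hyz w hw1 hw2
    rw [lift_inv_segalMap_compMap _ _ _
        (v ≫ P.map (ofMap (a := 2) (b := 3) ![0, 2, 3]).op) _ _,
      lift_inv_segalMap_compMap _ _ _
        (v ≫ P.map (ofMap (a := 2) (b := 3) ![0, 1, 3]).op) _ _, Category.assoc, Category.assoc]
    · exact congrArg (v ≫ ·) ((map_op_ofMap_comp _ _ ![0, 3] (by decide)).trans
        (map_op_ofMap_comp _ _ _ (by decide)).symm)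
    · rw [← hv1, Category.assoc]
      exact congrArg (v ≫ ·) (map_op_ofMap_comp _ _ _ (by decide))
    · rw [hyz', ← hv2, Category.assoc, Category.assoc]
      exact congrArg (v ≫ ·) ((map_op_ofMap_comp _ _ ![1, 3] (by decide)).trans
        (map_op_ofMap_comp _ _ _ (by decide)).symm)
    · rw [hxy', Category.assoc, Category.assoc]
      exact congrArg (v ≫ ·) ((map_op_ofMap_comp _ _ ![0, 2] (by decide)).trans
        (map_op_ofMap_comp _ _ _ (by decide)).symm)
    · rw [← hv23, Category.assoc]
      exact congrArg (v ≫ ·) (map_op_ofMap_comp _ _ _ (by decide))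
  · rw [lift_inv_segalMap_compMap _ _ _ (P.map (ofMap (a := 2) (b := 1) ![0, 0, 1]).op)]
    · exact (map_op_ofMap_comp _ _ ![0, 1] (by decide)).trans hid
    · exact (map_op_ofMap_comp _ _ ![0, 0] (by decide)).trans
        (map_op_ofMap_comp _ _ _ (by decide)).symm
    · exact (map_op_ofMap_comp _ _ ![0, 1] (by decide)).trans hid
  · rw [lift_inv_segalMap_compMap _ _ _ (P.map (ofMap (a := 2) (b := 1) ![0, 1, 1]).op)]
    · exact (map_op_ofMap_comp _ _ ![0, 1] (by decide)).trans hid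
    · exact (map_op_ofMap_comp _ _ ![0, 1] (by decide)).trans hid
    · exact (map_op_ofMap_comp _ _ ![1, 1] (by decide)).trans
        (map_op_ofMap_comp _ _ _ (by decide)).symm
  · rw [lift_inv_segalMap_compMap _ _ _ (P.map (ofMap (a := 2) (b := 1) ![0, 1, 0]).op)]
    · exact (map_op_ofMap_comp _ _ ![0, 0] (by decide)).trans
        (map_op_ofMap_comp _ _ _ (by decide)).symm
    · exact (map_op_ofMap_comp _ _ ![0, 1] (by decide)).trans hid
    · exact map_op_ofMap_comp _ _ ![1, 0] (by decide)
  · rw [lift_inv_segalMap_compMap _ _ _ (P.map (ofMap (a := 2) (b := 1) ![1, 0, 1]).op)]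
    · exact (map_op_ofMap_comp _ _ ![1, 1] (by decide)).trans
        (map_op_ofMap_comp _ _ _ (by decide)).symm
    · exact map_op_ofMap_comp _ _ ![1, 0] (by decide)
    · exact (map_op_ofMap_comp _ _ ![0, 1] (by decide)).trans hid

end Groupoid

/-! ### Descent of étaleness along smooth morphisms -/
section SourceDescent
open TensorProduct

/-- A morphism inherits a property from its composite with a monomorphism, being the base change of
the composite along it. -/
lemma CategoryTheory.MorphismProperty.of_comp_mono {C : Type*} [Category* C]
    (P : MorphismProperty C) [P.IsStableUnderBaseChange] {X Y Z : C} (f : X ⟶ Y) (g : Y ⟶ Z)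
    [Mono g] (h : P (f ≫ g)) : P f := by
  have H : IsPullback (𝟙 X) f (f ≫ g) g :=
    ⟨⟨by simp⟩, ⟨PullbackCone.IsLimit.mk _ (fun s ↦ s.fst) (fun s ↦ by simp)
      (fun s ↦ by rw [← cancel_mono g, Category.assoc, s.condition]) fun s m h1 _ ↦ by
        rw [← h1, Category.comp_id]⟩⟩
  exact P.of_isPullback H h

/-- Flatness over `R` descends along faithfully flat extensions `S ⟶ C`. -/
lemma Module.Flat.of_faithfullyFlat_of_flat (R S C : Type*) [CommRing R] [CommRing S] [CommRing C]
    [Algebra R S] [Algebra S C] [Algebra R C] [IsScalarTower R S C] [Module.FaithfullyFlat S C]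
    [Module.Flat R C] : Module.Flat R S := by
  refine Module.Flat.iff_lTensor_preserves_injective_linearMap.mpr fun M N _ _ _ _ f hf ↦ ?_
  have h : Function.Injective (f.lTensor C) :=
    Module.Flat.lTensor_preserves_injective_linearMap f hf
  let φ : S ⊗[R] M →ₗ[S] S ⊗[R] N := TensorProduct.AlgebraTensorModule.lTensor S S f
  have key : Function.Injective (φ.lTensor C) := by
    have e : (AlgebraTensorModule.cancelBaseChange R S S C N).toLinearMap ∘ₗ φ.lTensor C =
        (AlgebraTensorModule.lTensor S C f) ∘ₗ
          (AlgebraTensorModule.cancelBaseChange R S S C M).toLinearMap := by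
      ext
      simp [φ]
    have := congrArg (DFunLike.coe) e
    rw [LinearMap.coe_comp, LinearMap.coe_comp] at this
    refine Function.Injective.of_comp
      (f := (AlgebraTensorModule.cancelBaseChange R S S C N).toLinearMap) ?_
    rw [this]
    exact h.comp (AlgebraTensorModule.cancelBaseChange R S S C M).injective
  exact (Module.FaithfullyFlat.lTensor_injective_iff_injective S C φ).mp key

/-- If `C` is smooth over `S` and of finite type over `R`, the algebra `C` already exists over a finitely
generated `R`-subalgebra `S₁` of `S`, with the same underlying ring: one chooses a smooth model `C₁`
over a finitely generated subalgebra and enlarges it by the coefficients of the generators of `C`. -/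
lemma exists_subalgebra_fg_bijective (R S C : Type u) [CommRing R] [CommRing S] [CommRing C]
    [Algebra R S] [Algebra S C] [Algebra R C] [IsScalarTower R S C] [Algebra.Smooth S C]
    [Algebra.FiniteType R C] :
    ∃ (S₁ : Subalgebra R S) (C₁ : Type u) (_ : CommRing C₁) (_ : Algebra S₁ C₁), S₁.FG ∧
      Algebra.Smooth S₁ C₁ ∧
      Function.Bijective (Algebra.TensorProduct.includeRight : C₁ →ₐ[S₁] S ⊗[S₁] C₁) ∧
      Nonempty (C ≃ₐ[S] S ⊗[S₁] C₁) := by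
  classical
  obtain ⟨S₀, C₀, _, _, hS₀, _, ⟨ε⟩⟩ := Algebra.Smooth.exists_subalgebra_fg R S C
  obtain ⟨F, hF⟩ := Algebra.FiniteType.out (R := R) (A := C)
  have hfin (z : S ⊗[S₀] C₀) : ∃ A : Finset S, ∀ S' : Subalgebra R S, (A : Set S) ⊆ S' →
      z ∈ Submodule.span S₀ {w | ∃ s ∈ S', ∃ c : C₀, s ⊗ₜ c = w} := by
    induction z with
    | zero => exact ⟨∅, fun _ _ ↦ zero_mem _⟩
    | tmul s c =>
      exact ⟨{s}, fun S' h ↦ Submodule.subset_span ⟨s, h (by simp), c, rfl⟩⟩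
    | add x y hx hy =>
      obtain ⟨A, hA⟩ := hx
      obtain ⟨B, hB⟩ := hy
      refine ⟨A ∪ B, fun S' h ↦ ?_⟩
      rw [Finset.coe_union, Set.union_subset_iff] at h
      exact add_mem (hA S' h.1) (hB S' h.2)
  -- `A z` is a finite set of coefficients from `S` needed to write `z` as a sum of tensors
  choose A hA using hfin
  let S₁ : Subalgebra R S := S₀ ⊔ Algebra.adjoin R (↑(F.biUnion fun c ↦ A (ε c)) : Set S)
  have h01 : S₀ ≤ S₁ := le_sup_left
  let _ : Algebra S₀ S₁ := (Subalgebra.inclusion h01).toAlgebra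
  have : IsScalarTower S₀ S₁ S := .of_algebraMap_eq fun _ ↦ rfl
  have : IsScalarTower R S₀ S₁ := .of_algebraMap_eq fun _ ↦ rfl
  let C₁ := S₁ ⊗[S₀] C₀
  let θ : S ⊗[S₁] C₁ ≃ₐ[S] S ⊗[S₀] C₀ := Algebra.TensorProduct.cancelBaseChange S₀ S₁ S S C₀
  refine ⟨S₁, C₁, inferInstance, inferInstance, hS₀.sup ⟨_, rfl⟩, inferInstance, ⟨?_, ?_⟩,
    ⟨ε.trans θ.symm⟩⟩
  · exact Algebra.TensorProduct.includeRight_injective (by exact Subtype.val_injective)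
  · let ψ : C₁ →+* S ⊗[S₀] C₀ := (θ : S ⊗[S₁] C₁ →+* S ⊗[S₀] C₀).comp
      (Algebra.TensorProduct.includeRight : C₁ →ₐ[S₁] S ⊗[S₁] C₁).toRingHom
    have hψ (s : S₁) (c : C₀) : ψ (s ⊗ₜ c) = (s : S) ⊗ₜ c := by
      simp [ψ, θ, Algebra.smul_def, C₁]
    have hψ' : Function.Surjective ψ := by
      let ψR : C₁ →ₐ[R] S ⊗[S₀] C₀ := { ψ with
        commutes' r := by
          have : algebraMap R C₁ r = (algebraMap R S₁ r) ⊗ₜ (1 : C₀) := rfl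
          change ψ _ = _
          rw [this, hψ]
          rfl }
      have key : (⊤ : Subalgebra R C) ≤ ψR.range.comap (ε.toAlgHom.restrictScalars R) := by
        rw [← hF, Algebra.adjoin_le_iff]
        intro c hc
        have h1 := hA (ε c) S₁ (((Finset.coe_subset.mpr
          (Finset.subset_biUnion_of_mem (fun c ↦ A (ε c)) hc)).trans
            Algebra.subset_adjoin).trans (SetLike.coe_subset_coe.mpr le_sup_right))
        change ε c ∈ ψR.range
        have h2 : ∀ w ∈ Submodule.span S₀ {w | ∃ s ∈ S₁, ∃ c : C₀, s ⊗ₜ c = w},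
            w ∈ ψR.range := by
          intro w hw
          induction hw using Submodule.span_induction with
          | mem w hw =>
            obtain ⟨s, hs, c, rfl⟩ := hw
            exact ⟨(⟨s, hs⟩ : S₁) ⊗ₜ c, hψ ⟨s, hs⟩ c⟩
          | zero => exact zero_mem _
          | add x y _ _ hx hy => exact add_mem hx hy
          | smul a x _ hx =>
            obtain ⟨y, rfl⟩ := hx
            refine ⟨(algebraMap S₀ S₁ a ⊗ₜ 1) * y, ?_⟩
            exact (map_mul ψ _ _).trans ((congrArg (· * ψ y) (hψ _ _)).trans
              (Algebra.smul_def (A := S ⊗[S₀] C₀) a (ψ y)).symm)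
        exact h2 _ h1
      intro z
      obtain ⟨y, hy⟩ := key (x := ε.symm z) trivial
      exact ⟨y, hy.trans (ε.apply_symm_apply z)⟩
    intro z
    obtain ⟨y, hy⟩ := hψ' (θ z)
    exact ⟨y, θ.injective hy⟩

/-- A morphism which becomes an isomorphism after a flat base change locally of finite presentation is
an open immersion, as soon as its image lies in the image of the morphism along which the base is
changed. -/
lemma isOpenImmersion_of_isIso_snd {Y Z T E : Scheme.{u}} {j : Y ⟶ Z} {h : T ⟶ Z} {a : E ⟶ Y}
    {b : E ⟶ T} (H : IsPullback a b j h) [Flat h] [LocallyOfFinitePresentation h] [IsIso b]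
    [Surjective a] : IsOpenImmersion j := by
  let O : Z.Opens := ⟨Set.range h, h.isOpenMap.isOpen_range⟩
  have hj : Set.range j ⊆ O := by
    rintro _ ⟨y, rfl⟩
    obtain ⟨e, rfl⟩ := a.surjective y
    exact ⟨b e, by rw [← Scheme.Hom.comp_apply, ← H.w, Scheme.Hom.comp_apply]⟩
  let j' : Y ⟶ O := IsOpenImmersion.lift O.ι j (by simpa using hj)
  let h' : T ⟶ O := IsOpenImmersion.lift O.ι h (by simp [O])
  have ej : j' ≫ O.ι = j := IsOpenImmersion.lift_fac _ _ _
  have eh : h' ≫ O.ι = h := IsOpenImmersion.lift_fac _ _ _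
  have H' : IsPullback a b j' h' := by
    refine ⟨⟨by rw [← cancel_mono O.ι, Category.assoc, Category.assoc, ej, eh, H.w]⟩,
      ⟨PullbackCone.IsLimit.mk _ (fun s ↦ H.lift s.fst s.snd (by
        rw [← ej, ← eh, reassoc_of% s.condition])) (fun s ↦ H.lift_fst _ _ _)
        (fun s ↦ H.lift_snd _ _ _) fun s m h1 h2 ↦ H.hom_ext ?_ ?_⟩⟩
    · rw [h1, H.lift_fst]
    · rw [h2, H.lift_snd]
  have : Flat h' := MorphismProperty.of_comp_mono @Flat h' O.ι (by rwa [eh])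
  have : LocallyOfFinitePresentation h' :=
    MorphismProperty.of_comp_mono @LocallyOfFinitePresentation h' O.ι (by rwa [eh])
  have : Surjective h' := by
    refine ⟨fun ⟨x, t, ht⟩ ↦ ⟨t, O.ι.isOpenEmbedding.injective ?_⟩⟩
    rw [← Scheme.Hom.comp_apply, eh]
    exact ht
  have : IsIso j' := by
    have := MorphismProperty.of_isPullback_of_descendsAlong
      (P := MorphismProperty.isomorphisms Scheme.{u})
      (Q := @Surjective ⊓ @Flat ⊓ @LocallyOfFinitePresentation) H'.flip
      ⟨⟨‹_›, ‹_›⟩, ‹_›⟩ (by simpa using ‹IsIso b›)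
    simpa using this
  rw [← ej]
  infer_instance

/-- If `S ⟶ C` is smooth and faithfully flat and `C` is of finite type over `R`, then so is `S`:
`Spec S` is an open subscheme of the spectrum of a finitely generated subalgebra. -/
lemma Algebra.FiniteType.of_smooth_of_faithfullyFlat (R S C : Type u) [CommRing R] [CommRing S]
    [CommRing C] [Algebra R S] [Algebra S C] [Algebra R C] [IsScalarTower R S C]
    [Algebra.Smooth S C] [Module.FaithfullyFlat S C] [Algebra.FiniteType R C] :
    Algebra.FiniteType R S := by
  obtain ⟨S₁, C₁, _, _, hS₁, _, hbij, ⟨ε⟩⟩ := exists_subalgebra_fg_bijective R S C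
  have : Module.FaithfullyFlat S (S ⊗[S₁] C₁) :=
    Module.FaithfullyFlat.of_linearEquiv S C ε.symm.toLinearEquiv
  let j : CommRingCat.of S₁ ⟶ CommRingCat.of S := CommRingCat.ofHom (algebraMap S₁ S)
  have H := isPullback_SpecMap_of_isPushout _ _ _ _ (CommRingCat.isPushout_tensorProduct S₁ S C₁)
  have h1 : (CommRingCat.ofHom (algebraMap S₁ C₁)).hom.Smooth := by
    rw [CommRingCat.hom_ofHom, RingHom.smooth_algebraMap]
    infer_instance
  have : AlgebraicGeometry.Smooth (Spec.map (CommRingCat.ofHom (algebraMap S₁ C₁))) :=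
    (HasRingHomProperty.Spec_iff (P := @AlgebraicGeometry.Smooth)).mpr h1
  have : IsIso (Spec.map (CommRingCat.ofHom
      (Algebra.TensorProduct.includeRight : C₁ →ₐ[S₁] S ⊗[S₁] C₁).toRingHom)) := by
    have := (ConcreteCategory.isIso_iff_bijective (CommRingCat.ofHom
      (Algebra.TensorProduct.includeRight : C₁ →ₐ[S₁] S ⊗[S₁] C₁).toRingHom)).mpr hbij
    infer_instance
  have h2 : (CommRingCat.ofHom (Algebra.TensorProduct.includeLeftRingHom :
      S →+* S ⊗[S₁] C₁)).hom.FaithfullyFlat := by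
    rw [CommRingCat.hom_ofHom]
    exact RingHom.faithfullyFlat_algebraMap_iff.mpr ‹_›
  have := ((flat_and_surjective_SpecMap_iff _).mpr h2).2
  have := isOpenImmersion_of_isIso_snd H
  have h3 : RingHom.FiniteType (algebraMap S₁ S) :=
    (HasRingHomProperty.Spec_iff (P := @LocallyOfFiniteType) (φ := j)).mp inferInstance
  have : Algebra.FiniteType S₁ S := (RingHom.finiteType_algebraMap).mp h3
  have : Algebra.FiniteType R S₁ := S₁.fg_iff_finiteType.mp hS₁
  exact Algebra.FiniteType.trans (S := S₁) ‹_› ‹_›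

/-- The module of differentials of `S` over `R` vanishes if this holds after a base change to `T`
and a formally étale covering by `C`. -/
lemma Algebra.FormallyUnramified.of_formallyEtale_tensorProduct (R S T C : Type u) [CommRing R]
    [CommRing S] [CommRing T] [CommRing C] [Algebra R S] [Algebra R T] [Algebra S C] [Algebra T C]
    [Algebra R C] [IsScalarTower R S C] [IsScalarTower R T C] [Module.FaithfullyFlat S C]
    [Algebra.FormallyUnramified T C] (E : Type u) [CommRing E] [Algebra R E] [Algebra S E]
    [Algebra T E] [IsScalarTower R S E] [IsScalarTower R T E] [Algebra.IsPushout R T S E]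
    [Algebra E C] [IsScalarTower T E C] [IsScalarTower S E C] [Algebra.FormallyEtale E C] :
    Algebra.FormallyUnramified R S := by
  rw [Algebra.formallyUnramified_iff]
  have h1 : Subsingleton (C ⊗[E] Ω[E⁄T]) :=
    (KaehlerDifferential.tensorKaehlerEquivOfFormallyEtale T E C).toEquiv.subsingleton
  have h2 : Subsingleton (C ⊗[E] (E ⊗[S] Ω[S⁄R])) :=
    (LinearEquiv.lTensor C (KaehlerDifferential.tensorKaehlerEquiv R T S E)).toEquiv.subsingleton
  have h3 : Subsingleton (C ⊗[S] Ω[S⁄R]) :=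
    (AlgebraTensorModule.cancelBaseChange S E E C Ω[S⁄R]).symm.toEquiv.subsingleton
  exact (Module.FaithfullyFlat.subsingleton_tensorProduct_iff_right S C).mp h3

end SourceDescent

section SourceDescent
open TensorProduct

/-- Étaleness of `R ⟶ S` over a Noetherian ring `R` can be tested after base change along `R ⟶ T`, on an
étale algebra `C` over the base change `E` which is étale over `T` and a smooth covering of `S`. That
`S` is of finite type over `R` is part of the conclusion. -/
lemma CommRingCat.etale_of_isPushout {R S T E C : CommRingCat.{u}} {φ : R ⟶ S} {π : R ⟶ T}
    {i : T ⟶ E} {j : S ⟶ E} (H : IsPushout π φ i j) (w : E ⟶ C) [IsNoetherianRing R]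
    (hw : w.hom.Etale) (h1 : (i ≫ w).hom.Etale) (h2 : (j ≫ w).hom.Smooth)
    (h3 : (j ≫ w).hom.FaithfullyFlat) (hf : (π ≫ i ≫ w).hom.Flat)
    (hft : (π ≫ i ≫ w).hom.FiniteType) : φ.hom.Etale := by
  let _ := φ.hom.toAlgebra
  let _ := π.hom.toAlgebra
  let _ := i.hom.toAlgebra
  let _ := j.hom.toAlgebra
  let _ := w.hom.toAlgebra
  let _ := (i ≫ w).hom.toAlgebra
  let _ := (j ≫ w).hom.toAlgebra
  let _ := (π ≫ i ≫ w).hom.toAlgebra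
  let _ := (π ≫ i).hom.toAlgebra
  have : IsScalarTower R T E := .of_algebraMap_eq fun _ ↦ rfl
  have : IsScalarTower R S E := .of_algebraMap_eq' congr($(H.w).hom)
  have : IsScalarTower R S C := .of_algebraMap_eq' <| by
    change (π ≫ i ≫ w).hom = (φ ≫ j ≫ w).hom
    rw [← Category.assoc, H.w, Category.assoc]
  have : IsScalarTower R T C := .of_algebraMap_eq' rfl
  have : IsScalarTower T E C := .of_algebraMap_eq' rfl
  have : IsScalarTower S E C := .of_algebraMap_eq' rfl
  have : Algebra.IsPushout R T S E := CommRingCat.isPushout_iff_isPushout.mp H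
  have : Algebra.Etale E C := RingHom.etale_algebraMap.mp hw
  have : Algebra.Etale T C := RingHom.etale_algebraMap.mp h1
  have : Algebra.Smooth S C := RingHom.smooth_algebraMap.mp h2
  have : Module.FaithfullyFlat S C := RingHom.faithfullyFlat_algebraMap_iff.mp h3
  have : Module.Flat R C := RingHom.flat_algebraMap_iff.mp hf
  have : Algebra.FiniteType R C := RingHom.finiteType_algebraMap.mp hft
  have : Algebra.FiniteType R S := .of_smooth_of_faithfullyFlat R S C
  have : Algebra.FinitePresentation R S := Algebra.FinitePresentation.of_finiteType.mp ‹_›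
  have : Algebra.FormallyUnramified R S := .of_formallyEtale_tensorProduct R S T C E
  have : Module.Flat R S := .of_faithfullyFlat_of_flat R S C
  refine RingHom.Etale.iff_flat_and_formallyUnramified.mpr
    ⟨RingHom.flat_algebraMap_iff.mpr ‹_›, RingHom.formallyUnramified_algebraMap.mpr ‹_›,
      (RingHom.finitePresentation_algebraMap).mpr ‹_›⟩

lemma etale_of_isPullback_of_isAffine {P Q P' E W : Scheme.{u}} [IsAffine P] [IsAffine Q]
    [IsAffine P'] [IsAffine W] [IsLocallyNoetherian P] {q : Q ⟶ P} {π : P' ⟶ P} {i : E ⟶ P'}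
    {j : E ⟶ Q} (H : IsPullback i j π q) (w : W ⟶ E) [Etale w] [Etale (w ≫ i)] [Smooth (w ≫ j)]
    [Surjective (w ≫ j)] [Smooth π] : Etale q := by
  have : IsAffine E := .of_isIso H.isoPullback.hom
  have : IsNoetherianRing Γ(P, ⊤) := IsLocallyNoetherian.component_noetherian ⟨⊤, isAffineOpen_top P⟩
  rw [HasRingHomProperty.iff_of_isAffine (P := @Etale)]
  have : Smooth ((w ≫ i) ≫ π) := inferInstance
  refine CommRingCat.etale_of_isPushout (isPushout_appTop_of_isPullback H) w.appTop ?_ ?_ ?_ ?_ ?_ ?_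
  · exact (HasRingHomProperty.iff_of_isAffine (P := @Etale)).mp inferInstance
  · exact (HasRingHomProperty.iff_of_isAffine (P := @Etale) (f := w ≫ i)).mp inferInstance
  · exact (HasRingHomProperty.iff_of_isAffine (P := @Smooth) (f := w ≫ j)).mp inferInstance
  · exact (Flat.flat_and_surjective_iff_faithfullyFlat_of_isAffine (w ≫ j)).mp
      ⟨inferInstance, inferInstance⟩
  · exact (HasRingHomProperty.iff_of_isAffine (P := @Flat) (f := (w ≫ i) ≫ π)).mp inferInstance
  · exact (HasRingHomProperty.iff_of_isAffine (P := @LocallyOfFiniteType)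
      (f := (w ≫ i) ≫ π)).mp inferInstance

lemma le_etaleLocus {Q P : Scheme.{u}} {g : Q ⟶ P} {O : Q.Opens} (h : Etale (O.ι ≫ g)) :
    O ≤ etaleLocus g := le_sSup h

/-- Étaleness of `q` over a locally Noetherian scheme can be tested after a smooth base change `π`,
without any finiteness assumption on `q`. -/
lemma mem_etaleLocus_of_smooth {P Q P' W : Scheme.{u}} [IsLocallyNoetherian P] (q : Q ⟶ P)
    (π : P' ⟶ P) [Smooth π] (w : W ⟶ pullback π q) [Etale w] [Etale (w ≫ pullback.fst π q)]
    (x : W) : (w ≫ pullback.snd π q) x ∈ etaleLocus q := by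
  set w₁ := w ≫ pullback.snd π q with hw₁
  set w₂ := w ≫ pullback.fst π q with hw₂
  have hw : w₂ ≫ π = w₁ ≫ q := by simp [w₁, w₂, pullback.condition]
  have sm : Smooth w₁ := inferInstance
  obtain ⟨R, hR, hxR, -⟩ := exists_isAffineOpen_mem_and_subset (X := P) (x := q (w₁ x)) (U := ⊤)
    trivial
  obtain ⟨S, hS, hxS, hSR⟩ := exists_isAffineOpen_mem_and_subset (X := Q) (x := w₁ x)
    (U := q ⁻¹ᵁ R) hxR
  obtain ⟨T, hT, hxT, hTR⟩ := exists_isAffineOpen_mem_and_subset (X := P') (x := w₂ x)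
    (U := π ⁻¹ᵁ R) (by
      change π (w₂ x) ∈ R
      rwa [← Scheme.Hom.comp_apply, hw])
  obtain ⟨C, hC, hxC, hCST⟩ := exists_isAffineOpen_mem_and_subset (X := W) (x := x)
    (U := w₁ ⁻¹ᵁ S ⊓ w₂ ⁻¹ᵁ T) ⟨hxS, hxT⟩
  have hCS : C ≤ w₁ ⁻¹ᵁ S := fun y hy ↦ (hCST hy).1
  -- shrink `S` to a basic open subset in the image of `C`, and `C` to its preimage, so that
  -- `C` covers `S`
  let I : Q.Opens := ⟨w₁ '' C, w₁.isOpenMap _ C.2⟩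
  obtain ⟨g, hgI, hxg⟩ := hS.exists_basicOpen_le (V := I) ⟨w₁ x, x, hxC, rfl⟩ hxS
  let S' := Q.basicOpen g
  let C' := W.basicOpen (w₁.appLE S C hCS g)
  have hC' : (C' : Set W) = (C : Set W) ∩ w₁ ⁻¹' (S' : Set Q) := by
    have := Scheme.Hom.preimage_basicOpen w₁ g
    simp only [C', Scheme.Hom.appLE, CommRingCat.comp_apply, Scheme.basicOpen_res]
    rw [← this]
    rfl
  have hS' : IsAffineOpen S' := hS.basicOpen g
  have hC'' : IsAffineOpen C' := hC.basicOpen _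
  have hC'S' : C' ≤ w₁ ⁻¹ᵁ S' := fun y hy ↦ (hC'.le hy).2
  have hC'T : C' ≤ w₂ ⁻¹ᵁ T := fun y hy ↦ (hCST (hC'.le hy).1).2
  have hS'R : S' ≤ q ⁻¹ᵁ R := (Q.basicOpen_le g).trans hSR
  have : IsAffine R := hR
  have : IsAffine S' := hS'
  have : IsAffine T := hT
  have : IsAffine C' := hC''
  let q' : S'.toScheme ⟶ R := q.resLE R S' hS'R
  let π' : T.toScheme ⟶ R := π.resLE R T hTR
  have eq : q' ≫ R.ι = S'.ι ≫ q := Scheme.Hom.resLE_comp_ι _ _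
  have eπ : π' ≫ R.ι = T.ι ≫ π := Scheme.Hom.resLE_comp_ι _ _
  have hcond : w₂.resLE T C' hC'T ≫ π' = w₁.resLE S' C' hC'S' ≫ q' := by
    rw [← cancel_mono R.ι, Category.assoc, Category.assoc, eπ, eq, Scheme.Hom.resLE_comp_ι_assoc,
      Scheme.Hom.resLE_comp_ι_assoc, hw]
  let w' : C'.toScheme ⟶ pullback π' q' := pullback.lift (w₂.resLE T C' hC'T)
    (w₁.resLE S' C' hC'S') hcond
  let κ : pullback π' q' ⟶ pullback π q := pullback.map _ _ _ _ T.ι S'.ι R.ι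
    (Scheme.Hom.resLE_comp_ι _ _) (Scheme.Hom.resLE_comp_ι _ _)
  have e1 : w' ≫ pullback.fst π' q' = w₂.resLE T C' hC'T := pullback.lift_fst _ _ _
  have e2 : w' ≫ pullback.snd π' q' = w₁.resLE S' C' hC'S' := pullback.lift_snd _ _ _
  have : IsOpenImmersion κ := Scheme.pullback_map_isOpenImmersion ..
  have h1 : Etale (w' ≫ κ) := by
    have : w' ≫ κ = C'.ι ≫ w := by
      apply pullback.hom_ext
      · have : κ ≫ pullback.fst π q = pullback.fst π' q' ≫ T.ι := pullback.lift_fst _ _ _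
        rw [Category.assoc, this, reassoc_of% e1, Scheme.Hom.resLE_comp_ι, Category.assoc]
      · have : κ ≫ pullback.snd π q = pullback.snd π' q' ≫ S'.ι := pullback.lift_snd _ _ _
        rw [Category.assoc, this, reassoc_of% e2, Scheme.Hom.resLE_comp_ι, Category.assoc]
    rw [this]
    infer_instance
  have : Etale w' := Etale.of_comp w' κ
  have : Etale (w' ≫ pullback.fst π' q') := by rw [e1]; infer_instance
  have : Smooth (w' ≫ pullback.snd π' q') := by rw [e2]; infer_instance
  have : Surjective (w' ≫ pullback.snd π' q') := by
    rw [e2]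
    refine ⟨fun ⟨y, hy⟩ ↦ ?_⟩
    obtain ⟨z, hz, rfl⟩ := hgI hy
    refine ⟨⟨z, hC'.symm.le ⟨hz, hy⟩⟩, S'.ι.isOpenEmbedding.injective ?_⟩
    exact congr($(Scheme.Hom.resLE_comp_ι w₁ hC'S') ⟨z, hC'.symm.le ⟨hz, hy⟩⟩)
  have : Smooth (π' ≫ R.ι) := by rw [eπ]; infer_instance
  have : Smooth π' := MorphismProperty.of_comp_mono @Smooth π' R.ι this
  have : Etale q' := etale_of_isPullback_of_isAffine (IsPullback.of_hasPullback π' q') w'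
  refine le_etaleLocus (O := S') ?_ hxg
  have : S'.ι ≫ q = q' ≫ R.ι := by exact (Scheme.Hom.resLE_comp_ι _ _).symm
  rw [this]
  infer_instance

end SourceDescent

/-! ### Normalization in an affine morphism -/
section Normalization

/-- `Y ⟶ N ⟶ P` is, up to isomorphism, the normalization of `P` in the affine morphism `Y ⟶ P`: it is
initial among the factorizations through integral `P`-schemes, and `Y` is schematically dense
in `N`. In particular, `IsNormalization j (𝟙 P)` says that `P` is integrally closed in `U` along
`j : U ⟶ P`. -/
structure IsNormalization {Y N P : Scheme.{u}} (t : Y ⟶ N) (n : N ⟶ P) : Prop where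
  isIntegralHom : IsIntegralHom n
  isAffineHom : IsAffineHom t
  isSchemeTheoreticallyDominant : IsSchemeTheoreticallyDominant t
  exists_desc ⦃T : Scheme.{u}⦄ (f₁ : Y ⟶ T) (f₂ : T ⟶ P) (_ : IsIntegralHom f₂)
    (_ : f₁ ≫ f₂ = t ≫ n) : ∃ v : N ⟶ T, t ≫ v = f₁ ∧ v ≫ f₂ = n

namespace IsNormalization
variable {Y N P : Scheme.{u}} {t : Y ⟶ N} {n : N ⟶ P}

lemma of_hom (f : Y ⟶ P) [IsAffineHom f] :
    IsNormalization f.toNormalization f.fromNormalization where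
  isIntegralHom := inferInstance
  isAffineHom := inferInstance
  isSchemeTheoreticallyDominant := ⟨f.ker_toNormalization⟩
  exists_desc T f₁ f₂ _ h := by
    rw [Scheme.Hom.toNormalization_fromNormalization] at h
    exact ⟨f.normalizationDesc f₁ f₂ h.symm, f.toNormalization_normalizationDesc _ _ _,
      f.normalizationDesc_comp _ _ _⟩

lemma hom_ext (H : IsNormalization t n) {E S : Scheme.{u}} (z : E ⟶ S) [IsAffineHom z]
    {a b : N ⟶ E} (h : a ≫ z = b ≫ z) (h' : t ≫ a = t ≫ b) : a = b := by
  have := H.isAffineHom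
  have := H.isSchemeTheoreticallyDominant
  exact ext_of_dominant t z h h'

lemma isAffineHom_comp (H : IsNormalization t n) : IsAffineHom (t ≫ n) := by
  have := H.isAffineHom
  have := H.isIntegralHom
  infer_instance

lemma exists_iso (H : IsNormalization t n) {N' : Scheme.{u}} {t' : Y ⟶ N'} {n' : N' ⟶ P}
    (H' : IsNormalization t' n') (h : t ≫ n = t' ≫ n') :
    ∃ e : N ≅ N', t ≫ e.hom = t' ∧ e.hom ≫ n' = n := by
  have := H.isIntegralHom
  have := H'.isIntegralHom
  obtain ⟨v, hv, hv'⟩ := H.exists_desc t' n' inferInstance h.symm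
  obtain ⟨w, hw, hw'⟩ := H'.exists_desc t n inferInstance h
  refine ⟨⟨v, w, H.hom_ext n ?_ ?_, H'.hom_ext n' ?_ ?_⟩, hv, hv'⟩
  · rw [Category.assoc, hw', hv', Category.id_comp]
  · rw [reassoc_of% hv, hw, Category.comp_id]
  · rw [Category.assoc, hv', hw', Category.id_comp]
  · rw [reassoc_of% hw, hv, Category.comp_id]

lemma of_iso (H : IsNormalization t n) {Y' N' : Scheme.{u}} {t' : Y' ⟶ N'} {n' : N' ⟶ P}
    (α : Y' ⟶ Y) (β : N' ⟶ N) [IsIso α] [IsIso β] (h : t' ≫ β = α ≫ t) (h' : β ≫ n = n') :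
    IsNormalization t' n' := by
  have := H.isIntegralHom
  have := H.isAffineHom
  have := H.isSchemeTheoreticallyDominant
  have e : t' = α ≫ t ≫ inv β := by rw [← Category.assoc, ← h, Category.assoc, IsIso.hom_inv_id,
    Category.comp_id]
  refine ⟨by rw [← h']; infer_instance, by rw [e]; infer_instance, by rw [e]; infer_instance,
    fun T f₁ f₂ _ hf ↦ ?_⟩
  obtain ⟨v, hv, hv'⟩ := H.exists_desc (inv α ≫ f₁) f₂ inferInstance (by
    rw [Category.assoc, hf, ← h', reassoc_of% h, IsIso.inv_hom_id_assoc])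
  exact ⟨β ≫ v, by rw [reassoc_of% h, hv, IsIso.hom_inv_id_assoc], by rw [Category.assoc, hv', h']⟩

/-- Normalization commutes with smooth base change. -/
lemma of_isPullback (H : IsNormalization t n) {Y' N' P' : Scheme.{u}} {t' : Y' ⟶ N'}
    {n' : N' ⟶ P'} {a : Y' ⟶ Y} {b : N' ⟶ N} {g : P' ⟶ P} [Smooth g]
    (h₁ : IsPullback b n' n g) (h₂ : IsPullback a t' t b) : IsNormalization t' n' := by
  have := H.isAffineHom_comp
  set f := t ≫ n with hf
  obtain ⟨e, he, he'⟩ := H.exists_iso (of_hom f) (by simp [f])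
  have h₃ : IsPullback a (t' ≫ n') f g := h₂.paste_vert h₁
  have h₄ : IsPullback (b ≫ e.hom) n' f.fromNormalization g :=
    h₁.of_iso (Iso.refl _) e (Iso.refl _) (Iso.refl _) (by simp) (by simp) (by simp [he'])
      (by simp)
  have : IsAffineHom (pullback.snd f g) := MorphismProperty.of_isPullback
    (P := @IsAffineHom) (IsPullback.of_hasPullback f g) ‹_›
  refine (of_hom (pullback.snd f g)).of_iso (h₃.isoPullback.hom)
    (h₄.isoPullback.hom ≫ inv (f.normalizationPullback g)) ?_ ?_
  · rw [← Category.assoc, IsIso.comp_inv_eq]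
    apply pullback.hom_ext
    · simp only [Category.assoc, IsPullback.isoPullback_hom_fst,
        Scheme.Hom.toNormalization_normalizationPullback_fst, IsPullback.isoPullback_hom_fst_assoc]
      rw [← reassoc_of% h₂.w, he]
    · simp only [Category.assoc, IsPullback.isoPullback_hom_snd,
        Scheme.Hom.normalizationPullback_snd, Scheme.Hom.toNormalization_fromNormalization]
  · rw [Category.assoc, ← f.normalizationPullback_snd g, IsIso.inv_hom_id_assoc,
      IsPullback.isoPullback_hom_snd]

lemma isIso_of_isIntegralHom (H : IsNormalization t n) (h : IsIntegralHom (t ≫ n)) : IsIso t := by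
  have := H.isIntegralHom
  obtain ⟨v, hv, hv'⟩ := H.exists_desc (𝟙 _) (t ≫ n) inferInstance (Category.id_comp _)
  exact ⟨v, hv, H.hom_ext n (by rw [Category.assoc, hv', Category.id_comp])
    (by rw [reassoc_of% hv, Category.comp_id])⟩

/-- Over an open subscheme over which `Y` is integral, the normalization coincides with `Y`. -/
lemma isPullback_of_isIntegralHom (H : IsNormalization t n) {U : Scheme.{u}} {y : Y ⟶ U} {j : U ⟶ P}
    [IsOpenImmersion j] [IsIntegralHom y] (h : y ≫ j = t ≫ n) : IsPullback t y n j := by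
  let l : Y ⟶ pullback n j := pullback.lift t y h.symm
  have h1 : IsPullback (𝟙 Y) l t (pullback.fst n j) := by
    have h2 : IsPullback (𝟙 Y) y (t ≫ n) j := by
      rw [← h]
      exact ⟨⟨by simp⟩, ⟨PullbackCone.IsLimit.mk _ (fun s ↦ s.fst) (fun s ↦ by simp)
        (fun s ↦ by rw [← cancel_mono j, Category.assoc, s.condition]) fun s m h1 _ ↦ by
          rw [← h1, Category.comp_id]⟩⟩
    refine IsPullback.of_bot (v₂₁ := pullback.snd n j) (h₃₁ := j) (v₂₂ := n)
      ?_ ?_ (IsPullback.of_hasPullback n j)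
    · rwa [pullback.lift_snd]
    · rw [pullback.lift_fst, Category.id_comp]
  have h3 := H.of_isPullback (IsPullback.of_hasPullback n j) h1
  have : IsIso l := h3.isIso_of_isIntegralHom (by rwa [pullback.lift_snd])
  exact IsPullback.of_iso_pullback ⟨h.symm⟩ (asIso l) (pullback.lift_fst _ _ _)
    (pullback.lift_snd _ _ _)

/-- A section of the normalization of `P` in an étale scheme over an open subscheme `U` of `P` is an
open immersion, provided that `P` is normal in `U`: over `U`, it is the inclusion of an open and
closed subscheme. -/
lemma isOpenImmersion_section (H : IsNormalization t n) {U : Scheme.{u}} {y : Y ⟶ U} {j : U ⟶ P}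
    [IsOpenImmersion j] [IsIntegralHom y] [Etale y] (h : y ≫ j = t ≫ n)
    (hj : IsNormalization j (𝟙 P)) (σ : P ⟶ N) (hσ : σ ≫ n = 𝟙 P) : IsOpenImmersion σ := by
  have := H.isAffineHom_comp
  have := H.isIntegralHom
  have hpb := H.isPullback_of_isIntegralHom h
  let s : U ⟶ Y := hpb.lift (j ≫ σ) (𝟙 U) (by rw [Category.assoc, hσ]; simp)
  have hst : s ≫ t = j ≫ σ := hpb.lift_fst _ _ _
  have hsy : s ≫ y = 𝟙 U := hpb.lift_snd _ _ _
  have : Etale (s ≫ y) := by rw [hsy]; infer_instance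
  have : Etale s := Etale.of_comp s y
  have : IsClosedImmersion (s ≫ y) := by rw [hsy]; infer_instance
  have : IsClosedImmersion s := .of_comp s y
  have : IsOpenImmersion s := IsOpenImmersion.of_flat_of_mono s
  let C : Y.Opens := ⟨(Set.range s)ᶜ, s.isClosedEmbedding.isClosed_range.isOpen_compl⟩
  have hC : IsCompl s.opensRange C.ι.opensRange := by
    rw [Scheme.Opens.opensRange_ι]
    refine ⟨?_, ?_⟩
    · rw [disjoint_iff]
      ext x
      simp [C]
    · rw [codisjoint_iff]
      ext x
      simp [C]
  -- `Y` is the disjoint union of `U` and `C`, and normalization commutes with disjoint unions; the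
  -- summand of `N` over `U` is `P`, since `P` is normal in `U`
  obtain ⟨e⟩ := nonempty_isColimit_binaryCofanMk_of_isCompl _ _ hC
  have : QuasiCompact C.ι := by
    refine ⟨fun V _ hV ↦ ?_⟩
    have : Topology.IsClosedEmbedding C.ι := ⟨C.ι.isOpenEmbedding.isEmbedding, by
      rw [Scheme.Opens.range_ι]
      exact s.isOpenEmbedding.isOpen_range.isClosed_compl⟩
    exact this.isCompact_preimage hV
  set f := t ≫ n with hf
  have hsf : s ≫ f = j := by rw [hf, reassoc_of% hst, hσ, Category.comp_id]
  have : IsAffineHom (s ≫ f) := inferInstance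
  obtain ⟨e', he, he'⟩ := H.exists_iso (of_hom f) (by simp [f])
  have hiso : IsIso (s ≫ f).fromNormalization := by
    obtain ⟨ε, -, hε⟩ := (of_hom (s ≫ f)).exists_iso (n' := 𝟙 P) (t' := s ≫ f) (by rwa [hsf])
      (by simp)
    rw [← hε]
    infer_instance
  let c := f.normalizationCoprodIso e
  have h1 : (s ≫ f).toNormalization ≫ coprod.inl ≫ c.hom = s ≫ f.toNormalization :=
    Scheme.Hom.toNormalization_inl_normalizationCoprodIso_hom f e
  have h2 : coprod.inl ≫ c.hom ≫ f.fromNormalization = (s ≫ f).fromNormalization :=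
    Scheme.Hom.inl_normalizationCoprodIso_hom_fromNormalization f e
  have he₁ : e'.inv ≫ n = f.fromNormalization := by rw [Iso.inv_comp_eq, he']
  have he₂ : f.toNormalization ≫ e'.inv = t := by rw [Iso.comp_inv_eq, he]
  have : σ = inv (s ≫ f).fromNormalization ≫ coprod.inl ≫ c.hom ≫ e'.inv := by
    refine hj.hom_ext n ?_ ?_
    · rw [hσ, Category.assoc, Category.assoc, Category.assoc, he₁, h2, IsIso.inv_hom_id]
    · have h3 : j ≫ inv (s ≫ f).fromNormalization = (s ≫ f).toNormalization := by
        rw [IsIso.comp_inv_eq, Scheme.Hom.toNormalization_fromNormalization, hsf]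
      rw [reassoc_of% h3, reassoc_of% h1, he₂, hst]
  rw [this]
  infer_instance

/-- Let `P` be normal in the open subscheme `U`, let `N` be the normalization of `P` in a scheme
which is integral and étale over `U`, and let `N' ⟶ P'` be the base change of `N ⟶ P` by a smooth
morphism `g'`. Then morphisms over `P'` from étale `P'`-schemes to `N'` are étale. -/
lemma etale_of_etale_comp (H : IsNormalization t n) {U : Scheme.{u}} {y : Y ⟶ U} {j : U ⟶ P}
    [IsOpenImmersion j] [IsIntegralHom y] [Etale y] (h : y ≫ j = t ≫ n)
    (hj : IsNormalization j (𝟙 P)) {N' P' : Scheme.{u}} {b : N' ⟶ N} {n' : N' ⟶ P'} {g' : P' ⟶ P}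
    [Smooth g'] (h₁ : IsPullback b n' n g') {W : Scheme.{u}} (w : W ⟶ N') [Etale (w ≫ n')] :
    Etale w := by
  -- after base change to `W`, the morphism `w` defines a section of the normalization
  set g := (w ≫ n') ≫ g' with hg
  have hN := IsPullback.of_hasPullback n g
  have hY := IsPullback.of_hasPullback t (pullback.fst n g)
  have hU := IsPullback.of_hasPullback j g
  have H' := H.of_isPullback hN hY
  have hj' : IsNormalization (pullback.snd j g) (𝟙 W) :=
    hj.of_isPullback (IsPullback.of_vert_isIso (fst := g) (snd := 𝟙 W) (f := 𝟙 P) (g := g)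
      ⟨by simp⟩) hU
  have hYU : IsPullback (pullback.fst t (pullback.fst n g))
      (pullback.snd t (pullback.fst n g) ≫ pullback.snd n g) (y ≫ j) g := by
    rw [h]
    exact hY.paste_vert hN
  let y' : pullback t (pullback.fst n g) ⟶ pullback j g :=
    pullback.lift (pullback.fst _ _ ≫ y) (pullback.snd _ _ ≫ pullback.snd _ _)
      (by rw [Category.assoc]; exact hYU.w)
  have hy' : y' ≫ pullback.snd j g = pullback.snd _ _ ≫ pullback.snd _ _ := pullback.lift_snd _ _ _
  have hy : IsPullback (pullback.fst t (pullback.fst n g)) y' y (pullback.fst j g) :=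
    .of_bot (by rwa [hy']) (pullback.lift_fst _ _ _).symm hU
  have : IsIntegralHom y' := MorphismProperty.of_isPullback hy ‹_›
  have : Etale y' := MorphismProperty.of_isPullback hy ‹_›
  let σ : W ⟶ pullback n g := pullback.lift (w ≫ b) (𝟙 W) (by simp [g, h₁.w])
  have hσ : σ ≫ pullback.fst n g = w ≫ b := pullback.lift_fst _ _ _
  have hσ' : σ ≫ pullback.snd n g = 𝟙 W := pullback.lift_snd _ _ _
  have : IsOpenImmersion σ := H'.isOpenImmersion_section hy' hj' σ hσ'
  let ρ : pullback n g ⟶ N' := h₁.lift (pullback.fst n g) (pullback.snd n g ≫ w ≫ n')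
    (by rw [pullback.condition, hg, Category.assoc, Category.assoc, Category.assoc])
  have hρ : ρ ≫ b = pullback.fst n g := h₁.lift_fst _ _ _
  have hρ' : ρ ≫ n' = pullback.snd n g ≫ w ≫ n' := h₁.lift_snd _ _ _
  have hρN : IsPullback ρ (pullback.snd n g) n' (w ≫ n') :=
    .of_right (by rwa [hρ]) hρ' h₁
  have : Etale ρ := MorphismProperty.of_isPullback hρN.flip ‹_›
  have : w = σ ≫ ρ := by
    refine h₁.hom_ext ?_ ?_
    · rw [Category.assoc, hρ, hσ]
    · rw [Category.assoc, hρ', reassoc_of% hσ']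
  rw [this]
  infer_instance

end IsNormalization

end Normalization

/-! ### The étale locus of a normalized cover -/
section EtaleLocus

lemma etale_etaleLocus_ι {Q P : Scheme.{u}} (g : Q ⟶ P) : Etale ((etaleLocus g).ι ≫ g) := by
  let 𝒰 := (etaleLocus g).toScheme.openCoverOfIsOpenCover
    (fun O : {O : Q.Opens // Etale (O.ι ≫ g)} ↦ (etaleLocus g).ι ⁻¹ᵁ O.1) (by
      rw [TopologicalSpace.IsOpenCover, eq_top_iff]
      rintro ⟨x, hx⟩ -
      obtain ⟨O, hO, hxO⟩ := TopologicalSpace.Opens.mem_sSup.mp hx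
      exact TopologicalSpace.Opens.mem_iSup.mpr ⟨⟨O, hO⟩, hxO⟩)
  have : IsZariskiLocalAtSource @Etale := HasRingHomProperty.instIsZariskiLocalAtSource
  rw [IsZariskiLocalAtSource.iff_of_openCover (P := @Etale) 𝒰]
  intro O
  have : Etale (O.1.ι ≫ g) := O.2
  have : 𝒰.f O ≫ (etaleLocus g).ι ≫ g =
      ((etaleLocus g).ι ∣_ O.1) ≫ O.1.ι ≫ g := by
    rw [morphismRestrict_ι_assoc]
    rfl
  rw [this]
  have h1 : Etale ((etaleLocus g).ι ∣_ O.1) := inferInstance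
  have h2 : Etale (((etaleLocus g).ι ∣_ O.1) ≫ O.1.ι ≫ g) := inferInstance
  exact h2

/-- The image of an étale morphism from an étale `P`-scheme is contained in the étale locus. -/
lemma mem_etaleLocus_of_etale {Q P W : Scheme.{u}} [IsLocallyNoetherian P] (q : Q ⟶ P)
    (h : W ⟶ Q) [Etale h] [Etale (h ≫ q)] (x : W) : h x ∈ etaleLocus q := by
  let w : W ⟶ pullback (𝟙 P) q := pullback.lift (h ≫ q) h (by simp)
  have e1 : w ≫ pullback.fst _ _ = h ≫ q := pullback.lift_fst _ _ _
  have e2 : w ≫ pullback.snd _ _ = h := pullback.lift_snd _ _ _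
  have : Etale (w ≫ pullback.snd (𝟙 P) q) := by rwa [e2]
  have : Etale w := Etale.of_comp w (pullback.snd (𝟙 P) q)
  have : Etale (w ≫ pullback.fst (𝟙 P) q) := by rwa [e1]
  have := mem_etaleLocus_of_smooth q (𝟙 P) w x
  rwa [e2] at this

end EtaleLocus

lemma IsMultiplicativeHom.isMultiplicative {C : Type*} [Category* C] [HasPullbacks C]
    {Q P : OverSimplexᵒᵖ ⥤ C} {f : Q ⟶ P} (hf : IsMultiplicativeHom f) (hP : IsMultiplicative P) :
    IsMultiplicative Q := by
  intro m l n a b c d H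
  have h₁ := hf a b c d H
  have h₂ := hP a b c d H
  have w : Q.map c.op ≫ Q.map a.op = Q.map d.op ≫ Q.map b.op := by
    rw [← Q.map_comp, ← Q.map_comp, ← op_comp, ← op_comp, H.w]
  have hn (s : PullbackCone (Q.map a.op) (Q.map b.op)) :
      (s.fst ≫ f.app (op m)) ≫ P.map a.op = (s.snd ≫ f.app (op l)) ≫ P.map b.op := by
    rw [Category.assoc, Category.assoc, ← f.naturality, ← f.naturality, reassoc_of% s.condition]
  have hlift (s : PullbackCone (Q.map a.op) (Q.map b.op)) : ∃ v : s.pt ⟶ Q.obj (op n),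
      v ≫ Q.map c.op = s.fst ∧ v ≫ Q.map d.op = s.snd := by
    let u := h₂.lift _ _ (hn s)
    have h3 := h₁.lift_fst (pullback.lift s.fst u (h₂.lift_fst _ _ (hn s)).symm)
      (pullback.lift s.snd u (h₂.lift_snd _ _ (hn s)).symm)
      (by rw [pullback.lift_snd, pullback.lift_snd])
    have h4 := h₁.lift_snd (pullback.lift s.fst u (h₂.lift_fst _ _ (hn s)).symm)
      (pullback.lift s.snd u (h₂.lift_snd _ _ (hn s)).symm)
      (by rw [pullback.lift_snd, pullback.lift_snd])
    refine ⟨h₁.lift (pullback.lift s.fst u (h₂.lift_fst _ _ (hn s)).symm)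
      (pullback.lift s.snd u (h₂.lift_snd _ _ (hn s)).symm)
      (by rw [pullback.lift_snd, pullback.lift_snd]), ?_, ?_⟩
    · have := congr($h3 ≫ pullback.fst _ _)
      rwa [Category.assoc, pullback.lift_fst, pullback.lift_fst] at this
    · have := congr($h4 ≫ pullback.fst _ _)
      rwa [Category.assoc, pullback.lift_fst, pullback.lift_fst] at this
  refine ⟨⟨w⟩, ⟨PullbackCone.IsLimit.mk w (fun s ↦ (hlift s).choose)
    (fun s ↦ (hlift s).choose_spec.1) (fun s ↦ (hlift s).choose_spec.2) fun s v h3 h4 ↦ ?_⟩⟩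
  have h5 : v ≫ f.app (op n) = (hlift s).choose ≫ f.app (op n) := by
    refine h₂.hom_ext ?_ ?_
    · rw [Category.assoc, Category.assoc, ← f.naturality, reassoc_of% h3,
        reassoc_of% (hlift s).choose_spec.1]
    · rw [Category.assoc, Category.assoc, ← f.naturality, reassoc_of% h4,
        reassoc_of% (hlift s).choose_spec.2]
  refine h₁.hom_ext ?_ ?_
  · apply pullback.hom_ext
    · rw [Category.assoc, Category.assoc, pullback.lift_fst, h3, (hlift s).choose_spec.1]
    · rw [Category.assoc, Category.assoc, pullback.lift_snd, h5]
  · apply pullback.hom_ext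
    · rw [Category.assoc, Category.assoc, pullback.lift_fst, h4, (hlift s).choose_spec.2]
    · rw [Category.assoc, Category.assoc, pullback.lift_snd, h5]

/-- The hypotheses on `𝒱 ⟶ Q ⟶ P` under which the étale locus of `Q ⟶ P` is multiplicative: `Q` is
the normalization of `P` in a multiplicative oversimplicial scheme `𝒱` which, for every vertex
of `[0, n]`, is integral and étale over the inverse image in `P_n` of an open subscheme `𝒱_0` of
`P_0`. The oversimplicial scheme `P` is multiplicative, locally Noetherian and smooth over `P_0`
along every vertex, and `P_0` is integrally closed in `𝒱_0`. -/
structure IsNormalizedCover {𝒱 Q P : OverSimplexᵒᵖ ⥤ Scheme.{u}} (t : 𝒱 ⟶ Q) (q : Q ⟶ P) :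
    Prop where
  isNormalization (a : OverSimplexᵒᵖ) : IsNormalization (t.app a) (q.app a)
  isMultiplicative_target : IsMultiplicative P
  isMultiplicative_source : IsMultiplicative 𝒱
  smooth {n : OverSimplex} (α : .mk 0 ⟶ n) : Smooth (P.map α.op)
  isLocallyNoetherian (a : OverSimplexᵒᵖ) : IsLocallyNoetherian (P.obj a)
  isOpenImmersion_zero : IsOpenImmersion ((t ≫ q).app (op (.mk 0)))
  isNormalization_zero : IsNormalization ((t ≫ q).app (op (.mk 0))) (𝟙 _)
  etale (a : OverSimplexᵒᵖ) : Etale ((t ≫ q).app a)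
  isIntegralHom {n : OverSimplex} (α : .mk 0 ⟶ n) :
    IsIntegralHom (pullback.lift (f := P.map α.op) (g := (t ≫ q).app (op (.mk 0)))
      ((t ≫ q).app (op n)) (𝒱.map α.op) ((t ≫ q).naturality α.op).symm)

namespace IsNormalizedCover
variable {𝒱 Q P : OverSimplexᵒᵖ ⥤ Scheme.{u}} {t : 𝒱 ⟶ Q} {q : Q ⟶ P}

section
variable (H : IsNormalizedCover t q) {m l n : OverSimplex}

include H

/-- Over the inverse image of the open subscheme of `P_0` along a vertex, `Q_n` coincides with
`𝒱_n`. -/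
lemma isPullback_openPart (α : .mk 0 ⟶ n) :
    IsPullback (t.app (op n)) (pullback.lift (f := P.map α.op) (g := (t ≫ q).app (op (.mk 0)))
      ((t ≫ q).app (op n)) (𝒱.map α.op) ((t ≫ q).naturality α.op).symm) (q.app (op n))
      (pullback.fst _ _) := by
  have := H.isIntegralHom α
  have := H.isOpenImmersion_zero
  exact (H.isNormalization (op n)).isPullback_of_isIntegralHom (pullback.lift_fst _ _ _)

/-- `P_n` is integrally closed in the inverse image of the open subscheme of `P_0` along a vertex. -/
lemma isNormalization_openPart (α : .mk 0 ⟶ n) :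
    IsNormalization (pullback.fst (P.map α.op) ((t ≫ q).app (op (.mk 0)))) (𝟙 _) := by
  have := H.smooth α
  exact H.isNormalization_zero.of_isPullback (IsPullback.of_vert_isIso (fst := P.map α.op)
    (snd := 𝟙 _) (f := 𝟙 _) (g := P.map α.op) ⟨by simp⟩) (IsPullback.of_hasPullback _ _).flip

/-- Morphisms from étale schemes to smooth base changes of `Q_n` are étale. -/
lemma etale_of_isPullback {N' P' : Scheme.{u}} {b : N' ⟶ Q.obj (op n)} {n' : N' ⟶ P'}
    {g' : P' ⟶ P.obj (op n)} [Smooth g'] (h₁ : IsPullback b n' (q.app (op n)) g') {W : Scheme.{u}}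
    (w : W ⟶ N') [Etale (w ≫ n')] : Etale w := by
  let α : .mk 0 ⟶ n := fun _ ↦ (0 : Fin (n.len + 1))
  have := H.isIntegralHom α
  have := H.isOpenImmersion_zero
  have h : pullback.lift (f := P.map α.op) (g := (t ≫ q).app (op (.mk 0)))
      ((t ≫ q).app (op n)) (𝒱.map α.op) ((t ≫ q).naturality α.op).symm ≫ pullback.fst _ _ =
      (t ≫ q).app (op n) := pullback.lift_fst _ _ _
  have := H.etale (op n)
  rw [← h] at this
  have := Etale.of_comp (pullback.lift (f := P.map α.op) (g := (t ≫ q).app (op (.mk 0)))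
      ((t ≫ q).app (op n)) (𝒱.map α.op) ((t ≫ q).naturality α.op).symm) (pullback.fst _ _)
  exact (H.isNormalization (op n)).etale_of_etale_comp h (H.isNormalization_openPart α) h₁ w

lemma etale_of_etale_comp {W : Scheme.{u}} (w : W ⟶ Q.obj (op n)) [Etale (w ≫ q.app (op n))] :
    Etale w :=
  H.etale_of_isPullback (IsPullback.of_horiz_isIso (fst := 𝟙 _) (snd := q.app (op n))
    (g := 𝟙 _) ⟨by simp⟩) w

/-- The étale locus is preserved by the legs of cocartesian squares: the corresponding morphisms of
`P` are smooth. -/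
lemma map_mem_etaleLocus {a : .mk 0 ⟶ m} {b : .mk 0 ⟶ l} {c : m ⟶ n} {d : l ⟶ n}
    (hpo : IsPushout a b c d) (x : Q.obj (op n)) (hx : x ∈ etaleLocus (q.app (op n))) :
    Q.map c.op x ∈ etaleLocus (q.app (op m)) := by
  have := H.smooth b
  have : Smooth (P.map c.op) :=
    MorphismProperty.of_isPullback (H.isMultiplicative_target a b c d hpo).flip this
  have := H.isLocallyNoetherian (op m)
  let W := etaleLocus (q.app (op n))
  have hW : Etale (W.ι ≫ q.app (op n)) := etale_etaleLocus_ι _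
  let s := pullback.lift (f := P.map c.op) (g := q.app (op m)) (W.ι ≫ q.app (op n))
    (W.ι ≫ Q.map c.op) (by rw [Category.assoc, Category.assoc, q.naturality])
  have hs₁ : s ≫ pullback.fst _ _ = W.ι ≫ q.app (op n) := pullback.lift_fst _ _ _
  have hs₂ : s ≫ pullback.snd _ _ = W.ι ≫ Q.map c.op := pullback.lift_snd _ _ _
  have : Etale (s ≫ pullback.fst _ _) := by rwa [hs₁]
  have : Etale s :=
    H.etale_of_isPullback (IsPullback.of_hasPullback (P.map c.op) (q.app (op m))).flip s
  have := mem_etaleLocus_of_smooth (q.app (op m)) (P.map c.op) s ⟨x, hx⟩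
  rw [hs₂] at this
  exact this

end

end IsNormalizedCover

namespace IsNormalizedCover
variable {𝒱 Q P : OverSimplexᵒᵖ ⥤ Scheme.{u}} {t : 𝒱 ⟶ Q} {q : Q ⟶ P}

section
variable (H : IsNormalizedCover t q) {m l n : OverSimplex}
  {a : .mk 0 ⟶ m} {b : .mk 0 ⟶ l} {c : m ⟶ n} {d : l ⟶ n} (hpo : IsPushout a b c d)

include H hpo

/-- Although `Q` is not multiplicative, compatible morphisms to `Q_m` and `Q_l` glue to a morphism
to `Q_n` if the source `E` is smooth over `P_n`: they glue on a dense open subscheme, as `𝒱` is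
multiplicative, and extend, as `E` is normal in this open subscheme. -/
lemma exists_lift {E : Scheme.{u}} (e : E ⟶ P.obj (op n)) [Smooth e] (x : E ⟶ Q.obj (op m))
    (y : E ⟶ Q.obj (op l)) (hx : x ≫ q.app (op m) = e ≫ P.map c.op)
    (hy : y ≫ q.app (op l) = e ≫ P.map d.op) :
    ∃ h : E ⟶ Q.obj (op n), h ≫ q.app (op n) = e ∧ h ≫ Q.map c.op = x ∧ h ≫ Q.map d.op = y := by
  have := H.isOpenImmersion_zero
  have := (H.isNormalization (op n)).isIntegralHom
  have := (H.isNormalization (op m)).isIntegralHom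
  have := (H.isNormalization (op l)).isIntegralHom
  set f₀ := (t ≫ q).app (op (.mk 0)) with hf₀
  have hm := H.isPullback_openPart a
  have hl := H.isPullback_openPart b
  let j := pullback.fst (P.map (a ≫ c).op) f₀
  let τ := pullback.snd j e
  let κ := pullback.fst j e
  have hκ : κ ≫ j = τ ≫ e := pullback.condition
  have hac : P.map c.op ≫ P.map a.op = P.map (a ≫ c).op := by rw [op_comp, P.map_comp]
  have hbd : P.map d.op ≫ P.map b.op = P.map (a ≫ c).op := by rw [hpo.w, op_comp, P.map_comp]
  have hj : j ≫ P.map (a ≫ c).op = pullback.snd _ _ ≫ f₀ := pullback.condition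
  let u : pullback j e ⟶ pullback (P.map a.op) f₀ :=
    pullback.lift (τ ≫ e ≫ P.map c.op) (κ ≫ pullback.snd _ _) (by
      rw [Category.assoc, Category.assoc, hac, ← reassoc_of% hκ, hj, Category.assoc])
  let u' : pullback j e ⟶ pullback (P.map b.op) f₀ :=
    pullback.lift (τ ≫ e ≫ P.map d.op) (κ ≫ pullback.snd _ _) (by
      rw [Category.assoc, Category.assoc, hbd, ← reassoc_of% hκ, hj, Category.assoc])
  have hu : (τ ≫ x) ≫ q.app (op m) = u ≫ pullback.fst _ _ := by
    rw [pullback.lift_fst, Category.assoc, hx]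
  have hu' : (τ ≫ y) ≫ q.app (op l) = u' ≫ pullback.fst _ _ := by
    rw [pullback.lift_fst, Category.assoc, hy]
  let vm := hm.lift (τ ≫ x) u hu
  have hvm : vm ≫ t.app (op m) = τ ≫ x := hm.lift_fst _ _ _
  let vl := hl.lift (τ ≫ y) u' hu'
  have hvl : vl ≫ t.app (op l) = τ ≫ y := hl.lift_fst _ _ _
  have hV := H.isMultiplicative_source a b c d hpo
  have hv : vm ≫ 𝒱.map a.op = vl ≫ 𝒱.map b.op := by
    have hna : 𝒱.map a.op ≫ f₀ = t.app (op m) ≫ q.app (op m) ≫ P.map a.op := by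
      rw [hf₀, (t ≫ q).naturality, NatTrans.comp_app, Category.assoc]
    have hnb : 𝒱.map b.op ≫ f₀ = t.app (op l) ≫ q.app (op l) ≫ P.map b.op := by
      rw [hf₀, (t ≫ q).naturality, NatTrans.comp_app, Category.assoc]
    rw [← cancel_mono f₀, Category.assoc, Category.assoc, hna, hnb, reassoc_of% hvm,
      reassoc_of% hvl, reassoc_of% hx, reassoc_of% hy, hac, hbd]
  let v := hV.lift vm vl hv
  have hvc : v ≫ 𝒱.map c.op = vm := hV.lift_fst _ _ _
  have hvd : v ≫ 𝒱.map d.op = vl := hV.lift_snd _ _ _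
  have hvt : v ≫ t.app (op n) ≫ q.app (op n) = τ ≫ e := by
    refine (H.isMultiplicative_target a b c d hpo).hom_ext ?_ ?_
    · rw [Category.assoc, Category.assoc, ← q.naturality, ← t.naturality_assoc,
        reassoc_of% hvc, reassoc_of% hvm, hx, Category.assoc]
    · rw [Category.assoc, Category.assoc, ← q.naturality, ← t.naturality_assoc,
        reassoc_of% hvd, reassoc_of% hvl, hy, Category.assoc]
  -- `v` is the glued morphism on the open part of `E`; it extends to a section of the integral
  -- `E`-scheme `Q_n ×_{P_n} E`
  have hE : IsNormalization τ (𝟙 E) :=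
    (H.isNormalization_openPart (a ≫ c)).of_isPullback (IsPullback.of_vert_isIso (fst := e)
      (snd := 𝟙 _) (f := 𝟙 _) (g := e) ⟨by simp⟩) (IsPullback.of_hasPullback _ _)
  obtain ⟨s, hs, hs'⟩ := hE.exists_desc
    (pullback.lift (f := q.app (op n)) (g := e) (v ≫ t.app (op n)) τ
      (by rw [Category.assoc, hvt])) (pullback.snd _ _) inferInstance
    (by rw [pullback.lift_snd, Category.comp_id])
  have hτ : τ ≫ s ≫ pullback.fst _ _ = v ≫ t.app (op n) := by
    rw [reassoc_of% hs, pullback.lift_fst]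
  have hse : (s ≫ pullback.fst _ _) ≫ q.app (op n) = e := by
    rw [Category.assoc, pullback.condition, reassoc_of% hs']
  refine ⟨s ≫ pullback.fst _ _, hse, hE.hom_ext (q.app (op m)) ?_ ?_,
    hE.hom_ext (q.app (op l)) ?_ ?_⟩
  · rw [Category.assoc, q.naturality, ← Category.assoc, hse, hx]
  · rw [Category.assoc, reassoc_of% hτ, ← t.naturality, reassoc_of% hvc, hvm]
  · rw [Category.assoc, q.naturality, ← Category.assoc, hse, hy]
  · rw [Category.assoc, reassoc_of% hτ, ← t.naturality, reassoc_of% hvd, hvl]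

/-- A morphism to `Q_n` is determined by its components in `Q_m`, `Q_l` and `P_n` if its source has
a scheme-theoretically dense part mapping to the part of `Q_n` over the open subscheme. -/
lemma lift_unique {T T₀ : Scheme.{u}} (τ : T₀ ⟶ T) [IsSchemeTheoreticallyDominant τ]
    [QuasiCompact τ] (h h' : T ⟶ Q.obj (op n)) (v : T₀ ⟶ 𝒱.obj (op n))
    (hv : v ≫ t.app (op n) = τ ≫ h) (hq : h ≫ q.app (op n) = h' ≫ q.app (op n))
    (hc : h ≫ Q.map c.op = h' ≫ Q.map c.op) (hd : h ≫ Q.map d.op = h' ≫ Q.map d.op) : h = h' := by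
  have := H.isOpenImmersion_zero
  have := (H.isNormalization (op n)).isIntegralHom
  refine ext_of_dominant τ (q.app (op n)) hq ?_
  have hn := H.isPullback_openPart (a ≫ c)
  let v' := hn.lift (τ ≫ h') (v ≫ pullback.lift _ _ ((t ≫ q).naturality _).symm) (by
    rw [Category.assoc, Category.assoc, pullback.lift_fst, ← hq, ← reassoc_of% hv,
      NatTrans.comp_app])
  have hv' : v' ≫ t.app (op n) = τ ≫ h' := hn.lift_fst _ _ _
  have hvP : v ≫ (t ≫ q).app (op n) = v' ≫ (t ≫ q).app (op n) := by
    rw [NatTrans.comp_app, reassoc_of% hv, reassoc_of% hv', hq]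
  suffices v = v' by rw [← hv, this, hv']
  refine (H.isMultiplicative_source a b c d hpo).hom_ext ?_ ?_
  · refine (H.isPullback_openPart a).hom_ext ?_ ?_
    · rw [Category.assoc, Category.assoc, t.naturality, reassoc_of% hv, reassoc_of% hv', hc]
    · rw [← cancel_mono (pullback.fst _ _), Category.assoc, Category.assoc, Category.assoc,
        Category.assoc, pullback.lift_fst, (t ≫ q).naturality, reassoc_of% hvP]
  · refine (H.isPullback_openPart b).hom_ext ?_ ?_
    · rw [Category.assoc, Category.assoc, t.naturality, reassoc_of% hv, reassoc_of% hv', hd]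
    · rw [← cancel_mono (pullback.fst _ _), Category.assoc, Category.assoc, Category.assoc,
        Category.assoc, pullback.lift_fst, (t ≫ q).naturality, reassoc_of% hvP]

/-- On the fibre product `E` over `P_n` of the base changes of the étale loci of `Q_m` and `Q_l`,
there is an étale morphism to `Q_n`, which is a retraction of the canonical morphism
from the étale locus of `Q_n`. -/
lemma exists_etale_lift {A B : Scheme.{u}} {wA : A ⟶ Q.obj (op m)} {pA : A ⟶ P.obj (op n)}
    {wB : B ⟶ Q.obj (op l)} {pB : B ⟶ P.obj (op n)} [Etale pA] [Etale pB]
    (hA : wA ≫ q.app (op m) = pA ≫ P.map c.op) (hB : wB ≫ q.app (op l) = pB ≫ P.map d.op) :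
    ∃ h : pullback pA pB ⟶ Q.obj (op n), Etale h ∧
      h ≫ q.app (op n) = pullback.fst _ _ ≫ pA ∧ h ≫ Q.map c.op = pullback.fst _ _ ≫ wA ∧
      h ≫ Q.map d.op = pullback.snd _ _ ≫ wB ∧
      ∀ (T : (Q.obj (op n)).Opens) (g : T.toScheme ⟶ pullback pA pB),
        g ≫ pullback.fst _ _ ≫ pA = T.ι ≫ q.app (op n) →
        g ≫ pullback.fst _ _ ≫ wA = T.ι ≫ Q.map c.op →
        g ≫ pullback.snd _ _ ≫ wB = T.ι ≫ Q.map d.op → g ≫ h = T.ι := by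
  obtain ⟨h, h1, h2, h3⟩ := H.exists_lift hpo (pullback.fst pA pB ≫ pA) (pullback.fst _ _ ≫ wA)
    (pullback.snd _ _ ≫ wB) (by rw [Category.assoc, Category.assoc, hA])
    (by rw [Category.assoc, hB, ← pullback.condition_assoc, Category.assoc])
  have : Etale (h ≫ q.app (op n)) := by rw [h1]; infer_instance
  refine ⟨h, H.etale_of_etale_comp h, h1, h2, h3, fun T g hg₁ hg₂ hg₃ ↦ ?_⟩
  have := (H.isNormalization (op n)).isSchemeTheoreticallyDominant
  have := (H.isNormalization (op n)).isAffineHom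
  refine (H.lift_unique hpo (pullback.snd (t.app (op n)) T.ι) T.ι (g ≫ h) (pullback.fst _ _)
    pullback.condition ?_ ?_ ?_).symm
  · rw [Category.assoc, h1, hg₁]
  · rw [Category.assoc, h2, hg₂]
  · rw [Category.assoc, h3, hg₃]

/-- A point of `Q_n` lies in the étale locus if its images in `Q_m` and `Q_l` do. -/
lemma mem_etaleLocus_of_map (x : Q.obj (op n))
    (hc : Q.map c.op x ∈ etaleLocus (q.app (op m)))
    (hd : Q.map d.op x ∈ etaleLocus (q.app (op l))) : x ∈ etaleLocus (q.app (op n)) := by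
  have := H.isLocallyNoetherian (op n)
  let Wm := etaleLocus (q.app (op m))
  let Wl := etaleLocus (q.app (op l))
  have : Etale (Wm.ι ≫ q.app (op m)) := etale_etaleLocus_ι _
  have : Etale (Wl.ι ≫ q.app (op l)) := etale_etaleLocus_ι _
  obtain ⟨h, _, h1, -, -, huniq⟩ := H.exists_etale_lift hpo
    (wA := pullback.fst (Wm.ι ≫ q.app (op m)) (P.map c.op) ≫ Wm.ι) (pA := pullback.snd _ _)
    (wB := pullback.fst (Wl.ι ≫ q.app (op l)) (P.map d.op) ≫ Wl.ι) (pB := pullback.snd _ _)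
    (by rw [Category.assoc, pullback.condition]) (by rw [Category.assoc, pullback.condition])
  let T : (Q.obj (op n)).Opens := Q.map c.op ⁻¹ᵁ Wm ⊓ Q.map d.op ⁻¹ᵁ Wl
  let gm := pullback.lift (f := Wm.ι ≫ q.app (op m)) (g := P.map c.op)
    ((Q.map c.op).resLE Wm T inf_le_left) (T.ι ≫ q.app (op n)) (by
      rw [Scheme.Hom.resLE_comp_ι_assoc, Category.assoc, q.naturality])
  let gl := pullback.lift (f := Wl.ι ≫ q.app (op l)) (g := P.map d.op)
    ((Q.map d.op).resLE Wl T inf_le_right) (T.ι ≫ q.app (op n)) (by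
      rw [Scheme.Hom.resLE_comp_ι_assoc, Category.assoc, q.naturality])
  let g := pullback.lift (f := pullback.snd (Wm.ι ≫ q.app (op m)) (P.map c.op))
    (g := pullback.snd (Wl.ι ≫ q.app (op l)) (P.map d.op)) gm gl
    (by rw [pullback.lift_snd, pullback.lift_snd])
  have hg : g ≫ h = T.ι := by
    refine huniq T g ?_ ?_ ?_
    · rw [pullback.lift_fst_assoc, pullback.lift_snd]
    · rw [pullback.lift_fst_assoc, pullback.lift_fst_assoc, Scheme.Hom.resLE_comp_ι]
    · rw [pullback.lift_snd_assoc, pullback.lift_fst_assoc, Scheme.Hom.resLE_comp_ι]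
  have : Etale (h ≫ q.app (op n)) := by rw [h1]; infer_instance
  have hx : h (g ⟨x, hc, hd⟩) = x := congr($hg ⟨x, hc, hd⟩)
  exact hx ▸ mem_etaleLocus_of_etale (q.app (op n)) h (g ⟨x, hc, hd⟩)

end

variable (H : IsNormalizedCover t q)
include H

lemma etaleLocus_zero : etaleLocus (q.app (op (.mk 0))) = ⊤ := by
  have := (H.isNormalization (op (.mk 0))).exists_iso H.isNormalization_zero
    (by rw [NatTrans.comp_app, Category.comp_id])
  obtain ⟨e, -, he⟩ := this
  rw [Category.comp_id] at he
  refine top_le_iff.mp (le_etaleLocus ?_)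
  rw [← he]
  infer_instance

/-- The étale loci form an oversimplicial open subscheme as soon as the degenerate edges are étale:
simplices are glued from edges, and the nondegenerate edges are legs of cocartesian squares. -/
lemma map_mem_etaleLocus_of_bounded
    (hbd : ∀ x, Q.map (OverSimplex.toZero (.mk 1)).op x ∈ etaleLocus (q.app (op (.mk 1))))
    {n m : ℕ} (f : OverSimplex.mk n ⟶ .mk m) (x : Q.obj (op (.mk m)))
    (hx : x ∈ etaleLocus (q.app (op (.mk m)))) :
    Q.map f.op x ∈ etaleLocus (q.app (op (.mk n))) := by
  have hedge (f : OverSimplex.mk 1 ⟶ .mk m) :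
      Q.map f.op x ∈ etaleLocus (q.app (op (.mk 1))) := by
    by_cases hf : Function.Injective (OverSimplex.toMap f)
    · obtain ⟨l, a, b, d, hpo⟩ := OverSimplex.exists_isPushout_edge f hf
      exact H.map_mem_etaleLocus hpo x hx
    · let g : OverSimplex.mk 0 ⟶ .mk m := fun _ ↦ OverSimplex.toMap f 0
      have : f = OverSimplex.toZero (.mk 1) ≫ g := by
        have h01 : OverSimplex.toMap f 0 = OverSimplex.toMap f 1 := by
          by_contra h
          refine hf fun i j hij ↦ ?_
          change Fin 2 at i j
          fin_cases i <;> fin_cases j <;> simp_all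
        funext i
        change Fin 2 at i
        fin_cases i
        · rfl
        · exact h01.symm
      rw [this, op_comp, Q.map_comp, Scheme.Hom.comp_apply]
      exact hbd _
  induction n with
  | zero => rw [H.etaleLocus_zero]; trivial
  | succ n ih =>
    obtain ⟨a, b, c, d, hpo⟩ := OverSimplex.exists_isPushout_last n
    refine H.mem_etaleLocus_of_map hpo _ ?_ ?_
    · rw [← Scheme.Hom.comp_apply, ← Q.map_comp, ← op_comp]
      exact ih _
    · rw [← Scheme.Hom.comp_apply, ← Q.map_comp, ← op_comp]
      exact hedge _

end IsNormalizedCover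

namespace IsNormalizedCover
variable {𝒱 Q P : OverSimplexᵒᵖ ⥤ Scheme.{u}} {t : 𝒱 ⟶ Q} {q : Q ⟶ P}
  (H : IsNormalizedCover t q)

include H

/-- The étale morphism to `Q_n` from the fibre product of the base changes of the étale loci takes values
in the étale locus, and this provides the inverse of the canonical morphism. -/
lemma isMultiplicativeHom_etaleLocus
    (hW : ∀ {a b : OverSimplexᵒᵖ} (α : a ⟶ b),
      etaleLocus (q.app a) ≤ Q.map α ⁻¹ᵁ etaleLocus (q.app b)) :
    IsMultiplicativeHom (openFunctorι Q (fun a ↦ etaleLocus (q.app a)) hW ≫ q) := by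
  intro m l n a b c d hpo
  have := H.isLocallyNoetherian (op n)
  let W := openFunctor Q (fun a ↦ etaleLocus (q.app a)) hW
  let w : W ⟶ Q := openFunctorι Q (fun a ↦ etaleLocus (q.app a)) hW
  have hwq (a : OverSimplexᵒᵖ) : Etale ((w ≫ q).app a) := etale_etaleLocus_ι (q.app a)
  have hwm (a : OverSimplexᵒᵖ) : Mono (w.app a) :=
    inferInstanceAs (Mono (etaleLocus (q.app a)).ι)
  let pm := pullback.snd ((w ≫ q).app (op m)) (P.map c.op)
  let pl := pullback.snd ((w ≫ q).app (op l)) (P.map d.op)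
  have hcm : (pullback.fst ((w ≫ q).app (op m)) (P.map c.op) ≫ w.app (op m)) ≫ q.app (op m) =
      pm ≫ P.map c.op := by
    rw [Category.assoc, ← NatTrans.comp_app]
    exact pullback.condition
  have hcl : (pullback.fst ((w ≫ q).app (op l)) (P.map d.op) ≫ w.app (op l)) ≫ q.app (op l) =
      pl ≫ P.map d.op := by
    rw [Category.assoc, ← NatTrans.comp_app]
    exact pullback.condition
  obtain ⟨h, _, h1, h2, h3, huniq⟩ := H.exists_etale_lift hpo hcm hcl
  have : Etale (h ≫ q.app (op n)) := by rw [h1]; infer_instance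
  have hlift : ∃ h' : pullback pm pl ⟶ (etaleLocus (q.app (op n))).toScheme,
      h' ≫ (etaleLocus (q.app (op n))).ι = h := by
    refine ⟨IsOpenImmersion.lift (etaleLocus (q.app (op n))).ι h ?_, IsOpenImmersion.lift_fac _ _ _⟩
    rw [Scheme.Opens.range_ι]
    rintro _ ⟨x, rfl⟩
    exact mem_etaleLocus_of_etale (q.app (op n)) h x
  obtain ⟨h', hh'⟩ : ∃ h' : pullback pm pl ⟶ W.obj (op n), h' ≫ w.app (op n) = h := hlift
  let gm := pullback.lift (f := (w ≫ q).app (op m)) (g := P.map c.op) (W.map c.op)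
    ((w ≫ q).app (op n)) ((w ≫ q).naturality c.op)
  let gl := pullback.lift (f := (w ≫ q).app (op l)) (g := P.map d.op) (W.map d.op)
    ((w ≫ q).app (op n)) ((w ≫ q).naturality d.op)
  have gm1 : gm ≫ pullback.fst _ _ = W.map c.op := pullback.lift_fst _ _ _
  have gm2 : gm ≫ pm = (w ≫ q).app (op n) := pullback.lift_snd _ _ _
  have gl1 : gl ≫ pullback.fst _ _ = W.map d.op := pullback.lift_fst _ _ _
  have gl2 : gl ≫ pl = (w ≫ q).app (op n) := pullback.lift_snd _ _ _
  have hg : gm ≫ pm = gl ≫ pl := gm2.trans gl2.symm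
  have h'n : h' ≫ (w ≫ q).app (op n) = pullback.fst pm pl ≫ pm :=
    ((reassoc_of% hh') (q.app (op n))).trans h1
  obtain ⟨g, e1, e2⟩ : ∃ g : W.obj (op n) ⟶ pullback pm pl,
      g ≫ pullback.fst pm pl = gm ∧ g ≫ pullback.snd pm pl = gl :=
    ⟨pullback.lift gm gl hg, pullback.lift_fst _ _ _, pullback.lift_snd _ _ _⟩
  have hgh : g ≫ h = w.app (op n) := by
    refine huniq (etaleLocus (q.app (op n))) g ?_ ?_ ?_
    · exact ((reassoc_of% e1) pm).trans gm2
    · exact ((reassoc_of% e1) _).trans (((reassoc_of% gm1) _).trans (w.naturality c.op))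
    · exact ((reassoc_of% e2) _).trans (((reassoc_of% gl1) _).trans (w.naturality d.op))
  refine IsPullback.of_iso_pullback ⟨hg⟩ ⟨g, h', ?_, ?_⟩ e1 e2
  · rw [← cancel_mono (w.app (op n)), Category.assoc, hh', hgh, Category.id_comp]
  · apply pullback.hom_ext
    · rw [Category.assoc, e1, Category.id_comp]
      apply pullback.hom_ext
      · rw [Category.assoc, gm1, ← cancel_mono (w.app (op m)), Category.assoc, w.naturality,
          reassoc_of% hh', h2, Category.assoc]
      · rw [Category.assoc]
        exact (h' ≫= gm2).trans h'n
    · rw [Category.assoc, e2, Category.id_comp]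
      apply pullback.hom_ext
      · rw [Category.assoc, gl1, ← cancel_mono (w.app (op l)), Category.assoc, w.naturality,
          reassoc_of% hh', h3, Category.assoc]
      · rw [Category.assoc]
        exact (h' ≫= gl2).trans (h'n.trans pullback.condition)

/-- If the degenerate edges lie in the étale locus, the étale loci form a multiplicative
oversimplicial open subscheme. -/
theorem etaleLocus_isMultiplicative
    (hbd : ∀ x, Q.map (OverSimplex.toZero (.mk 1)).op x ∈ etaleLocus (q.app (op (.mk 1)))) :
    ∃ hW : ∀ {a b : OverSimplexᵒᵖ} (α : a ⟶ b),
        etaleLocus (q.app a) ≤ Q.map α ⁻¹ᵁ etaleLocus (q.app b),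
      IsMultiplicativeHom (openFunctorι Q (fun a ↦ etaleLocus (q.app a)) hW ≫ q) ∧
      IsMultiplicative (openFunctor Q (fun a ↦ etaleLocus (q.app a)) hW) ∧
      DefinesGroupoid (openFunctor Q (fun a ↦ etaleLocus (q.app a)) hW) := by
  have hW {a b : OverSimplexᵒᵖ} (α : a ⟶ b) :
      etaleLocus (q.app a) ≤ Q.map α ⁻¹ᵁ etaleLocus (q.app b) := fun x hx ↦
    H.map_mem_etaleLocus_of_bounded hbd (n := b.unop.len) (m := a.unop.len) α.unop x hx
  have h := (H.isMultiplicativeHom_etaleLocus hW).isMultiplicative H.isMultiplicative_target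
  exact ⟨hW, H.isMultiplicativeHom_etaleLocus hW, h, h.definesGroupoid⟩

end IsNormalizedCover

/-! ### Dilatations: base change and multiplicativity -/
section
open Scheme.IdealSheafData

/-- A closed subscheme of `T` maps into the image of a closed immersion `i` if and only if its
ideal sheaf contains the inverse image of the ideal sheaf of `i`. -/
lemma ker_comap_le_iff {Z X T : Scheme.{u}} (i : Z ⟶ X) [IsClosedImmersion i] (f : T ⟶ X)
    (K : T.IdealSheafData) : i.ker.comap f ≤ K ↔ ∃ g, K.subschemeι ≫ f = g ≫ i := by
  rw [← le_map_iff_comap_le]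
  have h : K.map f = (K.subschemeι ≫ f).ker := rfl
  rw [h]
  refine ⟨fun hle ↦ ⟨IsClosedImmersion.lift i (K.subschemeι ≫ f) hle,
    (IsClosedImmersion.lift_fac i (K.subschemeι ≫ f) hle).symm⟩, ?_⟩
  rintro ⟨g, hg⟩
  rw [hg]
  exact Scheme.Hom.le_ker_comp _ _

end

section Dilatation
variable {P Y : Scheme.{u}} {κ : Type*} [Fintype κ] {I J : κ → P.IdealSheafData}
  {hJ : ∀ i, IsLocallyPrincipal (J i)}

omit [Fintype κ] in
/-- A scheme not meeting the divisors is admissible, whatever the centers. -/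
lemma IsAdmissible.of_comap_eq_top {f : Y ⟶ P} (h : ∀ i, (J i).comap f = ⊤) :
    IsAdmissible I J f :=
  ⟨fun i ↦ by rw [h]; exact isInvertible_top, fun i ↦ by rw [h]; exact le_top⟩

/-- A dilatation does not change the complement of the divisor. -/
lemma isPullback_dilLift_of_comap_eq_top {f : Y ⟶ P} (h : ∀ i, (J i).comap f = ⊤) :
    IsPullback (dilLift hJ f (.of_comap_eq_top (I := I) h)) (𝟙 Y) (dilStr I J hJ) f := by
  refine ⟨⟨by rw [dilLift_str, Category.id_comp]⟩, ⟨PullbackCone.IsLimit.mk _ (fun s ↦ s.snd)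
    (fun s ↦ ?_) (fun s ↦ Category.comp_id _) (fun s v _ hv ↦ by rw [← hv, Category.comp_id])⟩⟩
  refine dil_hom_ext (f := s.snd ≫ f) (.of_comap_eq_top fun i ↦ ?_) ?_ s.condition
  · rw [Scheme.IdealSheafData.comap_comp, h, Scheme.IdealSheafData.comap_top]
  · rw [Category.assoc, dilLift_str]

lemma isIso_dilStr (h : IsAdmissible I J (𝟙 P)) : IsIso (dilStr I J hJ) := by
  refine ⟨dilLift hJ (𝟙 P) h, ?_, dilLift_str _ h⟩
  refine dil_hom_ext (f := dilStr I J hJ) isAdmissible_dilStr ?_ (Category.id_comp _)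
  rw [Category.assoc, dilLift_str, Category.comp_id]

end Dilatation

section DilatationFunctor
variable {C : Type*} [Category* C] {P : C ⥤ Scheme.{u}} {κ : C → Type*} [∀ c, Fintype (κ c)]
    {I J : ∀ c, κ c → (P.obj c).IdealSheafData} (hJ : ∀ c i, IsLocallyPrincipal (J c i))
    (h : ∀ {c d : C} (α : c ⟶ d),
      IsAdmissible (I d) (J d) (dilStr (I c) (J c) (hJ c) ≫ P.map α))

/-- Dilatations commute with flat base change. -/
lemma isPullback_dilFunctor_map {c d : C} (α : c ⟶ d) [Flat (P.map α)]
    (hIJ : ∀ i, ∃ j, J c i = (J d j).comap (P.map α) ∧ I c i = (I d j).comap (P.map α)) :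
    IsPullback ((dilFunctor P I J hJ h).map α) ((dilFunctorStr P I J hJ h).app c)
      ((dilFunctorStr P I J hJ h).app d) (P.map α) := by
  let F := dilFunctor P I J hJ h
  let s : F ⟶ P := dilFunctorStr P I J hJ h
  let T := pullback (s.app d) (P.map α)
  have hs : IsAdmissible (I d) (J d) (s.app d) := isAdmissible_dilStr (hJ := hJ d)
  have hd : IsAdmissible (I d) (J d) (pullback.fst (s.app d) (P.map α) ≫ s.app d) :=
    hs.comp_of_flat _
  have hc : IsAdmissible (I c) (J c) (pullback.snd (s.app d) (P.map α)) := by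
    refine ⟨fun i ↦ ?_, fun i ↦ ?_⟩
    · obtain ⟨j, hj, -⟩ := hIJ i
      rw [hj, ← Scheme.IdealSheafData.comap_comp, ← pullback.condition]
      exact hd.isInvertible j
    · obtain ⟨j, hj, hj'⟩ := hIJ i
      rw [hj, hj', ← Scheme.IdealSheafData.comap_comp, ← Scheme.IdealSheafData.comap_comp,
        ← pullback.condition]
      exact hd.le j
  let v : T ⟶ F.obj c := dilLift (hJ c) _ hc
  have hv : v ≫ s.app c = pullback.snd (s.app d) (P.map α) := dilLift_str _ hc
  have hw := s.naturality α
  refine IsPullback.of_iso_pullback ⟨hw⟩ ⟨pullback.lift (F.map α) (s.app c) hw, v, ?_, ?_⟩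
    (pullback.lift_fst _ _ _) (pullback.lift_snd _ _ _)
  · refine dil_hom_ext (f := s.app c) (isAdmissible_dilStr (hJ := hJ c)) ?_ (Category.id_comp _)
    exact (Category.assoc _ _ _).trans ((_ ≫= hv).trans (pullback.lift_snd _ _ _))
  · apply pullback.hom_ext
    · rw [Category.assoc, pullback.lift_fst, Category.id_comp]
      refine dil_hom_ext hd ?_ rfl
      exact (Category.assoc _ _ _).trans
        ((v ≫= hw).trans (((reassoc_of% hv) _).trans pullback.condition.symm))
    · rw [Category.assoc, pullback.lift_snd, Category.id_comp, hv]

/-- Dilatation preserves cartesian squares with the complements of the divisors. -/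
lemma isPullback_dilFunctorLift {Y : C ⥤ Scheme.{u}} (t : Y ⟶ P)
    (ht : ∀ c i, (J c i).comap (t.app c) = ⊤) {c d : C} (α : c ⟶ d)
    (hY : IsPullback (Y.map α) (t.app c) (t.app d) (P.map α)) :
    IsPullback (Y.map α) ((dilFunctorLift hJ h t ht).app c) ((dilFunctorLift hJ h t ht).app d)
      ((dilFunctor P I J hJ h).map α) := by
  let F := dilFunctor P I J hJ h
  let s : F ⟶ P := dilFunctorStr P I J hJ h
  let u : Y ⟶ F := dilFunctorLift hJ h t ht
  have hu (a : C) : u.app a ≫ s.app a = t.app a := dilFunctorLift_str hJ h t ht a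
  have hcond (x : PullbackCone (u.app d) (F.map α)) :
      x.fst ≫ t.app d = (x.snd ≫ s.app c) ≫ P.map α := by
    rw [Category.assoc, ← s.naturality, ← hu, reassoc_of% x.condition]
  refine ⟨⟨u.naturality α⟩, ⟨PullbackCone.IsLimit.mk _ (fun x ↦ hY.lift _ _ (hcond x))
    (fun x ↦ hY.lift_fst _ _ _) (fun x ↦ ?_) fun x v hv hv' ↦ ?_⟩⟩
  · have h1 : hY.lift _ _ (hcond x) ≫ t.app c = x.snd ≫ s.app c := hY.lift_snd _ _ _
    refine dil_hom_ext (f := hY.lift _ _ (hcond x) ≫ t.app c)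
      (.of_comap_eq_top fun i ↦ ?_) ?_ h1.symm
    · rw [Scheme.IdealSheafData.comap_comp, ht, Scheme.IdealSheafData.comap_top]
    · exact (Category.assoc _ _ _).trans (_ ≫= hu c)
  · refine hY.hom_ext (hv.trans (hY.lift_fst _ _ _).symm) ?_
    rw [hY.lift_snd, ← hu]
    exact (reassoc_of% hv') _

end DilatationFunctor

section MultiplicativeDilatation
variable {P : OverSimplexᵒᵖ ⥤ Scheme.{u}} {κ : OverSimplexᵒᵖ → Type*} [∀ c, Fintype (κ c)]
    {I J : ∀ c, κ c → (P.obj c).IdealSheafData} (hJ : ∀ c i, IsLocallyPrincipal (J c i))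
    (h : ∀ {c d : OverSimplexᵒᵖ} (α : c ⟶ d),
      IsAdmissible (I d) (J d) (dilStr (I c) (J c) (hJ c) ≫ P.map α))

/-- The dilatations of a multiplicative oversimplicial scheme with centers in the images of the
degeneracies form a multiplicative oversimplicial scheme, if they are flat over the `0`-th one
and every divisor restricted to the fibre product comes from both factors. -/
lemma isMultiplicative_dilFunctor (hP : IsMultiplicative P)
    (hcl : ∀ a : OverSimplexᵒᵖ, IsClosedImmersion (P.map a.unop.toZero.op))
    (hI : ∀ a i, I a i = (P.map a.unop.toZero.op).ker)
    (hflat : ∀ {n : OverSimplex} (α : .mk 0 ⟶ n), Flat ((dilFunctor P I J hJ h).map α.op))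
    (hleg : ∀ {m l n : OverSimplex} {a : .mk 0 ⟶ m} {b : .mk 0 ⟶ l} {c : m ⟶ n} {d : l ⟶ n},
      IsPushout a b c d → ∀ {T : Scheme.{u}} (u : T ⟶ (dilFunctor P I J hJ h).obj (op m))
        (v : T ⟶ (dilFunctor P I J hJ h).obj (op l)) (w : T ⟶ P.obj (op n)),
        w ≫ P.map c.op = u ≫ (dilFunctorStr P I J hJ h).app (op m) →
        w ≫ P.map d.op = v ≫ (dilFunctorStr P I J hJ h).app (op l) →
        ∀ i, ∃ j k,
          (J (op n) i).comap w =
            (J (op m) j).comap (u ≫ (dilFunctorStr P I J hJ h).app (op m)) ∧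
          (J (op n) i).comap w =
            (J (op l) k).comap (v ≫ (dilFunctorStr P I J hJ h).app (op l))) :
    IsMultiplicative (dilFunctor P I J hJ h) := by
  intro m l n a b c d hpo
  let F := dilFunctor P I J hJ h
  let s : F ⟶ P := dilFunctorStr P I J hJ h
  have hs (a : OverSimplexᵒᵖ) : IsAdmissible (I a) (J a) (s.app a) :=
    isAdmissible_dilStr (hJ := hJ a)
  have hfa : Flat (F.map a.op) := hflat a
  have hfb : Flat (F.map b.op) := hflat b
  have hPn := hP a b c d hpo
  let T := pullback (F.map a.op) (F.map b.op)
  let u : T ⟶ F.obj (op m) := pullback.fst _ _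
  let v : T ⟶ F.obj (op l) := pullback.snd _ _
  have huv : u ≫ F.map a.op = v ≫ F.map b.op := pullback.condition
  have hum : IsAdmissible (I (op m)) (J (op m)) (u ≫ s.app (op m)) := (hs _).comp_of_flat u
  have hvl : IsAdmissible (I (op l)) (J (op l)) (v ≫ s.app (op l)) := (hs _).comp_of_flat v
  have hw0 : (u ≫ s.app (op m)) ≫ P.map a.op = (v ≫ s.app (op l)) ≫ P.map b.op := by
    rw [Category.assoc, Category.assoc, ← s.naturality, ← s.naturality, reassoc_of% huv]
  let w : T ⟶ P.obj (op n) := hPn.lift _ _ hw0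
  have hwc : w ≫ P.map c.op = u ≫ s.app (op m) := hPn.lift_fst _ _ _
  have hwd : w ≫ P.map d.op = v ≫ s.app (op l) := hPn.lift_snd _ _ _
  have hz {x y : OverSimplex} (f : x ⟶ y) : P.map y.toZero.op ≫ P.map f.op = P.map x.toZero.op := by
    rw [← P.map_comp, ← op_comp, OverSimplex.toZero_ext (f ≫ y.toZero) x.toZero]
  have hz0 {y : OverSimplex} (f : .mk 0 ⟶ y) : P.map y.toZero.op ≫ P.map f.op = 𝟙 _ := by
    rw [← P.map_comp, ← op_comp, OverSimplex.toZero_ext (f ≫ y.toZero) (𝟙 _), op_id, P.map_id]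
  -- on the divisor, the components of `w` in `P_m` and `P_l` factor through the degenerate simplices,
  -- by morphisms to `P_0` which agree, hence so does `w`
  have hadm : IsAdmissible (I (op n)) (J (op n)) w := by
    refine ⟨fun i ↦ ?_, fun i ↦ ?_⟩
    · obtain ⟨j, k, hj, hk⟩ := hleg hpo u v w hwc hwd i
      rw [hj]
      exact hum.isInvertible j
    · obtain ⟨j, k, hj, hk⟩ := hleg hpo u v w hwc hwd i
      have hjm := hum.le j
      have hkl := hvl.le k
      rw [← show _ = Scheme.IdealSheafData.comap _ _ from hj, hI] at hjm
      rw [← show _ = Scheme.IdealSheafData.comap _ _ from hk, hI] at hkl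
      have := hcl (op m)
      have := hcl (op l)
      have := hcl (op n)
      obtain ⟨gm, hgm⟩ := (ker_comap_le_iff _ _ _).mp hjm
      obtain ⟨gl, hgl⟩ := (ker_comap_le_iff _ _ _).mp hkl
      rw [hI]
      refine (ker_comap_le_iff _ _ _).mpr ⟨gm, ?_⟩
      have hml : gm = gl := by
        rw [← Category.comp_id gm, ← hz0 a, ← Category.comp_id gl, ← hz0 b]
        have h1 := congr($hgm ≫ P.map a.op)
        have h2 := congr($hgl ≫ P.map b.op)
        simp only [Category.assoc] at h1 h2
        refine h1.symm.trans (Eq.trans ?_ h2)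
        rw [← Category.assoc u, hw0, Category.assoc]
      refine hPn.hom_ext ?_ ?_
      · rw [Category.assoc, hwc, hgm, Category.assoc]
        exact gm ≫= (hz c).symm
      · rw [Category.assoc, hwd, hgl, Category.assoc, hml]
        exact gl ≫= (hz d).symm
  let r : T ⟶ F.obj (op n) := dilLift (hJ _) w hadm
  have hr : r ≫ s.app (op n) = w := dilLift_str _ hadm
  have hcomm : F.map c.op ≫ F.map a.op = F.map d.op ≫ F.map b.op := by
    rw [← F.map_comp, ← F.map_comp, ← op_comp, ← op_comp, hpo.w]
  let g : F.obj (op n) ⟶ T := pullback.lift _ _ hcomm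
  have hgu : g ≫ u = F.map c.op := pullback.lift_fst _ _ _
  have hgv : g ≫ v = F.map d.op := pullback.lift_snd _ _ _
  refine IsPullback.of_iso_pullback ⟨hcomm⟩ ⟨g, r, ?_, ?_⟩ hgu hgv
  · refine dil_hom_ext (f := s.app (op n)) (hs _) ?_ (Category.id_comp _)
    refine (Category.assoc _ _ _).trans ((g ≫= hr).trans (hPn.hom_ext ?_ ?_))
    · rw [Category.assoc, hwc, reassoc_of% hgu]
      exact s.naturality c.op
    · rw [Category.assoc, hwd, reassoc_of% hgv]
      exact s.naturality d.op
  · apply pullback.hom_ext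
    · rw [Category.assoc, Category.id_comp]
      refine dil_hom_ext hum ?_ rfl
      refine ((r ≫= hgu) =≫ _).trans ((Category.assoc _ _ _).trans ?_)
      exact (r ≫= s.naturality c.op).trans (((reassoc_of% hr) _).trans hwc)
    · rw [Category.assoc, Category.id_comp]
      refine dil_hom_ext hvl ?_ rfl
      refine ((r ≫= hgv) =≫ _).trans ((Category.assoc _ _ _).trans ?_)
      exact (r ≫= s.naturality d.op).trans (((reassoc_of% hr) _).trans hwd)

end MultiplicativeDilatation

/-! ### The dilatation of a smooth scheme in a section is smooth -/
section SmoothDilatation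

/-- The kernel of a section of an étale algebra is generated by an idempotent. -/
lemma exists_isIdempotentElem_ker_eq_span {A E : Type*} [CommRing A] [CommRing E] [Algebra A E]
    [Algebra.Etale A E] (r : E →ₐ[A] A) :
    ∃ e : E, IsIdempotentElem e ∧ RingHom.ker r = Ideal.span {e} := by
  have hr : Function.Surjective r := fun a ↦ ⟨algebraMap A E a, r.commutes a⟩
  have hfg : (RingHom.ker r).FG := Algebra.FinitePresentation.ker_fG_of_surjective r hr
  refine (Ideal.isIdempotentElem_iff_of_fg _ hfg).mp ?_
  let _ : Algebra E A := r.toRingHom.toAlgebra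
  have : IsScalarTower A E A := .of_algebraMap_eq fun a ↦ (r.commutes a).symm
  have : Algebra.Etale E A := .of_restrictScalars A E A
  exact (Algebra.FormallyEtale.iff_of_surjective hr).mp inferInstance

lemma CommRingCat.etale_of_isPushout' {R S R' S' : CommRingCat.{u}} {f : R ⟶ S} {g : R ⟶ R'}
    {f' : S ⟶ S'} {g' : R' ⟶ S'} (h : IsPushout f g f' g') (hf : f.hom.Etale) : g'.hom.Etale :=
  (RingHom.isStableUnderCobaseChange_toMorphismProperty_iff.mpr
    RingHom.Etale.isStableUnderBaseChange).of_isPushout h.flip hf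

lemma RingHom.Flat.map_mem_nonZeroDivisors {A B : Type*} [CommRing A] [CommRing B] {f : A →+* B}
    (hf : f.Flat) {t : A} (ht : t ∈ nonZeroDivisors A) : f t ∈ nonZeroDivisors B := by
  let _ := f.toAlgebra
  have : Module.Flat A B := hf
  have := Module.Flat.isSMulRegular_of_nonZeroDivisors (M := B) ht
  rw [mem_nonZeroDivisors_iff_right]
  intro x hx
  apply this
  simp only [smul_zero]
  rw [Algebra.smul_def, mul_comm]
  exact hx

/-- Up to localization, a standard smooth algebra with a section is étale over a polynomial ring in
generators of the kernel of the section. -/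
lemma RingHom.IsStandardSmooth.exists_etale_span_le {A C : Type u} [CommRing A] [CommRing C]
    {f : A →+* C} (hf : f.IsStandardSmooth) (ε : C →+* A) (hε : ε.comp f = .id A) :
    ∃ (n : ℕ) (φ : MvPolynomial (Fin n) A →+* C) (g : C), φ.comp MvPolynomial.C = f ∧ φ.Etale ∧
      ε g = 1 ∧ (∀ i, ε (φ (.X i)) = 0) ∧
      ∀ z, ε z = 0 → z * g ∈ Ideal.span (Set.range fun i ↦ φ (.X i)) := by
  obtain ⟨n, φ₀, hφ₀, hφ₀'⟩ := hf.exists_etale_mvPolynomial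
  let a (i : Fin n) : A := ε (φ₀ (.X i))
  -- translate the coordinates so that the section becomes the zero section
  let τ : MvPolynomial (Fin n) A →+* MvPolynomial (Fin n) A :=
    MvPolynomial.eval₂Hom MvPolynomial.C fun i ↦ .X i - .C (a i)
  let τ' : MvPolynomial (Fin n) A →+* MvPolynomial (Fin n) A :=
    MvPolynomial.eval₂Hom MvPolynomial.C fun i ↦ .X i + .C (a i)
  have h1 : τ.comp τ' = .id _ := by
    refine MvPolynomial.ringHom_ext (fun x ↦ ?_) fun i ↦ ?_ <;> simp [τ, τ']
  have h2 : τ'.comp τ = .id _ := by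
    refine MvPolynomial.ringHom_ext (fun x ↦ ?_) fun i ↦ ?_ <;> simp [τ, τ']
  have hτ : τ.Etale := .of_bijective
    ⟨Function.LeftInverse.injective (g := τ') fun x ↦ congr($h2 x),
      Function.RightInverse.surjective (g := τ') fun x ↦ congr($h1 x)⟩
  let φ := φ₀.comp τ
  have hφ : φ.Etale := RingHom.Etale.stableUnderComposition _ _ hτ hφ₀'
  have hφC : φ.comp MvPolynomial.C = f := by
    rw [← hφ₀]
    ext x
    simp [φ, τ]
  have hεφ (i : Fin n) : ε (φ (.X i)) = 0 := by
    have : ε (φ₀ (.C (a i))) = a i := by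
      have := congr(ε ($hφ₀ (a i)))
      exact this.trans congr($hε (a i))
    simp [φ, τ, this, a]
  -- the fibre product of `Spec C` with the zero section is étale over `A`, with ring `C ⧸ I`, and `ε`
  -- defines a section of it; the complement of this section is open and closed
  let ev : MvPolynomial (Fin n) A →+* A := MvPolynomial.eval₂Hom (.id A) fun _ ↦ 0
  let i := pushout.inl (CommRingCat.ofHom φ) (CommRingCat.ofHom ev)
  let j := pushout.inr (CommRingCat.ofHom φ) (CommRingCat.ofHom ev)
  have hij : CommRingCat.ofHom φ ≫ i = CommRingCat.ofHom ev ≫ j := pushout.condition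
  have hj : j.hom.Etale := CommRingCat.etale_of_isPushout' (.of_hasPushout _ _) hφ
  let r := pushout.desc (f := CommRingCat.ofHom φ) (g := CommRingCat.ofHom ev)
    (CommRingCat.ofHom ε) (𝟙 _) (by
      refine CommRingCat.hom_ext (MvPolynomial.ringHom_ext (fun x ↦ ?_) fun i ↦ ?_)
      · have := congr(ε ($hφC x))
        simpa [ev] using this.trans congr($hε x)
      · simpa [ev] using hεφ i)
  have hir : i ≫ r = CommRingCat.ofHom ε := pushout.inl_desc _ _ _
  have hjr : j ≫ r = 𝟙 _ := pushout.inr_desc _ _ _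
  let I := Ideal.span (Set.range fun i ↦ φ (.X i))
  let s := pushout.desc (f := CommRingCat.ofHom φ) (g := CommRingCat.ofHom ev)
    (CommRingCat.ofHom (Ideal.Quotient.mk I)) (CommRingCat.ofHom ((Ideal.Quotient.mk I).comp f)) (by
      refine CommRingCat.hom_ext (MvPolynomial.ringHom_ext (fun x ↦ ?_) fun i ↦ ?_)
      · simp [ev, ← hφC]
      · simp only [CommRingCat.hom_comp, CommRingCat.hom_ofHom, RingHom.comp_apply]
        rw [Ideal.Quotient.eq_zero_iff_mem.mpr
          (show φ (.X i) ∈ I from Ideal.subset_span ⟨i, rfl⟩)]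
        simp [ev])
  have his : i ≫ s = CommRingCat.ofHom (Ideal.Quotient.mk I) := pushout.inl_desc _ _ _
  have hjs : j ≫ s = CommRingCat.ofHom ((Ideal.Quotient.mk I).comp f) := pushout.inr_desc _ _ _
  have hiI : I ≤ RingHom.ker i.hom := by
    rw [Ideal.span_le]
    rintro _ ⟨k, rfl⟩
    have : i (φ (.X k)) = j (ev (.X k)) := congr($hij (.X k))
    rw [SetLike.mem_coe, RingHom.mem_ker, this]
    simp [ev]
  let l : CommRingCat.of (C ⧸ I) ⟶ pushout (CommRingCat.ofHom φ) (CommRingCat.ofHom ev) :=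
    CommRingCat.ofHom (Ideal.Quotient.lift I i.hom fun x hx ↦ hiI hx)
  have hsl : s ≫ l = 𝟙 _ := by
    apply pushout.hom_ext
    · rw [← Category.assoc]
      refine (his =≫ l).trans ?_
      rfl
    · rw [← Category.assoc]
      refine (hjs =≫ l).trans ?_
      ext x
      have h3 : i (φ (.C x)) = j (ev (.C x)) := congr($hij (.C x))
      have h4 : φ (.C x) = f x := congr($hφC x)
      have h5 : ev (.C x) = x := by simp [ev]
      rw [h4, h5] at h3
      exact h3
  have hsurj : Function.Surjective i := fun x ↦ by
    obtain ⟨y, hy⟩ := Ideal.Quotient.mk_surjective (s x)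
    refine ⟨y, ?_⟩
    have h3 : l (s x) = x := congr($hsl x)
    rw [← h3, ← hy]
    rfl
  have hker (x : C) (hx : i x = 0) : x ∈ I := by
    have : s (i x) = Ideal.Quotient.mk I x := congr($his x)
    rw [hx, map_zero] at this
    exact Ideal.Quotient.eq_zero_iff_mem.mp this.symm
  let _ := j.hom.toAlgebra
  have : Algebra.Etale A ↑(pushout (CommRingCat.ofHom φ) (CommRingCat.ofHom ev)) := hj
  let r' : ↑(pushout (CommRingCat.ofHom φ) (CommRingCat.ofHom ev)) →ₐ[A] A :=
    { r.hom with commutes' x := congr($hjr x) }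
  obtain ⟨e, he, hre⟩ := exists_isIdempotentElem_ker_eq_span r'
  obtain ⟨e₀, rfl⟩ := hsurj e
  have hri (x : C) : r' (i x) = ε x := congr($hir x)
  have he₀ : ε e₀ = 0 := by
    rw [← hri, ← RingHom.mem_ker, hre]
    exact Ideal.mem_span_singleton_self _
  refine ⟨n, φ, 1 - e₀, hφC, hφ, by rw [map_sub, map_one, he₀, sub_zero], hεφ,
    fun z hz ↦ hker _ ?_⟩
  obtain ⟨w, hw⟩ := Ideal.mem_span_singleton.mp
    (show i z ∈ Ideal.span {i e₀} by rw [← hre, RingHom.mem_ker, hri, hz])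
  rw [map_mul, map_sub, map_one, hw]
  linear_combination -w * he.eq

/-- The dilatation of a standard smooth algebra in a section is smooth, locally around the section:
in étale coordinates, it is given by division of the coordinates by `t`. -/
lemma RingHom.IsStandardSmooth.exists_smooth_dilatation {A C : Type u} [CommRing A] [CommRing C]
    {f : A →+* C} (hf : f.IsStandardSmooth) (ε : C →+* A) (hε : ε.comp f = .id A) (t : A) :
    ∃ (g : C) (D : CommRingCat.{u}) (γ : C →+* D), ε g = 1 ∧ (γ.comp f).Smooth ∧
      IsUnit (γ g) ∧ (∀ z, ε z = 0 → γ (f t) ∣ γ z) ∧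
      (∀ (R : CommRingCat.{u}) (ρ : C →+* R), IsUnit (ρ g) → ρ (f t) ∈ nonZeroDivisors R →
        (∀ z, ε z = 0 → ρ (f t) ∣ ρ z) → ∃ δ : D →+* R, δ.comp γ = ρ) ∧
      (∀ (R : CommRingCat.{u}) (δ δ' : D →+* R), δ.comp γ = δ'.comp γ →
        δ (γ (f t)) ∈ nonZeroDivisors R → δ = δ') := by
  obtain ⟨n, φ, g, hφC, hφ, hg, hεφ, hker⟩ := hf.exists_etale_span_le ε hε
  -- `D` is a localization of the base change of `C` along multiplication of the coordinates by `t`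
  let ψ : MvPolynomial (Fin n) A →+* MvPolynomial (Fin n) A :=
    MvPolynomial.eval₂Hom MvPolynomial.C fun i ↦ .C t * .X i
  let i := pushout.inl (CommRingCat.ofHom φ) (CommRingCat.ofHom ψ)
  let j := pushout.inr (CommRingCat.ofHom φ) (CommRingCat.ofHom ψ)
  have hij : CommRingCat.ofHom φ ≫ i = CommRingCat.ofHom ψ ≫ j := pushout.condition
  have hj : j.hom.Etale := CommRingCat.etale_of_isPushout' (.of_hasPushout _ _) hφ
  have hif (x : A) : i (f x) = j (.C x) := by
    have h1 : φ (.C x) = f x := congr($hφC x)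
    have h2 : ψ (.C x) = .C x := by simp [ψ]
    rw [← h1]
    exact (congr($hij (.C x))).trans (congrArg j h2)
  have hix (k : Fin n) : i (φ (.X k)) = i (f t) * j (.X k) := by
    have h2 : ψ (.X k) = .C t * .X k := by simp [ψ]
    rw [hif, ← map_mul, ← h2]
    exact congr($hij (.X k))
  let D := CommRingCat.of (Localization.Away (i g))
  let loc : ↑(pushout (CommRingCat.ofHom φ) (CommRingCat.ofHom ψ)) →+* D :=
    algebraMap _ (Localization.Away (i g))
  let γ : C →+* D := loc.comp i.hom
  refine ⟨g, D, γ, hg, ?_, IsLocalization.Away.algebraMap_isUnit (i g), fun z hz ↦ ?_,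
    fun R ρ hρg hρt hρ ↦ ?_, fun R δ δ' hδ hδt ↦ ?_⟩
  · have h1 : γ.comp f = (loc.comp j.hom).comp MvPolynomial.C :=
      RingHom.ext fun x ↦ congrArg loc (hif x)
    have h2 : (MvPolynomial.C : A →+* MvPolynomial (Fin n) A).Smooth :=
      RingHom.smooth_algebraMap.mpr ⟨inferInstance, inferInstance⟩
    have h3 : loc.Smooth := RingHom.Smooth.holdsForLocalizationAway _ (i g)
    rw [h1]
    exact h2.comp ((RingHom.etale_iff_formallyUnramified_and_smooth j.hom).mp hj |>.2.comp h3)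
  · have h1 : Ideal.span (Set.range fun i ↦ φ (.X i)) ≤ (Ideal.span {γ (f t)}).comap γ := by
      rw [Ideal.span_le]
      rintro _ ⟨k, rfl⟩
      exact Ideal.mem_span_singleton.mpr ⟨loc (j (.X k)), (congrArg loc (hix k)).trans (map_mul _ _ _)⟩
    have h2 := Ideal.mem_span_singleton.mp (h1 (hker z hz))
    rw [map_mul] at h2
    exact (IsLocalization.Away.algebraMap_isUnit (i g)).dvd_mul_right.mp h2
  · choose r hr using fun k ↦ hρ _ (hεφ k)
    let η : MvPolynomial (Fin n) A →+* R := MvPolynomial.eval₂Hom (ρ.comp f) r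
    let δ₀ : pushout (CommRingCat.ofHom φ) (CommRingCat.ofHom ψ) ⟶ R :=
      pushout.desc (CommRingCat.ofHom ρ) (CommRingCat.ofHom η) (by
        refine CommRingCat.hom_ext (MvPolynomial.ringHom_ext (fun x ↦ ?_) fun k ↦ ?_)
        · simp [η, ψ, ← hφC]
        · simp [η, ψ, hr k])
    have hδ₀ : i ≫ δ₀ = CommRingCat.ofHom ρ := pushout.inl_desc _ _ _
    have hδ₀' (x : C) : δ₀ (i x) = ρ x := congr($hδ₀ x)
    have hu : IsUnit (δ₀.hom (i g)) := (hδ₀' g).symm ▸ hρg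
    exact ⟨IsLocalization.Away.lift (S := Localization.Away (i g)) (g := δ₀.hom) (i g) hu,
      RingHom.ext fun x ↦ (IsLocalization.Away.lift_eq (S := Localization.Away (i g)) (i g) hu
        (i x)).trans (hδ₀' x)⟩
  · have h1 (x : C) : δ (γ x) = δ' (γ x) := congr($hδ x)
    refine IsLocalization.ringHom_ext (S := Localization.Away (i g)) (.powers (i g)) ?_
    suffices CommRingCat.ofHom (δ.comp loc) = CommRingCat.ofHom (δ'.comp loc) from
      congr(($this).hom)
    apply pushout.hom_ext
    · exact CommRingCat.hom_ext hδ
    · refine CommRingCat.hom_ext (MvPolynomial.ringHom_ext (fun x ↦ ?_) fun k ↦ ?_)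
      · change δ (loc (j (.C x))) = δ' (loc (j (.C x)))
        rw [← hif]
        exact h1 _
      · change δ (loc (j (.X k))) = δ' (loc (j (.X k)))
        have h2 : γ (φ (.X k)) = γ (f t) * loc (j (.X k)) :=
          (congrArg loc (hix k)).trans (map_mul _ _ _)
        have h3 := congrArg δ h2
        have h4 := congrArg δ' h2
        rw [map_mul] at h3 h4
        rw [← h1, ← h1, h3] at h4
        exact (mul_cancel_left_mem_nonZeroDivisors hδt).mp h4

end SmoothDilatation

section DilatationChart
open Scheme.IdealSheafData

/-- A generator of an invertible ideal over any affine open subset is a nonzerodivisor. -/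
lemma IsInvertible.mem_nonZeroDivisors {X : Scheme.{u}} {K : X.IdealSheafData} (hK : IsInvertible K)
    {W : X.affineOpens} {t : Γ(X, W)} (e : K.ideal W = Ideal.span {t}) :
    t ∈ nonZeroDivisors Γ(X, W) := by
  rw [mem_nonZeroDivisors_iff_right]
  intro x hx
  refine TopCat.Presheaf.section_ext X.sheaf W.1 _ _ fun p hp ↦ ?_
  obtain ⟨U, hpU, hUW, t', ht', e'⟩ := hK.exists_le W.1 p hp
  rw [ideal_span_of_le hUW e] at e'
  obtain ⟨c, hc⟩ := Ideal.mem_span_singleton.mp (e'.ge (Ideal.mem_span_singleton_self t'))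
  have h1 : X.presheaf.map (homOfLE hUW).op x = 0 := by
    refine (mem_nonZeroDivisors_iff_right.mp ht') _ ?_
    rw [hc, ← mul_assoc, ← map_mul, hx, map_zero, zero_mul]
  have h2 := X.presheaf.germ_res_apply (homOfLE hUW) p hpU x
  rw [h1, map_zero] at h2
  exact h2.symm.trans (map_zero _).symm

variable {P : Scheme.{u}} {κ : Type*} [Fintype κ] {I J : κ → P.IdealSheafData}
  {hJ : ∀ i, IsLocallyPrincipal (J i)}

omit [Fintype κ] in
/-- Admissibility of a morphism from an affine scheme to an affine open subset, in terms of rings. -/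
lemma isAdmissible_specMap_iff {V : P.affineOpens} {R : CommRingCat.{u}} (ρ : Γ(P, V) ⟶ R)
    {t : κ → Γ(P, V)} (ht : ∀ i, (J i).ideal V = Ideal.span {t i}) :
    IsAdmissible I J (Spec.map ρ ≫ V.2.fromSpec) ↔
      ∀ i, ρ (t i) ∈ nonZeroDivisors R ∧ ∀ z ∈ (I i).ideal V, ρ (t i) ∣ ρ z := by
  let f := Spec.map ρ ≫ V.2.fromSpec
  let W : (Spec R).affineOpens := ⟨⊤, isAffineOpen_top _⟩
  have hW : W.1 ≤ f ⁻¹ᵁ V.1 := RelSpec.specMap_fromSpec_le V.2 ρ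
  let e : R ≃+* Γ(Spec R, W) := (Scheme.ΓSpecIso R).symm.commRingCatIsoToRingEquiv
  have he (x : Γ(P, V)) : f.appLE V W hW x = e (ρ x) := by
    have := congr((Scheme.ΓSpecIso R).inv ($(RelSpec.specMap_fromSpec_appLE V.2 ρ) x))
    refine Eq.trans ?_ this
    rw [CommRingCat.comp_apply]
    exact congr($((Scheme.ΓSpecIso R).hom_inv_id) _).symm
  have hJf (i : κ) : ((J i).comap f).ideal W = Ideal.span {e (ρ (t i))} := by
    rw [ideal_comap f (J i) V W hW, ht, Ideal.map_span, Set.image_singleton]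
    exact congrArg (fun x ↦ Ideal.span {x}) (he (t i))
  have hnzd (x : R) : e x ∈ nonZeroDivisors Γ(Spec R, W) ↔ x ∈ nonZeroDivisors R := by
    rw [mem_nonZeroDivisors_iff_right, mem_nonZeroDivisors_iff_right]
    refine ⟨fun h y hy ↦ ?_, fun h y hy ↦ ?_⟩
    · have := h (e y) (by rw [← map_mul, hy, map_zero])
      rwa [map_eq_zero_iff _ e.injective] at this
    · obtain ⟨y, rfl⟩ := e.surjective y
      rw [← map_mul, map_eq_zero_iff _ e.injective] at hy
      rw [h y hy, map_zero]
  have hle (i : κ) : (I i).comap f ≤ (J i).comap f ↔ ∀ z ∈ (I i).ideal V, ρ (t i) ∣ ρ z := by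
    refine ⟨fun h z hz ↦ ?_, fun h ↦ ?_⟩
    · have h1 := h W
      rw [hJf, ideal_comap f (I i) V W hW, Ideal.map_le_iff_le_comap] at h1
      have h2 := Ideal.mem_span_singleton.mp (h1 hz)
      change _ ∣ f.appLE V W hW z at h2
      rwa [he, map_dvd_iff] at h2
    · refine le_of_isAffine ?_
      change ((I i).comap f).ideal W ≤ ((J i).comap f).ideal W
      rw [hJf, ideal_comap f (I i) V W hW, Ideal.map_le_iff_le_comap]
      intro z hz
      refine Ideal.mem_span_singleton.mpr ?_
      change _ ∣ f.appLE V W hW z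
      rw [he, map_dvd_iff]
      exact h z hz
  refine ⟨fun h i ↦ ⟨?_, (hle i).mp (h.le i)⟩, fun h ↦ ⟨fun i x ↦ ⟨W, trivial, _, ?_, hJf i⟩,
    fun i ↦ (hle i).mpr (h i).2⟩⟩
  · exact (hnzd _).mp ((h.isInvertible i).mem_nonZeroDivisors (hJf i))
  · exact (hnzd _).mpr (h i).1

/-- Recognition of an affine chart of a dilatation by its universal property among the spectra of
algebras over the ring of an affine open subset. -/
lemma isOpenImmersion_dilLift_specMap {V : P.affineOpens} {R : CommRingCat.{u}} (γ : Γ(P, V) ⟶ R)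
    (g : Γ(P, V)) (hγ : IsAdmissible I J (Spec.map γ ≫ V.2.fromSpec)) (hg : IsUnit (γ g))
    (h₁ : ∀ (S : CommRingCat.{u}) (ρ : Γ(P, V) ⟶ S), IsUnit (ρ g) →
      IsAdmissible I J (Spec.map ρ ≫ V.2.fromSpec) → ∃ δ : R ⟶ S, γ ≫ δ = ρ)
    (h₂ : ∀ δ : R ⟶ R, γ ≫ δ = γ → δ = 𝟙 R) :
    IsOpenImmersion (dilLift hJ _ hγ) ∧
      ∀ x, dilStr I J hJ x ∈ P.basicOpen g → x ∈ Set.range (dilLift hJ _ hγ) := by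
  have := V.2.isOpenImmersion_fromSpec
  let E := dil I J hJ
  let s : E ⟶ P := dilStr I J hJ
  let n := Spec.map γ ≫ V.2.fromSpec
  let O : E.Opens := s ⁻¹ᵁ P.basicOpen g
  have hO : IsAffineOpen O := (V.2.basicOpen g).preimage s
  have hOV : O ≤ s ⁻¹ᵁ V.1 := fun x hx ↦ P.basicOpen_le g hx
  let ρ : Γ(P, V) ⟶ Γ(E, O) := s.appLE V O hOV
  have hρ : Spec.map ρ ≫ V.2.fromSpec = hO.fromSpec ≫ s := V.2.SpecMap_appLE_fromSpec s hO hOV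
  obtain ⟨δ, hδ⟩ := h₁ _ ρ (isUnit_appLE s hOV g le_rfl) (by
    rw [hρ]
    exact (isAdmissible_dilStr (hJ := hJ)).comp_of_flat _)
  -- the universal properties identify `Spec R` with the inverse image `O` of the basic open subset
  let μ : Spec R ⟶ E := dilLift hJ n hγ
  have hμ : μ ≫ s = n := dilLift_str _ hγ
  have hδμ : Spec.map δ ≫ μ = hO.fromSpec := by
    refine dil_hom_ext (f := hO.fromSpec ≫ s)
      ((isAdmissible_dilStr (hJ := hJ)).comp_of_flat _) ?_ rfl
    refine (Category.assoc _ _ _).trans ((Spec.map δ ≫= hμ).trans ?_)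
    rw [← hρ, ← hδ, Spec.map_comp, Category.assoc]
  have hrange : Set.range μ ⊆ Set.range hO.fromSpec := by
    rw [hO.range_fromSpec]
    rintro _ ⟨x, rfl⟩
    change s (μ x) ∈ P.basicOpen g
    rw [show s (μ x) = n x from congr($hμ x)]
    have h3 := RelSpec.specMap_fromSpec_le V.2 γ
    have h4 : IsUnit (n.appLE V ⊤ h3 g) := by
      have h5 : (Scheme.ΓSpecIso R).hom (n.appLE V ⊤ h3 g) = γ g :=
        congr($(RelSpec.specMap_fromSpec_appLE V.2 γ) g)
      rw [← h5] at hg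
      exact (isUnit_map_iff (Scheme.ΓSpecIso R).commRingCatIsoToRingEquiv _).mp hg
    have h5 := (Spec R).basicOpen_of_isUnit h4
    rw [Scheme.basicOpen_appLE] at h5
    exact (h5.ge (show x ∈ (⊤ : (Spec R).Opens) from trivial)).2
  let μ' : Spec R ⟶ Spec Γ(E, O) := IsOpenImmersion.lift hO.fromSpec μ hrange
  have hμ' : μ' ≫ hO.fromSpec = μ := IsOpenImmersion.lift_fac _ _ _
  have e₁ : Spec.map δ ≫ μ' = 𝟙 _ := by
    rw [← cancel_mono hO.fromSpec, Category.assoc, hμ', hδμ, Category.id_comp]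
  have e₂ : μ' ≫ Spec.map δ = 𝟙 _ := by
    have h3 : (μ' ≫ Spec.map δ) ≫ n = n := by
      have : Spec.map δ ≫ n = hO.fromSpec ≫ s := by
        rw [← hρ, ← hδ, Spec.map_comp, Category.assoc]
      rw [Category.assoc, this, reassoc_of% hμ', hμ]
    have h4 : Spec.preimage (μ' ≫ Spec.map δ) = 𝟙 _ := by
      refine h₂ _ (Spec.map_injective ?_)
      rw [Spec.map_comp, Spec.map_preimage, ← cancel_mono V.2.fromSpec, Category.assoc]
      exact h3
    rw [← Spec.map_preimage (μ' ≫ Spec.map δ), h4, Spec.map_id]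
  have : IsIso μ' := ⟨Spec.map δ, e₂, e₁⟩
  have hμo : IsOpenImmersion μ := by
    rw [← hμ']
    infer_instance
  refine ⟨hμo, fun x hx ↦ ?_⟩
  obtain ⟨y, hy⟩ : x ∈ Set.range hO.fromSpec := by
    rw [hO.range_fromSpec]
    exact hx
  exact ⟨Spec.map δ y, (congr($hδμ y)).trans hy⟩

end DilatationChart

section SmoothDilatation
open Scheme.IdealSheafData

lemma smooth_of_forall_exists {X Y : Scheme.{u}} (f : X ⟶ Y)
    (h : ∀ x, ∃ (U : Scheme.{u}) (j : U ⟶ X), IsOpenImmersion j ∧ x ∈ Set.range j ∧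
      Smooth (j ≫ f)) : Smooth f := by
  choose U j hj hx hf using h
  have : IsZariskiLocalAtSource @Smooth := HasRingHomProperty.instIsZariskiLocalAtSource
  exact (IsZariskiLocalAtSource.iff_of_openCover (P := @Smooth)
    (Scheme.Cover.mkOfCovers X U j (fun x ↦ ⟨x, hx x⟩) hj)).mpr hf

variable {Y S : Scheme.{u}} (q : Y ⟶ S) [Smooth q] (σ : S ⟶ Y) [IsClosedImmersion σ]

omit [IsClosedImmersion σ] in
/-- Affine charts around a point of a section of a smooth morphism. -/
lemma exists_isStandardSmooth_section (hσ : σ ≫ q = 𝟙 S) {J : S.IdealSheafData}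
    (hJ : IsInvertible J) (s : S) :
    ∃ (U : S.affineOpens) (V : Y.affineOpens) (_ : s ∈ U.1) (hV : V.1 ≤ q ⁻¹ᵁ U.1)
      (_ : U.1 ≤ σ ⁻¹ᵁ V.1) (t : Γ(S, U)), (q.appLE U V hV).hom.IsStandardSmooth ∧
      J.ideal U = Ideal.span {t} := by
  obtain ⟨U, hU, V, hV, hxV, hVU, hst⟩ := Smooth.exists_isStandardSmooth q (σ s)
  have hqs : q (σ s) = s := congr($hσ s)
  have hsU : s ∈ U := hqs ▸ hVU hxV
  obtain ⟨U', hsU', hU', t, ht, e⟩ := hJ.exists_le (U ⊓ σ ⁻¹ᵁ V) s ⟨hsU, hxV⟩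
  obtain ⟨a, ha, hsa⟩ := hU.exists_basicOpen_le (V := U'.1) ⟨s, hsU'⟩ hsU
  have hle : S.basicOpen a ≤ U'.1 := ha
  let a' : Γ(Y, V) := q.appLE U V hVU a
  have ha' : Y.basicOpen a' = V ⊓ q ⁻¹ᵁ S.basicOpen a := Scheme.basicOpen_appLE _ _ _ _ _
  refine ⟨⟨S.basicOpen a, hU.basicOpen a⟩, ⟨Y.basicOpen a', hV.basicOpen a'⟩, hsa,
    ha'.le.trans inf_le_right, fun x hx ↦ ?_, _, ?_, ideal_span_of_le hle e⟩
  · change σ x ∈ Y.basicOpen a'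
    rw [ha']
    refine ⟨(hU' (hle hx) : x ∈ U ⊓ σ ⁻¹ᵁ V).2, ?_⟩
    change q (σ x) ∈ S.basicOpen a
    rwa [show q (σ x) = x from congr($hσ x)]
  · have h1 := IsAffineOpen.appLE_eq_away_map q hU hV hVU a
    let _ := hU.isLocalization_basicOpen a
    let _ := hV.isLocalization_basicOpen a'
    have h2 := RingHom.isStandardSmooth_localizationPreserves.away (q.appLE U V hVU).hom a
      Γ(S, S.basicOpen a) Γ(Y, Y.basicOpen a') hst
    exact (congr(($h1).hom)).symm ▸ h2

/-- The dilatation of a smooth scheme in a section with respect to an effective Cartier divisor of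
the base is smooth. -/
theorem smooth_dilStr_ker_section (hσ : σ ≫ q = 𝟙 S) {J : S.IdealSheafData} (hJ : IsInvertible J)
    (hJ' : ∀ _ : Unit, IsLocallyPrincipal (J.comap q)) :
    Smooth (dilStr (fun _ : Unit ↦ σ.ker) (fun _ ↦ J.comap q) hJ' ≫ q) := by
  refine smooth_of_forall_exists _ fun e ↦ ?_
  let I' : Unit → Y.IdealSheafData := fun _ ↦ σ.ker
  let J' : Unit → Y.IdealSheafData := fun _ ↦ J.comap q
  let p := dilStr I' J' hJ'
  by_cases he : p e ∈ complOpen (J.comap q)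
  · -- away from the divisor, the dilatation is an isomorphism
    have hpb := isPullback_dilLift_of_comap_eq_top (f := (complOpen (J.comap q)).ι)
      (I := I') (J := J') (hJ := hJ') fun _ ↦ comap_complOpen_ι _
    refine ⟨_, _, MorphismProperty.of_isPullback hpb.flip inferInstance, ?_, ?_⟩
    · obtain ⟨z, hz, -⟩ := Scheme.exists_preimage_of_isPullback hpb e ⟨p e, he⟩ rfl
      exact ⟨z, hz⟩
    · rw [← Category.assoc, dilLift_str]
      infer_instance
  · have hadm : IsAdmissible I' J' p := isAdmissible_dilStr
    -- on the divisor, points of the dilatation map to the section, around which there are étale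
    -- coordinates
    obtain ⟨s, hs⟩ : p e ∈ Set.range σ := by
      have h1 : e ∈ ((J.comap q).comap p).support := by
        rw [support_comap]
        exact not_not.mp he
      have h2 := support_antitone (hadm.le ()) h1
      rw [support_comap] at h2
      have h3 : p e ∈ (σ.ker.support : Set Y) := h2
      rwa [Scheme.Hom.support_ker, σ.isClosedEmbedding.isClosed_range.closure_eq] at h3
    obtain ⟨U, V, hsU, hV, hU, t, hst, ht⟩ := exists_isStandardSmooth_section q σ hσ hJ s
    have hε : (σ.appLE V U hU).hom.comp (q.appLE U V hV).hom = .id _ := by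
      rw [← CommRingCat.hom_comp, Scheme.Hom.appLE_comp_appLE]
      refine RingHom.ext fun x ↦ (appLE_congr hσ U.1 U.1 _ le_rfl x).trans ?_
      exact congr($((Category.id_comp _).trans (S.presheaf.map_id _)) x)
    have htV : ∀ _ : Unit, (J.comap q).ideal V = Ideal.span {q.appLE U V hV t} := fun _ ↦ by
      rw [ideal_comap q J U V hV, ht, Ideal.map_span, Set.image_singleton]
    have hker (z : Γ(Y, V)) : z ∈ σ.ker.ideal V ↔ σ.appLE V U hU z = 0 := by
      have h1 : U.1 = σ ⁻¹ᵁ V.1 := hU.antisymm fun x hx ↦ by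
        have : q (σ x) ∈ U.1 := hV hx
        rwa [show q (σ x) = x from congr($hσ x)] at this
      have := isIso_map_of_eq (homOfLE hU) h1
      rw [Scheme.Hom.ker_apply, RingHom.mem_ker, Scheme.Hom.appLE, CommRingCat.comp_apply]
      exact (map_eq_zero_iff _ (ConcreteCategory.bijective_of_isIso
        (S.presheaf.map (homOfLE hU).op)).1).symm
    have htU : t ∈ nonZeroDivisors Γ(S, U) := hJ.mem_nonZeroDivisors ht
    obtain ⟨g, D, γ, hg, hγ, hγg, hdvd, hex, huniq⟩ := hst.exists_smooth_dilatation _ hε t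
    have hγt : γ (q.appLE U V hV t) ∈ nonZeroDivisors D := hγ.flat.map_mem_nonZeroDivisors htU
    obtain ⟨ho, hrange⟩ := isOpenImmersion_dilLift_specMap (I := I') (J := J') (hJ := hJ')
      (CommRingCat.ofHom γ) g ((isAdmissible_specMap_iff _ htV).mpr fun _ ↦
        ⟨hγt, fun z hz ↦ hdvd z ((hker z).mp hz)⟩) hγg (fun R ρ hρg hρ ↦ by
          have h1 := (isAdmissible_specMap_iff _ htV).mp hρ ()
          obtain ⟨δ, hδ⟩ := hex R ρ.hom hρg h1.1 fun z hz ↦ h1.2 z ((hker z).mpr hz)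
          exact ⟨CommRingCat.ofHom δ, CommRingCat.hom_ext hδ⟩) fun δ hδ ↦ by
            refine CommRingCat.hom_ext (huniq _ _ _ congr(($hδ).hom) ?_)
            have := congr($hδ (q.appLE U V hV t))
            exact this.symm ▸ hγt
    refine ⟨_, _, ho, hrange e ?_, ?_⟩
    · change p e ∈ _
      rw [← hs]
      have h1 := S.basicOpen_of_isUnit (hg.symm ▸ isUnit_one : IsUnit (σ.appLE V U hU g))
      rw [Scheme.basicOpen_appLE] at h1
      exact (h1.ge hsU).2
    · rw [← Category.assoc, dilLift_str, Category.assoc, ← U.2.SpecMap_appLE_fromSpec q V.2 hV, ← Category.assoc,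
        ← Spec.map_comp]
      have h1 : Smooth (Spec.map (q.appLE U V hV ≫ CommRingCat.ofHom γ)) :=
        (HasRingHomProperty.Spec_iff (P := @Smooth)).mpr hγ
      have := U.2.isOpenImmersion_fromSpec
      infer_instance

end SmoothDilatation

/-! ### Smoothness and multiplicativity of `P^{(D)}` -/
section EqualDivisors
open Scheme.IdealSheafData

/-- If `K ≤ J` are locally principal and become the same effective Cartier divisor on `Z`, then
they already coincide near the image of `Z`. -/
lemma exists_comap_ι_eq {Z E : Scheme.{u}} (f : Z ⟶ E) {J K : E.IdealSheafData} (hle : K ≤ J)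
    (hJ : IsLocallyPrincipal J) (hK : IsLocallyPrincipal K) (h : K.comap f = J.comap f)
    (hJf : IsInvertible (J.comap f)) (z : Z) :
    ∃ W : E.Opens, f z ∈ W ∧ J.comap W.ι = K.comap W.ι := by
  obtain ⟨U₁, h₁, t₁, e₁⟩ := hJ (f z)
  obtain ⟨U₂, h₂, s₁, e₂⟩ := hK (f z)
  obtain ⟨U, hU, hz, hUle⟩ := exists_isAffineOpen_mem_and_subset (X := E) (x := f z)
    (U := U₁.1 ⊓ U₂.1) ⟨h₁, h₂⟩
  have hJU := ideal_span_of_le (V := ⟨U, hU⟩) (fun x hx ↦ (hUle hx).1) e₁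
  have hKU := ideal_span_of_le (V := ⟨U, hU⟩) (fun x hx ↦ (hUle hx).2) e₂
  set t := E.presheaf.map (homOfLE _).op t₁ with ht
  set s := E.presheaf.map (homOfLE _).op s₁ with hs
  have hst : Ideal.span {s} ≤ Ideal.span {t} := by
    rw [← hJU, ← hKU]
    exact hle _
  obtain ⟨a, ha⟩ := Ideal.mem_span_singleton.mp (hst (Ideal.mem_span_singleton_self s))
  -- the equation of `K` is `a` times that of `J`, with `a` invertible at the image of `z`
  refine ⟨E.basicOpen a, ?_, ?_⟩
  · obtain ⟨W, hzW, hWU, τ, hτ, eτ⟩ := hJf.exists_le (f ⁻¹ᵁ U) z hz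
    have k₁ : Ideal.span {τ} = Ideal.span {f.appLE U W hWU t} := by
      rw [← eτ, ideal_comap f J ⟨U, hU⟩ W hWU, hJU, Ideal.map_span, Set.image_singleton]
    have k₂ : Ideal.span {τ} = Ideal.span {f.appLE U W hWU s} := by
      rw [← eτ, ← h, ideal_comap f K ⟨U, hU⟩ W hWU, hKU, Ideal.map_span, Set.image_singleton]
    obtain ⟨c, hc⟩ := Ideal.mem_span_singleton.mp
      (k₁.ge (Ideal.mem_span_singleton_self _))
    obtain ⟨d, hd⟩ := Ideal.mem_span_singleton.mp (k₂.le (Ideal.mem_span_singleton_self τ))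
    have hu : IsUnit (f.appLE U W hWU a) := by
      refine IsUnit.of_mul_eq_one (c * d) ?_
      refine (mem_nonZeroDivisors_iff_right.mp hτ _ ?_ : f.appLE U W hWU a * (c * d) - 1 = 0)
        |> sub_eq_zero.mp
      rw [ha, map_mul, hc] at hd
      linear_combination -hd
    have h3 := Z.basicOpen_of_isUnit hu
    rw [Scheme.basicOpen_appLE] at h3
    exact (h3.ge hzW).2
  · let B : E.affineOpens := ⟨E.basicOpen a, hU.basicOpen a⟩
    have hB : J.ideal B = K.ideal B := by
      rw [ideal_span_of_le (V := B) (E.basicOpen_le a) hJU,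
        ideal_span_of_le (V := B) (E.basicOpen_le a) hKU, ha, map_mul]
      exact (Ideal.span_singleton_mul_right_unit
        (RingedSpace.isUnit_res_basicOpen _ a) _).symm
    have hW (W : (E.basicOpen a).toScheme.affineOpens) : W.1 ≤ (E.basicOpen a).ι ⁻¹ᵁ B.1 :=
      fun x _ ↦ x.2
    refine Scheme.IdealSheafData.ext (funext fun W ↦ ?_)
    rw [ideal_comap _ J B W (hW W), ideal_comap _ K B W (hW W), hB]

lemma exists_comap_ι_eq_of_finite {Z E : Scheme.{u}} (f : Z ⟶ E) {κ : Type*} [Finite κ]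
    {J : E.IdealSheafData} {K : κ → E.IdealSheafData} (hle : ∀ k, K k ≤ J)
    (hJ : IsLocallyPrincipal J) (hK : ∀ k, IsLocallyPrincipal (K k))
    (h : ∀ k, (K k).comap f = J.comap f) (hJf : IsInvertible (J.comap f)) (z : Z) :
    ∃ W : E.Opens, f z ∈ W ∧ ∀ k, J.comap W.ι = (K k).comap W.ι := by
  choose W hW e using fun k ↦ exists_comap_ι_eq f (hle k) hJ (hK k) (h k) hJf z
  refine ⟨⟨⋂ k, W k, isOpen_iInter_of_finite fun k ↦ (W k).2⟩, Set.mem_iInter.mpr hW, fun k ↦ ?_⟩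
  have hk : (⟨⋂ k, W k, isOpen_iInter_of_finite fun k ↦ (W k).2⟩ : E.Opens) ≤ W k :=
    Set.iInter_subset _ k
  rw [← E.homOfLE_ι hk, comap_comp, comap_comp, e]

end EqualDivisors

section FibrePowers
variable {X B : Scheme.{u}} (p : X ⟶ B)

lemma isMultiplicative_powFunctor : IsMultiplicative (powFunctor p) := by
  intro m l n a b c d hpo
  have hcomm : (powFunctor p).map c.op ≫ (powFunctor p).map a.op =
      (powFunctor p).map d.op ≫ (powFunctor p).map b.op := by
    rw [← Functor.map_comp, ← Functor.map_comp, ← op_comp, ← op_comp, hpo.w]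
  have key (s : PullbackCone ((powFunctor p).map a.op) ((powFunctor p).map b.op)) :
      ∃ r : s.pt ⟶ (powFunctor p).obj (op n), r ≫ (powFunctor p).map c.op = s.fst ∧
        r ≫ (powFunctor p).map d.op = s.snd := by
    have h0 : s.fst ≫ powProj p (op m) (OverSimplex.toMap a 0) =
        s.snd ≫ powProj p (op l) (OverSimplex.toMap b 0) := by
      have := s.condition =≫ powProj p _ 0
      rwa [Category.assoc, Category.assoc, powFunctor_map_proj, powFunctor_map_proj] at this
    obtain ⟨v, hvc, hvd⟩ := OverSimplex.exists_extension hpo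
      (fun x ↦ s.fst ≫ powProj p (op m) x) (fun x ↦ s.snd ≫ powProj p (op l) x) h0
    have hm (x) : (s.fst ≫ powProj p (op m) x) ≫ p = (s.fst ≫ powProj p (op m) 0) ≫ p := by
      rw [Category.assoc, Category.assoc]
      exact s.fst ≫= ((fiberPow.proj_comp p _ _).trans (fiberPow.proj_comp p _ _).symm)
    have hl (x) : (s.snd ≫ powProj p (op l) x) ≫ p = (s.fst ≫ powProj p (op m) 0) ≫ p := by
      rw [← hm (OverSimplex.toMap a 0), h0, Category.assoc, Category.assoc]
      exact s.snd ≫= ((fiberPow.proj_comp p _ _).trans (fiberPow.proj_comp p _ _).symm)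
    have hv (z) : v z ≫ p = (s.fst ≫ powProj p (op m) 0) ≫ p := by
      obtain ⟨x, rfl⟩ | ⟨y, rfl⟩ := OverSimplex.jointly_surjective hpo z
      · rw [hvc, hm]
      · rw [hvd, hl]
    obtain ⟨r, hr⟩ : ∃ r : s.pt ⟶ (powFunctor p).obj (op n), ∀ z, r ≫ powProj p (op n) z = v z :=
      ⟨fiberPow.lift v _ hv, fiberPow.lift_proj v _ hv⟩
    refine ⟨r, powFunctor_hom_ext p fun x ↦ ?_, powFunctor_hom_ext p fun x ↦ ?_⟩
    · rw [Category.assoc, powFunctor_map_proj]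
      exact (hr _).trans (hvc x)
    · rw [Category.assoc, powFunctor_map_proj]
      exact (hr _).trans (hvd x)
  choose r hrc hrd using key
  refine ⟨⟨hcomm⟩, ⟨PullbackCone.IsLimit.mk _ r hrc hrd fun s v hv hv' ↦
    powFunctor_hom_ext p fun z ↦ ?_⟩⟩
  obtain ⟨x, rfl⟩ | ⟨y, rfl⟩ := OverSimplex.jointly_surjective hpo z
  · have := powFunctor_map_proj p c.op x
    refine (v ≫= this.symm).trans (Eq.trans ?_ (r s ≫= this))
    rw [reassoc_of% hv, reassoc_of% (hrc s)]
  · have := powFunctor_map_proj p d.op y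
    refine (v ≫= this.symm).trans (Eq.trans ?_ (r s ≫= this))
    rw [reassoc_of% hv', reassoc_of% (hrd s)]

lemma powFunctor_map_toZero (a : OverSimplexᵒᵖ) :
    (powFunctor p).map a.unop.toZero.op = powDiag p a :=
  powFunctor_hom_ext p fun j ↦
    (powFunctor_map_proj p a.unop.toZero.op j).trans (powDiag_proj p a j).symm

instance isIso_powProj_zero : IsIso (powProj p (op (.mk 0)) 0) :=
  inferInstanceAs (IsIso (𝟙 X))

instance smooth_fiberPow [Smooth p] (n : ℕ) : Smooth (fiberPow p n).hom := by
  induction n with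
  | zero => exact ‹Smooth p›
  | succ n ih => exact inferInstanceAs (Smooth (pullback.fst (fiberPow p n).hom p ≫ _))

instance smooth_powProj [Smooth p] (a : OverSimplexᵒᵖ) (j : Fin (a.unop.len + 1)) :
    Smooth (powProj p a j) := by
  have (n : ℕ) (j : Fin (n + 1)) : Smooth (fiberPow.proj p n j) := by
    induction n with
    | zero => exact inferInstanceAs (Smooth (𝟙 X))
    | succ n ih =>
      cases j using Fin.lastCases with
      | last =>
        rw [fiberPow.proj_last]
        have h : Smooth (pullback.snd (fiberPow p n).hom p) := inferInstance
        exact h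
      | cast j =>
        rw [fiberPow.proj_castSucc]
        have := ih j
        have h : Smooth (pullback.fst (fiberPow p n).hom p ≫ fiberPow.proj p n j) := inferInstance
        exact h
  exact this _ _

end FibrePowers

section FirstStage
open Scheme.IdealSheafData
variable {X B : Scheme.{u}} (p : X ⟶ B) [IsSeparated p] {ι : Type u} [Fintype ι]
  (D : ι → X.IdealSheafData) (hD : ∀ i, IsLocallyPrincipal (D i))

/-- On the dilatation, the inverse images of `D` by all the projections coincide. -/
lemma comap_powDiv_eq (a : OverSimplexᵒᵖ) (j k : Fin (a.unop.len + 1)) :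
    (powDiv p D a j).comap ((dilDStr p D hD).app a) =
      (powDiv p D a k).comap ((dilDStr p D hD).app a) := by
  have h (j) : (powDiv p D a j).comap ((dilDStr p D hD).app a) = ∏ i, divD p D hD a i j := by
    rw [powDiv, ← comap_comp, comap_prod]
    rfl
  rw [h, h]
  exact Finset.prod_congr rfl fun i _ ↦ divD_eq p D hD a i j k

/-- `P_n^{(D)}` is smooth over `X` by each projection: near every point, the dilatation with respect to
all the divisors `pr_j^* D` is an open subscheme of the dilatation `E` with respect to only one of
them, to which `smooth_dilStr_ker_section` applies. -/
theorem smooth_dilDStr_powProj [Smooth p] (hDi : ∀ i, IsInvertible (D i)) (a : OverSimplexᵒᵖ)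
    (j : Fin (a.unop.len + 1)) : Smooth ((dilDStr p D hD).app a ≫ powProj p a j) := by
  let I' : Unit → ((powFunctor p).obj a).IdealSheafData := fun _ ↦ (powDiag p a).ker
  let J' : Unit → ((powFunctor p).obj a).IdealSheafData := fun _ ↦ powDiv p D a j
  have hJ' : ∀ i, IsLocallyPrincipal (J' i) := fun _ ↦ isLocallyPrincipal_powDiv p hD a j
  let E := dil I' J' hJ'
  let s : E ⟶ (powFunctor p).obj a := dilStr I' J' hJ'
  have hs : IsAdmissible I' J' s := isAdmissible_dilStr
  let F := (dilD p D hD).obj a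
  let q : F ⟶ (powFunctor p).obj a := (dilDStr p D hD).app a
  have hq : IsAdmissible (fun _ ↦ (powDiag p a).ker) (powDiv p D a) q := isAdmissible_dilDStr p D hD a
  have := isClosedImmersion_powDiag p a
  have hE : Smooth (s ≫ powProj p a j) := smooth_dilStr_ker_section (powProj p a j) (powDiag p a)
    (powDiag_proj p a j) (IsInvertible.prod Finset.univ D hDi) hJ'
  have hq' : IsAdmissible I' J' q := ⟨fun _ ↦ hq.isInvertible j, fun _ ↦ hq.le j⟩
  let π : F ⟶ E := dilLift hJ' q hq'
  have hπ : π ≫ s = q := dilLift_str _ hq'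
  -- `pr_k^* D` contains `pr_j^* D` on `E`, as the two agree on the diagonal
  have hle (k) : (powDiv p D a k).comap s ≤ (powDiv p D a j).comap s := by
    rw [powDiv, powDiv, ← comap_comp, ← comap_comp]
    refine comap_le_comap_of_agree (K := (powDiag p a).ker.comap s) ?_ _ ?_
    · have h1 : ((powDiag p a).ker.comap s).subschemeι ≫ s =
          (((powDiag p a).ker.comapIso s).hom ≫ pullback.snd _ _) ≫ (powDiag p a).ker.subschemeι := by
        rw [Category.assoc, ← pullback.condition, ← Category.assoc, comapIso_hom_fst]
      rw [reassoc_of% h1, reassoc_of% h1, ker_powDiag_agree p a k j]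
    · have := hs.le ()
      rwa [comap_comp]
  refine smooth_of_forall_exists _ fun x ↦ ?_
  obtain ⟨W, hxW, hW⟩ := exists_comap_ι_eq_of_finite π hle ((hJ' ()).comap s)
    (fun k ↦ (isLocallyPrincipal_powDiv p hD a k).comap s) (fun k ↦ by
      rw [← comap_comp, ← comap_comp, hπ]
      exact comap_powDiv_eq p D hD a k j) (by
      rw [← comap_comp, hπ]
      exact hq.isInvertible j) x
  -- on `W`, all the `pr_k^* D` coincide, so that `W` lifts to `F`
  have hsW : IsAdmissible I' J' (W.ι ≫ s) := hs.comp_of_flat _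
  have hWq : IsAdmissible (fun _ ↦ (powDiag p a).ker) (powDiv p D a) (W.ι ≫ s) := by
    refine ⟨fun k ↦ ?_, fun k ↦ ?_⟩
    · rw [comap_comp, ← hW k, ← comap_comp]
      exact hsW.isInvertible ()
    · rw [comap_comp, comap_comp (powDiv p D a k), ← hW k, ← comap_comp, ← comap_comp]
      exact hsW.le ()
  let ν : W.toScheme ⟶ F := dilLift _ (W.ι ≫ s) hWq
  have hν : ν ≫ q = W.ι ≫ s := dilLift_str _ hWq
  have hνπ : ν ≫ π = W.ι := dil_hom_ext hsW (by rw [Category.assoc, hπ, hν]) rfl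
  have hT : pullback.snd π W.ι ≫ ν = pullback.fst π W.ι := by
    refine dil_hom_ext (hq.comp_of_flat (pullback.fst π W.ι)) ?_ rfl
    refine (Category.assoc _ _ _).trans ((_ ≫= hν).trans ?_)
    rw [← Category.assoc, ← pullback.condition, Category.assoc, hπ]
  let τ : W.toScheme ⟶ pullback π W.ι := pullback.lift ν (𝟙 _) (by rw [hνπ, Category.id_comp])
  have hτ₁ : τ ≫ pullback.fst _ _ = ν := pullback.lift_fst _ _ _
  have hτ₂ : τ ≫ pullback.snd _ _ = 𝟙 _ := pullback.lift_snd _ _ _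
  have hiso : IsIso τ := by
    refine ⟨pullback.snd _ _, hτ₂, pullback.hom_ext ?_ ?_⟩
    · rw [Category.assoc, hτ₁, hT, Category.id_comp]
    · rw [Category.assoc, hτ₂, Category.id_comp, Category.comp_id]
  refine ⟨W.toScheme, ν, ?_, ?_, ?_⟩
  · rw [← hτ₁]
    infer_instance
  · obtain ⟨z, hz, -⟩ := Scheme.Pullback.exists_preimage_pullback (f := π) (g := W.ι) x
      ⟨π x, hxW⟩ rfl
    refine ⟨pullback.snd π W.ι z, ?_⟩
    rw [← hz, ← hT]
    rfl
  · have : Smooth (W.ι ≫ s ≫ powProj p a j) := inferInstance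
    have h3 := reassoc_of% hν
    exact (h3 (powProj p a j)).symm ▸ this

end FirstStage

section CartesianOverZero
variable {C : Type*} [Category* C] {F P : OverSimplexᵒᵖ ⥤ C} (s : F ⟶ P)

/-- If `F` is obtained from `P` by base change of the `0`-th term along any structure map, then
`F` inherits multiplicativity from `P`. -/
lemma IsMultiplicative.of_isPullback (hP : IsMultiplicative P)
    (h : ∀ {n : OverSimplex} (α : .mk 0 ⟶ n),
      IsPullback (F.map α.op) (s.app (op n)) (s.app (op (.mk 0))) (P.map α.op)) :
    IsMultiplicative F := by
  intro m l n a b c d hpo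
  have hn : IsPullback (F.map d.op) (s.app (op n)) (s.app (op l)) (P.map d.op) := by
    refine IsPullback.of_right (h₁₂ := F.map b.op) (h₂₂ := P.map b.op)
      (v₁₃ := s.app (op (.mk 0))) ?_ (s.naturality _) (h b)
    rw [← F.map_comp, ← P.map_comp, ← op_comp]
    exact h _
  have h1 := hn.paste_vert (hP a b c d hpo).flip
  rw [← s.naturality, ← s.naturality] at h1
  refine (h1.of_bot ?_ (h a)).flip
  rw [← F.map_comp, ← F.map_comp, ← op_comp, ← op_comp, hpo.w]

end CartesianOverZero

section FirstStage
open Scheme.IdealSheafData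
variable {X B : Scheme.{u}} (p : X ⟶ B) [IsSeparated p] {ι : Type u} [Fintype ι]
  (D : ι → X.IdealSheafData) (hD : ∀ i, IsLocallyPrincipal (D i))

/-- `P_0^{(D)}` is `X`: the center is all of `X`. -/
lemma isIso_dilDStr_zero (hDi : ∀ i, IsInvertible (D i)) :
    IsIso ((dilDStr p D hD).app (op (.mk 0))) := by
  have h : powDiag p (op (.mk 0)) = 𝟙 X :=
    (Category.comp_id _).symm.trans (powDiag_proj p (op (.mk 0)) 0)
  refine isIso_dilStr ⟨fun j ↦ ?_, fun j ↦ ?_⟩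
  · rw [comap_id]
    have : Flat (powProj p (op (.mk 0)) j) := inferInstanceAs (Flat (𝟙 X))
    exact (IsInvertible.prod Finset.univ D hDi).comap_of_flat _
  · have : IsIso (powDiag p (op (.mk 0))) := h ▸ inferInstanceAs (IsIso (𝟙 X))
    refine le_of_eq_of_le ?_ bot_le
    exact (comap_id _).trans (Scheme.Hom.ker_eq_bot_of_isIso (powDiag p (op (.mk 0))))

lemma smooth_dilD_map [Smooth p] (hDi : ∀ i, IsInvertible (D i)) {n : OverSimplex}
    (α : .mk 0 ⟶ n) : Smooth ((dilD p D hD).map α.op) := by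
  have h1 := (dilDStr p D hD).naturality α.op =≫ powProj p (op (.mk 0)) 0
  rw [Category.assoc, Category.assoc, powFunctor_map_proj] at h1
  have := isIso_dilDStr_zero p D hD hDi
  have h2 : Smooth ((dilD p D hD).map α.op ≫ (dilDStr p D hD).app (op (.mk 0)) ≫
      powProj p (op (.mk 0)) 0) := h1 ▸ smooth_dilDStr_powProj p D hD hDi _ _
  have h3 := smooth_comp ((dilD p D hD).map α.op ≫ (dilDStr p D hD).app (op (.mk 0)) ≫
      powProj p (op (.mk 0)) 0)
    (inv ((dilDStr p D hD).app (op (.mk 0)) ≫ powProj p (op (.mk 0)) 0))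
  rwa [Category.assoc, IsIso.hom_inv_id, Category.comp_id] at h3

/-- Every vertex of `[0, n]` comes from `[0, m]` or `[0, l]`, and the inverse image of `D` by the
projection belonging to a vertex does not depend on the vertex. -/
lemma exists_comap_powDiv_eq {m l n : OverSimplex} {a : .mk 0 ⟶ m} {b : .mk 0 ⟶ l} {c : m ⟶ n}
    {d : l ⟶ n} (hpo : IsPushout a b c d) {T : Scheme.{u}} (u : T ⟶ (dilD p D hD).obj (op m))
    (v : T ⟶ (dilD p D hD).obj (op l)) (w : T ⟶ (powFunctor p).obj (op n))
    (hwc : w ≫ (powFunctor p).map c.op = u ≫ (dilDStr p D hD).app (op m))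
    (hwd : w ≫ (powFunctor p).map d.op = v ≫ (dilDStr p D hD).app (op l)) (i : Fin (n.len + 1)) :
    ∃ j k, (powDiv p D (op n) i).comap w =
        (powDiv p D (op m) j).comap (u ≫ (dilDStr p D hD).app (op m)) ∧
      (powDiv p D (op n) i).comap w =
        (powDiv p D (op l) k).comap (v ≫ (dilDStr p D hD).app (op l)) := by
  let q := dilDStr p D hD
  have hmul (x) : (powDiv p D (op n) (OverSimplex.toMap c x)).comap w =
      (powDiv p D (op m) x).comap (u ≫ q.app (op m)) := by
    rw [powDiv, powDiv, ← comap_comp, ← comap_comp, ← hwc, Category.assoc]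
    exact congr(Scheme.IdealSheafData.comap _ (w ≫ $(powFunctor_map_proj p c.op x))).symm
  have hmul' (y) : (powDiv p D (op n) (OverSimplex.toMap d y)).comap w =
      (powDiv p D (op l) y).comap (v ≫ q.app (op l)) := by
    rw [powDiv, powDiv, ← comap_comp, ← comap_comp, ← hwd, Category.assoc]
    exact congr(Scheme.IdealSheafData.comap _ (w ≫ $(powFunctor_map_proj p d.op y))).symm
  have hx (x x') : (powDiv p D (op m) x).comap (u ≫ q.app (op m)) =
      (powDiv p D (op m) x').comap (u ≫ q.app (op m)) := by
    rw [comap_comp, comap_comp, comap_powDiv_eq p D hD (op m) x x']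
  have hy (y y') : (powDiv p D (op l) y).comap (v ≫ q.app (op l)) =
      (powDiv p D (op l) y').comap (v ≫ q.app (op l)) := by
    rw [comap_comp, comap_comp, comap_powDiv_eq p D hD (op l) y y']
  have hab : OverSimplex.toMap c (OverSimplex.toMap a 0) =
      OverSimplex.toMap d (OverSimplex.toMap b 0) := congr(OverSimplex.toMap $hpo.w 0)
  refine ⟨OverSimplex.toMap a 0, OverSimplex.toMap b 0, ?_⟩
  obtain ⟨x, rfl⟩ | ⟨y, rfl⟩ := OverSimplex.jointly_surjective hpo i
  · have h1 := (hmul x).trans (hx x (OverSimplex.toMap a 0))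
    exact ⟨h1, (h1.trans (hmul _).symm).trans ((congr((powDiv p D (op n) $hab).comap w)).trans
      (hmul' _))⟩
  · have h1 := (hmul' y).trans (hy y (OverSimplex.toMap b 0))
    exact ⟨(h1.trans (hmul' _).symm).trans ((congr((powDiv p D (op n) $hab.symm).comap w)).trans
      (hmul _)), h1⟩

lemma isMultiplicative_dilD [Smooth p] (hDi : ∀ i, IsInvertible (D i)) :
    IsMultiplicative (dilD p D hD) := by
  refine isMultiplicative_dilFunctor _ _ (isMultiplicative_powFunctor p) (fun a ↦ ?_)
    (fun a _ ↦ by rw [powFunctor_map_toZero]; rfl) (fun α ↦ ?_) ?_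
  · rw [powFunctor_map_toZero]
    exact isClosedImmersion_powDiag p a
  · have := smooth_dilD_map p D hD hDi α
    exact inferInstanceAs (Flat ((dilD p D hD).map α.op))
  · intro m l n a b c d hpo T u v w hwc hwd i
    exact exists_comap_powDiv_eq p D hD hpo u v w hwc hwd i

end FirstStage

/-! ### Smoothness and multiplicativity of `P^{(D,M)}` and `P^{(R,M)}` -/
section SecondStage
open Scheme.IdealSheafData
variable {X B : Scheme.{u}} (p : X ⟶ B) [IsSeparated p] {ι : Type u} [Fintype ι]
  (D : ι → X.IdealSheafData) (hD : ∀ i, IsLocallyPrincipal (D i)) (m e : ι → ℕ)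

omit [Fintype ι] in
lemma isPullback_affFunctor {C : Type*} [Category* C] (P : C ⥤ Scheme.{u}) {c d : C} (α : c ⟶ d) :
    IsPullback ((affFunctor ι P).map α) (𝔸(ι; P.obj c) ↘ P.obj c) (𝔸(ι; P.obj d) ↘ P.obj d)
      (P.map α) :=
  AffineSpace.isPullback_map (P.map α)

omit [Fintype ι] in
lemma isMultiplicative_affFunctor {P : OverSimplexᵒᵖ ⥤ Scheme.{u}} (hP : IsMultiplicative P) :
    IsMultiplicative (affFunctor ι P) :=
  hP.of_isPullback (affOver ι P) fun α ↦ isPullback_affFunctor P α.op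

/-- The universal condition defining `P^{(D,M)}` is imposed on `P_0^{(D)} × 𝔸^ι` and pulled back. -/
lemma isPullback_dilM_map {c d : OverSimplexᵒᵖ} (α : c ⟶ d)
    (h : Flat ((affFunctor ι (dilD p D hD)).map α)) :
    IsPullback ((dilM p D hD m).map α) ((dilMStr p D hD m).app c)
      ((dilMStr p D hD m).app d) ((affFunctor ι (dilD p D hD)).map α) := by
  have key (x) := (comap_centerM p D hD m α x).symm
  exact isPullback_dilFunctor_map (isLocallyPrincipal_centerM p D hD m)
    (isAdmissible_M p D hD m) α (fun x ↦ ⟨x, key x, key (swapM x)⟩)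

variable [Smooth p] (hDi : ∀ i, IsInvertible (D i))
include hDi

lemma smooth_affFunctor_dilD_map {n : OverSimplex} (α : .mk 0 ⟶ n) :
    Smooth ((affFunctor ι (dilD p D hD)).map α.op) :=
  have := smooth_dilD_map p D hD hDi α
  MorphismProperty.of_isPullback (P := @Smooth) (isPullback_affFunctor (dilD p D hD) α.op).flip this

lemma smooth_dilM_map {n : OverSimplex} (α : .mk 0 ⟶ n) : Smooth ((dilM p D hD m).map α.op) := by
  have := smooth_affFunctor_dilD_map p D hD hDi α
  exact MorphismProperty.of_isPullback (P := @Smooth)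
    (isPullback_dilM_map p D hD m α.op inferInstance).flip this

lemma isMultiplicative_dilM : IsMultiplicative (dilM p D hD m) := by
  refine (isMultiplicative_affFunctor (isMultiplicative_dilD p D hD hDi)).of_isPullback
    (dilMStr p D hD m) fun α ↦ ?_
  have := smooth_affFunctor_dilD_map p D hD hDi α
  exact isPullback_dilM_map p D hD m α.op inferInstance

end SecondStage

section ThirdStage
open Scheme.IdealSheafData
variable {X B : Scheme.{u}} (p : X ⟶ B) [IsSeparated p] {ι : Type u} [Fintype ι]
  (D : ι → X.IdealSheafData) (hD : ∀ i, IsLocallyPrincipal (D i)) (m e : ι → ℕ)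

/-- The morphism from `P^{(D,M)}` to the fibre powers of `X`. -/
noncomputable def dilMToPow : dilM p D hD m ⟶ powFunctor p :=
  dilMStr p D hD m ≫ affOver ι (dilD p D hD) ≫ dilDStr p D hD

instance isAffineHom_dilMToPow (a : OverSimplexᵒᵖ) : IsAffineHom ((dilMToPow p D hD m).app a) :=
  inferInstanceAs (IsAffineHom ((dilMStr p D hD m).app a ≫
    (affOver ι (dilD p D hD)).app a ≫ (dilDStr p D hD).app a))

instance isSeparated_powFunctor_map {a b : OverSimplexᵒᵖ} (α : a ⟶ b) :
    IsSeparated ((powFunctor p).map α) := by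
  have h : (powFunctor p).map α ≫ powProj p b 0 ≫ p = (fiberPow p a.unop.len).hom := by
    rw [← Category.assoc, powFunctor_map_proj]
    exact fiberPow.proj_comp _ _ _
  have : IsSeparated ((powFunctor p).map α ≫ powProj p b 0 ≫ p) := by
    rw [h]
    exact isSeparated_fiberPow p a.unop.len
  exact IsSeparated.of_comp _ (powProj p b 0 ≫ p)

instance isSeparated_dilM_map {a b : OverSimplexᵒᵖ} (α : a ⟶ b) :
    IsSeparated ((dilM p D hD m).map α) := by
  have : IsSeparated ((dilM p D hD m).map α ≫ (dilMToPow p D hD m).app b) := by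
    rw [(dilMToPow p D hD m).naturality]
    infer_instance
  exact IsSeparated.of_comp _ ((dilMToPow p D hD m).app b)

lemma degM_zero : degM p D hD m (op (.mk 0)) = 𝟙 ((dilM p D hD m).obj (op (.mk 0))) := by
  rw [degM, ← (dilM p D hD m).map_id]
  exact congrArg (fun f ↦ (dilM p D hD m).map (Quiver.Hom.op f)) (OverSimplex.toZero_ext _ (𝟙 _))

lemma degM_map_eq_id {a : OverSimplexᵒᵖ} (α : a ⟶ op (.mk 0)) :
    degM p D hD m a ≫ (dilM p D hD m).map α = 𝟙 ((dilM p D hD m).obj (op (.mk 0))) :=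
  (degM_map p D hD m α).trans (degM_zero p D hD m)

instance isClosedImmersion_degM (a : OverSimplexᵒᵖ) : IsClosedImmersion (degM p D hD m a) := by
  let α : .mk 0 ⟶ a.unop := fun _ ↦ (0 : Fin (a.unop.len + 1))
  have : IsClosedImmersion (degM p D hD m a ≫ (dilM p D hD m).map α.op) := by
    rw [degM_map_eq_id]
    infer_instance
  exact IsClosedImmersion.of_comp _ ((dilM p D hD m).map α.op)

/-- The coordinates are nonzerodivisors on `P^{(D,M)}`, because their powers are. -/
lemma isInvertible_princ_coordM (hm : ∀ i, 1 ≤ m i) (a : OverSimplexᵒᵖ) (i : ι) :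
    IsInvertible (princ (coordM p D hD m a i)) := by
  have h := (isAdmissible_dilStr (I := fun x ↦ centerM p D hD m a (swapM x))
    (J := centerM p D hD m a) (hJ := isLocallyPrincipal_centerM p D hD m a)).isInvertible (i, false)
  have e : (centerM p D hD m a (i, false)).comap ((dilMStr p D hD m).app a) =
      princ (coordM p D hD m a i) ^ m i :=
    (comap_pow _ _ _).trans (congrArg (· ^ m i) (comap_princ _ _))
  have h' : IsInvertible (princ (coordM p D hD m a i) ^ m i) := e ▸ h
  intro x
  obtain ⟨U, hx, t, -, -⟩ := h' x
  refine ⟨U, hx, _, ?_, princ_ideal _ U⟩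
  have h1 : (princ (coordM p D hD m a i) ^ m i).ideal U = Ideal.span
      {((dilM p D hD m).obj a).presheaf.map (homOfLE le_top).op (coordM p D hD m a i) ^ m i} := by
    rw [ideal_pow, Pi.pow_apply, princ_ideal, Ideal.span_singleton_pow]
  have h2 := h'.mem_nonZeroDivisors h1
  rw [← Nat.sub_add_cancel (hm i), pow_succ] at h2
  exact (mul_mem_nonZeroDivisors.mp h2).2

lemma isInvertible_centerR (hm : ∀ i, 1 ≤ m i) (a : OverSimplexᵒᵖ) :
    IsInvertible (centerR p D hD m e a) := by
  intro x
  obtain ⟨U, hU, hx, -⟩ := exists_isAffineOpen_mem_and_subset (x := x) (U := ⊤) trivial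
  refine ⟨⟨U, hU⟩, hx, _, ?_, princ_ideal _ _⟩
  rw [map_prod]
  refine prod_mem fun i _ ↦ ?_
  rw [map_pow]
  exact pow_mem ((isInvertible_princ_coordM p D hD m hm a i).mem_nonZeroDivisors
    (princ_ideal _ ⟨U, hU⟩)) _

/-- `P_0^{(R,M)}` is `P_0^{(D,M)}`: the center is the whole scheme. -/
lemma isIso_dilRStr_zero (hm : ∀ i, 1 ≤ m i) : IsIso ((dilRStr p D hD m e).app (op (.mk 0))) := by
  refine isIso_dilStr ⟨fun _ ↦ ?_, fun _ ↦ ?_⟩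
  · rw [comap_id]
    exact isInvertible_centerR p D hD m e hm _
  · have : IsIso (degM p D hD m (op (.mk 0))) := by
      rw [degM_zero]
      infer_instance
    refine le_of_eq_of_le ?_ bot_le
    exact (comap_id _).trans (Scheme.Hom.ker_eq_bot_of_isIso (degM p D hD m (op (.mk 0))))

variable [Smooth p] (hDi : ∀ i, IsInvertible (D i)) (hm : ∀ i, 1 ≤ m i)
include hDi hm

/-- `P_n^{(R,M)}` is the dilatation of the smooth scheme `P_n^{(D,M)}` over `P_0^{(D,M)}` in the degenerate
section, with respect to a divisor from the base. -/
lemma smooth_dilRStr_map {n : OverSimplex} (α : .mk 0 ⟶ n) :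
    Smooth ((dilRStr p D hD m e).app (op n) ≫ (dilM p D hD m).map α.op) := by
  have := smooth_dilM_map p D hD m hDi α
  have key (J : ((dilM p D hD m).obj (op n)).IdealSheafData)
      (hJ : J = (centerR p D hD m e (op (.mk 0))).comap ((dilM p D hD m).map α.op))
      (hJ' : ∀ _ : Unit, IsLocallyPrincipal J) :
      Smooth (dilStr (fun _ : Unit ↦ (degM p D hD m (op n)).ker) (fun _ ↦ J) hJ' ≫
        (dilM p D hD m).map α.op) := by
    subst hJ
    exact smooth_dilStr_ker_section ((dilM p D hD m).map α.op) (degM p D hD m (op n))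
      (degM_map_eq_id p D hD m α.op) (isInvertible_centerR p D hD m e hm _) hJ'
  exact key _ (comap_centerR p D hD m e α.op).symm _

lemma smooth_dilR_map {n : OverSimplex} (α : .mk 0 ⟶ n) :
    Smooth ((dilR p D hD m e).map α.op) := by
  have h1 := (dilRStr p D hD m e).naturality α.op
  have := isIso_dilRStr_zero p D hD m e hm
  have h2 : Smooth ((dilR p D hD m e).map α.op ≫ (dilRStr p D hD m e).app (op (.mk 0))) :=
    h1 ▸ smooth_dilRStr_map p D hD m e hDi hm α
  have h3 := smooth_comp ((dilR p D hD m e).map α.op ≫ (dilRStr p D hD m e).app (op (.mk 0)))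
    (inv ((dilRStr p D hD m e).app (op (.mk 0))))
  rwa [Category.assoc, IsIso.hom_inv_id, Category.comp_id] at h3

theorem isMultiplicative_dilR : IsMultiplicative (dilR p D hD m e) := by
  refine isMultiplicative_dilFunctor (fun a _ ↦ isLocallyPrincipal_centerR p D hD m e a)
    (isAdmissible_R p D hD m e) (isMultiplicative_dilM p D hD m hDi)
    (fun a ↦ isClosedImmersion_degM p D hD m a) (fun a _ ↦ rfl) (fun α ↦ ?_) ?_
  · have := smooth_dilR_map p D hD m e hDi hm α
    exact inferInstanceAs (Flat ((dilR p D hD m e).map α.op))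
  · intro m' l n a b c d _ T u v w hwc hwd _
    refine ⟨(), (), ?_, ?_⟩
    · rw [← hwc, comap_comp, comap_centerR]
    · rw [← hwd, comap_comp, comap_centerR]

end ThirdStage

/-! ### The open part `U^{•+1} × 𝔾_m^ι` -/
section CartesianOpenPart
open Scheme.IdealSheafData

lemma exists_comp_ι_eq_of_comap_eq_top {T X : Scheme.{u}} (f : T ⟶ X) {J : X.IdealSheafData}
    (h : J.comap f = ⊤) : ∃ g : T ⟶ (complOpen J).toScheme, g ≫ (complOpen J).ι = f := by
  have h1 : Set.range f ⊆ Set.range (complOpen J).ι := by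
    rintro _ ⟨x, rfl⟩
    rw [Scheme.Opens.range_ι]
    have h2 := preimage_complOpen f J
    rw [h] at h2
    have h3 : x ∈ f ⁻¹ᵁ complOpen J := by
      rw [h2, complOpen]
      simp
    exact h3
  exact ⟨IsOpenImmersion.lift _ f h1, IsOpenImmersion.lift_fac _ _ _⟩

section Functors
variable {C : Type*} [Category* C] {ι : Type u} {Y P : C ⥤ Scheme.{u}} (t : Y ⟶ P) {c d : C}
  (α : c ⟶ d)

lemma isPullback_affMap (h : IsPullback (Y.map α) (t.app c) (t.app d) (P.map α)) :
    IsPullback ((affFunctor ι Y).map α) ((affMap ι t).app c) ((affMap ι t).app d)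
      ((affFunctor ι P).map α) := by
  have h1 := (isPullback_affFunctor (ι := ι) Y α).paste_vert h
  have h2 := isPullback_affFunctor (ι := ι) P α
  have e (x : C) : (𝔸(ι; Y.obj x) ↘ Y.obj x) ≫ t.app x =
      (affMap ι t).app x ≫ (𝔸(ι; P.obj x) ↘ P.obj x) := (AffineSpace.map_over (t.app x)).symm
  have h3 : IsPullback ((affFunctor ι Y).map α) ((affMap ι t).app c ≫ (𝔸(ι; P.obj c) ↘ P.obj c))
      ((affMap ι t).app d ≫ (𝔸(ι; P.obj d) ↘ P.obj d)) (P.map α) := e c ▸ e d ▸ h1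
  exact h3.of_bot ((affMap ι t).naturality α) h2

variable [Fintype ι]

lemma preimage_gmOpen {S T : Scheme.{u}} (f : S ⟶ T) :
    AffineSpace.map ι f ⁻¹ᵁ gmOpen ι T = gmOpen ι S := by
  rw [gmOpen, gmOpen, Scheme.preimage_basicOpen]
  refine congrArg _ ((map_prod (AffineSpace.map ι f).appTop.hom _ _).trans ?_)
  exact Finset.prod_congr rfl fun i _ ↦ AffineSpace.map_appTop_coord f i

lemma isPullback_gm_resLE {S T : Scheme.{u}} (f : S ⟶ T) :
    IsPullback ((AffineSpace.map ι f).resLE _ _ (gmOpen_le ι f)) (gmOpen ι S).ι (gmOpen ι T).ι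
      (AffineSpace.map ι f) := by
  have key (O : (𝔸(ι; S)).Opens) (hO : AffineSpace.map ι f ⁻¹ᵁ gmOpen ι T = O) :
      IsPullback ((AffineSpace.map ι f).resLE (gmOpen ι T) O hO.ge) O.ι (gmOpen ι T).ι
        (AffineSpace.map ι f) := by
    subst hO
    rw [Scheme.Hom.resLE_eq_morphismRestrict]
    exact isPullback_morphismRestrict _ _
  exact key _ (preimage_gmOpen f)

lemma isPullback_gmι (Y : C ⥤ Scheme.{u}) : IsPullback ((gmFunctor ι Y).map α) ((gmι ι Y).app c)
    ((gmι ι Y).app d) ((affFunctor ι Y).map α) :=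
  isPullback_gm_resLE (Y.map α)

lemma isPullback_gmι_affOver (Y : C ⥤ Scheme.{u}) : IsPullback ((gmFunctor ι Y).map α)
    ((gmι ι Y).app c ≫ (𝔸(ι; Y.obj c) ↘ Y.obj c)) ((gmι ι Y).app d ≫ (𝔸(ι; Y.obj d) ↘ Y.obj d))
    (Y.map α) :=
  (isPullback_gmι α Y).paste_vert (isPullback_affFunctor Y α)

/-- `t × 𝔾_m^ι` is a base change of `t`. -/
lemma isPullback_gmMap (c : C) : IsPullback ((gmMap ι t).app c)
    ((gmι ι Y).app c ≫ (𝔸(ι; Y.obj c) ↘ Y.obj c)) ((gmι ι P).app c ≫ (𝔸(ι; P.obj c) ↘ P.obj c))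
    (t.app c) :=
  (isPullback_gm_resLE (t.app c)).paste_vert (AffineSpace.isPullback_map (t.app c))

end Functors

variable {X B : Scheme.{u}} (p : X ⟶ B) [IsSeparated p] {ι : Type u} [Fintype ι]
  (D : ι → X.IdealSheafData) (hD : ∀ i, IsLocallyPrincipal (D i)) (m e : ι → ℕ)
  {c d : OverSimplexᵒᵖ} (α : c ⟶ d)

/-- `U^{n+1}` is the inverse image of `U` in `P_n^{(D)}` by each projection, since the inverse images
of `D` by all the projections coincide there. -/
lemma isPullback_toDilD : IsPullback ((powFunctor ((complUnion D).ι ≫ p)).map α)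
    ((toDilD p D hD).app c) ((toDilD p D hD).app d) ((dilD p D hD).map α) := by
  let j := (complUnion D).ι
  let F := dilD p D hD
  let q : F ⟶ powFunctor p := dilDStr p D hD
  let t := toDilD p D hD
  have htq (a) : t.app a ≫ q.app a = (powMap p j rfl).app a := toDilD_str p D hD a
  have htop (a) (k) : (powDiv p D a k).comap ((powMap p j rfl).app a) = ⊤ := comap_powDiv p D a k
  have key (x : PullbackCone (t.app d) (F.map α)) : ∃ v : x.pt ⟶ (powFunctor (j ≫ p)).obj c,
      v ≫ (powFunctor (j ≫ p)).map α = x.fst ∧ v ≫ t.app c = x.snd := by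
    have h0 : (x.snd ≫ q.app c) ≫ (powFunctor p).map α = x.fst ≫ (powMap p j rfl).app d := by
      rw [Category.assoc, ← q.naturality, ← htq, reassoc_of% x.condition]
    have hU (k) : ∃ g : x.pt ⟶ (complUnion D).toScheme,
        g ≫ j = (x.snd ≫ q.app c) ≫ powProj p c k := by
      refine exists_comp_ι_eq_of_comap_eq_top _ ?_
      have h1 : (powDiv p D c (OverSimplex.toMap α.unop 0)).comap (x.snd ≫ q.app c) = ⊤ := by
        rw [powDiv, ← powFunctor_map_proj, ← comap_comp, ← Category.assoc, h0, Category.assoc,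
          comap_comp]
        have := htop d 0
        rw [powDiv] at this
        rw [comap_comp, this, comap_top]
      rw [comap_comp] at h1 ⊢
      rw [comap_comp]
      have h2 := comap_powDiv_eq p D hD c k (OverSimplex.toMap α.unop 0)
      rw [powDiv] at h2
      exact (congrArg (fun K ↦ K.comap x.snd) h2).trans h1
    choose g hg using hU
    have hgp (k) : g k ≫ j ≫ p = x.snd ≫ q.app c ≫ (fiberPow p c.unop.len).hom := by
      rw [reassoc_of% (hg k)]
      exact (x.snd ≫ q.app c) ≫= fiberPow.proj_comp p _ k
    obtain ⟨v, hv⟩ : ∃ v : x.pt ⟶ (powFunctor (j ≫ p)).obj c,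
        ∀ k, v ≫ powProj (j ≫ p) c k = g k := ⟨fiberPow.lift g _ hgp, fiberPow.lift_proj g _ hgp⟩
    have hvm : v ≫ (powMap p j rfl).app c = x.snd ≫ q.app c := by
      refine powFunctor_hom_ext p fun k ↦ ?_
      rw [Category.assoc, powMap_app_proj, reassoc_of% (hv k), hg]
    refine ⟨v, powFunctor_hom_ext _ fun k ↦ ?_, ?_⟩
    · rw [← cancel_mono j, Category.assoc, Category.assoc, Category.assoc, ← powMap_app_proj p j rfl,
        ← Category.assoc x.fst, ← h0, ← hvm]
      have h3 := (powMap p j rfl).naturality α =≫ powProj p d k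
      rw [Category.assoc] at h3
      simp only [Category.assoc] at h3 ⊢
      exact v ≫= h3
    · refine dil_hom_ext (f := v ≫ (powMap p j rfl).app c) (.of_comap_eq_top fun k ↦ ?_) ?_ hvm.symm
      · rw [comap_comp, htop, comap_top]
      · exact (Category.assoc _ _ _).trans (v ≫= htq c)
  choose v hv hv' using key
  refine ⟨⟨t.naturality α⟩, ⟨PullbackCone.IsLimit.mk _ v hv hv' fun x w _ hw ↦ ?_⟩⟩
  refine powFunctor_hom_ext _ fun k ↦ ?_
  have h1 : w ≫ (powMap p j rfl).app c = v x ≫ (powMap p j rfl).app c := by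
    rw [← htq, reassoc_of% hw, reassoc_of% (hv' x)]
  have h2 := h1 =≫ powProj p c k
  rw [Category.assoc, Category.assoc, powMap_app_proj, ← Category.assoc, ← Category.assoc] at h2
  exact (cancel_mono j).mp h2

/-- `U^{n+1} × 𝔾_m^ι` is the inverse image in `P_n^{(R,M)}` of its `0`-th term along every vertex. -/
lemma isPullback_toDilR : IsPullback ((gmFunctor ι (powFunctor ((complUnion D).ι ≫ p))).map α)
    ((toDilR p D hD m e).app c) ((toDilR p D hD m e).app d) ((dilR p D hD m e).map α) := by
  have h1 : IsPullback ((gmFunctor ι (powFunctor ((complUnion D).ι ≫ p))).map α)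
      ((toAffDilD p D hD).app c) ((toAffDilD p D hD).app d) ((affFunctor ι (dilD p D hD)).map α) :=
    (isPullback_gmι α (powFunctor ((complUnion D).ι ≫ p))).paste_vert
      (isPullback_affMap (toDilD p D hD) α (isPullback_toDilD p D hD α))
  have h2 := isPullback_dilFunctorLift (isLocallyPrincipal_centerM p D hD m)
    (isAdmissible_M p D hD m) (toAffDilD p D hD) (comap_centerM_eq_top p D hD m) α h1
  exact isPullback_dilFunctorLift (fun a _ ↦ isLocallyPrincipal_centerR p D hD m e a)
    (isAdmissible_R p D hD m e) (toDilM p D hD m) (comap_centerR_eq_top p D hD m e) α h2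

instance isOpenImmersion_toDilR_zero :
    IsOpenImmersion ((toDilR p D hD m e).app (op (.mk 0))) := by
  let Z : OverSimplexᵒᵖ := op (.mk 0)
  have h0 : IsOpenImmersion ((powMap p (complUnion D).ι rfl).app Z) := by
    have h := powMap_app_proj p (complUnion D).ι rfl Z 0
    have h' : (powMap p (complUnion D).ι rfl).app Z = (complUnion D).ι :=
      (Category.comp_id _).symm.trans (h.trans (Category.id_comp _))
    have h'' : IsOpenImmersion (complUnion D).ι := inferInstance
    rw [h']
    exact h''
  have h1 : IsOpenImmersion ((toDilD p D hD).app Z) :=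
    MorphismProperty.of_isPullback (isPullback_dilLift_of_comap_eq_top
      (hJ := isLocallyPrincipal_powDiv p hD Z) (comap_powDiv p D Z)).flip h0
  have h2 : IsOpenImmersion ((affMap ι (toDilD p D hD)).app Z) :=
    MorphismProperty.of_isPullback (AffineSpace.isPullback_map ((toDilD p D hD).app Z)).flip h1
  have h3 : IsOpenImmersion ((toAffDilD p D hD).app Z) := by
    have : IsOpenImmersion ((gmι ι (powFunctor ((complUnion D).ι ≫ p))).app Z) :=
      inferInstanceAs (IsOpenImmersion (gmOpen ι _).ι)
    exact MorphismProperty.comp_mem @IsOpenImmersion _ _ this h2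
  have h4 : IsOpenImmersion ((toDilM p D hD m).app Z) :=
    MorphismProperty.of_isPullback (isPullback_dilLift_of_comap_eq_top
      (hJ := isLocallyPrincipal_centerM p D hD m Z) (comap_centerM_eq_top p D hD m Z)).flip h3
  exact MorphismProperty.of_isPullback (isPullback_dilLift_of_comap_eq_top
      (hJ := fun _ ↦ isLocallyPrincipal_centerR p D hD m e Z)
      (comap_centerR_eq_top p D hD m e Z)).flip h4

end CartesianOpenPart

/-! ### Parameters of a divisor with simple normal crossings -/
section Jacobian
open KaehlerDifferential TensorProduct IsLocalRing

/-- If `A ⊗ Ω[P⁄k] → Ω[A⁄k]` is a split injection and `A` is formally smooth over `k`, then `A` is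
formally smooth over `P`. -/
lemma Algebra.FormallySmooth.of_mapBaseChange_split {k P A : Type u} [CommRing k] [CommRing P]
    [CommRing A] [Algebra k P] [Algebra k A] [Algebra P A] [IsScalarTower k P A]
    [Algebra.FormallySmooth k A] (l : Ω[A⁄k] →ₗ[A] A ⊗[P] Ω[P⁄k])
    (hl : l ∘ₗ mapBaseChange k P A = LinearMap.id) : Algebra.FormallySmooth P A := by
  have hinj : Function.Injective (mapBaseChange k P A) :=
    Function.LeftInverse.injective (g := l) fun x ↦ congr($hl x)
  have hex := exact_mapBaseChange_map k P A
  have hsurj := map_surjective k P A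
  refine ⟨?_, ?_⟩
  · obtain ⟨s, hs⟩ : ∃ s : Ω[A⁄P] →ₗ[A] Ω[A⁄k],
        KaehlerDifferential.map k P A A ∘ₗ s = LinearMap.id := by
      have h01 := (hex.split_tfae hinj hsurj).out 0 1
      rw [h01]
      exact ⟨l, hl⟩
    exact Module.Projective.of_split s (KaehlerDifferential.map k P A A) hs
  · have h1 := Algebra.H1Cotangent.exact_δ_mapBaseChange k P A
    have h2 := Algebra.H1Cotangent.exact_map_δ k P A
    have h0 (x) : Algebra.H1Cotangent.δ k P A x = 0 :=
      hinj (((h1 _).mpr ⟨x, rfl⟩).trans (map_zero _).symm)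
    refine ⟨fun x y ↦ ?_⟩
    obtain ⟨x', rfl⟩ := (h2 x).mp (h0 x)
    obtain ⟨y', rfl⟩ := (h2 y).mp (h0 y)
    rw [Subsingleton.elim x' y']

/-- The Jacobian criterion over a perfect field: a part of a regular system of parameters of a
smooth local ring defines a smooth morphism to an affine space. -/
theorem Algebra.FormallySmooth.of_linearIndependent_toCotangent {k O : Type u} [Field k]
    [PerfectField k] [CommRing O] [IsLocalRing O] [Algebra k O] [Algebra.EssFiniteType k O]
    [Algebra.FormallySmooth k O] {J : Type u} [Finite J] [Algebra (MvPolynomial J k) O]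
    [IsScalarTower k (MvPolynomial J k) O] (s : J → maximalIdeal O)
    (hs : ∀ j, (s j : O) = algebraMap (MvPolynomial J k) O (.X j))
    (hli : LinearIndependent (ResidueField O) fun j ↦ (maximalIdeal O).toCotangent (s j)) :
    Algebra.FormallySmooth (MvPolynomial J k) O := by
  let P := MvPolynomial J k
  let κ := ResidueField O
  have hκ : Algebra.FormallySmooth k κ := by
    have : Algebra.EssFiniteType k κ := .comp k O κ
    infer_instance
  have hsurj : Function.Surjective (algebraMap O κ) := residue_surjective
  -- the cotangent space of `O` embeds into the fibre of the differentials
  have hinj : Function.Injective (kerCotangentToTensor k O κ) :=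
    (Algebra.FormallySmooth.kerCotangentToTensor_injective_iff hsurj).mpr hκ.2
  have hker : RingHom.ker (algebraMap O κ) = maximalIdeal O := ker_residue
  have hd : LinearIndependent κ fun j ↦ (1 : κ) ⊗ₜ[O] D k O (s j : O) := by
    have := Fintype.ofFinite J
    let s' (j) : RingHom.ker (algebraMap O κ) := ⟨s j, hker.symm ▸ (s j).2⟩
    rw [Fintype.linearIndependent_iff] at hli ⊢
    intro c hc
    choose a ha using fun j ↦ hsurj (c j)
    have h1 : kerCotangentToTensor k O κ (Ideal.toCotangent _ (∑ j, a j • s' j)) = 0 := by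
      rw [map_sum, map_sum, ← hc]
      refine Finset.sum_congr rfl fun j _ ↦ ?_
      rw [map_smul, map_smul, kerCotangentToTensor_toCotangent, ← ha, algebraMap_smul]
    have h2 := hinj (h1.trans (map_zero _).symm)
    have h4 : ((∑ j, a j • s' j : RingHom.ker (algebraMap O κ)) : O) = ∑ j, a j * s j := by
      simp [s']
    rw [Ideal.toCotangent_eq_zero, h4] at h2
    refine hli c ?_
    have h3 : (maximalIdeal O).toCotangent (∑ j, a j • s j) = 0 := by
      rw [Ideal.toCotangent_eq_zero]
      rw [hker] at h2
      convert h2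
      simp
    rw [map_sum] at h3
    rw [← h3]
    refine Finset.sum_congr rfl fun j _ ↦ ?_
    rw [map_smul, ← ha]
    exact (algebraMap_smul κ (a j) _)
  have : Module.Projective O Ω[O⁄k] := Algebra.FormallySmooth.projective_kaehlerDifferential
  have : Module.Free O Ω[O⁄k] := Module.free_of_flat_of_isLocalRing
  let b := (KaehlerDifferential.mvPolynomialBasis k J).baseChange O
  have : Module.Finite P Ω[P⁄k] := .of_basis (KaehlerDifferential.mvPolynomialBasis k J)
  obtain ⟨l, hl⟩ := (split_injective_iff_lTensor_residueField_injective
    (mapBaseChange k P O)).mpr (by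
      have hb (j) : (mapBaseChange k P O).baseChange κ (b.baseChange κ j) =
          (1 : κ) ⊗ₜ[O] D k O (s j : O) := by
        simp [b, hs, P]
      have hf : ((mapBaseChange k P O).baseChange κ) = (Finsupp.linearCombination κ
          fun j ↦ (1 : κ) ⊗ₜ[O] D k O (s j : O)) ∘ₗ (b.baseChange κ).repr.toLinearMap := by
        refine (b.baseChange κ).ext fun j ↦ ?_
        rw [hb, LinearMap.comp_apply, LinearEquiv.coe_coe, Module.Basis.repr_self,
          Finsupp.linearCombination_single, one_smul]
      change Function.Injective ((mapBaseChange k P O).baseChange κ)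
      rw [hf]
      have hd' : Function.Injective (Finsupp.linearCombination κ
        fun j ↦ (1 : κ) ⊗ₜ[O] D k O (s j : O)) := hd
      rw [LinearMap.coe_comp]
      exact hd'.comp (b.baseChange κ).repr.injective)
  exact .of_mapBaseChange_split l hl

/-- The Jacobian criterion at a point of a smooth algebra over a perfect field. -/
theorem exists_smooth_away_of_linearIndependent_toCotangent {k A : Type u} [Field k]
    [PerfectField k] [CommRing A] [Algebra k A] [Algebra.Smooth k A] (𝔭 : Ideal A) [𝔭.IsPrime]
    (O : Type u) [CommRing O] [IsLocalRing O] [Algebra A O] [IsLocalization.AtPrime O 𝔭]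
    {J : Type u} [Finite J] (t : J → A) (s : J → maximalIdeal O)
    (hs : ∀ j, (s j : O) = algebraMap A O (t j))
    (hli : LinearIndependent (ResidueField O) fun j ↦ (maximalIdeal O).toCotangent (s j)) :
    ∃ f ∉ 𝔭, ∀ (g : A), f ∣ g → ∀ (B : Type u) [CommRing B] [Algebra A B]
      [IsLocalization.Away g B], ((algebraMap A B).comp
        (MvPolynomial.aeval (R := k) t).toRingHom).Smooth := by
  let P := MvPolynomial J k
  let _ : Algebra P A := (MvPolynomial.aeval (R := k) t).toAlgebra
  have : IsScalarTower k P A := .of_algHom (MvPolynomial.aeval (R := k) t)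
  let _ : Algebra P O := ((algebraMap A O).comp (algebraMap P A)).toAlgebra
  have : IsScalarTower P A O := .of_algebraMap_eq' rfl
  let _ : Algebra k O := ((algebraMap A O).comp (algebraMap k A)).toAlgebra
  have : IsScalarTower k A O := .of_algebraMap_eq' rfl
  have : IsScalarTower k P O := .of_algebraMap_eq fun x ↦ by
    rw [IsScalarTower.algebraMap_apply k A O, IsScalarTower.algebraMap_apply k P A]
    rfl
  have : Algebra.EssFiniteType A O := .of_isLocalization O 𝔭.primeCompl
  have : Algebra.EssFiniteType k O := .comp k A O
  have : Algebra.FormallySmooth A O := .of_isLocalization 𝔭.primeCompl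
  have : Algebra.FormallySmooth k O := .comp k A O
  have hO : Algebra.FormallySmooth P O := .of_linearIndependent_toCotangent s (fun j ↦ by
    rw [hs, IsScalarTower.algebraMap_apply P A O]
    exact congrArg _ (MvPolynomial.aeval_X (R := k) t j).symm) hli
  have : Algebra.FinitePresentation P A := .of_restrict_scalars_finitePresentation k P A
  have : Algebra.IsSmoothAt P 𝔭 := .of_equiv
    ((IsLocalization.algEquiv 𝔭.primeCompl O (Localization.AtPrime 𝔭)).restrictScalars P)
  obtain ⟨f, hf, h⟩ := Algebra.IsSmoothAt.exists_notMem_smooth P 𝔭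
  refine ⟨f, hf, fun g hfg B _ _ _ ↦ ?_⟩
  let _ : Algebra P B := ((algebraMap A B).comp (algebraMap P A)).toAlgebra
  have : IsScalarTower P A B := .of_algebraMap_eq' rfl
  have hg : Algebra.Smooth P (Localization.Away g) := by
    rw [← Algebra.basicOpen_subset_smoothLocus_iff_smooth] at h ⊢
    obtain ⟨c, rfl⟩ := hfg
    exact fun q hq ↦ h fun h' ↦ hq (Ideal.mul_mem_right _ _ h')
  have hB : Algebra.Smooth P B := .of_equiv
    ((IsLocalization.algEquiv (Submonoid.powers g) (Localization.Away g) B).restrictScalars P)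
  exact RingHom.smooth_algebraMap.mpr hB

end Jacobian

section Parameters
open Scheme.IdealSheafData

variable {k : Type u} [Field k] {X : Scheme.{u}} (p : X ⟶ Spec (CommRingCat.of k))

/-- The ring homomorphism from the base field to the sections over an open subset. -/
noncomputable def scalarHom (U : X.Opens) : k →+* Γ(X, U) :=
  ((Scheme.ΓSpecIso (CommRingCat.of k)).inv ≫ p.appLE ⊤ U le_top).hom

lemma scalarHom_res {U V : X.Opens} (h : V ≤ U) :
    (X.presheaf.map (homOfLE h).op).hom.comp (scalarHom p U) = scalarHom p V := by
  rw [scalarHom, scalarHom, ← CommRingCat.hom_comp, Category.assoc]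
  exact congrArg (fun f ↦ ((Scheme.ΓSpecIso (CommRingCat.of k)).inv ≫ f).hom)
    (p.appLE_map _ (homOfLE h).op)

lemma scalarHom_smooth [Smooth p] (U : X.affineOpens) : (scalarHom p U.1).Smooth := by
  have h1 : (p.appLE ⊤ U.1 le_top).hom.Smooth := HasRingHomProperty.appLE (P := @Smooth) p
    inferInstance ⟨⊤, isAffineOpen_top _⟩ U le_top
  exact RingHom.Smooth.respectsIso.2 (p.appLE ⊤ U.1 le_top).hom
    (Scheme.ΓSpecIso (CommRingCat.of k)).symm.commRingCatIsoToRingEquiv h1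

/-- Around every point, the components of a divisor with simple normal crossings passing through
it define a smooth morphism to an affine space. -/
theorem IsSimpleNormalCrossings.exists_smooth_parameters [PerfectField k] [Smooth p] {ι : Type u}
    [Fintype ι] {D : ι → X.IdealSheafData} (hD : IsSimpleNormalCrossings D) (x : X) :
    ∃ (U : X.affineOpens) (_ : x ∈ U.1) (t : ι → Γ(X, U)),
      (∀ i, (D i).ideal U = Ideal.span {t i}) ∧ (∀ i, x ∉ (D i).support → IsUnit (t i)) ∧
      (MvPolynomial.eval₂Hom (scalarHom p U.1)
        fun j : {i : ι // x ∈ (D i).support} ↦ t j).Smooth := by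
  classical
  obtain ⟨U, hx, t, ht, s, hs, hli⟩ := hD.exists_parameters x
  let A := Γ(X, U)
  let O := X.presheaf.stalk x
  let _ : Algebra k A := (scalarHom p U.1).toAlgebra
  have : Algebra.Smooth k A := scalarHom_smooth p U
  let _ : Algebra A O := (X.presheaf.germ U.1 x hx).hom.toAlgebra
  have : IsLocalization.AtPrime O (U.2.primeIdealOf ⟨x, hx⟩).asIdeal :=
    U.2.isLocalization_stalk ⟨x, hx⟩
  obtain ⟨a, ha, h⟩ := exists_smooth_away_of_linearIndependent_toCotangent (k := k)
    (U.2.primeIdealOf ⟨x, hx⟩).asIdeal O (fun j : {i : ι // x ∈ (D i).support} ↦ t j) s hs hli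
  let b : A := a * ∏ i with x ∉ (D i).support, t i
  have hxa : x ∈ X.basicOpen a := by
    rw [Scheme.mem_basicOpen _ _ _ hx]
    exact IsLocalization.map_units O (⟨a, ha⟩ : (U.2.primeIdealOf ⟨x, hx⟩).asIdeal.primeCompl)
  have hxb : x ∈ X.basicOpen b := by
    rw [Scheme.mem_basicOpen _ _ _ hx, map_mul, map_prod]
    refine ((Scheme.mem_basicOpen _ _ _ hx).mp hxa).mul ?_
    rw [IsUnit.prod_iff]
    intro i hi
    rw [← Scheme.mem_basicOpen, ← complOpen_inf (D i) U (ht i)]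
    exact ⟨(Finset.mem_filter.mp hi).2, hx⟩
  let W : X.affineOpens := X.affineBasicOpen b
  have hWU : W.1 ≤ U.1 := X.basicOpen_le b
  let _ : Algebra A Γ(X, W) := (X.presheaf.map (homOfLE hWU).op).hom.toAlgebra
  have hW : IsLocalization.Away b Γ(X, W) := U.2.isLocalization_basicOpen b
  have hb : IsUnit (X.presheaf.map (homOfLE hWU).op b) :=
    IsLocalization.Away.algebraMap_isUnit (S := Γ(X, W)) b
  refine ⟨W, hxb, fun i ↦ X.presheaf.map (homOfLE hWU).op (t i),
    fun i ↦ ideal_span_of_le hWU (ht i), fun i hi ↦ ?_, ?_⟩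
  · refine isUnit_of_dvd_unit ?_ hb
    refine map_dvd (X.presheaf.map (homOfLE hWU).op).hom (Dvd.dvd.mul_left ?_ a)
    exact Finset.dvd_prod_of_mem _ (Finset.mem_filter.mpr ⟨Finset.mem_univ i, hi⟩)
  · have h1 := h b (Dvd.intro _ rfl) Γ(X, W)
    convert h1 using 1
    refine MvPolynomial.ringHom_ext (fun r ↦ ?_) fun j ↦ ?_
    · have := congr($(scalarHom_res p hWU) r)
      refine (MvPolynomial.eval₂Hom_C _ _ _).trans (this.symm.trans ?_)
      exact congrArg _ (MvPolynomial.aeval_C (R := k) _ r).symm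
    · simp
      rfl

/-- The components of a divisor with simple normal crossings of a smooth scheme over a perfect
field are effective Cartier divisors. -/
lemma IsSimpleNormalCrossings.isInvertible [PerfectField k] [Smooth p] {ι : Type u}
    [Fintype ι] {D : ι → X.IdealSheafData} (hD : IsSimpleNormalCrossings D) (i : ι) :
    IsInvertible (D i) := fun x ↦ by
  obtain ⟨U, hx, t, ht, hu, hs⟩ := hD.exists_smooth_parameters p x
  refine ⟨U, hx, t i, ?_, ht i⟩
  by_cases hi : x ∈ (D i).support
  · have h1 := hs.flat.map_mem_nonZeroDivisors (mem_nonZeroDivisors_of_ne_zero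
      (MvPolynomial.X_ne_zero (R := k) (⟨i, hi⟩ : {i : ι // x ∈ (D i).support})))
    simpa using h1
  · exact (hu i hi).mem_nonZeroDivisors

end Parameters

/-! ### The root construction -/
section RootChart
open MvPolynomial TensorProduct

/-- A pushout of a smooth ring homomorphism, with its universal property among bare ring
homomorphisms. -/
lemma RingHom.exists_smooth_pushout {P A C : Type u} [CommRing P] [CommRing A] [CommRing C]
    {φ : P →+* A} (hφ : φ.Smooth) (τ : P →+* C) :
    ∃ (B : Type u) (_ : CommRing B) (β : A →+* B) (γ : C →+* B), γ.Smooth ∧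
      (∀ x, β (φ x) = γ (τ x)) ∧
      (∀ (S : Type u) [CommRing S] (ρ : A →+* S) (ε : C →+* S), ε.comp τ = ρ.comp φ →
        ∃ δ : B →+* S, δ.comp β = ρ ∧ δ.comp γ = ε) ∧
      (∀ (S : Type u) [CommRing S] (δ δ' : B →+* S), δ.comp β = δ'.comp β →
        δ.comp γ = δ'.comp γ → δ = δ') := by
  let _ : Algebra P A := φ.toAlgebra
  let _ : Algebra P C := τ.toAlgebra
  have hA : Algebra.Smooth P A := hφ
  refine ⟨C ⊗[P] A, inferInstance, Algebra.TensorProduct.includeRight.toRingHom,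
    algebraMap C (C ⊗[P] A), RingHom.smooth_algebraMap.mpr inferInstance, fun x ↦ ?_,
    fun S _ ρ ε h ↦ ?_, fun S _ δ δ' h h' ↦ ?_⟩
  · exact ((Algebra.TensorProduct.includeRight (R := P) (A := C) (B := A)).commutes x).trans
      (IsScalarTower.algebraMap_apply P C (C ⊗[P] A) x)
  · let _ : Algebra P S := (ρ.comp φ).toAlgebra
    let e₁ : C →ₐ[P] S := ⟨ε, fun x ↦ congr($h x)⟩
    let e₂ : A →ₐ[P] S := ⟨ρ, fun x ↦ rfl⟩
    refine ⟨(Algebra.TensorProduct.productMap e₁ e₂).toRingHom, ?_, ?_⟩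
    · ext x
      exact Algebra.TensorProduct.productMap_right_apply e₁ e₂ x
    · ext x
      exact Algebra.TensorProduct.productMap_left_apply e₁ e₂ x
  · refine RingHom.ext fun x ↦ ?_
    induction x with
    | zero => simp
    | add x y hx hy => rw [map_add, map_add, hx, hy]
    | tmul c a =>
      have h1 : c ⊗ₜ[P] a = algebraMap C (C ⊗[P] A) c *
          Algebra.TensorProduct.includeRight (R := P) (A := C) (B := A) a := by simp
      rw [h1, map_mul, map_mul]
      exact congr($(congr($h' c)) * $(congr($h a)))

/-- The universal `A`-algebra in which the elements `t i` become associated to `m i`-th powers of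
chosen elements `s i`: if those `t i` that are not units are the coordinates of a smooth morphism to
an affine space, then the `s i` are the coordinates of a smooth morphism to an affine space. -/
theorem exists_smooth_rootChart {k A ι : Type u} [Field k] [CommRing A] [Fintype ι]
    (φ : k →+* A) (t : ι → A) (m : ι → ℕ) (J : ι → Prop) (hu : ∀ i, ¬ J i → IsUnit (t i))
    (hm : ∀ i, 1 ≤ m i)
    (hs : (eval₂Hom φ fun j : {i : ι // J i} ↦ t j).Smooth) :
    ∃ (B : Type u) (_ : CommRing B) (β : A →+* B) (s : ι → B),
      (eval₂Hom (β.comp φ) s).Smooth ∧ (∀ i, Associated (β (t i)) (s i ^ m i)) ∧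
      (∀ (S : Type u) [CommRing S] (ρ : A →+* S) (σ : ι → S),
        (∀ i, Associated (ρ (t i)) (σ i ^ m i)) → ∃ δ : B →+* S, δ.comp β = ρ ∧ ∀ i, δ (s i) = σ i) ∧
      (∀ (S : Type u) [CommRing S] (δ δ' : B →+* S), δ.comp β = δ'.comp β →
        (∀ i, δ (s i) = δ' (s i)) → (∀ i, δ (β (t i)) ∈ nonZeroDivisors S) → δ = δ') := by
  classical
  let P := MvPolynomial {i : ι // J i} k
  let S₀ := MvPolynomial ι k
  let M := MvPolynomial {i : ι // J i} S₀
  -- `L = k[s i, v j^{±1}]`, with the `s i` for `i ∉ J` inverted, and `B` is its base change along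
  -- `t j ↦ v j⁻¹ * s j ^ m j`
  let g : M := (∏ j, X j) * C (∏ i with ¬ J i, X i)
  obtain ⟨L, _, η, hη, hηs, hLex, hLuniq⟩ : ∃ (L : Type u) (_ : CommRing L) (η : M →+* L),
      IsUnit (η g) ∧ (η.comp C).Smooth ∧
      (∀ (S : Type u) [CommRing S] (ε : M →+* S), IsUnit (ε g) → ∃ δ : L →+* S, δ.comp η = ε) ∧
      (∀ (S : Type u) [CommRing S] (δ δ' : L →+* S), δ.comp η = δ'.comp η → δ = δ') := by
    refine ⟨Localization.Away g, inferInstance, algebraMap M _,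
      IsLocalization.Away.algebraMap_isUnit g, ?_,
      fun S _ ε hε ↦ ⟨IsLocalization.Away.lift g hε, RingHom.ext (IsLocalization.Away.lift_eq g hε)⟩,
      fun S _ δ δ' h ↦ IsLocalization.ringHom_ext (Submonoid.powers g) h⟩
    have h1 : (algebraMap M (Localization.Away g)).Smooth :=
      RingHom.smooth_algebraMap.mpr (.of_isLocalization_Away g)
    have h2 : Algebra.Smooth S₀ M := ⟨inferInstance, inferInstance⟩
    exact .comp (f := algebraMap S₀ M) (RingHom.smooth_algebraMap.mpr h2) h1
  have hv (j : {i : ι // J i}) : IsUnit (η (X j)) := by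
    refine isUnit_of_dvd_unit (map_dvd _ (Dvd.dvd.mul_right ?_ _)) hη
    exact Finset.dvd_prod_of_mem _ (Finset.mem_univ j)
  have hsu (i : ι) (hi : ¬ J i) : IsUnit (η (C (X i))) := by
    refine isUnit_of_dvd_unit (map_dvd _ (Dvd.dvd.mul_left (map_dvd _ ?_) _)) hη
    exact Finset.dvd_prod_of_mem _ (Finset.mem_filter.mpr ⟨Finset.mem_univ i, hi⟩)
  choose v hv using hv
  let τ : P →+* L := eval₂Hom ((η.comp C).comp C) fun j ↦ ↑(v j)⁻¹ * η (C (X j.1)) ^ m j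
  obtain ⟨B, _, β, γ, hγ, hβγ, hBex, hBuniq⟩ := RingHom.exists_smooth_pushout hs τ
  have hβt (j : {i : ι // J i}) : β (t j) = γ (↑(v j)⁻¹ * η (C (X j.1)) ^ m j) := by
    simpa [τ] using hβγ (X j)
  let s (i : ι) : B := γ (η (C (X i)))
  refine ⟨B, inferInstance, β, s, ?_, fun i ↦ ?_, fun S _ ρ σ h ↦ ?_, fun S _ δ δ' h h' hd ↦ ?_⟩
  · have : eval₂Hom (β.comp φ) s = γ.comp (η.comp C) := by
      refine ringHom_ext (fun r ↦ ?_) fun i ↦ ?_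
      · simpa [τ] using hβγ (C r)
      · simp [s]
    rw [this]
    exact hηs.comp hγ
  · by_cases hi : J i
    · refine ⟨(v ⟨i, hi⟩).map γ, ?_⟩
      rw [hβt ⟨i, hi⟩, Units.coe_map, MonoidHom.coe_coe, ← map_mul, mul_right_comm,
        Units.inv_mul, one_mul, map_pow]
    · exact (associated_one_iff_isUnit.mpr ((hu i hi).map _)).trans
        (associated_one_iff_isUnit.mpr (((hsu i hi).map _).pow _)).symm
  · choose w hw using fun j : {i : ι // J i} ↦ h j
    have hσ (i) (hi : ¬ J i) : IsUnit (σ i) := by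
      have h1 := ((h i).isUnit_iff.mp ((hu i hi).map ρ))
      exact (isUnit_pow_iff (by have := hm i; omega)).mp h1
    obtain ⟨ε, hεk, hεs, hεv⟩ : ∃ ε : M →+* S, (∀ r, ε (C (C r)) = ρ (φ r)) ∧
        (∀ i, ε (C (X i)) = σ i) ∧ ∀ j, ε (X j) = w j :=
      ⟨eval₂Hom (eval₂Hom (ρ.comp φ) σ) fun j ↦ (w j : S),
        fun _ ↦ (eval₂Hom_C _ _ _).trans (eval₂Hom_C _ _ _),
        fun _ ↦ (eval₂Hom_C _ _ _).trans (eval₂Hom_X' _ _ _), fun _ ↦ eval₂Hom_X' _ _ _⟩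
    have hε : IsUnit (ε g) := by
      rw [map_mul, map_prod, map_prod, map_prod]
      refine .mul (IsUnit.prod_iff.mpr fun j _ ↦ ?_) (IsUnit.prod_iff.mpr fun i hi ↦ ?_)
      · exact hεv j ▸ (w j).isUnit
      · exact hεs i ▸ hσ i (Finset.mem_filter.mp hi).2
    obtain ⟨ε', hε''⟩ := hLex S ε hε
    have hε' (x) : ε' (η x) = ε x := congr($hε'' x)
    obtain ⟨δ, h1, h2⟩ := hBex S ρ ε' (by
      refine ringHom_ext (fun r ↦ ?_) fun j ↦ ?_
      · simp [τ, hε', hεk]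
      · have h1 : ε' (v j) = w j := by
          rw [hv, hε', hεv]
        have h2 : ε' ↑(v j)⁻¹ * w j = 1 := by
          rw [← h1, ← map_mul, Units.inv_mul, map_one]
        have h3 : ρ (t j) * w j = σ j ^ m j := hw j
        simp only [τ, RingHom.comp_apply, eval₂Hom_X', map_mul, map_pow, hε', hεs]
        rw [← h3]
        linear_combination (ρ (t j)) * h2)
    refine ⟨δ, h1, fun i ↦ ?_⟩
    refine (congr($h2 (η (C (X i))))).trans ?_
    rw [hε', hεs]
  · refine hBuniq S δ δ' h (hLuniq S _ _ (ringHom_ext' (ringHom_ext' (RingHom.ext fun r ↦ ?_) ?_) ?_))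
    · have h1 := hβγ (C r)
      simp only [eval₂Hom_C, τ, RingHom.comp_apply] at h1
      have := congr($h (φ r))
      simp only [RingHom.comp_apply, h1] at this
      exact this
    · exact fun i ↦ h' i
    · intro j
      -- `v j` is determined by `v j * t j = s j ^ m j`, as `t j` is a nonzerodivisor
      have h1 : γ (v j) * β (t j) = s j ^ m j := by
        rw [hβt, ← map_mul, Units.mul_inv_cancel_left, map_pow]
      have h2 := congrArg δ h1
      have h3 := congrArg δ' h1
      rw [map_mul, map_pow] at h2 h3
      have h4 : δ' (β (t j)) = δ (β (t j)) := congr($h (t j)).symm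
      rw [← h', ← h2, h4] at h3
      rw [RingHom.comp_apply, RingHom.comp_apply, RingHom.comp_apply, RingHom.comp_apply, ← hv]
      exact ((mul_cancel_right_mem_nonZeroDivisors (hd j)).mp h3).symm

end RootChart

section AffineSpaceSections
variable {Y : Scheme.{u}} {ι : Type u} (U : Y.affineOpens)

/-- The part of the affine space over an affine open subset. -/
noncomputable def affPreimage (ι : Type u) (U : Y.affineOpens) : (𝔸(ι; Y)).affineOpens :=
  ⟨(𝔸(ι; Y) ↘ Y) ⁻¹ᵁ U.1, U.2.preimage _⟩

lemma affPreimage_le (ι : Type u) (U : Y.affineOpens) :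
    (affPreimage ι U).1 ≤ (𝔸(ι; Y) ↘ Y) ⁻¹ᵁ U.1 := le_rfl

/-- The scalars in the ring of functions on the affine space over an affine open subset. -/
noncomputable def affScalar (ι : Type u) (U : Y.affineOpens) :
    Γ(Y, U) ⟶ Γ(𝔸(ι; Y), affPreimage ι U) :=
  (𝔸(ι; Y) ↘ Y).appLE U (affPreimage ι U) (affPreimage_le ι U)

/-- The coordinates in the ring of functions on the affine space over an affine open subset. -/
noncomputable def affCoord (U : Y.affineOpens) (i : ι) : Γ(𝔸(ι; Y), affPreimage ι U) :=
  (𝔸(ι; Y)).presheaf.map (homOfLE le_top).op (AffineSpace.coord Y i)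

lemma specMap_fromSpec_appTop {X : Scheme.{u}} (V : X.affineOpens) {R : CommRingCat.{u}}
    (ρ : Γ(X, V) ⟶ R) (s : Γ(X, ⊤)) : (Spec.map ρ ≫ V.2.fromSpec).appTop s =
      (Scheme.ΓSpecIso R).inv (ρ (X.presheaf.map (homOfLE le_top).op s)) := by
  let f := Spec.map ρ ≫ V.2.fromSpec
  have hW : ⊤ ≤ f ⁻¹ᵁ V.1 := RelSpec.specMap_fromSpec_le V.2 ρ
  have h1 := congr((Scheme.ΓSpecIso R).inv
    ($(RelSpec.specMap_fromSpec_appLE V.2 ρ) (X.presheaf.map (homOfLE le_top).op s)))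
  refine Eq.trans ?_ h1
  rw [CommRingCat.comp_apply]
  refine Eq.trans ?_ congr($((Scheme.ΓSpecIso R).hom_inv_id) _).symm
  have h2 := f.map_appLE hW (homOfLE le_top).op
  refine Eq.trans ?_ (congr($h2 s)).symm
  exact congr($(f.app_eq_appLE) s)

/-- The universal property of the polynomial ring for the functions on the affine space over `U`. -/
lemma exists_hom_affPreimage {S : CommRingCat.{u}} (ρ : Γ(Y, U) ⟶ S) (σ : ι → S) :
    ∃ δ : Γ(𝔸(ι; Y), affPreimage ι U) ⟶ S,
      affScalar ι U ≫ δ = ρ ∧ ∀ i, δ (affCoord U i) = σ i := by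
  let f : Spec S ⟶ 𝔸(ι; Y) := AffineSpace.homOfVector (Spec.map ρ ≫ U.2.fromSpec)
    fun i ↦ (Scheme.ΓSpecIso S).inv (σ i)
  have hf : f ≫ (𝔸(ι; Y) ↘ Y) = Spec.map ρ ≫ U.2.fromSpec := AffineSpace.homOfVector_over _ _
  have hU : ⊤ ≤ (Spec.map ρ ≫ U.2.fromSpec) ⁻¹ᵁ U.1 := RelSpec.specMap_fromSpec_le U.2 ρ
  have hW : ⊤ ≤ f ⁻¹ᵁ (affPreimage ι U).1 := by rwa [← hf] at hU
  refine ⟨f.appLE _ ⊤ hW ≫ (Scheme.ΓSpecIso S).hom, ?_, fun i ↦ ?_⟩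
  · have h1 := RelSpec.specMap_fromSpec_appLE U.2 ρ
    rw [affScalar, ← Category.assoc, Scheme.Hom.appLE_comp_appLE]
    refine Eq.trans ?_ h1
    congr 2
  · have h1 : f.appTop (AffineSpace.coord Y i) = (Scheme.ΓSpecIso S).inv (σ i) :=
      AffineSpace.homOfVector_appTop_coord _ _ i
    have h2 := f.map_appLE hW (homOfLE (le_top : (affPreimage ι U).1 ≤ ⊤)).op
    have h3 : f.appLE _ ⊤ hW (affCoord U i) = f.appTop (AffineSpace.coord Y i) :=
      (congr($h2 (AffineSpace.coord Y i))).trans (congr($(f.app_eq_appLE) _)).symm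
    rw [CommRingCat.comp_apply, h3, h1]
    exact congr($((Scheme.ΓSpecIso S).inv_hom_id) (σ i))

lemma specMap_fromSpec_over {S : CommRingCat.{u}} (δ : Γ(𝔸(ι; Y), affPreimage ι U) ⟶ S) :
    (Spec.map δ ≫ (affPreimage ι U).2.fromSpec) ≫ (𝔸(ι; Y) ↘ Y) =
      Spec.map (affScalar ι U ≫ δ) ≫ U.2.fromSpec := by
  rw [Category.assoc, ← U.2.SpecMap_appLE_fromSpec (𝔸(ι; Y) ↘ Y) (affPreimage ι U).2
    (affPreimage_le ι U),
    Spec.map_comp, Category.assoc]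
  rfl

lemma affPreimage_hom_ext {S : CommRingCat.{u}} {δ δ' : Γ(𝔸(ι; Y), affPreimage ι U) ⟶ S}
    (h : affScalar ι U ≫ δ = affScalar ι U ≫ δ') (h' : ∀ i, δ (affCoord U i) = δ' (affCoord U i)) :
    δ = δ' := by
  have := (affPreimage ι U).2.isOpenImmersion_fromSpec
  refine Spec.map_injective ?_
  rw [← cancel_mono (affPreimage ι U).2.fromSpec]
  refine AffineSpace.hom_ext ?_ fun i ↦ ?_
  · rw [specMap_fromSpec_over, specMap_fromSpec_over, h]
  · rw [specMap_fromSpec_appTop, specMap_fromSpec_appTop]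
    exact congrArg _ (h' i)

lemma fromSpec_comp_eq_scalarHom {k : Type u} [Field k] (q : Y ⟶ Spec (CommRingCat.of k)) :
    U.2.fromSpec ≫ q = Spec.map (CommRingCat.ofHom (scalarHom q U.1)) := by
  rw [← (isAffineOpen_top _).SpecMap_appLE_fromSpec q U.2 le_top, IsAffineOpen.fromSpec_top,
    Scheme.isoSpec_Spec_inv, ← Spec.map_comp]
  rfl

lemma ΓSpecIso_inv_specMap_appTop {R S : CommRingCat.{u}} (f : R ⟶ S) (x : R) :
    (Scheme.ΓSpecIso S).inv (f x) = (Spec.map f).appTop ((Scheme.ΓSpecIso R).inv x) :=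
  congr($(Scheme.ΓSpecIso_inv_naturality f) x)

lemma specMap_fromSpec_map {k : Type u} [Field k] (q : Y ⟶ Spec (CommRingCat.of k))
    {S : CommRingCat.{u}} (δ : Γ(𝔸(ι; Y), affPreimage ι U) ⟶ S) :
    (Spec.map δ ≫ (affPreimage ι U).2.fromSpec) ≫ AffineSpace.map ι q =
      Spec.map (CommRingCat.ofHom (MvPolynomial.eval₂Hom
        ((affScalar ι U ≫ δ).hom.comp (scalarHom q U.1)) fun i ↦ δ (affCoord U i))) ≫
      (AffineSpace.SpecIso ι (CommRingCat.of k)).inv := by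
  refine AffineSpace.hom_ext ?_ fun i ↦ ?_
  · rw [Category.assoc, AffineSpace.map_over, ← Category.assoc, specMap_fromSpec_over,
      Category.assoc, fromSpec_comp_eq_scalarHom, Category.assoc, AffineSpace.SpecIso_inv_over,
      ← Spec.map_comp, ← Spec.map_comp]
    refine congrArg Spec.map (CommRingCat.hom_ext (RingHom.ext fun r ↦ ?_))
    exact (MvPolynomial.eval₂Hom_C _ _ _).symm
  · let θ := CommRingCat.ofHom (MvPolynomial.eval₂Hom
      ((affScalar ι U ≫ δ).hom.comp (scalarHom q U.1)) fun i ↦ δ (affCoord U i))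
    calc
      _ = (Spec.map δ ≫ (affPreimage ι U).2.fromSpec).appTop
          ((AffineSpace.map ι q).appTop (AffineSpace.coord _ i)) :=
        congr($(Scheme.Hom.comp_appTop (Spec.map δ ≫ (affPreimage ι U).2.fromSpec)
          (AffineSpace.map ι q)) (AffineSpace.coord _ i))
      _ = (Spec.map δ ≫ (affPreimage ι U).2.fromSpec).appTop (AffineSpace.coord Y i) :=
        congrArg (Spec.map δ ≫ (affPreimage ι U).2.fromSpec).appTop
          (AffineSpace.map_appTop_coord q i)
      _ = (Scheme.ΓSpecIso S).inv (δ (affCoord U i)) := specMap_fromSpec_appTop _ _ _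
      _ = (Scheme.ΓSpecIso S).inv (θ (.X i)) :=
        congrArg (Scheme.ΓSpecIso S).inv (MvPolynomial.eval₂Hom_X'
          ((affScalar ι U ≫ δ).hom.comp (scalarHom q U.1)) (fun i ↦ δ (affCoord U i)) i).symm
      _ = (Spec.map θ).appTop ((Scheme.ΓSpecIso (.of (MvPolynomial ι k))).inv (.X i)) :=
        ΓSpecIso_inv_specMap_appTop θ (.X i)
      _ = (Spec.map θ).appTop ((AffineSpace.SpecIso ι (CommRingCat.of k)).inv.appTop
          (AffineSpace.coord _ i)) :=
        congrArg (Spec.map θ).appTop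
          (AffineSpace.SpecIso_inv_appTop_coord (CommRingCat.of k) i).symm
      _ = (Spec.map θ ≫ (AffineSpace.SpecIso ι (CommRingCat.of k)).inv).appTop
          (AffineSpace.coord _ i) := by
        rw [Scheme.Hom.comp_appTop]
        rfl

end AffineSpaceSections

section RootStack
open Scheme.IdealSheafData

/-- Locally on `Y`, the ideals `E i` are generated by functions that are either units or, taken
together, the coordinates of a smooth morphism to an affine space over `k`. -/
def HasSmoothParameters {k : Type u} [Field k] {Y : Scheme.{u}} (q : Y ⟶ Spec (CommRingCat.of k))
    {ι : Type u} (E : ι → Y.IdealSheafData) : Prop :=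
  ∀ y : Y, ∃ (U : Y.affineOpens) (_ : y ∈ U.1) (t : ι → Γ(Y, U)) (J : ι → Prop),
    (∀ i, (E i).ideal U = Ideal.span {t i}) ∧ (∀ i, ¬ J i → IsUnit (t i)) ∧
    (MvPolynomial.eval₂Hom (scalarHom q U.1) fun j : {i : ι // J i} ↦ t j).Smooth

variable {k : Type u} [Field k] {Y : Scheme.{u}} {q : Y ⟶ Spec (CommRingCat.of k)}
  {ι : Type u} {E : ι → Y.IdealSheafData}

/-- Coordinates pull back to coordinates along smooth morphisms. -/
lemma HasSmoothParameters.comap_of_smooth (h : HasSmoothParameters q E) {Z : Scheme.{u}}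
    (w : Z ⟶ Y) [Smooth w] : HasSmoothParameters (w ≫ q) fun i ↦ (E i).comap w := fun z ↦ by
  obtain ⟨U, hU, t, J, ht, hu, hs⟩ := h (w z)
  obtain ⟨W, hW, hz, hWU⟩ := exists_isAffineOpen_mem_and_subset (X := Z) (x := z) (U := w ⁻¹ᵁ U.1) hU
  refine ⟨⟨W, hW⟩, hz, fun i ↦ w.appLE U W hWU (t i), J, fun i ↦ ?_,
    fun i hi ↦ (hu i hi).map (w.appLE U W hWU).hom, ?_⟩
  · rw [ideal_comap w (E i) U ⟨W, hW⟩ hWU, ht, Ideal.map_span, Set.image_singleton]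
  · have h1 : (w.appLE U W hWU).hom.Smooth := HasRingHomProperty.appLE (P := @Smooth) w
      inferInstance U ⟨W, hW⟩ hWU
    have h2 := hs.comp h1
    convert h2 using 1
    refine MvPolynomial.ringHom_ext (fun r ↦ ?_) fun j ↦ ?_
    · have h3 : scalarHom (w ≫ q) W = (w.appLE U W hWU).hom.comp (scalarHom q U.1) := by
        rw [scalarHom, scalarHom, ← CommRingCat.hom_comp, Category.assoc]
        exact congrArg (fun f ↦ ((Scheme.ΓSpecIso (CommRingCat.of k)).inv ≫ f).hom)
          (Scheme.Hom.appLE_comp_appLE w q ⊤ U.1 W le_top hWU).symm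
      rw [h3]
      simp
    · simp

lemma associated_of_dvd_of_mem_nonZeroDivisors {R : Type*} [CommRing R] {a b : R}
    (ha : a ∈ nonZeroDivisors R) (h : a ∣ b) (h' : b ∣ a) : Associated a b := by
  obtain ⟨c, rfl⟩ := h
  obtain ⟨d, hd⟩ := h'
  have h1 : c * d = 1 := by
    rw [← sub_eq_zero]
    refine (mem_nonZeroDivisors_iff_right.mp ha) _ ?_
    linear_combination -hd
  exact ⟨Units.mkOfMulEqOne c d h1, rfl⟩

/-- The universal scheme over `𝔸(ι; Y)` on which the `E i` are `m i`-th powers of the coordinates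
is smooth over `𝔸(ι; k)`. -/
theorem HasSmoothParameters.smooth_dilStr [Fintype ι] (h : HasSmoothParameters q E) (m : ι → ℕ)
    (hm : ∀ i, 1 ≤ m i) {J : ι × Bool → (𝔸(ι; Y)).IdealSheafData}
    (hJ : ∀ x, IsLocallyPrincipal (J x)) (hJt : ∀ i, J (i, true) = (E i).comap (𝔸(ι; Y) ↘ Y))
    (hJf : ∀ i, J (i, false) = princ (AffineSpace.coord Y i) ^ m i) :
    Smooth (dilStr (fun x ↦ J (swapM x)) J hJ ≫ AffineSpace.map ι q) := by
  refine smooth_of_forall_exists _ fun e ↦ ?_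
  obtain ⟨U, hyU, t, K, ht, hu, hs⟩ := h ((𝔸(ι; Y) ↘ Y) (dilStr (fun x ↦ J (swapM x)) J hJ e))
  let V := affPreimage ι U
  obtain ⟨B, _, β, s, hsm, hass, hex, huniq⟩ :=
    exists_smooth_rootChart (scalarHom q U.1) t m K hu hm hs
  obtain ⟨γ, hγ, hγ'⟩ := exists_hom_affPreimage U (CommRingCat.ofHom β) s
  let g : ι × Bool → Γ(𝔸(ι; Y), V)
    | (i, true) => affScalar ι U (t i)
    | (i, false) => affCoord U i ^ m i
  have hg (x) : (J x).ideal V = Ideal.span {g x} := by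
    obtain ⟨i, _ | _⟩ := x
    · rw [hJf, ideal_pow, Pi.pow_apply, princ_ideal, Ideal.span_singleton_pow]
      rfl
    · rw [hJt, ideal_comap _ (E i) U V (affPreimage_le ι U), ht, Ideal.map_span,
        Set.image_singleton]
      rfl
  -- admissibility says that `t i` and `s i ^ m i` are associated nonzerodivisors
  have hadm {S : CommRingCat.{u}} (ρ : Γ(𝔸(ι; Y), V) ⟶ S) :
      IsAdmissible (fun x ↦ J (swapM x)) J (Spec.map ρ ≫ V.2.fromSpec) ↔
        ∀ i, ρ (affScalar ι U (t i)) ∈ nonZeroDivisors S ∧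
          Associated (ρ (affScalar ι U (t i))) (ρ (affCoord U i) ^ m i) := by
    rw [isAdmissible_specMap_iff ρ hg]
    have h1 (x) : (∀ z ∈ (J (swapM x)).ideal V, ρ (g x) ∣ ρ z) ↔ ρ (g x) ∣ ρ (g (swapM x)) := by
      rw [hg]
      refine ⟨fun h ↦ h _ (Ideal.mem_span_singleton_self _), fun h z hz ↦ ?_⟩
      exact h.trans (map_dvd ρ.hom (Ideal.mem_span_singleton.mp hz))
    simp_rw [h1]
    refine ⟨fun h i ↦ ⟨(h (i, true)).1, ?_⟩, fun h x ↦ ?_⟩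
    · rw [← map_pow]
      exact associated_of_dvd_of_mem_nonZeroDivisors (h (i, true)).1 (h (i, true)).2
        (h (i, false)).2
    · obtain ⟨i, _ | _⟩ := x
      · obtain ⟨h2, h3⟩ := h i
        rw [← map_pow] at h3
        refine ⟨?_, h3.symm.dvd⟩
        obtain ⟨c, hc⟩ := h3
        exact hc ▸ mul_mem h2 c.isUnit.mem_nonZeroDivisors
      · refine ⟨(h i).1, ?_⟩
        have := (h i).2.dvd
        rwa [← map_pow] at this
  have hγt (i) : γ (affScalar ι U (t i)) = β (t i) := congr($hγ (t i))
  -- by flatness over `k[s i]`, the coordinates `s i` are nonzerodivisors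
  have hnzd (i) : β (t i) ∈ nonZeroDivisors B := by
    have h1 : s i ∈ nonZeroDivisors B := by
      have := hsm.flat.map_mem_nonZeroDivisors (mem_nonZeroDivisors_of_ne_zero
        (MvPolynomial.X_ne_zero (R := k) i))
      simpa using this
    obtain ⟨c, hc⟩ := (hass i).symm
    exact hc ▸ mul_mem (pow_mem h1 _) c.isUnit.mem_nonZeroDivisors
  obtain ⟨ho, hrange⟩ := isOpenImmersion_dilLift_specMap (I := fun x ↦ J (swapM x)) (J := J)
    (hJ := hJ) (V := V) γ 1 ((hadm γ).mpr fun i ↦ by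
      rw [hγt, hγ']
      exact ⟨hnzd i, hass i⟩) (by rw [map_one]; exact isUnit_one) (fun S ρ _ hρ ↦ by
      obtain ⟨δ, h1, h2⟩ := hex S (affScalar ι U ≫ ρ).hom (fun i ↦ ρ (affCoord U i))
        fun i ↦ ((hadm ρ).mp hρ i).2
      refine ⟨CommRingCat.ofHom δ, affPreimage_hom_ext U ?_ fun i ↦ ?_⟩
      · rw [← Category.assoc, hγ]
        exact CommRingCat.hom_ext h1
      · rw [CommRingCat.comp_apply, hγ']
        exact h2 i) fun δ hδ ↦ by
      have h1 : δ.hom.comp β = (RingHom.id B).comp β := by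
        have h2 : CommRingCat.ofHom β ≫ δ = CommRingCat.ofHom β := by
          rw [← hγ, Category.assoc, hδ]
        exact congr(($h2).hom)
      refine CommRingCat.hom_ext (huniq B δ.hom (.id B) h1 (fun i ↦ ?_) fun i ↦ ?_)
      · rw [← hγ']
        exact congr($hδ (affCoord U i))
      · rw [show δ.hom (β (t i)) = β (t i) from congr($h1 (t i))]
        exact hnzd i
  refine ⟨_, _, ho, hrange e ?_, ?_⟩
  · rw [Scheme.basicOpen_of_isUnit _ isUnit_one]
    exact hyU
  · rw [← Category.assoc, dilLift_str, specMap_fromSpec_map]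
    have h1 : (fun i ↦ γ (affCoord U i)) = s := funext hγ'
    have h2 : Smooth (Spec.map (CommRingCat.ofHom (MvPolynomial.eval₂Hom
        ((affScalar ι U ≫ γ).hom.comp (scalarHom q U.1)) fun i ↦ γ (affCoord U i)))) := by
      refine (HasRingHomProperty.Spec_iff (P := @Smooth)).mpr ?_
      rw [h1, hγ]
      exact hsm
    infer_instance

end RootStack

/-! ### Normality of the `0`-th term -/
section GmNormalization

/-- A ring that is integrally closed in an overring is its normalization. -/
lemma isNormalization_specMap {R K : CommRingCat.{u}} (φ : R ⟶ K)
    (hφ : Function.Injective φ) (h : ∀ x : K, φ.hom.IsIntegralElem x → x ∈ φ.hom.range) :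
    IsNormalization (Spec.map φ) (𝟙 (Spec R)) where
  isIntegralHom := inferInstance
  isAffineHom := inferInstance
  isSchemeTheoreticallyDominant := by
    refine ⟨le_bot_iff.mp (Scheme.IdealSheafData.le_of_isAffine ?_)⟩
    rw [Scheme.Hom.ker_apply]
    intro x hx
    refine (map_eq_zero_iff (Scheme.ΓSpecIso R).commRingCatIsoToRingEquiv (RingEquiv.injective _)).mp
      (hφ ?_)
    rw [map_zero]
    have h1 := congr($(Scheme.ΓSpecIso_naturality φ) x)
    refine h1.symm.trans ?_
    rw [CommRingCat.comp_apply]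
    exact (congrArg (Scheme.ΓSpecIso K).hom hx).trans (map_zero _)
  exists_desc T f₁ f₂ _ hf := by
    have : IsAffine T := isAffine_of_isAffineHom f₂
    let a : Γ(T, ⊤) ⟶ K := Spec.preimage (f₁ ≫ T.isoSpec.hom)
    let b : R ⟶ Γ(T, ⊤) := Spec.preimage (T.isoSpec.inv ≫ f₂)
    have ha : Spec.map a = f₁ ≫ T.isoSpec.hom := Spec.map_preimage _
    have hb : Spec.map b = T.isoSpec.inv ≫ f₂ := Spec.map_preimage _
    have hab : b ≫ a = φ := Spec.map_injective (by
      rw [Spec.map_comp, ha, hb, Category.assoc, Iso.hom_inv_id_assoc, hf, Category.comp_id])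
    have hbi : b.hom.IsIntegral := by
      have : IsIntegralHom (Spec.map b) := hb ▸ inferInstance
      exact (IsIntegralHom.SpecMap_iff).mp this
    let e : R ≃+* φ.hom.range := RingEquiv.ofBijective φ.hom.rangeRestrict
      ⟨fun x y hxy ↦ hφ congr(($hxy).1), φ.hom.rangeRestrict_surjective⟩
    -- the functions on `T` are integral over `R`, so their images in `K` lie in the image of `R`
    let c : Γ(T, ⊤) ⟶ R := CommRingCat.ofHom (e.symm.toRingHom.comp (a.hom.codRestrict φ.hom.range
      fun x ↦ h _ (by
        obtain ⟨q, hq, hqx⟩ := hbi x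
        refine ⟨q, hq, ?_⟩
        rw [← hab, CommRingCat.hom_comp, ← Polynomial.hom_eval₂, hqx, map_zero])))
    have hc : c ≫ φ = a := by
      refine CommRingCat.hom_ext (RingHom.ext fun x ↦ ?_)
      exact congr(($(e.apply_symm_apply ⟨a x, _⟩)).1)
    have hbc : b ≫ c = 𝟙 R := by
      refine CommRingCat.hom_ext (RingHom.ext fun x ↦ hφ ?_)
      exact congr(($hc) (b x)).trans congr($hab x)
    refine ⟨Spec.map c ≫ T.isoSpec.inv, ?_, ?_⟩
    · rw [← Category.assoc, ← Spec.map_comp, hc, ha, Category.assoc, Iso.hom_inv_id,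
        Category.comp_id]
    · rw [Category.assoc, ← hb, ← Spec.map_comp, hbc, Spec.map_id]

/-- An integrally closed domain is integrally closed in its localizations. -/
lemma IsLocalization.Away.mem_range_of_isIntegralElem {R K : Type*} [CommRing R] [IsDomain R]
    [IsIntegrallyClosed R] [CommRing K] [Algebra R K] {s : R} (hs : s ≠ 0)
    [IsLocalization.Away s K] (x : K) (hx : IsIntegral R x) : x ∈ (algebraMap R K).range := by
  let F := FractionRing R
  have hu : IsUnit (algebraMap R F s) := by
    rw [isUnit_iff_ne_zero]
    simpa using hs
  let l : K →+* F := IsLocalization.Away.lift s hu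
  let _ : Algebra K F := l.toAlgebra
  have : IsScalarTower R K F := .of_algebraMap_eq fun r ↦ (IsLocalization.Away.lift_eq s hu r).symm
  have hl : Function.Injective (algebraMap K F) := by
    rw [injective_iff_map_eq_zero]
    intro x hx
    obtain ⟨n, r, hr⟩ := IsLocalization.Away.surj s x
    have h1 : algebraMap R F r = 0 := by
      rw [IsScalarTower.algebraMap_apply R K F, ← hr, map_mul, hx, zero_mul]
    rw [FaithfulSMul.algebraMap_eq_zero_iff] at h1
    rw [h1, map_zero] at hr
    exact ((IsLocalization.Away.algebraMap_isUnit (S := K) s).pow n).mul_left_eq_zero.mp hr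
  obtain ⟨y, hy⟩ := IsIntegrallyClosed.isIntegral_iff.mp (hx.algebraMap (B := F))
  exact ⟨y, hl ((IsScalarTower.algebraMap_apply R K F y).symm.trans hy)⟩

variable {k : Type u} [Field k] (ι : Type u) [Fintype ι]

/-- Affine space over a field is normal in the complement of the coordinate hyperplanes. -/
lemma isNormalization_gmOpen_spec :
    IsNormalization (gmOpen ι (Spec (CommRingCat.of k))).ι
      (𝟙 𝔸(ι; Spec (CommRingCat.of k))) := by
  let R := MvPolynomial ι k
  let s : R := ∏ i, .X i
  have hs : s ≠ 0 := Finset.prod_ne_zero_iff.mpr fun i _ ↦ MvPolynomial.X_ne_zero i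
  let K := Localization.Away s
  let φ : CommRingCat.of R ⟶ CommRingCat.of K := CommRingCat.ofHom (algebraMap R K)
  have h := isNormalization_specMap φ
    (IsLocalization.injective K (powers_le_nonZeroDivisors_of_noZeroDivisors hs))
    fun x hx ↦ IsLocalization.Away.mem_range_of_isIntegralElem hs x hx
  let σ := (AffineSpace.SpecIso ι (CommRingCat.of k)).hom
  have : IsOpenImmersion (Spec.map φ) := IsOpenImmersion.of_isLocalization s
  have hrange : σ ⁻¹ᵁ (Spec.map φ).opensRange = (gmOpen ι (Spec (CommRingCat.of k))).ι.opensRange := by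
    have h1 : (Spec.map φ).opensRange =
        (Spec (CommRingCat.of R)).basicOpen ((Scheme.ΓSpecIso (CommRingCat.of R)).inv s) := by
      exact (Scheme.Hom.opensRange_localizationAway (R := CommRingCat.of R) s).trans
        (basicOpen_eq_of_affine (R := CommRingCat.of R) s).symm
    rw [h1, Scheme.preimage_basicOpen, Scheme.Opens.opensRange_ι, gmOpen]
    refine congrArg (𝔸(ι; Spec (CommRingCat.of k))).basicOpen ?_
    have h2 : (Scheme.ΓSpecIso (CommRingCat.of R)).inv ≫ σ.appTop = CommRingCat.ofHom
        (MvPolynomial.eval₂Hom ((Scheme.ΓSpecIso (CommRingCat.of k)).inv ≫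
          (𝔸(ι; Spec (CommRingCat.of k)) ↘ Spec (CommRingCat.of k)).appTop).hom
          (AffineSpace.coord (Spec (CommRingCat.of k)))) := by
      rw [AffineSpace.SpecIso_hom_appTop, Iso.inv_hom_id_assoc]
    refine (congr($h2 s)).trans ?_
    refine (map_prod (MvPolynomial.eval₂Hom _ _) _ _).trans ?_
    exact Finset.prod_congr rfl fun i _ ↦ MvPolynomial.eval₂Hom_X' _ _ _
  have hle : Set.range ((gmOpen ι (Spec (CommRingCat.of k))).ι ≫ σ) ⊆ Set.range (Spec.map φ) := by
    rintro _ ⟨x, rfl⟩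
    have h1 : (gmOpen ι (Spec (CommRingCat.of k))).ι x ∈ σ ⁻¹ᵁ (Spec.map φ).opensRange := by
      rw [hrange]
      exact ⟨x, rfl⟩
    exact h1
  exact h.of_isPullback (IsPullback.of_vert_isIso (fst := σ) (snd := 𝟙 _) (f := 𝟙 _) (g := σ)
    ⟨by simp⟩) (IsOpenImmersion.isPullback _ _ _ _ (IsOpenImmersion.lift_fac _ _ hle).symm hrange)

end GmNormalization

section RootOpenPart
open Scheme.IdealSheafData

/-- The part of the universal scheme over `𝔸(ι; Y)` on which the `E i` are powers of the coordinates
where the coordinates are invertible lies over the open subscheme where the `E i` are trivial. -/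
lemma isPullback_gmOpen_dilStr {Y U S : Scheme.{u}} {ι : Type u} [Fintype ι] (j : U ⟶ Y) (q : Y ⟶ S)
    {E : ι → Y.IdealSheafData} (hj : ∀ ⦃T : Scheme.{u}⦄ (h : T ⟶ Y),
      (∀ i, (E i).comap h = ⊤) → ∃ u, u ≫ j = h) (m : ι → ℕ)
    {J : ι × Bool → (𝔸(ι; Y)).IdealSheafData}
    {hJ : ∀ x, IsLocallyPrincipal (J x)} (hJt : ∀ i, J (i, true) = (E i).comap (𝔸(ι; Y) ↘ Y))
    (hJf : ∀ i, J (i, false) = princ (AffineSpace.coord Y i) ^ m i)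
    (t : (gmOpen ι U).toScheme ⟶ dil (fun x ↦ J (swapM x)) J hJ) (hmono : Mono t)
    (ht : t ≫ dilStr _ _ _ = (gmOpen ι U).ι ≫ AffineSpace.map ι j) :
    IsPullback t ((AffineSpace.map ι (j ≫ q)).resLE _ _ (gmOpen_le ι _))
      (dilStr _ _ _ ≫ AffineSpace.map ι q) (gmOpen ι S).ι := by
  have hsq := isPullback_gm_resLE (ι := ι) (j ≫ q)
  have hpb := hsq.paste_vert (AffineSpace.isPullback_map (j ≫ q))
  have hadm : IsAdmissible (fun x ↦ J (swapM x)) J (dilStr _ _ hJ) := isAdmissible_dilStr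
  have key (T : Scheme.{u}) (f : T ⟶ dil (fun x ↦ J (swapM x)) J hJ)
      (g : T ⟶ (gmOpen ι S).toScheme)
      (hfg : f ≫ dilStr _ _ _ ≫ AffineSpace.map ι q = g ≫ (gmOpen ι S).ι) :
      ∃ v, v ≫ t = f ∧ v ≫ (AffineSpace.map ι (j ≫ q)).resLE _ _ (gmOpen_le ι _) = g := by
    let s := dilStr (fun x ↦ J (swapM x)) J hJ
    have hf (i) : (J (i, false)).comap (f ≫ s) = ⊤ := by
      have h1 : (f ≫ s).appTop (AffineSpace.coord Y i) =
          g.appTop ((gmOpen ι S).ι.appTop (AffineSpace.coord S i)) := by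
        have h2 := congr(($hfg).appTop (AffineSpace.coord S i))
        rw [Scheme.Hom.comp_appTop g, ← Category.assoc, Scheme.Hom.comp_appTop (f ≫ _)] at h2
        refine Eq.trans ?_ h2
        exact (congrArg (f ≫ s).appTop (AffineSpace.map_appTop_coord q i)).symm
      rw [hJf, comap_pow, comap_princ, h1,
        princ_of_isUnit ((isUnit_coord S i).map g.appTop.hom), ← one_eq_top, one_pow]
    -- the coordinates are invertible on `T`, hence so are the equations of the `E i`
    have hfE (i) : (E i).comap (f ≫ s ≫ (𝔸(ι; Y) ↘ Y)) = ⊤ := by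
      have h1 := comap_mono f (hadm.le (i, true))
      have h2 : ((J (i, false)).comap s).comap f ≤ ((J (i, true)).comap s).comap f := h1
      rw [← comap_comp, hf, top_le_iff, hJt, ← comap_comp, ← comap_comp] at h2
      exact h2
    obtain ⟨u, hu⟩ := hj _ hfE
    have hcond : g ≫ (gmOpen ι S).ι ≫ (𝔸(ι; S) ↘ S) = u ≫ j ≫ q := by
      rw [← Category.assoc, ← hfg, ← Category.assoc u, hu, Category.assoc, Category.assoc,
        AffineSpace.map_over, Category.assoc, Category.assoc]
    obtain ⟨v, hv, hv'⟩ : ∃ v, v ≫ _ = g ∧ v ≫ (gmOpen ι U).ι ≫ (𝔸(ι; U) ↘ U) = u :=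
      ⟨hpb.lift g u hcond, hpb.lift_fst _ _ _, hpb.lift_snd _ _ _⟩
    have hvs : v ≫ (gmOpen ι U).ι ≫ AffineSpace.map ι j = f ≫ s := by
      refine (AffineSpace.isPullback_map q).hom_ext ?_ ?_
      · rw [Category.assoc, Category.assoc, Category.assoc, hfg, ← AffineSpace.map_comp, ← hsq.w,
          ← hv, Category.assoc]
      · rw [Category.assoc, Category.assoc, Category.assoc, AffineSpace.map_over, ← hu, ← hv']
        simp only [Category.assoc]
    refine ⟨v, dil_hom_ext (f := f ≫ s) (.of_comap_eq_top fun x ↦ ?_) ?_ rfl, hv⟩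
    · obtain ⟨i, _ | _⟩ := x
      · exact hf i
      · rw [hJt, ← comap_comp, Category.assoc]
        exact hfE i
    rw [Category.assoc, ht, hvs]
  refine ⟨⟨?_⟩, ⟨PullbackCone.IsLimit.mk _ (fun x ↦ (key x.pt x.fst x.snd x.condition).choose)
    (fun x ↦ (key x.pt x.fst x.snd x.condition).choose_spec.1)
    (fun x ↦ (key x.pt x.fst x.snd x.condition).choose_spec.2) fun x w hw _ ↦ ?_⟩⟩
  · rw [reassoc_of% ht, hsq.w, AffineSpace.map_comp]
  · rw [← cancel_mono t, hw, (key x.pt x.fst x.snd x.condition).choose_spec.1]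

end RootOpenPart

section CoordinateMap
open Scheme.IdealSheafData
variable {k : Type u} [Field k] {X : Scheme.{u}} (p : X ⟶ Spec (CommRingCat.of k)) [IsSeparated p]
  {ι : Type u} [Fintype ι] (D : ι → X.IdealSheafData) (hD : ∀ i, IsLocallyPrincipal (D i))
  (m e : ι → ℕ)

/-- The morphism from `P_0^{(D)}` to the spectrum of the base field. -/
noncomputable def dilDZeroStr : (dilD p D hD).obj (op (.mk 0)) ⟶ Spec (CommRingCat.of k) :=
  ((dilDStr p D hD).app (op (.mk 0)) ≫ powProj p (op (.mk 0)) 0) ≫ p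

/-- The morphism from `P_0^{(D,M)}` to the affine space over the base field given by the
coordinates. -/
noncomputable def coordMap :
    (dilM p D hD m).obj (op (.mk 0)) ⟶ 𝔸(ι; Spec (CommRingCat.of k)) :=
  (dilMStr p D hD m).app (op (.mk 0)) ≫ AffineSpace.map ι (dilDZeroStr p D hD)

section Smooth
variable [Smooth p] [PerfectField k] (hS : IsSimpleNormalCrossings D)

omit [IsSeparated p] in
lemma IsSimpleNormalCrossings.hasSmoothParameters (hS : IsSimpleNormalCrossings D) :
    HasSmoothParameters p D := fun x ↦ by
  obtain ⟨U, hx, t, ht, hu, hs⟩ := hS.exists_smooth_parameters p x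
  exact ⟨U, hx, t, _, ht, hu, hs⟩

include hS in
/-- `P_0^{(D,M)}` is smooth over the affine space by the coordinates: it is locally given by
`t i * v i = s i ^ m i` with `v i` invertible, so that the parameters `t i` of `X` can be
eliminated. -/
lemma smooth_coordMap (hm : ∀ i, 1 ≤ m i) : Smooth (coordMap p D hD m) := by
  have := isIso_dilDStr_zero p D hD (hS.isInvertible p)
  have h : HasSmoothParameters (dilDZeroStr p D hD)
      fun i ↦ (D i).comap ((dilDStr p D hD).app (op (.mk 0)) ≫ powProj p (op (.mk 0)) 0) :=
    (hS.hasSmoothParameters p D).comap_of_smooth _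
  exact h.smooth_dilStr m hm (isLocallyPrincipal_centerM p D hD m (op (.mk 0))) (fun i ↦ rfl)
    fun i ↦ rfl

include hS in
/-- `P_0^{(D,M)}` is integrally closed in `U × 𝔾_m^ι`, because this is the inverse image of the
complement of the coordinate hyperplanes under the smooth morphism `coordMap`. -/
lemma isNormalization_toDilM_zero (hm : ∀ i, 1 ≤ m i) :
    IsNormalization ((toDilM p D hD m).app (op (.mk 0))) (𝟙 _) := by
  let Z : OverSimplexᵒᵖ := op (.mk 0)
  have := smooth_coordMap p D hD m hS hm
  have hi := isIso_dilDStr_zero p D hD (hS.isInvertible p)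
  let w := (dilDStr p D hD).app Z ≫ powProj p Z 0
  have hwi : IsIso w := IsIso.comp_isIso
  have htw : (toDilD p D hD).app Z ≫ w = (complUnion D).ι := by
    refine (Category.assoc _ _ _).symm.trans (((toDilD_str p D hD Z) =≫ powProj p Z 0).trans ?_)
    exact (powMap_app_proj p (complUnion D).ι rfl Z 0).trans (Category.id_comp _)
  have hmono : Mono ((toDilM p D hD m).app Z) := by
    have := isIso_dilRStr_zero p D hD m m hm
    rw [← toDilR_str p D hD m m Z]
    exact mono_comp _ _
  have hpb := isPullback_gmOpen_dilStr (ι := ι) ((toDilD p D hD).app Z) (dilDZeroStr p D hD)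
    (E := fun i ↦ (D i).comap w) (fun T h hh ↦ by
      have hprod : (∏ i, D i).comap (h ≫ w) = ⊤ := by
        rw [comap_prod]
        exact Finset.prod_eq_one fun i _ ↦ (comap_comp _ _ _).trans (hh i)
      obtain ⟨u, hu⟩ : ∃ u : T ⟶ (powFunctor ((complUnion D).ι ≫ p)).obj Z,
        u ≫ (complUnion D).ι = h ≫ w := exists_comp_ι_eq_of_comap_eq_top _ hprod
      refine ⟨u, ?_⟩
      rw [← cancel_mono w, Category.assoc]
      exact (u ≫= htw).trans hu) m (hJ := isLocallyPrincipal_centerM p D hD m Z)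
    (fun i ↦ rfl) (fun i ↦ rfl) ((toDilM p D hD m).app Z) hmono
    (toDilM_str p D hD m Z)
  exact (isNormalization_gmOpen_spec ι).of_isPullback (b := coordMap p D hD m)
    (g := coordMap p D hD m) (IsPullback.of_vert_isIso ⟨by simp⟩) hpb.flip

include hS in
lemma isNormalization_toDilR_zero (hm : ∀ i, 1 ≤ m i) :
    IsNormalization ((toDilR p D hD m e).app (op (.mk 0))) (𝟙 _) := by
  have := isIso_dilRStr_zero p D hD m e hm
  have hpb := isPullback_dilLift_of_comap_eq_top (I := fun _ ↦ (degM p D hD m (op (.mk 0))).ker)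
      (hJ := fun _ ↦ isLocallyPrincipal_centerR p D hD m e (op (.mk 0)))
      (comap_centerR_eq_top p D hD m e (op (.mk 0)))
  exact (isNormalization_toDilM_zero p D hD m hS hm).of_isPullback
    (b := (dilRStr p D hD m e).app (op (.mk 0))) (g := (dilRStr p D hD m e).app (op (.mk 0)))
    (IsPullback.of_vert_isIso ⟨by simp⟩) hpb.flip

include hS in
lemma isLocallyNoetherian_dilR (hm : ∀ i, 1 ≤ m i) (a : OverSimplexᵒᵖ) :
    IsLocallyNoetherian ((dilR p D hD m e).obj a) := by
  have h0 : IsLocallyNoetherian ((dilM p D hD m).obj (op (.mk 0))) := by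
    have := smooth_coordMap p D hD m hS hm
    exact LocallyOfFiniteType.isLocallyNoetherian (coordMap p D hD m ≫
      (𝔸(ι; Spec (CommRingCat.of k)) ↘ Spec (CommRingCat.of k)))
  have := isIso_dilRStr_zero p D hD m e hm
  obtain ⟨n⟩ := a
  let α : .mk 0 ⟶ n := fun _ ↦ (0 : Fin (n.len + 1))
  have := smooth_dilR_map p D hD m e (hS.isInvertible p) hm α
  exact LocallyOfFiniteType.isLocallyNoetherian
    ((dilR p D hD m e).map α.op ≫ (dilRStr p D hD m e).app (op (.mk 0)))

end Smooth

end CoordinateMap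

/-! ### Quotients by a finite group acting freely -/

section GaloisDescent

/-- Elements of a pushout of commutative rings are sums of products. -/
lemma CommRingCat.exists_eq_sum_of_isPushout {A Z C B : CommRingCat.{u}} {α : A ⟶ Z} {φ : A ⟶ C}
    {i : Z ⟶ B} {ψ : C ⟶ B} (H : IsPushout α φ i ψ) (b : B) :
    ∃ (n : ℕ) (x : Fin n → Z) (y : Fin n → C), b = ∑ j, i (x j) * ψ (y j) := by
  algebraize [α.hom, φ.hom]
  let e : CommRingCat.of (TensorProduct A Z C) ≅ B :=
    IsPushout.isoIsPushout _ _ (CommRingCat.isPushout_tensorProduct A Z C) H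
  have hi : CommRingCat.ofHom Algebra.TensorProduct.includeLeftRingHom ≫ e.hom = i :=
    IsPushout.inl_isoIsPushout_hom _ _ (CommRingCat.isPushout_tensorProduct A Z C) H
  have hψ : CommRingCat.ofHom (Algebra.TensorProduct.includeRight (R := A)
      (A := Z) (B := C)).toRingHom ≫ e.hom = ψ :=
    IsPushout.inr_isoIsPushout_hom _ _ (CommRingCat.isPushout_tensorProduct A Z C) H
  obtain ⟨t, rfl⟩ := (ConcreteCategory.bijective_of_isIso e.hom).2 b
  obtain ⟨n, x, y, rfl⟩ : ∃ (n : ℕ) (x : Fin n → Z) (y : Fin n → C), t = ∑ j, x j ⊗ₜ y j := by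
    obtain ⟨S, hS⟩ := TensorProduct.exists_finset t
    refine ⟨S.card, fun j ↦ (S.equivFin.symm j).1.1, fun j ↦ (S.equivFin.symm j).1.2, ?_⟩
    rw [hS, ← S.sum_coe_sort]
    exact (S.equivFin.symm.sum_comp (fun s : S ↦ s.1.1 ⊗ₜ[A] s.1.2)).symm
  refine ⟨n, x, y, ?_⟩
  rw [map_sum]
  refine Finset.sum_congr rfl fun j _ ↦ ?_
  have h1 : e.hom (x j ⊗ₜ 1) = i (x j) := congr($hi (x j))
  have h2 : e.hom (1 ⊗ₜ y j) = ψ (y j) := congr($hψ (y j))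
  rw [← h1, ← h2, ← map_mul, Algebra.TensorProduct.tmul_mul_tmul, mul_one, one_mul]

/-- Galois descent: if `∑ x j * g (y j) = δ_{g, 1}` in the Galois extension `C` of `A`, the inverse
of `Z ⊗ C ⟶ B`, where `Z` is the ring of invariants of `B`, is `b ↦ ∑ tr (b y_j) ⊗ x_j`. -/
lemma CommRingCat.isPushout_invariants {A Z C B : CommRingCat.{u}} {α : A ⟶ Z} {φ : A ⟶ C}
    {i : Z ⟶ B} {ψ : C ⟶ B} (w : α ≫ i = φ ≫ ψ) {G : Type*} [Group G] [Finite G]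
    (σ : G → (B →+* B)) (τ : G → (C →+* C)) (hσ : ∀ g h b, σ (g * h) b = σ h (σ g b))
    (hτ : ∀ g h c, τ (g * h) c = τ h (τ g c)) (hστ : ∀ g c, σ g (ψ c) = ψ (τ g c))
    (hσ1 : ∀ b, σ 1 b = b)
    (hi : Function.Injective i) (hi' : ∀ b, (∀ g, σ g b = b) → ∃ z, i z = b)
    (hi'' : ∀ g z, σ g (i z) = i z)
    (hC : ∀ c, (∀ g, τ g c = c) → ∃ a, φ a = c)
    {n : ℕ} (x y : Fin n → C)
    (hxy₁ : ∑ j, x j * y j = 1) (hxy : ∀ g ≠ 1, ∑ j, x j * τ g (y j) = 0)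
    (hτ1 : ∀ c, τ 1 c = c) :
    IsPushout α φ i ψ := by
  classical
  cases nonempty_fintype G
  algebraize [α.hom, φ.hom]
  -- the traces of elements of `B` and `C` lie in `Z` and `A`
  have htrB (b : B) : ∃ z, i z = ∑ g, σ g b := hi' _ fun h ↦ by
    rw [map_sum, ← Equiv.sum_comp (Equiv.mulRight h) (fun g ↦ σ g b)]
    exact Finset.sum_congr rfl fun g _ ↦ (hσ g h b).symm
  have htrC (c : C) : ∃ a, φ a = ∑ g, τ g c := hC _ fun h ↦ by
    rw [map_sum, ← Equiv.sum_comp (Equiv.mulRight h) (fun g ↦ τ g c)]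
    exact Finset.sum_congr rfl fun g _ ↦ (hτ g h c).symm
  choose trB htrB using htrB
  choose trC htrC using htrC
  have hφψ (a : A) : i (α a) = ψ (φ a) := congr($w a)
  have htr (c : C) : trB (ψ c) = α (trC c) := hi <| by
    rw [hφψ, htrB, htrC, map_sum]
    exact Finset.sum_congr rfl fun g _ ↦ hστ g c
  have htr_mul (z : Z) (b : B) : trB (i z * b) = z * trB b := hi <| by
    rw [map_mul, htrB, htrB, Finset.mul_sum]
    exact Finset.sum_congr rfl fun g _ ↦ by rw [map_mul, hi'']
  have hsum (b : B) : ∑ j, i (trB (b * ψ (y j))) * ψ (x j) = b := by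
    have : ∑ j, i (trB (b * ψ (y j))) * ψ (x j) =
        ∑ g, σ g b * ψ (∑ j, x j * τ g (y j)) := by
      simp only [htrB, Finset.sum_mul, map_sum, Finset.mul_sum]
      rw [Finset.sum_comm]
      refine Finset.sum_congr rfl fun g _ ↦ Finset.sum_congr rfl fun j _ ↦ ?_
      rw [map_mul, map_mul, hστ]
      ring
    rw [this, Finset.sum_eq_single 1]
    · simp only [hτ1, hxy₁, hσ1, map_one, mul_one]
    · intro g _ hg
      rw [hxy g hg, map_zero, mul_zero]
    · simp
  have hsumC (c : C) : ∑ j, φ (trC (c * y j)) * x j = c := by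
    have : ∑ j, φ (trC (c * y j)) * x j =
        ∑ g, τ g c * (∑ j, x j * τ g (y j)) := by
      simp only [htrC, Finset.sum_mul, Finset.mul_sum]
      rw [Finset.sum_comm]
      refine Finset.sum_congr rfl fun g _ ↦ Finset.sum_congr rfl fun j _ ↦ ?_
      rw [map_mul]
      ring
    rw [this, Finset.sum_eq_single 1]
    · simp only [hτ1, hxy₁, mul_one]
    · intro g _ hg
      rw [hxy g hg, mul_zero]
    · simp
  have htrB_add (b b' : B) : trB (b + b') = trB b + trB b' := hi <| by
    rw [map_add, htrB, htrB, htrB, ← Finset.sum_add_distrib]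
    exact Finset.sum_congr rfl fun g _ ↦ map_add _ _ _
  have P := CommRingCat.isPushout_tensorProduct A Z C
  let d : CommRingCat.of (TensorProduct A Z C) ⟶ B := P.desc i ψ w
  have hd1 (z : Z) : d (z ⊗ₜ 1) = i z := congr($(P.inl_desc i ψ w) z)
  have hd2 (c : C) : d (1 ⊗ₜ c) = ψ c := congr($(P.inr_desc i ψ w) c)
  have hd (z : Z) (c : C) : d (z ⊗ₜ c) = i z * ψ c := by
    rw [← hd1, ← hd2, ← map_mul, Algebra.TensorProduct.tmul_mul_tmul, mul_one, one_mul]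
  let F (b : B) : TensorProduct A Z C := ∑ j, trB (b * ψ (y j)) ⊗ₜ x j
  have hF_add (b b' : B) : F (b + b') = F b + F b' := by
    simp only [F, add_mul, htrB_add, TensorProduct.add_tmul, Finset.sum_add_distrib]
  have hFd (t : TensorProduct A Z C) : F (d t) = t := by
    induction t using TensorProduct.induction_on with
    | zero =>
      have := hF_add 0 0
      rw [add_zero, left_eq_add] at this
      exact (congrArg F (map_zero d.hom)).trans this
    | tmul z c =>
      have (j : Fin n) : trB (d (z ⊗ₜ c) * ψ (y j)) ⊗ₜ[A] x j =
          z ⊗ₜ[A] (φ (trC (c * y j)) * x j) := by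
        rw [hd, mul_assoc, ← map_mul, htr_mul, htr, mul_comm]
        exact TensorProduct.smul_tmul (trC (c * y j)) z (x j)
      simp only [F, this]
      rw [← TensorProduct.tmul_sum, hsumC]
    | add s t hs ht => 
      refine (congrArg F (map_add d.hom s t)).trans ((hF_add _ _).trans ?_)
      exact congrArg₂ (· + ·) hs ht
  have : IsIso d := by
    rw [ConcreteCategory.isIso_iff_bijective]
    refine ⟨Function.LeftInverse.injective hFd, fun b ↦ ⟨F b, ?_⟩⟩
    refine (map_sum d.hom _ _).trans ((Finset.sum_congr rfl fun j _ ↦ hd _ _).trans (hsum b))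
  exact .of_iso P (.refl _) (.refl _) (.refl _) (asIso d) (by simp; rfl) (by simp; rfl)
    ((P.inl_desc i ψ w).trans (Category.id_comp _).symm)
    ((P.inr_desc i ψ w).trans (Category.id_comp _).symm)

end GaloisDescent

lemma isIso_of_isIso_app {Y T : Scheme.{u}} (l : Y ⟶ T) [IsAffineHom l] {κ : Type*}
    (W : κ → T.Opens) (hW : iSup W = ⊤) (hW' : ∀ i, IsAffineOpen (W i))
    (h : ∀ i, IsIso (l.app (W i))) : IsIso l := by
  refine (IsZariskiLocalAtTarget.iff_of_iSup_eq_top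
    (P := MorphismProperty.isomorphisms Scheme.{u}) W hW).mpr fun i ↦ ?_
  have : IsAffine (W i) := hW' i
  have : IsAffine (l ⁻¹ᵁ W i) := (hW' i).preimage l
  have h1 (O : T.Opens) (hO : O = W i) : IsIso (l.app O) := by
    subst hO
    exact h i
  have h2 : IsIso (l ∣_ W i).appTop := by
    have := h1 ((W i).ι ''ᵁ ⊤) (by simp)
    rw [morphismRestrict_appTop]
    exact IsIso.comp_isIso' this (Functor.map_isIso _ _)
  exact ((MorphismProperty.isomorphisms Scheme.{u}).arrow_mk_iso_iff
    (arrowIsoSpecΓOfIsAffine (l ∣_ W i))).mpr (inferInstanceAs (IsIso (Spec.map (l ∣_ W i).appTop)))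

/-- A square whose horizontal maps are affine is cartesian if it induces cocartesian squares of
rings of sections on an affine open cover. -/
lemma isPullback_of_forall_isPushout {Y Z V U : Scheme.{u}} {a : Y ⟶ Z} {h : Y ⟶ V} {w : Z ⟶ U}
    {f : V ⟶ U} [IsAffineHom a] [IsAffineHom f] (H : a ≫ w = h ≫ f)
    (hZ : ∀ z : Z, ∃ (U' : U.Opens) (Z' : Z.Opens), IsAffineOpen U' ∧ IsAffineOpen Z' ∧ z ∈ Z' ∧
      ∃ (e : Z' ≤ w ⁻¹ᵁ U') (e' : a ⁻¹ᵁ Z' ≤ h ⁻¹ᵁ f ⁻¹ᵁ U'),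
        IsPushout (w.appLE U' Z' e) (f.app U') (a.app Z') (h.appLE (f ⁻¹ᵁ U') (a ⁻¹ᵁ Z') e')) :
    IsPullback a h w f := by
  choose U' Z' hU' hZ' hz e e' H' using hZ
  let l : Y ⟶ pullback w f := pullback.lift a h H
  have hla : l ≫ pullback.fst w f = a := pullback.lift_fst _ _ _
  have hlh : l ≫ pullback.snd w f = h := pullback.lift_snd _ _ _
  suffices IsIso l from .of_iso_pullback ⟨H⟩ (asIso l) hla hlh
  have : IsAffineHom (pullback.fst w f) := MorphismProperty.IsStableUnderBaseChange.of_isPullback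
    (P := @IsAffineHom) (IsPullback.of_hasPullback w f).flip ‹IsAffineHom f›
  have hfst (z : Z) : IsAffineOpen (pullback.fst w f ⁻¹ᵁ Z' z) := (hZ' z).preimage _
  have : IsAffineHom l := by
    have h1 : IsAffineHom (l ≫ pullback.fst w f) := by rwa [hla]
    exact MorphismProperty.of_postcomp (W := @IsAffineHom) (W' := @IsSeparated) l
      (pullback.fst w f) inferInstance h1
  refine isIso_of_isIso_app l (fun z ↦ pullback.fst w f ⁻¹ᵁ Z' z)
    (top_le_iff.mp fun t _ ↦ TopologicalSpace.Opens.mem_iSup.mpr ⟨pullback.fst w f t, hz _⟩)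
    hfst fun z ↦ ?_
  have hsnd : pullback.fst w f ⁻¹ᵁ Z' z ≤ pullback.snd w f ⁻¹ᵁ f ⁻¹ᵁ U' z := by
    rw [← Scheme.Hom.comp_preimage, ← pullback.condition, Scheme.Hom.comp_preimage]
    exact (pullback.fst w f).preimage_mono (e z)
  have h1 := (isIso_pushoutSection_iff (IsPullback.of_hasPullback w f) (US := U' z)
      (UT := f ⁻¹ᵁ U' z) (UX := Z' z) le_rfl (e z) (UY := pullback.fst w f ⁻¹ᵁ Z' z)
      (inf_eq_left.mpr hsnd).symm).mp
    (isIso_pushoutSection_of_isAffineOpen _ _ _ _ (hU' z) ((hU' z).preimage f) (hZ' z))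
  simp only [← Scheme.Hom.app_eq_appLE] at h1
  have hle : a ⁻¹ᵁ Z' z ≤ l ⁻¹ᵁ pullback.fst w f ⁻¹ᵁ Z' z := by
    rw [← Scheme.Hom.comp_preimage, hla]
  have hge : l ⁻¹ᵁ pullback.fst w f ⁻¹ᵁ Z' z ≤ a ⁻¹ᵁ Z' z := by
    rw [← Scheme.Hom.comp_preimage, hla]
  have hl : l.appLE _ _ hle = (h1.isoIsPushout _ _ (H' z)).hom := by
    refine h1.hom_ext ?_ ?_
    · rw [IsPushout.inl_isoIsPushout_hom]
      ext x
      rw [Scheme.Hom.app_eq_appLE, Scheme.Hom.app_eq_appLE, Scheme.Hom.appLE_comp_appLE]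
      exact appLE_congr hla _ _ _ _ _
    · rw [IsPushout.inr_isoIsPushout_hom]
      ext x
      rw [Scheme.Hom.appLE_comp_appLE]
      exact appLE_congr hlh _ _ _ _ _
  have h3 : IsIso (l.appLE _ _ hle) := by rw [hl]; infer_instance
  have h4 : ∀ (O : Y.Opens) (hO : O = l ⁻¹ᵁ pullback.fst w f ⁻¹ᵁ Z' z)
      (hle : O ≤ l ⁻¹ᵁ pullback.fst w f ⁻¹ᵁ Z' z), IsIso (l.appLE _ O hle) →
      IsIso (l.app (pullback.fst w f ⁻¹ᵁ Z' z)) := by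
    rintro _ rfl hle h
    rwa [Scheme.Hom.app_eq_appLE]
  exact h4 _ (le_antisymm hle hge) hle h3

namespace QcohSubalgebra
variable {Y S : Scheme.{u}} {f : Y ⟶ S} (B : QcohSubalgebra f) [QuasiCompact f]

/-- Over an affine open subscheme, the sections of the relative spectrum of a sub-algebra are the
elements of the sub-algebra. -/
lemma exists_appLE_toSpec_eq {U : S.Opens} (hU : IsAffineOpen U) (h0 : f ⁻¹ᵁ U ≤ B.toSpec ⁻¹ᵁ B.str ⁻¹ᵁ U)
    {b : Γ(Y, f ⁻¹ᵁ U)} (hb : b ∈ B.carrier U hU) :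
    ∃ x, B.toSpec.appLE (B.str ⁻¹ᵁ U) (f ⁻¹ᵁ U) h0 x = b := by
  have h1 : ⊤ ≤ (B.chart U hU) ⁻¹ᵁ (B.str ⁻¹ᵁ U) := by
    rw [str_preimage _ _ hU]
    simp
  have h2 := isIso_appLE_of_opensRange (B.chart U hU) (V := B.str ⁻¹ᵁ U)
    (by rw [str_preimage _ _ hU]; simp) h1
  have h4 : (⊤ : (f ⁻¹ᵁ U).toScheme.Opens) ≤ ((f ⁻¹ᵁ U).ι ≫ B.toSpec) ⁻¹ᵁ (B.str ⁻¹ᵁ U) := by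
    rw [← Scheme.Hom.comp_preimage, Category.assoc, toSpec_str]
    exact fun x _ ↦ x.2
  let σ := CommRingCat.ofHom (B.carrier U hU).subtype
  obtain ⟨y, hy⟩ := (ConcreteCategory.bijective_of_isIso
    (Scheme.ΓSpecIso (.of (B.carrier U hU))).hom).2 ⟨b, hb⟩
  obtain ⟨x, hx⟩ := (ConcreteCategory.bijective_of_isIso
    ((B.chart U hU).appLE (B.str ⁻¹ᵁ U) ⊤ h1)).2 y
  refine ⟨x, ?_⟩
  apply (ConcreteCategory.bijective_of_isIso (f ⁻¹ᵁ U).topIso.inv).1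
  have e1 := congr($(Scheme.Hom.appLE_comp_appLE (Spec.map σ) (B.chart U hU)
    (B.str ⁻¹ᵁ U) ⊤ ⊤ h1 le_rfl) x)
  have e2 := congr($(Scheme.Hom.appLE_comp_appLE (f ⁻¹ᵁ U).toSpecΓ (Spec.map σ ≫ B.chart U hU)
    (B.str ⁻¹ᵁ U) ⊤ ⊤ (fun x _ ↦ h1 trivial) le_rfl) x)
  have e3 := appLE_congr (B.ι_toSpec U hU) _ _ h4 (fun x _ ↦ h1 trivial) x
  have e4 := congr($(Scheme.Hom.appLE_comp_appLE (f ⁻¹ᵁ U).ι B.toSpec (B.str ⁻¹ᵁ U) (f ⁻¹ᵁ U) ⊤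
    h0 (fun x _ ↦ x.2)) x)
  have e5 : (f ⁻¹ᵁ U).ι.appLE (f ⁻¹ᵁ U) ⊤ (fun x _ ↦ x.2) = (f ⁻¹ᵁ U).topIso.inv :=
    ι_appLE_top _ _
  have e6 := congr($(Scheme.ΓSpecIso_naturality σ) y)
  have e7 := (f ⁻¹ᵁ U).toSpecΓ_appTop
  refine congr($e5 _).symm.trans ?_
  refine e4.trans (e3.trans (e2.symm.trans ?_))
  have e8 : (Spec.map σ).appLE ⊤ ⊤ le_rfl y = (Spec.map σ).appTop y := by
    rw [Scheme.Hom.appTop, Scheme.Hom.app_eq_appLE]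
    rfl
  have e9 (w : Γ(Spec Γ(Y, f ⁻¹ᵁ U), ⊤)) : (f ⁻¹ᵁ U).toSpecΓ.appLE ⊤ ⊤ le_rfl w =
      (f ⁻¹ᵁ U).topIso.inv ((Scheme.ΓSpecIso _).hom w) := by
    have : (f ⁻¹ᵁ U).toSpecΓ.appLE ⊤ ⊤ le_rfl w = (f ⁻¹ᵁ U).toSpecΓ.appTop w := by
      rw [Scheme.Hom.appTop, Scheme.Hom.app_eq_appLE]
      rfl
    rw [this, e7]
    rfl
  refine (e9 _).trans (congrArg _ ?_)
  refine (congrArg _ (e1.symm.trans ((congrArg _ hx).trans e8))).trans (e6.trans ?_)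
  exact congrArg Subtype.val hy

/-- Sections of the relative spectrum of a sub-algebra inject into the sections of `Y`. -/
lemma appLE_toSpec_injective [IsAffineHom f] (U : S.Opens)
    (h0 : f ⁻¹ᵁ U ≤ B.toSpec ⁻¹ᵁ B.str ⁻¹ᵁ U) :
    Function.Injective (B.toSpec.appLE (B.str ⁻¹ᵁ U) (f ⁻¹ᵁ U) h0) := by
  have h4 : ∀ (O : Y.Opens) (hO : O = B.toSpec ⁻¹ᵁ B.str ⁻¹ᵁ U)
      (hle : O ≤ B.toSpec ⁻¹ᵁ B.str ⁻¹ᵁ U), Function.Injective (B.toSpec.appLE _ O hle) := by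
    rintro _ rfl hle
    rw [← Scheme.Hom.app_eq_appLE]
    exact B.toSpec.app_injective _
  exact h4 _ (by rw [← Scheme.Hom.comp_preimage, toSpec_str]) h0

end QcohSubalgebra

lemma appLE_apply_of_eq_id {X : Scheme.{u}} {a : X ⟶ X} (h : a = 𝟙 X) (O : X.Opens)
    (e : O ≤ a ⁻¹ᵁ O) (x : Γ(X, O)) : a.appLE O O e x = x := by
  subst h
  exact congr($((Scheme.Hom.app_eq_appLE (𝟙 X) (U := O)).symm.trans (Scheme.Hom.id_app O)) x)

namespace IsTorsor
variable {V U : Scheme.{u}} {f : V ⟶ U} {G : Type u} [Group G] {ρ : G →* Aut V}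

lemma map_mul_hom (g h : G) : (ρ (g * h)).hom = (ρ h).hom ≫ (ρ g).hom := by
  rw [map_mul]
  rfl

section
variable (hf : IsTorsor f ρ)
include hf

/-- Morphisms out of `V ×_U V` are determined by their restrictions to the graphs of the elements
of `G`. -/
lemma pullback_hom_ext {T : Scheme.{u}} {a b : pullback f f ⟶ T}
    (h : ∀ (g : G) (c : V ⟶ pullback f f), c ≫ pullback.fst f f = 𝟙 V →
      c ≫ pullback.snd f f = (ρ g).hom → c ≫ a = c ≫ b) : a = b := by
  have := hf.isIso
  rw [← cancel_epi (Sigma.desc fun g : G ↦ pullback.lift (f := f) (g := f) (𝟙 V) (ρ g).hom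
    (by rw [hf.comp_eq, Category.id_comp]))]
  refine Sigma.hom_ext _ _ fun g ↦ ?_
  rw [Sigma.ι_desc_assoc, Sigma.ι_desc_assoc]
  exact h g _ (pullback.lift_fst _ _ _) (pullback.lift_snd _ _ _)

/-- A family of morphisms out of the graphs of the elements of `G` extends to `V ×_U V`. -/
lemma exists_pullback_desc {T : Scheme.{u}} (a : G → (V ⟶ T)) : ∃ b : pullback f f ⟶ T,
    ∀ (g : G) (c : V ⟶ pullback f f), c ≫ pullback.fst f f = 𝟙 V →
      c ≫ pullback.snd f f = (ρ g).hom → c ≫ b = a g := by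
  have := hf.isIso
  let d := Sigma.desc fun g : G ↦ pullback.lift (f := f) (g := f) (𝟙 V) (ρ g).hom
    (by rw [hf.comp_eq, Category.id_comp])
  refine ⟨inv d ≫ Sigma.desc a, fun g c h₁ h₂ ↦ ?_⟩
  have : c = Sigma.ι (fun _ : G ↦ V) g ≫ d := pullback.hom_ext
    (by rw [h₁, Category.assoc, Sigma.ι_desc_assoc, pullback.lift_fst])
    (by rw [h₂, Category.assoc, Sigma.ι_desc_assoc, pullback.lift_snd])
  rw [this, Category.assoc, IsIso.hom_inv_id_assoc, Sigma.ι_desc]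

lemma effectiveEpi : EffectiveEpi f := by
  have := hf.isFinite
  have := hf.etale
  have := hf.surjective
  infer_instance

/-- The quotient of a torsor by the group is the base. -/
lemma isIso_invAlg_str [Finite G] [IsAffineHom f] :
    IsIso (invAlg (fun g ↦ (ρ g).hom) hf.comp_eq).str := by
  have := hf.effectiveEpi
  let B := invAlg (fun g ↦ (ρ g).hom) hf.comp_eq
  have h : pullback.fst f f ≫ B.toSpec = pullback.snd f f ≫ B.toSpec :=
    hf.pullback_hom_ext fun g c h₁ h₂ ↦ by
      rw [reassoc_of% h₁, reassoc_of% h₂]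
      exact (comp_toSpec_invAlg (fun g ↦ (ρ g).hom) hf.comp_eq g).symm
  have h' {Z : Scheme.{u}} (a b : Z ⟶ V) (hab : a ≫ f = b ≫ f) :
      a ≫ B.toSpec = b ≫ B.toSpec := by
    have := pullback.lift a b hab ≫= h
    rwa [pullback.lift_fst_assoc, pullback.lift_snd_assoc] at this
  let s : U ⟶ B.spec := EffectiveEpi.desc f B.toSpec h'
  have hs : f ≫ s = B.toSpec := EffectiveEpi.fac f B.toSpec h'
  have hs' : s ≫ B.str = 𝟙 U := by
    rw [← cancel_epi f, reassoc_of% hs, B.toSpec_str, Category.comp_id]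
  refine ⟨s, ext_of_dominant B.toSpec B.str ?_ ?_, hs'⟩
  · rw [Category.assoc, hs', Category.comp_id, Category.id_comp]
  · rw [← Category.assoc, B.toSpec_str, hs, Category.comp_id]

/-- Invariant functions on the torsor are functions on the base. -/
lemma exists_app_eq [Finite G] [IsAffineHom f] {U' : U.Opens} (hU' : IsAffineOpen U')
    {c : Γ(V, f ⁻¹ᵁ U')}
    (hc : ∀ g, (ρ g).hom.appLE (f ⁻¹ᵁ U') (f ⁻¹ᵁ U') (le_of_over (hf.comp_eq g) U') c = c) :
    ∃ a, f.app U' a = c := by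
  have := hf.isIso_invAlg_str
  let B := invAlg (fun g ↦ (ρ g).hom) hf.comp_eq
  have h0 : f ⁻¹ᵁ U' ≤ B.toSpec ⁻¹ᵁ B.str ⁻¹ᵁ U' := by
    rw [← Scheme.Hom.comp_preimage, B.toSpec_str]
  obtain ⟨x, rfl⟩ := B.exists_appLE_toSpec_eq hU' h0 (b := c) hc
  obtain ⟨a, rfl⟩ := (ConcreteCategory.bijective_of_isIso (B.str.app U')).2 x
  refine ⟨a, ?_⟩
  rw [Scheme.Hom.app_eq_appLE, Scheme.Hom.app_eq_appLE, ← CommRingCat.comp_apply,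
    Scheme.Hom.appLE_comp_appLE]
  exact appLE_congr B.toSpec_str.symm _ _ _ _ _

/-- The function on `V ×_U V` which is `1` on the diagonal and `0` on the other graphs is of the
form `∑ x j ⊗ y j` over an affine open subscheme of `U`. -/
lemma exists_sum_eq [IsAffineHom f] {U' : U.Opens} (hU' : IsAffineOpen U') :
    ∃ (n : ℕ) (x y : Fin n → Γ(V, f ⁻¹ᵁ U')), ∑ j, x j * y j = 1 ∧ ∀ g ≠ 1,
      ∑ j, x j * (ρ g).hom.appLE (f ⁻¹ᵁ U') (f ⁻¹ᵁ U') (le_of_over (hf.comp_eq g) U') (y j) = 0 := by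
  classical
  obtain ⟨d, hd⟩ := hf.exists_pullback_desc (T := Spec (.of (MvPolynomial PUnit.{u + 1} (ULift.{u} ℤ))))
    fun g ↦ (AffineSpace.toSpecMvPolyIntEquiv PUnit.{u + 1}).symm fun _ ↦ if g = 1 then 1 else 0
  let δ : Γ(pullback f f, ⊤) := AffineSpace.toSpecMvPolyIntEquiv PUnit.{u + 1} d ⟨⟩
  have hδ (g : G) (c : V ⟶ pullback f f) (h₁ : c ≫ pullback.fst f f = 𝟙 V)
      (h₂ : c ≫ pullback.snd f f = (ρ g).hom) : c.appTop δ = if g = 1 then 1 else 0 := by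
    have := congr(AffineSpace.toSpecMvPolyIntEquiv PUnit.{u + 1} $(hd g c h₁ h₂) ⟨⟩)
    rwa [Equiv.apply_symm_apply, AffineSpace.toSpecMvPolyIntEquiv_comp] at this
  let O : (pullback f f).Opens := pullback.fst f f ⁻¹ᵁ f ⁻¹ᵁ U'
  have hsnd : O ≤ pullback.snd f f ⁻¹ᵁ f ⁻¹ᵁ U' := by
    rw [← Scheme.Hom.comp_preimage, ← pullback.condition, Scheme.Hom.comp_preimage]
  have hfst : O ≤ pullback.fst f f ⁻¹ᵁ f ⁻¹ᵁ U' := fun _ h ↦ h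
  have h1 := (isIso_pushoutSection_iff (IsPullback.of_hasPullback f f) (US := U')
      (UT := f ⁻¹ᵁ U') (UX := f ⁻¹ᵁ U') le_rfl le_rfl (UY := O)
      (inf_eq_left.mpr hsnd).symm).mp
    (isIso_pushoutSection_of_isAffineOpen _ _ _ _ hU' (hU'.preimage f) (hU'.preimage f))
  obtain ⟨n, x, y, h⟩ := CommRingCat.exists_eq_sum_of_isPushout h1
    ((pullback f f).presheaf.map (homOfLE le_top).op δ)
  have key (g : G) : ∑ j, x j * (ρ g).hom.appLE (f ⁻¹ᵁ U') (f ⁻¹ᵁ U')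
      (le_of_over (hf.comp_eq g) U') (y j) = if g = 1 then 1 else 0 := by
    let c : V ⟶ pullback f f := pullback.lift (𝟙 V) (ρ g).hom
      (by rw [hf.comp_eq, Category.id_comp])
    have hc₁ : c ≫ pullback.fst f f = 𝟙 V := pullback.lift_fst _ _ _
    have hc₂ : c ≫ pullback.snd f f = (ρ g).hom := pullback.lift_snd _ _ _
    have hcO : f ⁻¹ᵁ U' ≤ c ⁻¹ᵁ O := by
      rw [← Scheme.Hom.comp_preimage, hc₁]
      exact fun _ h ↦ h
    have h2 := congr(c.appLE O (f ⁻¹ᵁ U') hcO $h)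
    rw [map_sum, ← CommRingCat.comp_apply, Scheme.Hom.map_appLE] at h2
    have h3 : c.appLE ⊤ (f ⁻¹ᵁ U') (fun _ _ ↦ trivial) δ = if g = 1 then 1 else 0 := by
      have h4 := congr(V.presheaf.map (homOfLE (le_top : f ⁻¹ᵁ U' ≤ ⊤)).op $(hδ g c hc₁ hc₂))
      rw [apply_ite (V.presheaf.map (homOfLE (le_top : f ⁻¹ᵁ U' ≤ ⊤)).op), map_one, map_zero] at h4
      exact h4
    refine Eq.trans (Finset.sum_congr rfl fun j _ ↦ ?_) (h2.symm.trans h3)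
    rw [map_mul, ← CommRingCat.comp_apply, ← CommRingCat.comp_apply,
      Scheme.Hom.appLE_comp_appLE, Scheme.Hom.appLE_comp_appLE]
    refine congrArg₂ (· * ·) (appLE_apply_of_eq_id hc₁ _ _ _).symm
      (appLE_congr hc₂.symm _ _ _ _ _)
  refine ⟨n, x, y, ?_, fun g hg ↦ by rw [key, if_neg hg]⟩
  have := key 1
  rw [if_pos rfl] at this
  refine Eq.trans (Finset.sum_congr rfl fun j _ ↦ congrArg _ ?_) this
  exact (appLE_apply_of_eq_id (by rw [map_one]; rfl) _ _ _).symm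

/-- If `Y` is affine over `S` and carries an action of `G` over `S` for which there is an
equivariant morphism to a torsor `V` over `U`, compatible with a morphism `S ⟶ U`, then `Y` is the
pull-back of `V` to the quotient of `Y`. -/
lemma isPullback_toSpec [Finite G] {Y S : Scheme.{u}} {f₀ : Y ⟶ S} [IsAffineHom f₀]
    (σ : G → (Y ⟶ Y)) (hσ : ∀ g, σ g ≫ f₀ = f₀) (hσ_mul : ∀ g h, σ (g * h) = σ h ≫ σ g)
    (hσ_one : σ 1 = 𝟙 Y) {v : S ⟶ U} {h : Y ⟶ V} (hσh : ∀ g, σ g ≫ h = h ≫ (ρ g).hom)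
    (hv : h ≫ f = f₀ ≫ v) :
    IsPullback (invAlg σ hσ).toSpec h ((invAlg σ hσ).str ≫ v) f := by
  have := hf.isAffineHom
  let B := invAlg σ hσ
  have hB : B.toSpec ≫ B.str = f₀ := B.toSpec_str
  refine isPullback_of_forall_isPushout (by rw [hv, reassoc_of% hB]) fun z ↦ ?_
  obtain ⟨U', hU', hzU', -⟩ := exists_isAffineOpen_mem_and_subset (X := U) (x := v (B.str z))
    (U := ⊤) trivial
  obtain ⟨S', hS', hzS', hSU⟩ := exists_isAffineOpen_mem_and_subset (X := S) (x := B.str z)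
    (U := v ⁻¹ᵁ U') hzU'
  have hle : B.str ⁻¹ᵁ S' ≤ (B.str ≫ v) ⁻¹ᵁ U' := B.str.preimage_mono hSU
  have hY : B.toSpec ⁻¹ᵁ B.str ⁻¹ᵁ S' = f₀ ⁻¹ᵁ S' := by rw [← Scheme.Hom.comp_preimage, hB]
  have hh : f₀ ⁻¹ᵁ S' ≤ h ⁻¹ᵁ f ⁻¹ᵁ U' := by
    rw [← Scheme.Hom.comp_preimage, hv]
    exact f₀.preimage_mono hSU
  refine ⟨U', B.str ⁻¹ᵁ S', hU', hS'.preimage _, hzS', hle, by rwa [hY], ?_⟩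
  obtain ⟨n, x, y, hxy₁, hxy⟩ := hf.exists_sum_eq hU'
  have key : ∀ (O : Y.Opens) (hO : O = f₀ ⁻¹ᵁ S') (h₁ : O ≤ B.toSpec ⁻¹ᵁ B.str ⁻¹ᵁ S')
      (h₂ : O ≤ h ⁻¹ᵁ f ⁻¹ᵁ U'), IsPushout ((B.str ≫ v).appLE U' (B.str ⁻¹ᵁ S') hle) (f.app U')
        (B.toSpec.appLE (B.str ⁻¹ᵁ S') O h₁) (h.appLE (f ⁻¹ᵁ U') O h₂) := by
    rintro _ rfl h₁ h₂
    refine CommRingCat.isPushout_invariants ?_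
      (fun g ↦ ((σ g).appLE (f₀ ⁻¹ᵁ S') (f₀ ⁻¹ᵁ S') (le_of_over (hσ g) S')).hom)
      (fun g ↦ ((ρ g).hom.appLE (f ⁻¹ᵁ U') (f ⁻¹ᵁ U') (le_of_over (hf.comp_eq g) U')).hom)
      ?_ ?_ ?_ ?_ (B.appLE_toSpec_injective S' h₁) ?_ ?_ ?_ x y hxy₁ hxy ?_
    · rw [Scheme.Hom.app_eq_appLE, Scheme.Hom.appLE_comp_appLE, Scheme.Hom.appLE_comp_appLE]
      ext s
      exact appLE_congr (by rw [reassoc_of% hB, hv]) _ _ _ _ _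
    · intro g h b
      change _ = (σ h).appLE _ _ _ ((σ g).appLE _ _ _ b)
      rw [← CommRingCat.comp_apply, Scheme.Hom.appLE_comp_appLE]
      exact appLE_congr (hσ_mul g h) _ _ _ _ _
    · intro g h b
      change _ = (ρ h).hom.appLE _ _ _ ((ρ g).hom.appLE _ _ _ b)
      rw [← CommRingCat.comp_apply, Scheme.Hom.appLE_comp_appLE]
      exact appLE_congr (map_mul_hom g h) _ _ _ _ _
    · intro g c
      change (σ g).appLE _ _ _ (h.appLE _ _ _ c) = h.appLE _ _ _ ((ρ g).hom.appLE _ _ _ c)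
      rw [← CommRingCat.comp_apply, ← CommRingCat.comp_apply, Scheme.Hom.appLE_comp_appLE,
        Scheme.Hom.appLE_comp_appLE]
      exact appLE_congr (hσh g) _ _ _ _ _
    · exact fun b ↦ appLE_apply_of_eq_id hσ_one _ _ _
    · exact fun b hb ↦ B.exists_appLE_toSpec_eq hS' h₁ hb
    · exact fun g z ↦ B.appLE_toSpec_mem S' hS' z g
    · exact fun c hc ↦ hf.exists_app_eq hU' hc
    · exact fun c ↦ appLE_apply_of_eq_id (by rw [map_one]; rfl) _ _ _
  have := key _ hY le_rfl (by rwa [hY])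
  rwa [← Scheme.Hom.app_eq_appLE] at this

end

end IsTorsor

/-! ### Quotients of the powers of a torsor -/
/-- Fibre powers of a morphism inherit the properties stable under composition and base change. -/
lemma fiberPow.map_mem (W : MorphismProperty Scheme.{u}) [W.IsStableUnderComposition]
    [W.IsStableUnderBaseChange] {X B : Scheme.{u}} {p : X ⟶ B} {X' : Scheme.{u}} {p' : X' ⟶ B}
    (f : X' ⟶ X) (hf : f ≫ p = p') (hW : W f) (n : ℕ) : W (fiberPow.map f hf n) := by
  induction n with
  | zero =>
    have : fiberPow.map f hf 0 = f := by
      have := fiberPow.map_proj f hf 0 0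
      exact (Category.comp_id _).symm.trans (this.trans (Category.id_comp _))
    rw [this]
    exact hW
  | succ n ih =>
    have e : fiberPow.map f hf (n + 1) = pullback.map (fiberPow p' n).hom p' (fiberPow p n).hom p
        (fiberPow.map f hf n) f (𝟙 B) (by rw [fiberPow.map_hom]; exact Category.comp_id _)
        (by rw [hf, Category.comp_id]) := by
      refine fiberPow.hom_ext p fun i ↦ ?_
      rw [fiberPow.map_proj]
      cases i using Fin.lastCases with
      | last =>
        rw [fiberPow.proj_last, fiberPow.proj_last]
        exact (pullback.lift_snd _ _ _).symm
      | cast j =>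
        rw [fiberPow.proj_castSucc, fiberPow.proj_castSucc]
        refine (Category.assoc _ _ _).trans (Eq.trans ?_ (pullback.lift_fst_assoc _ _ _ _).symm)
        exact (congrArg (pullback.fst (fiberPow p' n).hom p' ≫ ·)
          (fiberPow.map_proj f hf n j).symm).trans (Category.assoc _ _ _).symm
    rw [e]
    exact MorphismProperty.pullbackMap (P := W) ih hW (fiberPow.map_hom f hf n).symm hf.symm

/-- The quotient of an integral `S`-scheme by an action over `S` is integral over `S`. -/
lemma isIntegralHom_invAlg_str {Y S : Scheme.{u}} {f : Y ⟶ S} [IsIntegralHom f] {G : Type*}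
    [Finite G] (ρ : G → (Y ⟶ Y)) (hρ : ∀ g, ρ g ≫ f = f) : IsIntegralHom (invAlg ρ hρ).str := by
  let B := invAlg ρ hρ
  refine (isIntegralHom_iff _).mpr ⟨inferInstanceAs (IsAffineHom B.str), fun U hU ↦ ?_⟩
  have h0 : f ⁻¹ᵁ U ≤ B.toSpec ⁻¹ᵁ B.str ⁻¹ᵁ U := by
    rw [← Scheme.Hom.comp_preimage, B.toSpec_str]
  refine RingHom.IsIntegral.tower_bot (B.str.app U).hom (B.toSpec.appLE (B.str ⁻¹ᵁ U) _ h0).hom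
    (B.appLE_toSpec_injective U h0) ?_
  have h := IsIntegralHom.isIntegral_app f U hU
  have e : f.app U = B.str.app U ≫ B.toSpec.appLE (B.str ⁻¹ᵁ U) _ h0 := by
    rw [Scheme.Hom.app_eq_appLE, Scheme.Hom.app_eq_appLE, Scheme.Hom.appLE_comp_appLE]
    ext x
    exact appLE_congr B.toSpec_str.symm _ _ _ _ _
  rw [e] at h
  exact h

/-- A quotient of a finite étale scheme by a group action which is induced by a torsor is étale. -/
lemma IsTorsor.etale_invAlg_str {V U : Scheme.{u}} {f : V ⟶ U} {G : Type u} [Group G] [Finite G]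
    {ρ : G →* Aut V} (hf : IsTorsor f ρ) {Y S : Scheme.{u}} {f₀ : Y ⟶ S} [IsAffineHom f₀]
    [Etale f₀] (σ : G → (Y ⟶ Y)) (hσ : ∀ g, σ g ≫ f₀ = f₀)
    (hσ_mul : ∀ g h, σ (g * h) = σ h ≫ σ g) (hσ_one : σ 1 = 𝟙 Y) {v : S ⟶ U} {h : Y ⟶ V}
    (hσh : ∀ g, σ g ≫ h = h ≫ (ρ g).hom) (hv : h ≫ f = f₀ ≫ v) :
    Etale (invAlg σ hσ).str := by
  have := hf.isFinite
  have := hf.etale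
  have := hf.surjective
  let B := invAlg σ hσ
  have hB : B.toSpec ≫ B.str = f₀ := B.toSpec_str
  have h₁ := hf.isPullback_toSpec σ hσ hσ_mul hσ_one hσh hv
  let w : Y ⟶ pullback v f := pullback.lift f₀ h hv.symm
  have hw₁ : w ≫ pullback.fst v f = f₀ := pullback.lift_fst _ _ _
  have hw₂ : w ≫ pullback.snd v f = h := pullback.lift_snd _ _ _
  have h₂ : IsPullback B.toSpec w B.str (pullback.fst v f) := by
    refine IsPullback.of_bot ?_ (hB.trans hw₁.symm) (.of_hasPullback v f)
    rwa [hw₂]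
  have : Etale w := by
    have : Etale (w ≫ pullback.fst v f) := by rwa [hw₁]
    exact Etale.of_comp w (pullback.fst v f)
  exact MorphismProperty.of_isPullback_of_descendsAlong (P := @Etale)
    (Q := @Surjective ⊓ @Flat ⊓ @QuasiCompact) h₂.flip ⟨⟨inferInstance, inferInstance⟩, inferInstance⟩
    ‹Etale w›

section Descent
variable {F Z : OverSimplexᵒᵖ ⥤ Scheme.{u}} (s : F ⟶ Z)

/-- Multiplicativity descends along a morphism of oversimplicial schemes which is cartesian and
faithfully flat in degree `0`. -/
lemma IsMultiplicative.of_isPullback_of_surjective (hF : IsMultiplicative F)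
    (h : ∀ {n : OverSimplex} (α : .mk 0 ⟶ n),
      IsPullback (F.map α.op) (s.app (op n)) (s.app (op (.mk 0))) (Z.map α.op))
    [Surjective (s.app (op (.mk 0)))] [Flat (s.app (op (.mk 0)))]
    [QuasiCompact (s.app (op (.mk 0)))] : IsMultiplicative Z := by
  intro m l n a b c d hpo
  have hw : Z.map c.op ≫ Z.map a.op = Z.map d.op ≫ Z.map b.op := by
    rw [← Functor.map_comp, ← Functor.map_comp, ← op_comp, ← op_comp, hpo.w]
  have hm₁ : Surjective (s.app (op m)) := MorphismProperty.of_isPullback (h a) ‹_›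
  have hm₂ : Flat (s.app (op m)) := MorphismProperty.of_isPullback (h a) ‹_›
  have hm₃ : QuasiCompact (s.app (op m)) := MorphismProperty.of_isPullback (h a) ‹_›
  have hn : IsPullback (F.map c.op) (s.app (op n)) (s.app (op m)) (Z.map c.op) := by
    refine IsPullback.of_right (h₁₂ := F.map a.op) (h₂₂ := Z.map a.op)
      (v₁₃ := s.app (op (.mk 0))) ?_ (s.naturality _) (h a)
    rw [← F.map_comp, ← Z.map_comp, ← op_comp]
    exact h _
  let l' : Z.obj (op n) ⟶ pullback (Z.map a.op) (Z.map b.op) := pullback.lift _ _ hw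
  have hl₁ : l' ≫ pullback.fst _ _ = Z.map c.op := pullback.lift_fst _ _ _
  have hl₂ : l' ≫ pullback.snd _ _ = Z.map d.op := pullback.lift_snd _ _ _
  suffices IsIso l' from .of_iso_pullback ⟨hw⟩ (asIso l') hl₁ hl₂
  -- the fibre product of `F` is the base change of the fibre product of `Z` along `s`
  have hE : IsPullback (F.map c.op) (s.app (op n) ≫ l') (s.app (op m)) (pullback.fst _ _) := by
    have h1 : IsPullback (F.map c.op) (F.map d.op ≫ s.app (op l))
        (F.map a.op ≫ s.app (op (.mk 0))) (Z.map b.op) := (hF a b c d hpo).paste_vert (h b)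
    rw [s.naturality, s.naturality a.op, ← hl₂, ← Category.assoc] at h1
    refine IsPullback.of_bot h1 ?_ (.of_hasPullback _ _)
    rw [Category.assoc, hl₁, s.naturality c.op]
  have hS : IsPullback (𝟙 _) (s.app (op n)) (s.app (op n) ≫ l') l' :=
    IsPullback.of_right (by rwa [Category.id_comp, hl₁]) (Category.id_comp _) hE
  have hT : (@Surjective ⊓ @Flat ⊓ @QuasiCompact : MorphismProperty Scheme.{u}) (s.app (op n) ≫ l') :=
    ⟨⟨MorphismProperty.of_isPullback (P := @Surjective) hE hm₁,
      MorphismProperty.of_isPullback (P := @Flat) hE hm₂⟩,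
      MorphismProperty.of_isPullback (P := @QuasiCompact) hE hm₃⟩
  exact MorphismProperty.of_isPullback_of_descendsAlong (P := MorphismProperty.isomorphisms Scheme)
    (Q := @Surjective ⊓ @Flat ⊓ @QuasiCompact) hS hT
    (MorphismProperty.isomorphisms.infer_property _)

end Descent

section QuotientPower
variable {X B : Scheme.{u}} (p : X ⟶ B) [IsSeparated p] {ι : Type u} [Fintype ι]
  (D : ι → X.IdealSheafData) {V : Scheme.{u}} {f : V ⟶ (complUnion D).toScheme} {G : Type u}
  [Group G] [Finite G] {ρ : G →* Aut V} (hf : IsTorsor f ρ)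

/-- The quotient morphism `V^{•+1} ⟶ V^{•+1}/ΔG`. -/
noncomputable def toQuotPow : powFunctor (f ≫ (complUnion D).ι ≫ p) ⟶ quotPow p D hf :=
  have := hf.isAffineHom
  toFunctorOfDominant (powFunctor (f ≫ (complUnion D).ι ≫ p)) (powFunctor ((complUnion D).ι ≫ p))
    (fun c ↦ (quotAlg (powMap ((complUnion D).ι ≫ p) f rfl) (diagAct p D f ρ hf.comp_eq)
      (diagAct_comp p D f ρ hf.comp_eq) c).spec)
    (fun c ↦ (quotAlg (powMap ((complUnion D).ι ≫ p) f rfl) (diagAct p D f ρ hf.comp_eq)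
      (diagAct_comp p D f ρ hf.comp_eq) c).toSpec)
    (fun c ↦ (quotAlg (powMap ((complUnion D).ι ≫ p) f rfl) (diagAct p D f ρ hf.comp_eq)
      (diagAct_comp p D f ρ hf.comp_eq) c).str)
    (exists_quotAlgMap (powMap ((complUnion D).ι ≫ p) f rfl) (diagAct p D f ρ hf.comp_eq)
      (diagAct_comp p D f ρ hf.comp_eq))

omit [IsSeparated p] [Finite G] in
lemma diagAct_app_proj (g : G) (a : OverSimplexᵒᵖ) (j : Fin (a.unop.len + 1)) :
    (diagAct p D f ρ hf.comp_eq g).app a ≫ powProj (f ≫ (complUnion D).ι ≫ p) a j =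
      powProj (f ≫ (complUnion D).ι ≫ p) a j ≫ (ρ g).hom :=
  powMap_app_proj _ _ _ a j

omit [IsSeparated p] [Finite G] in
lemma diagAct_one (a : OverSimplexᵒᵖ) : (diagAct p D f ρ hf.comp_eq 1).app a = 𝟙 _ :=
  powFunctor_hom_ext _ fun j ↦ by
    rw [diagAct_app_proj p D hf, map_one, Category.id_comp]
    exact Category.comp_id _

omit [IsSeparated p] [Finite G] in
lemma diagAct_mul (g h : G) (a : OverSimplexᵒᵖ) : (diagAct p D f ρ hf.comp_eq (g * h)).app a =
    (diagAct p D f ρ hf.comp_eq h).app a ≫ (diagAct p D f ρ hf.comp_eq g).app a :=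
  powFunctor_hom_ext _ fun j ↦ by
    rw [diagAct_app_proj p D hf, Category.assoc, diagAct_app_proj p D hf, IsTorsor.map_mul_hom,
      reassoc_of% (diagAct_app_proj p D hf h a j)]

lemma diagAct_app_comp (g : G) (a : OverSimplexᵒᵖ) : (diagAct p D f ρ hf.comp_eq g).app a ≫
    (powMap ((complUnion D).ι ≫ p) f rfl).app a = (powMap ((complUnion D).ι ≫ p) f rfl).app a := by
  rw [← NatTrans.comp_app, diagAct_comp]

/-- `V^{n+1}` is the pull-back of the torsor `V` to `V^{n+1}/ΔG` by each projection to `U`. -/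
lemma isPullback_toQuotPow_proj (a : OverSimplexᵒᵖ) (j : Fin (a.unop.len + 1)) :
    IsPullback ((toQuotPow p D hf).app a) (powProj (f ≫ (complUnion D).ι ≫ p) a j)
      ((quotPowStr p D hf).app a ≫ powProj ((complUnion D).ι ≫ p) a j) f := by
  have := hf.isAffineHom
  exact hf.isPullback_toSpec (fun g ↦ (diagAct p D f ρ hf.comp_eq g).app a)
    (fun g ↦ diagAct_app_comp p D hf g a) (fun g h ↦ diagAct_mul p D hf g h a)
    (diagAct_one p D hf a) (fun g ↦ diagAct_app_proj p D hf g a j)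
    (powMap_app_proj _ _ _ a j).symm

omit [IsSeparated p] in
lemma etale_powMap {X' : Scheme.{u}} {p' : X' ⟶ B} (f : X' ⟶ X) (hf : f ≫ p = p') [Etale f]
    (a : OverSimplexᵒᵖ) : Etale ((powMap p f hf).app a) :=
  have := @MorphismProperty.IsMultiplicative.toIsStableUnderComposition Scheme.{u} _ @Etale
    inferInstance
  fiberPow.map_mem @Etale f hf ‹_› _

lemma etale_quotPowStr (a : OverSimplexᵒᵖ) : Etale ((quotPowStr p D hf).app a) := by
  have := hf.isAffineHom
  have := hf.etale
  have := etale_powMap ((complUnion D).ι ≫ p) f rfl a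
  exact hf.etale_invAlg_str (fun g ↦ (diagAct p D f ρ hf.comp_eq g).app a)
    (fun g ↦ diagAct_app_comp p D hf g a) (fun g h ↦ diagAct_mul p D hf g h a)
    (diagAct_one p D hf a) (fun g ↦ diagAct_app_proj p D hf g a 0)
    (powMap_app_proj _ _ _ a 0).symm

lemma isIntegralHom_quotPowStr (a : OverSimplexᵒᵖ) : IsIntegralHom ((quotPowStr p D hf).app a) := by
  have := hf.isFinite
  have : IsIntegralHom ((powMap ((complUnion D).ι ≫ p) f rfl).app a) :=
    fiberPow.map_mem @IsIntegralHom f rfl inferInstance _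
  exact isIntegralHom_invAlg_str (fun g ↦ (diagAct p D f ρ hf.comp_eq g).app a)
    (fun g ↦ diagAct_app_comp p D hf g a)

/-- For `n = 0`, the quotient `V/G` is `U`. -/
lemma isIso_quotPowStr_zero : IsIso ((quotPowStr p D hf).app (op (.mk 0))) := by
  have := hf.isFinite
  have := hf.etale
  have := hf.surjective
  have h := isPullback_toQuotPow_proj p D hf (op (.mk 0)) 0
  have h1 : IsIso (powProj ((complUnion D).ι ≫ p) (op (.mk 0)) 0) := isIso_powProj_zero _
  have h2 : IsIso (powProj (f ≫ (complUnion D).ι ≫ p) (op (.mk 0)) 0) := isIso_powProj_zero _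
  have h3 : IsIso ((quotPowStr p D hf).app (op (.mk 0)) ≫
      powProj ((complUnion D).ι ≫ p) (op (.mk 0)) 0) :=
    MorphismProperty.of_isPullback_of_descendsAlong (P := MorphismProperty.isomorphisms Scheme)
      (Q := @Surjective ⊓ @Flat ⊓ @QuasiCompact) h.flip
      ⟨⟨inferInstance, inferInstance⟩, inferInstance⟩ h2
  exact IsIso.of_isIso_comp_right _ (powProj ((complUnion D).ι ≫ p) (op (.mk 0)) 0)

/-- The multiplicativity of `V^{•+1}` descends to the quotient by `ΔG`, over which it is a torsor
pulled back from degree `0`. -/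
lemma isMultiplicative_quotPow : IsMultiplicative (quotPow p D hf) := by
  have := hf.isFinite
  have := hf.etale
  have := hf.surjective
  have h0 := (isPullback_toQuotPow_proj p D hf (op (.mk 0)) 0).flip
  have h1 : Surjective ((toQuotPow p D hf).app (op (.mk 0))) :=
    MorphismProperty.of_isPullback h0 ‹_›
  have h2 : Flat ((toQuotPow p D hf).app (op (.mk 0))) :=
    MorphismProperty.of_isPullback (P := @Flat) h0 inferInstance
  have h3 : QuasiCompact ((toQuotPow p D hf).app (op (.mk 0))) :=
    MorphismProperty.of_isPullback (P := @QuasiCompact) h0 inferInstance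
  refine (isMultiplicative_powFunctor _).of_isPullback_of_surjective (toQuotPow p D hf)
    fun {n} α ↦ ?_
  refine IsPullback.flip (IsPullback.of_bot ?_ ((toQuotPow p D hf).naturality α.op).symm h0.flip)
  have e1 := powFunctor_map_proj (f ≫ (complUnion D).ι ≫ p) α.op 0
  have e2 : (quotPow p D hf).map α.op ≫ (quotPowStr p D hf).app (op (.mk 0)) ≫
      powProj ((complUnion D).ι ≫ p) (op (.mk 0)) 0 = (quotPowStr p D hf).app (op n) ≫
      powProj ((complUnion D).ι ≫ p) (op n) (OverSimplex.toMap α 0) :=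
    ((quotPowStr p D hf).naturality_assoc α.op _).trans
      (_ ≫= powFunctor_map_proj ((complUnion D).ι ≫ p) α.op 0)
  rw [e2]
  have := isPullback_toQuotPow_proj p D hf (op n) (OverSimplex.toMap α 0)
  exact e1.symm ▸ this

end QuotientPower

/-! ### The normalization of `P^{(R,M)}` -/
/-- If `B` is the inverse image of `B₀ ≅ A₀` in `P`, integrality of `A` over `B` is integrality over
`P ×_{P₀} A₀`. -/
lemma isIntegralHom_pullback_lift {A A₀ B B₀ P P₀ : Scheme.{u}} {a : A ⟶ B} {a₀ : A₀ ⟶ B₀}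
    {v : A ⟶ A₀} {w : B ⟶ B₀} {j : B ⟶ P} {j₀ : B₀ ⟶ P₀} {π : P ⟶ P₀} [IsIntegralHom a] [IsIso a₀]
    (h : IsPullback w j j₀ π) (e : v ≫ a₀ = a ≫ w) (e' : (a ≫ j) ≫ π = v ≫ a₀ ≫ j₀) :
    IsIntegralHom (pullback.lift (a ≫ j) v e') := by
  have h' : IsPullback j (w ≫ inv a₀) π (a₀ ≫ j₀) :=
    .of_iso h.flip (.refl _) (.refl _) (asIso (inv a₀)) (.refl _) (by simp) (by simp) (by simp)
      (by simp)
  have : pullback.lift (a ≫ j) v e' = a ≫ h'.isoPullback.hom := by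
    refine pullback.hom_ext ?_ ?_
    · rw [pullback.lift_fst, Category.assoc, IsPullback.isoPullback_hom_fst]
    · rw [pullback.lift_snd, Category.assoc, IsPullback.isoPullback_hom_snd, ← Category.assoc, ← e,
        Category.assoc, IsIso.hom_inv_id, Category.comp_id]
  rw [this]
  infer_instance

section Final
variable {k : Type u} [Field k] [PerfectField k] {X : Scheme.{u}}
  (p : X ⟶ Spec (CommRingCat.of k)) [Smooth p] [IsSeparated p] {ι : Type u} [Fintype ι]
  (D : ι → X.IdealSheafData) (hD : IsSimpleNormalCrossings D) (m e : ι → ℕ) {V : Scheme.{u}}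
  {f : V ⟶ (complUnion D).toScheme} {G : Type u} [Group G] [Finite G] {ρ : G →* Aut V}
  (hf : IsTorsor f ρ)

/-- The morphism from `V^{•+1}/ΔG × G_m^ι` to the normalization `Q^{(R,M)}`. -/
noncomputable def toNormR {X B : Scheme.{u}} (p : X ⟶ B) [IsSeparated p] (D : ι → X.IdealSheafData)
    (hD : ∀ i, IsLocallyPrincipal (D i)) {V : Scheme.{u}} {f : V ⟶ (complUnion D).toScheme}
    {ρ : G →* Aut V} (hf : IsTorsor f ρ) :
    gmFunctor ι (quotPow p D hf) ⟶ normR p D hD m e hf :=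
  toFunctorOfDominant _ _ (fun c ↦ ((coverMap p D hD m e hf).app c).normalization)
    (fun c ↦ ((coverMap p D hD m e hf).app c).toNormalization)
    (fun c ↦ ((coverMap p D hD m e hf).app c).fromNormalization)
    (exists_normMap (coverMap p D hD m e hf))

lemma toNormR_normRStr {X B : Scheme.{u}} (p : X ⟶ B) [IsSeparated p]
    (D : ι → X.IdealSheafData) (hD : ∀ i, IsLocallyPrincipal (D i)) {V : Scheme.{u}} {f : V ⟶ (complUnion D).toScheme}
    {ρ : G →* Aut V} (hf : IsTorsor f ρ) :
    toNormR m e p D hD hf ≫ normRStr p D hD m e hf = coverMap p D hD m e hf := by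
  ext a : 2
  exact Scheme.Hom.toNormalization_fromNormalization _

lemma isOpenImmersion_toDilR {X B : Scheme.{u}} (p : X ⟶ B) [IsSeparated p]
    (D : ι → X.IdealSheafData) (hD : ∀ i, IsLocallyPrincipal (D i)) (a : OverSimplexᵒᵖ) :
    IsOpenImmersion ((toDilR p D hD m e).app a) := by
  obtain ⟨n⟩ := a
  let α : .mk 0 ⟶ n := fun _ ↦ (0 : Fin (n.len + 1))
  exact MorphismProperty.of_isPullback (isPullback_toDilR p D hD m e α.op)
    (isOpenImmersion_toDilR_zero p D hD m e)

/-- The abstract hypotheses on the étale locus hold for `𝒱 = V^{•+1}/ΔG × 𝔾_m^ι` and `P = P^{(R,M)}`. -/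
theorem isNormalizedCover_normR (hm : ∀ i, 1 ≤ m i) :
    IsNormalizedCover (toNormR m e p D hD.isLocallyPrincipal hf)
      (normRStr p D hD.isLocallyPrincipal m e hf) := by
  have hq := isIso_quotPowStr_zero p D hf
  have hq₀ : IsIso ((gmMap ι (quotPowStr p D hf)).app (op (.mk 0))) :=
    (MorphismProperty.isomorphisms Scheme).of_isPullback
      (isPullback_gmMap (ι := ι) (quotPowStr p D hf) (op (.mk 0))).flip hq
  have hcov := toNormR_normRStr m e p D hD.isLocallyPrincipal hf
  refine
    { isNormalization := fun a ↦ .of_hom _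
      isMultiplicative_target := isMultiplicative_dilR p D _ m e (hD.isInvertible p) hm
      isMultiplicative_source := (isMultiplicative_quotPow p D hf).of_isPullback
        (gmι ι _ ≫ affOver ι _) fun α ↦ isPullback_gmι_affOver α.op _
      smooth := fun α ↦ smooth_dilR_map p D _ m e (hD.isInvertible p) hm α
      isLocallyNoetherian := fun a ↦ isLocallyNoetherian_dilR p D _ m e hD hm a
      isOpenImmersion_zero := ?_
      isNormalization_zero := ?_
      etale := fun a ↦ ?_
      isIntegralHom := fun {n} α ↦ ?_ }
  · rw [hcov, coverMap, NatTrans.comp_app]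
    infer_instance
  · rw [hcov, coverMap, NatTrans.comp_app]
    have := isNormalization_toDilR_zero p D hD.isLocallyPrincipal m e hD hm
    exact this.of_isPullback (a := (gmMap ι (quotPowStr p D hf)).app (op (.mk 0))) (b := 𝟙 _)
      (g := 𝟙 _) (n' := 𝟙 _) (.of_vert_isIso ⟨rfl⟩) (.of_horiz_isIso ⟨by simp⟩)
  · rw [hcov, coverMap, NatTrans.comp_app]
    have := isOpenImmersion_toDilR m e p D hD.isLocallyPrincipal a
    have := etale_quotPowStr p D hf a
    have : Etale ((gmMap ι (quotPowStr p D hf)).app a) :=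
      MorphismProperty.of_isPullback (isPullback_gmMap (ι := ι) (quotPowStr p D hf) a).flip this
    infer_instance
  · have : IsIntegralHom ((gmMap ι (quotPowStr p D hf)).app (op n)) :=
      MorphismProperty.of_isPullback (isPullback_gmMap (ι := ι) (quotPowStr p D hf) (op n)).flip
        (isIntegralHom_quotPowStr p D hf (op n))
    have key (c : gmFunctor ι (quotPow p D hf) ⟶ dilR p D hD.isLocallyPrincipal m e)
        (hc : c = coverMap p D hD.isLocallyPrincipal m e hf) :
        IsIntegralHom (pullback.lift (f := (dilR p D hD.isLocallyPrincipal m e).map α.op)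
          (g := c.app (op (.mk 0))) (c.app (op n)) ((gmFunctor ι (quotPow p D hf)).map α.op)
          (c.naturality α.op).symm) := by
      subst hc
      exact isIntegralHom_pullback_lift (isPullback_toDilR p D hD.isLocallyPrincipal m e α.op)
        ((gmMap ι (quotPowStr p D hf)).naturality α.op) _
    exact key _ hcov

end Final

theorem mainTheorem1 {k : Type u} [Field k] [PerfectField k] {X : Scheme.{u}}
    (p : X ⟶ Spec (CommRingCat.of k)) [Smooth p] [IsSeparated p] {ι : Type u} [Fintype ι]
    (D : ι → X.IdealSheafData) (hD : IsSimpleNormalCrossings D) {V : Scheme.{u}}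
    (f : V ⟶ (complUnion D).toScheme) {G : Type u} [Group G] [Finite G] (ρ : G →* Aut V)
    (hf : IsTorsor f ρ) (r : ι → ℚ) (m : ι → ℕ) (hr : ∀ i, 1 ≤ r i) (hm : ∀ i, 1 ≤ m i)
    (hmr : ∀ i, ∃ z : ℤ, (m i : ℚ) * r i = z)
    (hbd : IsBounded p D hD.isLocallyPrincipal m (fun i ↦ ⌊(m i : ℚ) * (r i - 1)⌋₊) hf) :
    ∃ hW : EtaleRCompatible p D hD.isLocallyPrincipal m (fun i ↦ ⌊(m i : ℚ) * (r i - 1)⌋₊) hf,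
      IsMultiplicativeHom (etaleRStr p D hD.isLocallyPrincipal m _ hf hW) ∧
      IsMultiplicative (etaleRFunctor p D hD.isLocallyPrincipal m _ hf hW) ∧
      DefinesGroupoid (etaleRFunctor p D hD.isLocallyPrincipal m _ hf hW) := by
  -- the neighbourhood of the degenerate edges on which `Q_1` is étale lies in the étale locus
  obtain ⟨O, hO, hO'⟩ := hbd
  exact (isNormalizedCover_normR p D hD m _ hf hm).etaleLocus_isMultiplicative fun x ↦
    le_etaleLocus hO' (hO ⟨x, rfl⟩)
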